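/- Let $\Pi_n$ be the lattice of set partitions of $\{1,\dots,n\}$ ordered by refinement, $\Pi_n^*$ its dual, and let $\Delta(P)$ denote the order complex of $P\setminus\{\hat 0,\hat 1\}$. Attach to every $i\in\{1,\dots,n\}$ a letter in $\{1,\dots,k\}$, let $\lambda_j$ be the number of points with letter $j$, and let $S_\lambda\cong S_{\lambda_1}\times\cdots\times S_{\lambda_k}$ be the Young subgroup of all letter-preserving permutations. The quotient complex $\Delta(P)/S_\lambda$ ($P=\Pi_n$ or $\Pi_n^*$) consists of the $S_\lambda$-orbits of faces of $\Delta(P)$. A partitioning of it assigns to each facet $F$ a face $G_F\le F$ such that the intervals $[G_F,F]$ are of boolean type and every face (the empty one included) lies in exactly one of them. A block is a nonempty sub-multiset of $M=\{1^{\lambda_1},\dots,k^{\lambda_k}\}$. A block order is a total order $\le$ on blocks; it satisfies the lengthening condition if $B\le B'$ implies $B\le BB'$ for all blocks $B,B'$ whose concatenation (multiset sum) $BB'$ is a block. In the length-lex order, blocks are compared first by size, and, for equal size, by the lexicographic order of their words of increasingly sorted letters. Sets of points are compared through their multisets of letters, and two sets are called equivalent if these multisets coincide. Given a block order, let $F$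 be a facet, represented by a saturated chain from the one-block partition to the partition into singletons, each step of which splits one block into a left child and a right child, the left child being $\le$ the right child; blocks of each partition are placed from left to right accordingly. For consecutive members $u,v,w$ of the chain, where the step $u\to v$ creates the left child $X$ and the right child $Y$ and the step $v\to w$ creates the left child $X'$ and the right child $Y'$, the chain has a topological descent at $v$ if one of the following holds: (1) the step $v\to w$ splits $X$; or the two steps split distinct blocks of $u$, and the one split by $v\to w$ lies to the left of the other (that is, some step of the chain has a left child $L$ containing the former and a right child $R$ containing the latter, with $L<R$); (2) the step $v\to w$ splits $Y$, and $X'<X$; (3) the step $v\to w$ splits $Y$, $X$ and $X'$ are equivalent of size two, and $X'$ is split before $X$. (If two children are equivalent, either may be taken as the left one; it suffices that one choice satisfies one of these conditions.) Say that $F$ has no equal blocks if, whenever a step of the chain splits off a block $A$ with sibling $Y$, no block of the chain that is contained in (or equal to) $Y$ is equivalent to $A$, except possibly when $|A|\le 2$. Theorem. Let $S_\lambda$ be any Young subgroup of $S_n$. Any block order that satisfies the lengthening condition yields a partitioning of $\Delta(\Pi_n^*)/S_\lambda$: this complex is pure and has a partitioning $F\mapsto G_F$ such that, for every facet $F$ that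 has no equal blocks, the vertices of $G_F$ are exactly those of $F$ at which $F$ has a topological descent. The length-lex order is a block order that satisfies the lengthening condition, and it yields a partitioning of $\Delta(\Pi_n)/S_\lambda$ in the same sense; in particular, $\Delta(\Pi_n)/S_\lambda$ is partitionable. -/

import Mathlib

/-! ### The quotient of the order complex of a bounded poset by a group of order automorphisms -/

section OrderComplex

variable {P : Type*} [PartialOrder P] [BoundedOrder P] {G : Type*} [Group G]

/-- The faces of the order complex `Δ(P)`: finite chains of elements of `P` other than
`⊥` and `⊤`. The empty chain is the empty face. -/
def Face (P : Type*) [PartialOrder P] [BoundedOrder P] : Type _ :=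
  {C : Finset P // IsChain (· ≤ ·) (C : Set P) ∧ ⊥ ∉ C ∧ ⊤ ∉ C}

/-- Two faces are equivalent if some group element carries one onto the other. -/
def FaceRel (ρ : G →* (P ≃o P)) (C D : Face P) : Prop :=
  ∃ g : G, C.1.map (ρ g).toEquiv.toEmbedding = D.1

theorem faceRel_iff (ρ : G →* (P ≃o P)) (C D : Face P) :
    FaceRel ρ C D ↔ ∃ g : G, ∀ x, x ∈ C.1 ↔ ρ g x ∈ D.1 := by
  constructor
  · rintro ⟨g, hg⟩
    refine ⟨g, fun x => ?_⟩
    rw [← hg]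
    simp
  · rintro ⟨g, hg⟩
    refine ⟨g, ?_⟩
    ext y
    obtain ⟨x, rfl⟩ := (ρ g).surjective y
    rw [← hg x]
    simp

theorem rho_inv_mul {P : Type*} [PartialOrder P] {G : Type*} [Group G] (ρ : G →* (P ≃o P)) (g : G) (x : P) : ρ g (ρ g⁻¹ x) = x := by
  have h : (ρ g * ρ g⁻¹) x = x := by rw [← map_mul]; simp
  exact h

/-- The orbit equivalence relation on faces. -/
def faceSetoid (ρ : G →* (P ≃o P)) : Setoid (Face P) where
  r := FaceRel ρ
  iseqv :=
    { refl := fun C => (faceRel_iff ρ C C).2 ⟨1, fun x => by simp⟩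
      symm := by
        intro C D h
        obtain ⟨g, hg⟩ := (faceRel_iff ρ C D).1 h
        refine (faceRel_iff ρ D C).2 ⟨g⁻¹, fun x => ?_⟩
        rw [hg, rho_inv_mul]
      trans := by
        intro C D E h h'
        obtain ⟨g, hg⟩ := (faceRel_iff ρ C D).1 h
        obtain ⟨g', hg'⟩ := (faceRel_iff ρ D E).1 h'
        refine (faceRel_iff ρ C E).2 ⟨g' * g, fun x => ?_⟩
        rw [hg, hg', map_mul]
        rfl }

/-- The quotient complex `Δ(P)/G`: its faces are the `G`-orbits of faces of `Δ(P)`. -/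
def QuotientComplex (ρ : G →* (P ≃o P)) : Type _ := Quotient (faceSetoid ρ)

/-- The orbit of a face. -/
def orbitOf (ρ : G →* (P ≃o P)) (C : Face P) : QuotientComplex ρ := Quotient.mk (faceSetoid ρ) C

theorem orbitOf_eq_iff (ρ : G →* (P ≃o P)) (C D : Face P) :
    orbitOf ρ C = orbitOf ρ D ↔ FaceRel ρ C D :=
  ⟨fun h => Quotient.exact h, fun h => Quotient.sound h⟩

/-- The number of vertices of a face of the quotient complex. -/
def QuotientComplex.card {ρ : G →* (P ≃o P)} (a : QuotientComplex ρ) : ℕ :=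
  Quotient.lift (s := faceSetoid ρ) (fun C : Face P => C.1.card)
    (by
      rintro C D ⟨g, hg⟩
      rw [← hg, Finset.card_map]) a

/-- The face order of the quotient complex: an orbit lies below another one if some
representative of the first is contained in some representative of the second. -/
instance (ρ : G →* (P ≃o P)) : PartialOrder (QuotientComplex ρ) where
  le a b := ∃ C D : Face P, orbitOf ρ C = a ∧ orbitOf ρ D = b ∧ C.1 ⊆ D.1
  le_refl a := by
    obtain ⟨C, rfl⟩ := Quotient.exists_rep a
    exact ⟨C, C, rfl, rfl, subset_rfl⟩
  le_trans := by
    rintro a b d ⟨A, B, rfl, rfl, h⟩ ⟨B', D, h', rfl, h''⟩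
    obtain ⟨g, hg⟩ := (orbitOf_eq_iff ρ B' B).1 h'
    have hg' := (faceRel_iff ρ B' B).1 ⟨g, hg⟩
    obtain ⟨g, hg⟩ := hg'
    let D' : Face P := ⟨D.1.map (ρ g).toEquiv.toEmbedding, by
      refine ⟨?_, ?_, ?_⟩
      · intro x hx y hy hxy
        simp only [Finset.coe_map, Set.mem_image, Finset.mem_coe] at hx hy
        obtain ⟨x, hx, rfl⟩ := hx
        obtain ⟨y, hy, rfl⟩ := hy
        rcases D.2.1.total hx hy with h | h
        · exact Or.inl ((ρ g).monotone h)
        · exact Or.inr ((ρ g).monotone h)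
      · intro hx
        obtain ⟨x, hx, he⟩ := Finset.mem_map.1 hx
        have he' : ρ g x = ρ g ⊥ := by rw [(ρ g).map_bot]; exact he
        exact D.2.2.1 ((ρ g).injective he' ▸ hx)
      · intro hx
        obtain ⟨x, hx, he⟩ := Finset.mem_map.1 hx
        have he' : ρ g x = ρ g ⊤ := by rw [(ρ g).map_top]; exact he
        exact D.2.2.2 ((ρ g).injective he' ▸ hx)⟩
    refine ⟨A, D', rfl, ?_, ?_⟩
    · exact ((orbitOf_eq_iff ρ D D').2 ⟨g, rfl⟩).symm
    · intro x hx
      obtain ⟨y, rfl⟩ := (ρ g).surjective x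
      have hy : y ∈ D.1 := h'' ((hg y).2 (h hx))
      exact Finset.mem_map.2 ⟨y, hy, rfl⟩
  le_antisymm := by
    rintro a b ⟨A, B, rfl, rfl, h⟩ ⟨B', A', hB, hA, h'⟩
    have h1 : B'.1.card = B.1.card := congrArg QuotientComplex.card hB
    have h2 : A'.1.card = A.1.card := congrArg QuotientComplex.card hA
    have h3 := Finset.card_le_card h'
    have h4 : A.1 = B.1 := Finset.eq_of_subset_of_card_le h (by omega)
    exact congrArg (orbitOf ρ) (Subtype.ext h4)

end OrderComplex

/-! ### Partitionings -/

/-- A partitioning of a complex with face poset `Q`: it assigns to every facet `F` a face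
`bot F ≤ F` such that the intervals `[bot F, F]` are of boolean type and every face lies in
exactly one of them. -/
structure IsPartitioning {Q : Type*} [PartialOrder Q] (bot : {F : Q // IsMax F} → Q) : Prop where
  le : ∀ F, bot F ≤ F.1
  boolean : ∀ F, ∃ m : ℕ, Nonempty (Set.Icc (bot F) F.1 ≃o Finset (Fin m))
  cover : ∀ a : Q, ∃! F : {F : Q // IsMax F}, a ∈ Set.Icc (bot F) F.1

/-! ### The partition lattice and Young subgroups

The partition lattice `Π_n` is `Setoid (Fin n)`, ordered by refinement: `⊥` is the partition into
singletons and `⊤` is the partition with one block. Its dual `Π_n^*` is `(Setoid (Fin n))ᵒᵈ`.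
A map `c : Fin n → Fin k` attaches a letter to every point; `λ_i` is the number of points with
letter `i`. -/

section PartitionLattice

variable {n k : ℕ}

/-- The Young subgroup `S_λ` of `S_n`: the permutations which preserve all letters. -/
def youngSubgroup (c : Fin n → Fin k) : Subgroup (Equiv.Perm (Fin n)) where
  carrier := {σ | ∀ i, c (σ i) = c i}
  one_mem' := fun _ => rfl
  mul_mem' := by
    intro σ τ hσ hτ i
    rw [Equiv.Perm.mul_apply, hσ, hτ]
  inv_mem' := by
    intro σ hσ i
    have h := hσ (σ⁻¹ i)
    have h' : σ (σ⁻¹ i) = i := Equiv.apply_symm_apply σ i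
    rw [h'] at h
    exact h.symm

/-- The action of `S_n` on `Π_n`: `σ x` and `σ y` lie in one block of the image of a partition
if and only if `x` and `y` lie in one block of the partition. -/
def permAction (n : ℕ) : Equiv.Perm (Fin n) →* (Setoid (Fin n) ≃o Setoid (Fin n)) where
  toFun σ :=
    { toFun := fun s => s.comap (σ⁻¹ : Equiv.Perm (Fin n))
      invFun := fun s => s.comap σ
      left_inv := fun s => by ext x y; simp [Setoid.comap_rel]
      right_inv := fun s => by ext x y; simp [Setoid.comap_rel]
      map_rel_iff' := by
        intro s t
        constructor
        · intro h x y hxy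
          have hs : ∀ z, (σ⁻¹ : Equiv.Perm (Fin n)) (σ z) = z := fun z => Equiv.symm_apply_apply σ z
          have h' : s ((σ⁻¹ : Equiv.Perm (Fin n)) (σ x)) ((σ⁻¹ : Equiv.Perm (Fin n)) (σ y)) →
              t ((σ⁻¹ : Equiv.Perm (Fin n)) (σ x)) ((σ⁻¹ : Equiv.Perm (Fin n)) (σ y)) :=
            @h (σ x) (σ y)
          rw [hs, hs] at h'
          exact h' hxy
        · intro h x y hxy
          exact h hxy }
  map_one' := by ext s x y; rfl
  map_mul' σ τ := by
    ext s x y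
    change s ((σ * τ)⁻¹ x) ((σ * τ)⁻¹ y) ↔ s (τ⁻¹ (σ⁻¹ x)) (τ⁻¹ (σ⁻¹ y))
    rw [mul_inv_rev]
    rfl

/-- The action of `S_λ` on `Π_n`. -/
def youngAction (c : Fin n → Fin k) :
    youngSubgroup c →* (Setoid (Fin n) ≃o Setoid (Fin n)) :=
  (permAction n).comp (youngSubgroup c).subtype

/-- The action of `S_λ` on `Π_n^*`. -/
def youngActionDual (c : Fin n → Fin k) :
    youngSubgroup c →* ((Setoid (Fin n))ᵒᵈ ≃o (Setoid (Fin n))ᵒᵈ) where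
  toFun σ := (youngAction c σ).dual
  map_one' := by rw [map_one]; rfl
  map_mul' σ τ := by rw [map_mul]; rfl

/-! ### Block orders -/

/-- The multiset of letters `{1^{λ_1}, …, k^{λ_k}}`. -/
def letters (c : Fin n → Fin k) : Multiset (Fin k) := Finset.univ.val.map c

/-- The multiset of letters in a set of points. -/
def content (c : Fin n → Fin k) (X : Finset (Fin n)) : Multiset (Fin k) := X.val.map c

/-- A block is a nonempty sub-multiset of the multiset `M` of all letters. -/
def IsBlock (M B : Multiset (Fin k)) : Prop := B ≠ 0 ∧ B ≤ M

/-- A block order is a (non-strict) total order on blocks. -/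
structure IsBlockOrder (M : Multiset (Fin k))
    (r : Multiset (Fin k) → Multiset (Fin k) → Prop) : Prop where
  total : ∀ B B', IsBlock M B → IsBlock M B' → r B B' ∨ r B' B
  antisymm : ∀ B B', IsBlock M B → IsBlock M B' → r B B' → r B' B → B = B'
  trans : ∀ A B D, IsBlock M A → IsBlock M B → IsBlock M D → r A B → r B D → r A D

/-- The lengthening condition: `B ≤ B'` implies `B ≤ BB'`. -/
def LengtheningCondition (M : Multiset (Fin k))
    (r : Multiset (Fin k) → Multiset (Fin k) → Prop) : Prop :=
  ∀ B B', IsBlock M B → IsBlock M B' → IsBlock M (B + B') → r B B' → r B (B + B')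

/-- The length-lex order: blocks are compared by size first and, if they have the same size, by
the lexicographic order of the words obtained by sorting their letters increasingly. -/
def lengthLex (B B' : Multiset (Fin k)) : Prop :=
  B.card < B'.card ∨ B.card = B'.card ∧ B.sort (· ≤ ·) ≤ B'.sort (· ≤ ·)

/-! ### Topological descents

A saturated chain in `Π_n^*` starts with the one-block partition, and every step of it splits one
block into two. Below, `K` is the set of all members of the chain, the partition into one block
and the partition into singletons included. In pictures, the blocks of each partition are placed
from left to right; when a block is split, the child which is smaller in the block order
goes to the left of the other one, and both take the place of their parent. -/

/-- `v` arises from `u` by splitting a block of `u` into the two blocks `X` and `Y` of `v`. -/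
def IsSplit (u v : Setoid (Fin n)) (X Y : Finset (Fin n)) : Prop :=
  v ⋖ u ∧ (X : Set (Fin n)) ∈ v.classes ∧ (Y : Set (Fin n)) ∈ v.classes ∧ X ≠ Y ∧
    (X : Set (Fin n)) ∪ Y ∈ u.classes

/-- Strict comparison of the contents of two sets of points. -/
def ContentLT (c : Fin n → Fin k) (r : Multiset (Fin k) → Multiset (Fin k) → Prop)
    (X Y : Finset (Fin n)) : Prop :=
  r (content c X) (content c Y) ∧ content c X ≠ content c Y

/-- Topological descent of a saturated chain at its member `v`: here `u → v → w` are consecutive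
members, the first step creates the left child `X` and the right child `Y`, and the second step
creates the left child `X'` and the right child `Y'`. -/
def IsTopologicalDescent (c : Fin n → Fin k)
    (r : Multiset (Fin k) → Multiset (Fin k) → Prop)
    (K : Set (Setoid (Fin n))) (v : Setoid (Fin n)) : Prop :=
  ∃ u ∈ K, ∃ w ∈ K, ∃ X Y X' Y' : Finset (Fin n),
    IsSplit u v X Y ∧ IsSplit v w X' Y' ∧
    r (content c X) (content c Y) ∧ r (content c X') (content c Y') ∧
    -- the second step splits the left child of the first step
    (X' ∪ Y' = X ∨
    -- the steps split distinct blocks, and the block split second lies to the left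
    (∃ a ∈ K, ∃ b ∈ K, ∃ L R : Finset (Fin n), IsSplit a b L R ∧ ContentLT c r L R ∧
      X ∪ Y ⊆ R ∧ X' ∪ Y' ⊆ L) ∨
    -- the second step splits the right child, and the left children decrease
    (X' ∪ Y' = Y ∧ ContentLT c r X' X) ∨
    -- the second step splits the right child, the left children are equivalent blocks of size
    -- two, and the second one is split before the first one
    (X' ∪ Y' = Y ∧ content c X' = content c X ∧ X.card = 2 ∧
      ∃ p ∈ K, p ≤ w ∧ (X : Set (Fin n)) ∈ p.classes ∧ (X' : Set (Fin n)) ∉ p.classes))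

/-- The chain has no equivalent blocks of size greater than two with a common parent: if a step
splits off a block `A` with sibling `Y`, then no block of the same content and of size greater
than two is equal to `Y` or split off from `Y` later in the chain. -/
def HasNoEqualBlocks (c : Fin n → Fin k) (K : Set (Setoid (Fin n))) : Prop :=
  ∀ u ∈ K, ∀ v ∈ K, ∀ A Y : Finset (Fin n), IsSplit u v A Y →
    ∀ p ∈ K, ∀ B : Finset (Fin n), (B : Set (Fin n)) ∈ p.classes → B ⊆ Y →
      content c A = content c B → A.card ≤ 2

/-- The block order `r` yields a partitioning of the quotient complex `Δ(P)/S_λ`, where `P` is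
`Π_n` or `Π_n^*`, `ρ` is the action of `S_λ` on `P`, and `e` identifies the elements of `P` with
the partitions of `{1, …, n}`: the complex is pure, and it has a partitioning such that, for each
facet without equivalent blocks of size greater than two, the vertices of the minimal face
of its interval are its topological descents with respect to `r`. -/
def YieldsPartitioning (c : Fin n → Fin k)
    (r : Multiset (Fin k) → Multiset (Fin k) → Prop)
    {P : Type} [PartialOrder P] [BoundedOrder P]
    (ρ : youngSubgroup c →* (P ≃o P)) (e : P ≃ Setoid (Fin n)) : Prop :=
  (∀ F F' : QuotientComplex ρ, IsMax F → IsMax F' → F.card = F'.card) ∧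
  ∃ bot : {F : QuotientComplex ρ // IsMax F} → QuotientComplex ρ,
    IsPartitioning bot ∧
    ∀ (C D : Face P) (hC : IsMax (orbitOf ρ C)), D.1 ⊆ C.1 →
      orbitOf ρ D = bot ⟨orbitOf ρ C, hC⟩ →
      HasNoEqualBlocks c (insert ⊤ (insert ⊥ (e '' (C.1 : Set P)))) →
      ∀ x ∈ C.1, x ∈ D.1 ↔
        IsTopologicalDescent c r (insert ⊤ (insert ⊥ (e '' (C.1 : Set P)))) (e x)

end PartitionLattice

set_option linter.unusedSectionVars false

/-! A saturated chain of partitions is a binary tree whose leaves are the points and whose nodes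
carry the times of the splits; its orbit under the Young subgroup only remembers the letters at the
leaves. Keeping a set `S` of levels amounts to a weakly increasing identification of times (`countLE
S`), and the orbit of the resulting face is the coloured tree in which adjacent nodes of equal time
are merged. The code `wk` is a complete invariant of such merged trees (`wk_eq_of_lca_eq`,
`exists_matching_of_wk_eq`).

The proof is a standardization argument in the spirit of P-partitions. A reading order is put on the
times of every canonically drawn facet, and an identification of times is called compatible if it
only identifies times that occur in reading order. Every merged tree arises from exactly one facet
orbit by a compatible identification. Since `countLE S` is compatible exactly if `S` contains all
descents of the reading order (`compat_countLE_iff`), the faces with `S` between the descent set and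
the set of all levels form boolean intervals that cover every face once.

The block order enters through a numerical weight `μ` that is injective on blocks and satisfies `μ A
< μ (A + B)` whenever `μ A ≤ μ B`. In a `Valid` tree, the left child is the lighter one; ties are
broken by the code of the standardized shape and then by the time of the root.

The reading order is recursive. The right spine is followed as long as the left children have one
common weight `γ`. This yields rows, which are the left subtrees together with the times at which
they are split off, and possibly a rest; without a rest, the last two rows are siblings and share
their split time. The times inside the rows are read first. Rows of one shape are regarded as words
and read column by column, the columns in the reading order of the shape; inside a column, rows are
ordered by the time in the next column, and in the last column by the split time. The split times
come next, and the rest last, except that the rest precedes the split times if it starts with a left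
child lighter than `γ`. Consequently a compatible identification never merges a row with its split
time, and it merges the rest with a split time only if all parts of the rest are heavier than `γ`.
By lengthening, everything further down the spine is heavier than `γ` as well. So the rows are the
lightest children in the merged tree, and the run can be read off from the code (`WRun.unique`).

For uniqueness (`eq_of_wk_mapT_eq`), the rows turn out to be sorted by split value, shape and word,
so the merged tree determines the list of these data. The times of the facet are ordered like
explicit lexicographic codes made of suffixes of the words (`SRun.pairTree_lt`); hence the data
determine the facet. For existence (`exists_col`), a merged tree is cut into rows and a rest, the
parts are treated recursively, the rows are sorted, and the ranks of the same codes are used as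
times.

Without equal blocks of size greater than two, any two blocks of equal weight that have to be
compared have at most two leaves, and such blocks have only one shape. The comparison of consecutive
times in the reading order can then be computed, and it produces exactly the clauses of a
topological descent (`key_lt_key_iff_desc`). Only comparability of partitions matters in all this,
not the direction of the order, so the argument covers the partition lattice and its dual at once.
-/

/-- Binary trees whose internal nodes carry times and whose leaves carry labels. -/
inductive TimedTree (Λ α : Type*) where
  | leaf (x : α) : TimedTree Λ α
  | node (t : Λ) (l r : TimedTree Λ α) : TimedTree Λ α

/-! ### Timed binary trees: relabelling, times, leaves and heap order -/

namespace TimedTree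

section Basic

variable {Λ Λ' Λ'' α β : Type*}

/-- Relabelling of the times. -/
def mapT (f : Λ → Λ') : TimedTree Λ α → TimedTree Λ' α
  | leaf x => leaf x
  | node t l r => node (f t) (mapT f l) (mapT f r)

/-- Relabelling of the leaves. -/
def mapL (f : α → β) : TimedTree Λ α → TimedTree Λ β
  | leaf x => leaf (f x)
  | node t l r => node t (mapL f l) (mapL f r)

/-- The times of all internal nodes. -/
def times : TimedTree Λ α → List Λ
  | leaf _ => []
  | node t l r => t :: (times l ++ times r)

/-- The labels of all leaves, from left to right. -/
def leaves : TimedTree Λ α → List α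
  | leaf x => [x]
  | node _ l r => leaves l ++ leaves r

/-- The time of the root. -/
def root : TimedTree Λ α → Option Λ
  | leaf _ => none
  | node t _ _ => some t

theorem mapT_mapT (f : Λ → Λ') (g : Λ' → Λ'') (T : TimedTree Λ α) :
    mapT g (mapT f T) = mapT (g ∘ f) T := by
  induction T with
  | leaf x => rfl
  | node t l r hl hr => simp [mapT, hl, hr]

theorem mapT_congr {f g : Λ → Λ'} {T : TimedTree Λ α} (h : ∀ t ∈ T.times, f t = g t) :
    mapT f T = mapT g T := by
  induction T with
  | leaf x => rfl
  | node t l r hl hr =>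
    simp only [times, List.mem_cons, List.mem_append] at h
    simp only [mapT]
    rw [h t (Or.inl rfl), hl fun u hu => h u (Or.inr (Or.inl hu)),
      hr fun u hu => h u (Or.inr (Or.inr hu))]

theorem eq_of_mapT_eq {f g : Λ → Λ'} {T : TimedTree Λ α} (h : mapT f T = mapT g T) :
    ∀ t ∈ T.times, f t = g t := by
  induction T with
  | leaf x => simp [times]
  | node t l r hl hr =>
    simp only [mapT, node.injEq] at h
    simp only [times, List.mem_cons, List.mem_append]
    rintro u (rfl | hu | hu)
    · exact h.1
    · exact hl h.2.1 u hu
    · exact hr h.2.2 u hu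

theorem mapT_id (T : TimedTree Λ α) : mapT (fun t => t) T = T := by
  induction T with
  | leaf x => rfl
  | node t l r hl hr => simp [mapT, hl, hr]

@[simp] theorem times_mapT (f : Λ → Λ') (T : TimedTree Λ α) :
    (mapT f T).times = T.times.map f := by
  induction T with
  | leaf x => rfl
  | node t l r hl hr => simp [mapT, times, hl, hr]

@[simp] theorem leaves_mapT (f : Λ → Λ') (T : TimedTree Λ α) : (mapT f T).leaves = T.leaves := by
  induction T with
  | leaf x => rfl
  | node t l r hl hr => simp [mapT, leaves, hl, hr]

@[simp] theorem root_mapT (f : Λ → Λ') (T : TimedTree Λ α) : (mapT f T).root = T.root.map f := by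
  cases T <;> rfl

@[simp] theorem times_mapL (f : α → β) (T : TimedTree Λ α) : (mapL f T).times = T.times := by
  induction T with
  | leaf x => rfl
  | node t l r hl hr => simp [mapL, times, hl, hr]

@[simp] theorem leaves_mapL (f : α → β) (T : TimedTree Λ α) :
    (mapL f T).leaves = T.leaves.map f := by
  induction T with
  | leaf x => rfl
  | node t l r hl hr => simp [mapL, leaves, hl, hr]

@[simp] theorem root_mapL (f : α → β) (T : TimedTree Λ α) : (mapL f T).root = T.root := by
  cases T <;> rfl

theorem mapL_mapT (f : Λ → Λ') (g : α → β) (T : TimedTree Λ α) :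
    mapL g (mapT f T) = mapT f (mapL g T) := by
  induction T with
  | leaf x => rfl
  | node t l r hl hr => simp [mapT, mapL, hl, hr]

theorem leaves_ne_nil (T : TimedTree Λ α) : T.leaves ≠ [] := by
  induction T with
  | leaf x => simp [leaves]
  | node t l r hl hr => simp [leaves, hl]

theorem length_leaves (T : TimedTree Λ α) : T.leaves.length = T.times.length + 1 := by
  induction T with
  | leaf x => rfl
  | node t l r hl hr => simp [leaves, times, hl, hr]; omega

theorem mem_times_of_root {T : TimedTree Λ α} {t : Λ} (h : T.root = some t) : t ∈ T.times := by
  cases T <;> simp_all [root, times]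

/-- Times increase weakly on the way from the root to the leaves. -/
def Heap [LE Λ] : TimedTree Λ α → Prop
  | leaf _ => True
  | node t l r => (∀ u ∈ l.times, t ≤ u) ∧ (∀ u ∈ r.times, t ≤ u) ∧ Heap l ∧ Heap r

theorem Heap.root_le [Preorder Λ] {T : TimedTree Λ α} (h : T.Heap) {t : Λ} (ht : T.root = some t) :
    ∀ u ∈ T.times, t ≤ u := by
  cases T with
  | leaf x => simp [times]
  | node s l r =>
    simp only [root, Option.some.injEq] at ht
    subst ht
    simp only [times, List.mem_cons, List.mem_append]
    rintro u (rfl | hu | hu)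
    · exact le_rfl
    · exact h.1 u hu
    · exact h.2.1 u hu

theorem Heap.mapT [Preorder Λ] [Preorder Λ'] {T : TimedTree Λ α} (h : T.Heap) {f : Λ → Λ'}
    (hf : ∀ t ∈ T.times, ∀ u ∈ T.times, t ≤ u → f t ≤ f u) : (mapT f T).Heap := by
  induction T with
  | leaf x => trivial
  | node t l r hl hr =>
    simp only [times, List.mem_cons, List.mem_append] at hf
    refine ⟨?_, ?_, hl h.2.2.1 ?_, hr h.2.2.2 ?_⟩
    · simp only [times_mapT, List.mem_map]
      rintro _ ⟨u, hu, rfl⟩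
      exact hf _ (Or.inl rfl) _ (Or.inr (Or.inl hu)) (h.1 u hu)
    · simp only [times_mapT, List.mem_map]
      rintro _ ⟨u, hu, rfl⟩
      exact hf _ (Or.inl rfl) _ (Or.inr (Or.inr hu)) (h.2.1 u hu)
    · exact fun a ha b hb => hf a (Or.inr (Or.inl ha)) b (Or.inr (Or.inl hb))
    · exact fun a ha b hb => hf a (Or.inr (Or.inr ha)) b (Or.inr (Or.inr hb))

end Basic

end TimedTree

/-! ### Positions in a list without repetitions -/

section Position

variable {Λ : Type*} [LinearOrder Λ]

/-- The number of members of `L` that are smaller than `t`. -/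
def listIdx (L : List Λ) (t : Λ) : ℕ := L.countP (fun u => decide (u < t))

theorem listIdx_mono (L : List Λ) {t u : Λ} (h : t ≤ u) : listIdx L t ≤ listIdx L u :=
  List.countP_mono_left fun x _ hx => by
    simp only [decide_eq_true_eq] at hx ⊢
    exact lt_of_lt_of_le hx h

theorem listIdx_lt {L : List Λ} {t u : Λ} (ht : t ∈ L) (h : t < u) : listIdx L t < listIdx L u := by
  obtain ⟨A, B, rfl⟩ := List.append_of_mem ht
  have hA := listIdx_mono A h.le
  have hB := listIdx_mono B h.le
  simp only [listIdx, List.countP_append, List.countP_cons, decide_eq_true_eq, lt_self_iff_false,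
    if_false, h, if_true] at *
  omega

theorem listIdx_lt_iff {L : List Λ} {t u : Λ} (ht : t ∈ L) :
    listIdx L t < listIdx L u ↔ t < u := by
  refine ⟨fun h => ?_, listIdx_lt ht⟩
  by_contra h'
  exact absurd (listIdx_mono L (not_lt.1 h')) (not_le.2 h)

theorem listIdx_inj {L : List Λ} {t u : Λ} (ht : t ∈ L) (hu : u ∈ L)
    (h : listIdx L t = listIdx L u) : t = u := by
  rcases lt_trichotomy t u with h' | h' | h'
  · exact absurd (listIdx_lt ht h') (by omega)
  · exact h'
  · exact absurd (listIdx_lt hu h') (by omega)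

theorem listIdx_lt_length {L : List Λ} {t : Λ} (ht : t ∈ L) : listIdx L t < L.length := by
  obtain ⟨A, B, rfl⟩ := List.append_of_mem ht
  have hA : listIdx A t ≤ A.length := List.countP_le_length
  have hB : listIdx B t ≤ B.length := List.countP_le_length
  simp only [listIdx, List.countP_append, List.countP_cons, decide_eq_true_eq, lt_self_iff_false,
    if_false, List.length_append, List.length_cons] at *
  omega

theorem listIdx_map {Λ' : Type*} [LinearOrder Λ'] {L : List Λ} {f : Λ → Λ'} {t : Λ}
    (hf : ∀ u ∈ L, f u < f t ↔ u < t) : listIdx (L.map f) (f t) = listIdx L t := by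
  rw [listIdx, listIdx, List.countP_map]
  exact List.countP_congr fun u hu => by simp [hf u hu]

theorem map_listIdx_perm {L : List Λ} (hL : L.Nodup) :
    (L.map (listIdx L)).Perm (List.range L.length) := by
  have h1 : (L.map (listIdx L)).Nodup :=
    List.Nodup.map_on (fun t ht u hu h => listIdx_inj ht hu h) hL
  have h2 : (L.map (listIdx L)).Subperm (List.range L.length) := by
    refine List.subperm_of_subset h1 fun x hx => ?_
    obtain ⟨t, ht, rfl⟩ := List.mem_map.1 hx
    exact List.mem_range.2 (listIdx_lt_length ht)
  exact h2.perm_of_length_le (by simp)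

theorem exists_listIdx_eq {L : List Λ} (hL : L.Nodup) {j : ℕ} (hj : j < L.length) :
    ∃ t ∈ L, listIdx L t = j := by
  have h := (map_listIdx_perm hL).mem_iff.2 (List.mem_range.2 hj)
  simpa using h

theorem listIdx_range {n t : ℕ} (h : t < n) : listIdx (List.range n) t = t := by
  induction n with
  | zero => omega
  | succ n ih =>
    rw [listIdx, List.range_succ, List.countP_append]
    rcases Nat.lt_succ_iff_lt_or_eq.1 h with h' | rfl
    · have := ih h'
      rw [listIdx] at this
      simp [this]
      omega
    · have h1 : ∀ u ∈ List.range t, decide (u < t) = true := by simp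
      rw [List.countP_eq_length.2 h1]
      simp

theorem listIdx_perm {L L' : List Λ} (h : L.Perm L') (t : Λ) : listIdx L t = listIdx L' t :=
  h.countP_eq _

open Classical in
/-- The member of `L` at position `j` of the sorted list. -/
noncomputable def listUnidx [Nonempty Λ] (L : List Λ) (j : ℕ) : Λ :=
  Function.invFunOn (listIdx L) {t | t ∈ L} j

variable [Nonempty Λ]

theorem listUnidx_listIdx {L : List Λ} {t : Λ} (ht : t ∈ L) : listUnidx L (listIdx L t) = t := by
  have h1 : ∃ u ∈ {t : Λ | t ∈ L}, listIdx L u = listIdx L t := ⟨t, ht, rfl⟩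
  exact listIdx_inj (L := L) (Function.invFunOn_mem (s := {t : Λ | t ∈ L}) h1) ht
    (Function.invFunOn_eq (s := {t : Λ | t ∈ L}) h1)

theorem listUnidx_mem {L : List Λ} (hL : L.Nodup) {j : ℕ} (hj : j < L.length) :
    listUnidx L j ∈ L := by
  obtain ⟨t, ht, rfl⟩ := exists_listIdx_eq hL hj
  rwa [listUnidx_listIdx ht]

theorem listIdx_listUnidx {L : List Λ} (hL : L.Nodup) {j : ℕ} (hj : j < L.length) :
    listIdx L (listUnidx L j) = j := by
  obtain ⟨t, ht, rfl⟩ := exists_listIdx_eq hL hj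
  rw [listUnidx_listIdx ht]

theorem listUnidx_lt_iff {L : List Λ} (hL : L.Nodup) {i j : ℕ} (hi : i < L.length)
    (hj : j < L.length) : listUnidx L i < listUnidx L j ↔ i < j := by
  rw [← listIdx_lt_iff (listUnidx_mem hL hi), listIdx_listUnidx hL hi, listIdx_listUnidx hL hj]

open Classical in
/-- The smallest member of `L` after `t`, or `s` if there is none. -/
noncomputable def listNext (L : List ℕ) (s t : ℕ) : ℕ :=
  if ∃ u ∈ L, t < u then sInf {u | u ∈ L ∧ t < u} else s

theorem listNext_mem {L : List ℕ} (s t : ℕ) : listNext L s t = s ∨ listNext L s t ∈ L := by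
  unfold listNext
  split_ifs with h
  · exact Or.inr (Nat.sInf_mem (s := {u | u ∈ L ∧ t < u}) h).1
  · exact Or.inl rfl

theorem listNext_listUnidx {L : List ℕ} (hL : L.Nodup) (s : ℕ) {j : ℕ} (hj : j + 1 < L.length) :
    listNext L s (listUnidx L j) = listUnidx L (j + 1) := by
  have h0 : listUnidx L j < listUnidx L (j + 1) :=
    (listUnidx_lt_iff hL (by omega) hj).2 (by omega)
  have h : ∃ u ∈ L, listUnidx L j < u := ⟨_, listUnidx_mem hL hj, h0⟩
  rw [listNext, if_pos h]
  refine le_antisymm (Nat.sInf_le ⟨listUnidx_mem hL hj, h0⟩) ?_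
  have h1 := Nat.sInf_mem (s := {u | u ∈ L ∧ listUnidx L j < u}) h
  set m := sInf {u | u ∈ L ∧ listUnidx L j < u}
  by_contra h2
  obtain ⟨i, hi, hm⟩ : ∃ i < L.length, listUnidx L i = m :=
    ⟨_, listIdx_lt_length h1.1, listUnidx_listIdx h1.1⟩
  rw [← hm] at h1 h2
  have h4 := (listUnidx_lt_iff hL (by omega) hi).1 h1.2
  have h5 := (listUnidx_lt_iff hL hi hj).1 (not_le.1 h2)
  omega

theorem listNext_last {L : List ℕ} (hL : L.Nodup) (s : ℕ) {j : ℕ} (hj : j + 1 = L.length) :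
    listNext L s (listUnidx L j) = s := by
  rw [listNext, if_neg]
  rintro ⟨u, hu, h⟩
  rw [← listUnidx_listIdx hu] at h
  have := listIdx_lt_length hu
  have := (listUnidx_lt_iff hL (by omega) this).1 h
  omega

end Position

/-! ### Standardization of times and numerical codes of shapes -/

namespace TimedTree

section Std

variable {Λ Λ' α : Type*} [LinearOrder Λ] [LinearOrder Λ']

/-- The tree with every time replaced by its position. -/
def std (T : TimedTree Λ α) : TimedTree ℕ α := mapT (listIdx T.times) T

/-- Standardization only sees the relative order of the labels, which may come from two different
ordered sets. This allows the times to be replaced by lexicographically ordered lists. -/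
theorem std_mapT_eq {Λ'' : Type*} {T : TimedTree Λ'' α} {f : Λ'' → Λ} {g : Λ'' → Λ'}
    (h : ∀ a ∈ T.times, ∀ b ∈ T.times, f a < f b ↔ g a < g b) :
    std (mapT f T) = std (mapT g T) := by
  rw [std, std, mapT_mapT, mapT_mapT]
  refine mapT_congr fun t ht => ?_
  simp only [Function.comp, listIdx, times_mapT, List.countP_map]
  exact List.countP_congr fun u hu => by simp [h u hu t ht]

theorem std_mapT {T : TimedTree Λ α} {f : Λ → Λ'}
    (h : ∀ a ∈ T.times, ∀ b ∈ T.times, f a < f b ↔ a < b) : std (mapT f T) = std T := by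
  have := std_mapT_eq (T := T) (f := f) (g := fun t => t) h
  rwa [mapT_id] at this

theorem std_std (T : TimedTree Λ α) : std (std T) = std T :=
  std_mapT fun _ ha _ _ => listIdx_lt_iff ha

@[simp] theorem times_std (T : TimedTree Λ α) : (std T).times = T.times.map (listIdx T.times) :=
  times_mapT _ _

theorem mapT_listUnidx_std [Nonempty Λ] (T : TimedTree Λ α) :
    mapT (listUnidx T.times) (std T) = T := by
  rw [std, mapT_mapT]
  conv_rhs => rw [← mapT_id T]
  exact mapT_congr fun t ht => listUnidx_listIdx ht

theorem times_std_perm {T : TimedTree Λ α} (h : T.times.Nodup) :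
    (std T).times.Perm (List.range T.times.length) := by
  rw [times_std]
  exact map_listIdx_perm h

end Std

/-- An encoding of trees by natural numbers. -/
def enc {α : Type*} [Encodable α] : TimedTree ℕ α → ℕ
  | leaf x => 2 * Encodable.encode x
  | node t l r => 2 * Nat.pair t (Nat.pair (enc l) (enc r)) + 1

theorem enc_injective {α : Type*} [Encodable α] : Function.Injective (enc (α := α)) := by
  intro T
  induction T with
  | leaf x =>
    intro T' h
    cases T' with
    | leaf y =>
      simp only [enc] at h
      rw [Encodable.encode_injective (by omega : Encodable.encode x = Encodable.encode y)]
    | node t l r => simp only [enc] at h; omega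
  | node t l r hl hr =>
    intro T' h
    cases T' with
    | leaf y => simp only [enc] at h; omega
    | node t' l' r' =>
      simp only [enc, Nat.add_right_cancel_iff, Nat.mul_right_inj (two_ne_zero),
        Nat.pair_eq_pair] at h
      rw [h.1, hl h.2.1, hr h.2.2]

/-- The code of the standardized tree. -/
def fcode {Λ α : Type*} [LinearOrder Λ] [Encodable α] (T : TimedTree Λ α) : ℕ := enc (std T)

theorem std_eq_of_fcode_eq {Λ Λ' α : Type*} [LinearOrder Λ] [LinearOrder Λ'] [Encodable α]
    {T : TimedTree Λ α} {T' : TimedTree Λ' α} (h : fcode T = fcode T') : std T = std T' :=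
  enc_injective h

end TimedTree

/-! ### Codes of merged trees, and the recovery of a run from its code -/

namespace TimedTree

/-- Codes of timed trees up to isomorphism: a leaf label, or the time of the root with the
weights and codes of its children. -/
abbrev TreeCode (κ : Type*) := κ ⊕ (ℕ × Multiset (ℕ × ℕ))

section Build

variable {Λ Λ' α : Type*}

/-- The tree whose right spine carries the given rows, with the last one in place of a rest if
there is none. -/
def build : (Λ × TimedTree Λ α) → List (Λ × TimedTree Λ α) → Option (TimedTree Λ α) → TimedTree Λ α
  | p, [], none => p.2
  | p, [], some Y => node p.1 p.2 Y
  | p, q :: qs, Yo => node p.1 p.2 (build q qs Yo)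

theorem mapT_build (f : Λ → Λ') (p : Λ × TimedTree Λ α) (ps : List (Λ × TimedTree Λ α))
    (Yo : Option (TimedTree Λ α)) :
    mapT f (build p ps Yo) =
      build (f p.1, mapT f p.2) (ps.map fun q => (f q.1, mapT f q.2)) (Yo.map (mapT f)) := by
  induction ps generalizing p with
  | nil => cases Yo <;> rfl
  | cons q qs ih => simp [build, mapT, ih]

end Build

section Codes

variable {κ : Type*} [Encodable κ] (μ : Multiset κ → ℕ)

/-- The weight of the multiset of leaf labels. -/
def wt {Λ : Type*} (T : TimedTree Λ κ) : ℕ := μ (T.leaves : Multiset κ)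

@[simp] theorem wt_mapT {Λ Λ' : Type*} (f : Λ → Λ') (T : TimedTree Λ κ) :
    wt μ (mapT f T) = wt μ T := by
  simp [wt]

/-- The contribution of a subtree with weight `m` and code `c` to the children of a node with
time `t`. -/
def codePart (t m : ℕ) : TreeCode κ → Multiset (ℕ × ℕ)
  | .inl x => {(m, Encodable.encode (Sum.inl x : TreeCode κ))}
  | .inr p => if p.1 = t then p.2 else {(m, Encodable.encode (Sum.inr p : TreeCode κ))}

/-- The code of a timed tree, where adjacent nodes of equal time are merged. -/
def wk : TimedTree ℕ κ → TreeCode κ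
  | leaf x => .inl x
  | node t l r => .inr (t, codePart t (wt μ l) (wk l) + codePart t (wt μ r) (wk r))

/-- The code of a timed tree as a natural number. -/
def ecode (T : TimedTree ℕ κ) : ℕ := Encodable.encode (wk μ T)

/-- The subtrees that become children when adjacent nodes of time `t` are merged. -/
def ktrees {α : Type*} (t : ℕ) : TimedTree ℕ α → List (TimedTree ℕ α)
  | leaf x => [leaf x]
  | node t' l r => if t' = t then ktrees t l ++ ktrees t r else [node t' l r]

theorem ktrees_ne_nil {α : Type*} (t : ℕ) (T : TimedTree ℕ α) : ktrees t T ≠ [] := by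
  induction T with
  | leaf x => simp [ktrees]
  | node t' l r hl hr =>
    rw [ktrees]
    split_ifs <;> simp [hl]

theorem ktrees_of_root_ne {α : Type*} {t : ℕ} {T : TimedTree ℕ α} (h : T.root ≠ some t) :
    ktrees t T = [T] := by
  cases T with
  | leaf x => rfl
  | node t' l r =>
    rw [ktrees, if_neg]
    rintro rfl
    exact h rfl

/-- Merging flattens nested nodes of time `t`, so the code depends on the binary bracketing only
through the multiset of subtrees that hang below the merged node. -/
theorem codePart_wk (t : ℕ) (T : TimedTree ℕ κ) :
    codePart t (wt μ T) (wk μ T) =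
      ((ktrees t T).map fun u => (wt μ u, ecode μ u) : List (ℕ × ℕ)) := by
  induction T with
  | leaf x => rfl
  | node t' l r hl hr =>
    rw [ktrees, wk, codePart]
    by_cases h : t' = t
    · subst h
      simp only [if_true]
      rw [hl, hr]
      simp
    · rw [if_neg h, if_neg h]
      rfl

theorem wk_of_root {t : ℕ} {T : TimedTree ℕ κ} (h : T.root = some t) :
    wk μ T = .inr (t, codePart t (wt μ T) (wk μ T)) := by
  cases T with
  | leaf x => simp [root] at h
  | node t' l r =>
    simp only [root, Option.some.injEq] at h
    subst h
    simp [wk, codePart]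

theorem codePart_of_root_ne {t : ℕ} {T : TimedTree ℕ κ} (h : T.root ≠ some t) :
    codePart t (wt μ T) (wk μ T) = {(wt μ T, ecode μ T)} := by
  rw [codePart_wk, ktrees_of_root_ne h]
  rfl

theorem two_le_card_codePart {t : ℕ} {T : TimedTree ℕ κ} (h : T.root = some t) :
    2 ≤ Multiset.card (codePart t (wt μ T) (wk μ T)) := by
  rw [codePart_wk]
  cases T with
  | leaf x => simp [root] at h
  | node t' l r =>
    simp only [root, Option.some.injEq] at h
    subst h
    have h1 := List.length_pos_iff.2 (ktrees_ne_nil t' l)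
    have h2 := List.length_pos_iff.2 (ktrees_ne_nil t' r)
    simp [ktrees]
    omega

/-- The smallest weight of a child. -/
noncomputable def codeMin : TreeCode κ → Option ℕ
  | .inl _ => none
  | .inr p => some (sInf {m | ∃ q ∈ p.2, q.1 = m})

/-- The children `A` are meant to be the rows of weight `γ` and `B` what remains at the merged node.
-/
theorem codeMin_add {t γ : ℕ} {A B : Multiset (ℕ × ℕ)} (hA0 : A ≠ 0) (hA : ∀ q ∈ A, q.1 = γ)
    (hB : ∀ q ∈ B, γ < q.1) : codeMin (.inr (t, A + B) : TreeCode κ) = some γ := by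
  obtain ⟨a, ha⟩ := Multiset.exists_mem_of_ne_zero hA0
  rw [codeMin, Option.some.injEq]
  refine le_antisymm (Nat.sInf_le ⟨a, Multiset.mem_add.2 (Or.inl ha), hA a ha⟩) ?_
  refine le_csInf ⟨γ, a, Multiset.mem_add.2 (Or.inl ha), hA a ha⟩ ?_
  rintro m ⟨q, hq, rfl⟩
  rcases Multiset.mem_add.1 hq with h | h
  · exact (hA q h).ge
  · exact (hB q h).le

open Classical in
/-- One step of the decomposition of a code, where `A` are the children of weight `γ` and `B` the
other ones. -/
noncomputable def runStep (f : TreeCode κ → Multiset (ℕ × ℕ) × Option (TreeCode κ)) (t γ : ℕ)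
    (A B : Multiset (ℕ × ℕ)) : Multiset (ℕ × ℕ) × Option (TreeCode κ) :=
  if B = 0 then (A.map fun q => (t, q.2), none)
  else if h : ∃ y : TreeCode κ, ∃ m, B = {(m, Encodable.encode y)} then
    if codeMin h.choose = some γ then
      ((A.map fun q => (t, q.2)) + (f h.choose).1, (f h.choose).2)
    else (A.map fun q => (t, q.2), some h.choose)
  else (A.map fun q => (t, q.2), some (.inr (t, B)))

/-- The decomposition of a code into the rows of equal weight and the rest. -/
noncomputable def runCode : ℕ → TreeCode κ → Multiset (ℕ × ℕ) × Option (TreeCode κ)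
  | 0, _ => (0, none)
  | _ + 1, .inl x => (0, some (.inl x))
  | n + 1, .inr p =>
    runStep (runCode n) p.1 ((codeMin (.inr p : TreeCode κ)).getD 0)
      (p.2.filter fun q => q.1 = (codeMin (.inr p : TreeCode κ)).getD 0)
      (p.2.filter fun q => q.1 ≠ (codeMin (.inr p : TreeCode κ)).getD 0)

theorem runCode_succ {n t γ : ℕ} {A B : Multiset (ℕ × ℕ)} (hA0 : A ≠ 0) (hA : ∀ q ∈ A, q.1 = γ)
    (hB : ∀ q ∈ B, γ < q.1) :
    runCode (n + 1) (.inr (t, A + B) : TreeCode κ) = runStep (runCode n) t γ A B := by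
  rw [runCode, codeMin_add hA0 hA hB]
  simp only [Option.getD_some, Multiset.filter_add]
  rw [Multiset.filter_eq_self.2 hA, Multiset.filter_eq_nil.2 fun q hq => (hB q hq).ne',
    Multiset.filter_eq_nil.2 fun q hq => not_not.2 (hA q hq),
    Multiset.filter_eq_self.2 fun q hq => (hB q hq).ne']
  simp

/-- Further rows of weight `γ` at the same merged node are passed on to the output and do not
influence the branch taken, so a run can be decoded one row at a time. -/
theorem runStep_add (f : TreeCode κ → Multiset (ℕ × ℕ) × Option (TreeCode κ)) (t γ : ℕ)
    (A A' B : Multiset (ℕ × ℕ)) :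
    runStep f t γ (A' + A) B =
      ((A'.map fun q => (t, q.2)) + (runStep f t γ A B).1, (runStep f t γ A B).2) := by
  unfold runStep
  split_ifs <;> simp [add_assoc]

/-- Encodings are injective, so the code chosen in `runStep` can only be `y`. -/
theorem runStep_singleton (f : TreeCode κ → Multiset (ℕ × ℕ) × Option (TreeCode κ)) (t γ m : ℕ)
    (A : Multiset (ℕ × ℕ)) (y : TreeCode κ) :
    runStep f t γ A {(m, Encodable.encode y)} =
      if codeMin y = some γ then ((A.map fun q => (t, q.2)) + (f y).1, (f y).2)
      else (A.map fun q => (t, q.2), some y) := by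
  have h : ∃ z : TreeCode κ, ∃ m', ({(m, Encodable.encode y)} : Multiset (ℕ × ℕ)) =
      {(m', Encodable.encode z)} := ⟨y, m, rfl⟩
  have h1 : h.choose = y := by
    obtain ⟨m', hm⟩ := h.choose_spec
    generalize h.choose = z at hm ⊢
    simp only [Multiset.singleton_inj, Prod.mk.injEq] at hm
    exact (Encodable.encode_injective hm.2).symm
  rw [runStep, if_neg (by simp), dif_pos h, h1]

/-- The rows `p :: ps` of weight `γ` and the rest `Yo` form the run of `build p ps Yo`. -/
inductive WRun (γ : ℕ) :
    (ℕ × TimedTree ℕ κ) → List (ℕ × TimedTree ℕ κ) → Option (TimedTree ℕ κ) → Prop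
  | last (p : ℕ × TimedTree ℕ κ) (Y : TimedTree ℕ κ) : wt μ p.2 = γ → p.2.root ≠ some p.1 →
      γ < wt μ Y → codeMin (wk μ Y) ≠ some γ →
      (Y.root = some p.1 → ∀ q ∈ codePart p.1 (wt μ Y) (wk μ Y), γ < q.1) → WRun γ p [] (some Y)
  | pair (p q : ℕ × TimedTree ℕ κ) : wt μ p.2 = γ → p.2.root ≠ some p.1 → wt μ q.2 = γ →
      q.2.root ≠ some p.1 → q.1 = p.1 → WRun γ p [q] none
  | cons (p q : ℕ × TimedTree ℕ κ) (qs : List (ℕ × TimedTree ℕ κ))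
      (Yo : Option (TimedTree ℕ κ)) : wt μ p.2 = γ → p.2.root ≠ some p.1 → WRun γ q qs Yo →
      WRun γ p (q :: qs) Yo

variable {μ}

/-- This is the lengthening condition, in the strict form in which the trees use it. -/
theorem lt_wt_node (hμ : ∀ A B : Multiset κ, A ≠ 0 → B ≠ 0 → μ A ≤ μ B → μ A < μ (A + B))
    {Λ : Type*} {t : Λ} {l r : TimedTree Λ κ} (h : wt μ l ≤ wt μ r) :
    wt μ l < wt μ (node t l r) := by
  have := hμ l.leaves r.leaves (by simpa using l.leaves_ne_nil) (by simpa using r.leaves_ne_nil) h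
  simpa [wt, leaves] using this

/-- Induction along the spine. At each merged node the children of weight `γ` are rows, and what is
left is empty, a single child or several children. A single child continues the run precisely if its
own lightest child has weight `γ`; several children form a rest whose root was merged with the row.
These are the branches of `runStep`, so the decoding returns the rows and the rest. -/
theorem WRun.spec (hμ : ∀ A B : Multiset κ, A ≠ 0 → B ≠ 0 → μ A ≤ μ B → μ A < μ (A + B))
    {γ : ℕ} {p : ℕ × TimedTree ℕ κ} {ps : List (ℕ × TimedTree ℕ κ)} {Yo : Option (TimedTree ℕ κ)}
    (h : WRun μ γ p ps Yo) :
    γ < wt μ (build p ps Yo) ∧ (build p ps Yo).root = some p.1 ∧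
    ∃ A B : Multiset (ℕ × ℕ), A ≠ 0 ∧ (∀ q ∈ A, q.1 = γ) ∧ (∀ q ∈ B, γ < q.1) ∧
      wk μ (build p ps Yo) = .inr (p.1, A + B) ∧
      ∀ n, ps.length ≤ n → runStep (runCode n) p.1 γ A B =
        ((((p :: ps).map fun q => (q.1, ecode μ q.2) : List (ℕ × ℕ)) : Multiset (ℕ × ℕ)),
          Yo.map (wk μ)) := by
  induction h with
  | last p Y hp hr hY hm hB =>
    refine ⟨by rw [← hp]; exact lt_wt_node hμ (by omega), rfl, {(γ, ecode μ p.2)},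
      codePart p.1 (wt μ Y) (wk μ Y), by simp, by simp, ?_, ?_, ?_⟩
    · by_cases h : Y.root = some p.1
      · exact hB h
      · rw [codePart_of_root_ne μ h]
        simpa using hY
    · rw [build, wk, codePart_of_root_ne μ hr, hp]
    · intro n _
      -- If the root of the rest is merged with the row, at least two children of it remain, and the
      -- rest is the node that they form; otherwise the rest is the only remaining child.
      by_cases h : Y.root = some p.1
      · have h2 := two_le_card_codePart μ h
        have h3 : codePart p.1 (wt μ Y) (wk μ Y) ≠ 0 := by
          intro h0
          rw [h0] at h2
          simp at h2
        rw [runStep, if_neg h3, dif_neg]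
        · rw [← wk_of_root μ h]
          simp
        · rintro ⟨y, m, h4⟩
          rw [h4] at h2
          simp at h2
      · rw [codePart_of_root_ne μ h, ecode, ecode, runStep_singleton, if_neg hm]
        simp [ecode]
  | pair p q hp hr hq hqr hs =>
    refine ⟨by rw [← hp]; exact lt_wt_node hμ (by simp [build, hp, hq]), rfl,
      {(γ, ecode μ p.2), (γ, ecode μ q.2)}, 0, by simp, by simp, by simp, ?_, ?_⟩
    · rw [build, wk, codePart_of_root_ne μ hr, build, codePart_of_root_ne μ hqr, hp, hq]
      rfl
    · intro n _
      rw [runStep, if_pos rfl]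
      simp [hs]
      rfl
  | cons p q qs Yo hp hr hrun ih =>
    obtain ⟨h1, h2, A, B, hA0, hA, hB, hwk, hstep⟩ := ih
    refine ⟨by rw [← hp]; exact lt_wt_node hμ (by omega), rfl, ?_⟩
    -- Rows with equal split times lie at one merged node; a later split time starts a new node,
    -- which is then the only child apart from the row.
    by_cases h : q.1 = p.1
    · refine ⟨{(γ, ecode μ p.2)} + A, B, by simp, ?_, hB, ?_, ?_⟩
      · simpa using hA
      · rw [build, wk, codePart_of_root_ne μ hr, hwk, codePart, if_pos h, hp, add_assoc]
      · intro n hn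
        rw [runStep_add, ← h, hstep n (by simp at hn; omega), h]
        simp
    · have h' : (build q qs Yo).root ≠ some p.1 := by
        rw [h2]
        simpa using h
      refine ⟨{(γ, ecode μ p.2)}, {(wt μ (build q qs Yo), ecode μ (build q qs Yo))}, by simp,
        by simp, by simpa using h1, ?_, ?_⟩
      · rw [build, wk, codePart_of_root_ne μ hr, codePart_of_root_ne μ h', hp]
      · intro n hn
        obtain ⟨n, rfl⟩ : ∃ k, n = k + 1 := ⟨n - 1, by simp at hn; omega⟩
        rw [ecode, ecode, runStep_singleton, hwk, if_pos (codeMin_add hA0 hA hB),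
          runCode_succ hA0 hA hB, hstep n (by simpa using hn)]
        simp [ecode]

theorem WRun.codeMin_wk (hμ : ∀ A B : Multiset κ, A ≠ 0 → B ≠ 0 → μ A ≤ μ B → μ A < μ (A + B))
    {γ : ℕ} {p : ℕ × TimedTree ℕ κ} {ps : List (ℕ × TimedTree ℕ κ)} {Yo : Option (TimedTree ℕ κ)}
    (h : WRun μ γ p ps Yo) : codeMin (wk μ (build p ps Yo)) = some γ := by
  obtain ⟨-, -, A, B, hA0, hA, hB, hwk, -⟩ := h.spec hμ
  rw [hwk, codeMin_add hA0 hA hB]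

/-- The weight `γ` is the smallest weight of a child, and `runCode` computes the rows and the rest
from the code alone. Rows are recovered only up to order, because a merged node has no order on its
children. -/
theorem WRun.unique (hμ : ∀ A B : Multiset κ, A ≠ 0 → B ≠ 0 → μ A ≤ μ B → μ A < μ (A + B))
    {γ γ' : ℕ} {p p' : ℕ × TimedTree ℕ κ} {ps ps' : List (ℕ × TimedTree ℕ κ)}
    {Yo Yo' : Option (TimedTree ℕ κ)} (h : WRun μ γ p ps Yo) (h' : WRun μ γ' p' ps' Yo')
    (e : wk μ (build p ps Yo) = wk μ (build p' ps' Yo')) :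
    γ = γ' ∧ ((p :: ps).map fun q => (q.1, ecode μ q.2)).Perm
      ((p' :: ps').map fun q => (q.1, ecode μ q.2)) ∧ Yo.map (wk μ) = Yo'.map (wk μ) := by
  have hγ : γ = γ' := by
    have := h.codeMin_wk hμ
    rw [e, h'.codeMin_wk hμ] at this
    exact (Option.some.inj this).symm
  subst hγ
  obtain ⟨-, -, A, B, hA0, hA, hB, hwk, hstep⟩ := h.spec hμ
  obtain ⟨-, -, A', B', hA0', hA', hB', hwk', hstep'⟩ := h'.spec hμ
  have h1 := hstep (max ps.length ps'.length) (le_max_left _ _)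
  have h2 := hstep' (max ps.length ps'.length) (le_max_right _ _)
  rw [← runCode_succ hA0 hA hB, ← hwk] at h1
  rw [← runCode_succ hA0' hA' hB', ← hwk', ← e, h1] at h2
  simp only [Prod.mk.injEq] at h2
  exact ⟨rfl, Multiset.coe_eq_coe.1 h2.1, h2.2⟩

end Codes

end TimedTree

/-! ### Valid trees and their runs along the right spine -/

namespace TimedTree

section Runs

variable {κ : Type*} [Encodable κ] (μ : Multiset κ → ℕ)

/-- The time of the root, or zero for a leaf. -/
def rt {α : Type*} (T : TimedTree ℕ α) : ℕ := T.root.getD 0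

/-- The tie-breaking comparison of two subtrees of equal weight. -/
def TieLE (l r : TimedTree ℕ κ) : Prop := fcode l < fcode r ∨ fcode l = fcode r ∧ rt l ≤ rt r

/-- Trees with distinct times, which increase from the root to the leaves, where every left child
precedes its sibling. -/
def Valid : TimedTree ℕ κ → Prop
  | leaf _ => True
  | node t l r => (∀ u ∈ l.times, t < u) ∧ (∀ u ∈ r.times, t < u) ∧ l.times.Disjoint r.times ∧
      (wt μ l < wt μ r ∨ wt μ l = wt μ r ∧ TieLE l r) ∧ Valid l ∧ Valid r

/-- The weight of the left child. -/
def leftWt : TimedTree ℕ κ → Option ℕ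
  | leaf _ => none
  | node _ l _ => some (wt μ l)

/-- The maximal initial part of the right spine with left children of equal weight. -/
def run : TimedTree ℕ κ →
    (ℕ × TimedTree ℕ κ) × List (ℕ × TimedTree ℕ κ) × Option (TimedTree ℕ κ)
  | leaf x => ((0, leaf x), [], none)
  | node t l r =>
    if leftWt μ r = some (wt μ l) then ((t, l), (run r).1 :: (run r).2.1, (run r).2.2)
    else if wt μ r = wt μ l then ((t, l), [(t, r)], none) else ((t, l), [], some r)

/-- The rows `p :: ps` of weight `γ` and the rest `Yo` form the run of `build p ps Yo`. -/
inductive SRun (γ : ℕ) :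
    (ℕ × TimedTree ℕ κ) → List (ℕ × TimedTree ℕ κ) → Option (TimedTree ℕ κ) → Prop
  | last (p : ℕ × TimedTree ℕ κ) (Y : TimedTree ℕ κ) : wt μ p.2 = γ → wt μ Y ≠ γ →
      leftWt μ Y ≠ some γ → SRun γ p [] (some Y)
  | pair (p q : ℕ × TimedTree ℕ κ) : wt μ p.2 = γ → wt μ q.2 = γ → leftWt μ q.2 ≠ some γ →
      q.1 = p.1 → SRun γ p [q] none
  | cons (p q : ℕ × TimedTree ℕ κ) (qs : List (ℕ × TimedTree ℕ κ))
      (Yo : Option (TimedTree ℕ κ)) : wt μ p.2 = γ → SRun γ q qs Yo → SRun γ p (q :: qs) Yo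

variable {μ}

theorem Valid.heap {T : TimedTree ℕ κ} (h : Valid μ T) : T.Heap := by
  induction T with
  | leaf x => trivial
  | node t l r hl hr =>
    exact ⟨fun u hu => (h.1 u hu).le, fun u hu => (h.2.1 u hu).le, hl h.2.2.2.2.1, hr h.2.2.2.2.2⟩

theorem Valid.nodup {T : TimedTree ℕ κ} (h : Valid μ T) : T.times.Nodup := by
  induction T with
  | leaf x => simp [times]
  | node t l r hl hr =>
    rw [times, List.nodup_cons, List.nodup_append']
    refine ⟨fun h' => ?_, hl h.2.2.2.2.1, hr h.2.2.2.2.2, h.2.2.1⟩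
    rcases List.mem_append.1 h' with h' | h'
    · exact lt_irrefl _ (h.1 t h')
    · exact lt_irrefl _ (h.2.1 t h')

theorem Valid.wt_le {t : ℕ} {l r : TimedTree ℕ κ} (h : Valid μ (node t l r)) :
    wt μ l ≤ wt μ r := by
  rcases h.2.2.2.1 with h | h
  · exact h.le
  · exact h.1.le

theorem fcode_mapT {T : TimedTree ℕ κ} {f : ℕ → ℕ}
    (hf : ∀ a ∈ T.times, ∀ b ∈ T.times, f a < f b ↔ a < b) : fcode (mapT f T) = fcode T := by
  rw [fcode, fcode, std_mapT hf]

theorem TieLE.mapT {l r : TimedTree ℕ κ} {f g : ℕ → ℕ}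
    (hf : ∀ a ∈ l.times, ∀ b ∈ l.times, f a < f b ↔ a < b)
    (hg : ∀ a ∈ r.times, ∀ b ∈ r.times, g a < g b ↔ a < b)
    (hfg : ∀ a ∈ l.times, ∀ b ∈ r.times, a ≤ b → f a ≤ g b)
    (h : TieLE l r) : TieLE (mapT f l) (mapT g r) := by
  rw [TieLE, fcode_mapT hf, fcode_mapT hg]
  rcases h with h | ⟨h, h'⟩
  · exact Or.inl h
  · refine Or.inr ⟨h, ?_⟩
    cases l with
    | leaf x => simp [rt, root, TimedTree.mapT]
    | node t l1 l2 =>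
      cases r with
      | leaf x =>
        have := std_eq_of_fcode_eq h
        simp [std, TimedTree.mapT] at this
      | node s r1 r2 => exact hfg t (by simp [times]) s (by simp [times]) h'

theorem Valid.mapT {T : TimedTree ℕ κ} (h : Valid μ T) {f : ℕ → ℕ}
    (hf : ∀ a ∈ T.times, ∀ b ∈ T.times, f a < f b ↔ a < b) : Valid μ (mapT f T) := by
  induction T with
  | leaf x => trivial
  | node t l r hl hr =>
    obtain ⟨h1, h2, h3, h4, h5, h6⟩ := h
    simp only [times, List.mem_cons, List.mem_append] at hf
    have hfl : ∀ a ∈ l.times, ∀ b ∈ l.times, f a < f b ↔ a < b := fun a ha b hb =>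
      hf a (Or.inr (Or.inl ha)) b (Or.inr (Or.inl hb))
    have hfr : ∀ a ∈ r.times, ∀ b ∈ r.times, f a < f b ↔ a < b := fun a ha b hb =>
      hf a (Or.inr (Or.inr ha)) b (Or.inr (Or.inr hb))
    refine ⟨?_, ?_, ?_, ?_, hl h5 hfl, hr h6 hfr⟩
    · simp only [times_mapT, List.mem_map]
      rintro _ ⟨u, hu, rfl⟩
      exact (hf _ (Or.inl rfl) _ (Or.inr (Or.inl hu))).2 (h1 u hu)
    · simp only [times_mapT, List.mem_map]
      rintro _ ⟨u, hu, rfl⟩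
      exact (hf _ (Or.inl rfl) _ (Or.inr (Or.inr hu))).2 (h2 u hu)
    · simp only [times_mapT]
      intro x hx hx'
      obtain ⟨a, ha, rfl⟩ := List.mem_map.1 hx
      obtain ⟨b, hb, hab⟩ := List.mem_map.1 hx'
      have e1 := hf a (Or.inr (Or.inl ha)) b (Or.inr (Or.inr hb))
      have e2 := hf b (Or.inr (Or.inr hb)) a (Or.inr (Or.inl ha))
      rw [hab] at e1 e2
      have : a = b := by
        rcases lt_trichotomy a b with h | h | h
        · exact absurd (e1.2 h) (lt_irrefl _)
        · exact h
        · exact absurd (e2.2 h) (lt_irrefl _)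
      exact h3 ha (this ▸ hb)
    · rw [wt_mapT, wt_mapT]
      rcases h4 with h4 | ⟨h4, h4'⟩
      · exact Or.inl h4
      · refine Or.inr ⟨h4, h4'.mapT hfl hfr fun a ha b hb hab => ?_⟩
        rw [← not_lt, hf b (Or.inr (Or.inr hb)) a (Or.inr (Or.inl ha))]
        exact not_lt.2 hab

theorem Valid.std {T : TimedTree ℕ κ} (h : Valid μ T) : Valid μ (std T) :=
  h.mapT fun _ ha _ _ => listIdx_lt_iff ha

@[simp] theorem leftWt_mapT (f : ℕ → ℕ) (T : TimedTree ℕ κ) :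
    leftWt μ (mapT f T) = leftWt μ T := by
  cases T <;> simp [leftWt, mapT]

theorem build_run (T : TimedTree ℕ κ) :
    build (run μ T).1 (run μ T).2.1 (run μ T).2.2 = T := by
  induction T with
  | leaf x => rfl
  | node t l r hl hr =>
    rw [run]
    split_ifs
    · simp [build, hr]
    · rfl
    · rfl

theorem sRun_run {T : TimedTree ℕ κ} {γ : ℕ} (h : leftWt μ T = some γ) :
    SRun μ γ (run μ T).1 (run μ T).2.1 (run μ T).2.2 := by
  induction T with
  | leaf x => simp [leftWt] at h
  | node t l r hl hr =>
    simp only [leftWt, Option.some.injEq] at h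
    rw [run]
    split_ifs with h1 h2
    · exact SRun.cons _ _ _ _ h (hr (by rw [h1, h]))
    · exact SRun.pair _ _ h (h2.trans h) (by rwa [h] at h1) rfl
    · exact SRun.last _ _ h (by rwa [h] at h2) (by rwa [h] at h1)

theorem SRun.leftWt_build {γ : ℕ} {p : ℕ × TimedTree ℕ κ} {ps : List (ℕ × TimedTree ℕ κ)}
    {Yo : Option (TimedTree ℕ κ)} (h : SRun μ γ p ps Yo) :
    leftWt μ (build p ps Yo) = some γ := by
  cases h <;> simp_all [build, leftWt]

theorem SRun.root_build {γ : ℕ} {p : ℕ × TimedTree ℕ κ} {ps : List (ℕ × TimedTree ℕ κ)}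
    {Yo : Option (TimedTree ℕ κ)} (h : SRun μ γ p ps Yo) :
    (build p ps Yo).root = some p.1 := by
  cases h <;> rfl

theorem SRun.wt_eq {γ : ℕ} {p : ℕ × TimedTree ℕ κ} {ps : List (ℕ × TimedTree ℕ κ)}
    {Yo : Option (TimedTree ℕ κ)} (h : SRun μ γ p ps Yo) : ∀ q ∈ p :: ps, wt μ q.2 = γ := by
  induction h with
  | last p Y hp _ _ => simpa using hp
  | pair p q hp hq _ _ => simp [hp, hq]
  | cons p q qs Yo hp _ ih =>
    intro q' hq'
    rcases List.mem_cons.1 hq' with rfl | h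
    · exact hp
    · exact ih _ h

/-- The side conditions in `SRun` are the branching conditions of `run`, so a decomposition that
satisfies them is the run. -/
theorem SRun.run_build {γ : ℕ} {p : ℕ × TimedTree ℕ κ} {ps : List (ℕ × TimedTree ℕ κ)}
    {Yo : Option (TimedTree ℕ κ)} (h : SRun μ γ p ps Yo) :
    run μ (build p ps Yo) = (p, ps, Yo) := by
  induction h with
  | last p Y hp hY hl => simp [build, run, hp, hY, hl]
  | pair p q hp hq hl hs =>
    simp [build, run, hp, hq, hl]
    exact Prod.ext hs.symm rfl
  | cons p q qs Yo hp hrun ih => simp [build, run, hp, hrun.leftWt_build, ih]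

theorem SRun.map {γ : ℕ} {p : ℕ × TimedTree ℕ κ} {ps : List (ℕ × TimedTree ℕ κ)}
    {Yo : Option (TimedTree ℕ κ)} (h : SRun μ γ p ps Yo) (f : ℕ → ℕ) :
    SRun μ γ (f p.1, mapT f p.2) (ps.map fun q => (f q.1, mapT f q.2)) (Yo.map (mapT f)) := by
  induction h with
  | last p Y hp hY hl => exact SRun.last _ _ (by simpa) (by simpa) (by simpa)
  | pair p q hp hq hl hs => exact SRun.pair _ _ (by simpa) (by simpa) (by simpa) (by simp [hs])
  | cons p q qs Yo hp hrun ih => exact SRun.cons _ _ _ _ (by simpa) ih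

theorem SRun.length_lt {γ : ℕ} {p : ℕ × TimedTree ℕ κ} {ps : List (ℕ × TimedTree ℕ κ)}
    {Yo : Option (TimedTree ℕ κ)} (h : SRun μ γ p ps Yo) :
    (∀ q ∈ p :: ps, q.2.times.length < (build p ps Yo).times.length) ∧
      ∀ Y ∈ Yo, Y.times.length < (build p ps Yo).times.length := by
  induction h with
  | last p Y hp hY hl =>
    simp [build, times]
  | pair p q hp hq hl hs =>
    simp [build, times]
  | cons p q qs Yo hp hrun ih =>
    simp only [build, times, List.length_cons, List.length_append]
    refine ⟨fun q' hq' => ?_, fun Y hY => ?_⟩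
    · rcases List.mem_cons.1 hq' with rfl | h
      · omega
      · have := ih.1 _ h
        omega
    · have := ih.2 Y hY
      omega

/-- The rows that contribute the time of a node of the right spine. -/
def sRows {α : Type*} (p : α) (ps : List α) {β : Type*} : Option β → List α
  | none => (p :: ps).dropLast
  | some _ => p :: ps

theorem mem_of_mem_sRows {α β : Type*} {p : α} {ps : List α} {Yo : Option β} {q : α}
    (h : q ∈ sRows p ps Yo) : q ∈ p :: ps := by
  cases Yo with
  | none => exact List.mem_of_mem_dropLast h
  | some Y => exact h

/-- Without a rest, the last row sits in the place of a right child and no node is split off for it;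
therefore `sRows` omits it. -/
theorem times_build_perm {Λ α : Type*} (p : Λ × TimedTree Λ α) (ps : List (Λ × TimedTree Λ α))
    (Yo : Option (TimedTree Λ α)) :
    (build p ps Yo).times.Perm ((p :: ps).flatMap (fun q => q.2.times) ++
      ((sRows p ps Yo).map Prod.fst ++ Yo.elim [] times)) := by
  induction ps generalizing p with
  | nil =>
    cases Yo with
    | none => simp [build, sRows]
    | some Y =>
      simp only [build, times, sRows, List.flatMap_cons, List.flatMap_nil, List.append_nil,
        List.map_cons, List.map_nil, Option.elim, List.singleton_append]
      exact List.perm_middle.symm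
  | cons q qs ih =>
    have h1 : sRows p (q :: qs) Yo = p :: sRows q qs Yo := by
      cases Yo <;> simp [sRows]
    rw [build, times, h1, List.map_cons, List.flatMap_cons]
    refine ((List.Perm.append_left _ (ih q)).cons p.1).trans ?_
    rw [List.append_assoc]
    refine List.perm_middle.symm.trans ?_
    refine List.Perm.append_left _ ?_
    exact List.perm_middle.symm

theorem mem_times_build {Λ α : Type*} {p : Λ × TimedTree Λ α} {ps : List (Λ × TimedTree Λ α)}
    {Yo : Option (TimedTree Λ α)} {t : Λ} :
    t ∈ (build p ps Yo).times ↔ (∃ q ∈ p :: ps, t ∈ q.2.times) ∨ (∃ q ∈ sRows p ps Yo, q.1 = t) ∨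
      ∃ Y ∈ Yo, t ∈ Y.times := by
  rw [(times_build_perm p ps Yo).mem_iff, List.mem_append, List.mem_append, List.mem_flatMap,
    List.mem_map]
  cases Yo <;> simp

theorem Valid.of_build {p : ℕ × TimedTree ℕ κ} {ps : List (ℕ × TimedTree ℕ κ)}
    {Yo : Option (TimedTree ℕ κ)} (h : Valid μ (build p ps Yo)) :
    (∀ q ∈ p :: ps, Valid μ q.2) ∧ ∀ Y ∈ Yo, Valid μ Y := by
  induction ps generalizing p with
  | nil =>
    cases Yo with
    | none => simpa [build] using h
    | some Y => simpa using ⟨h.2.2.2.2.1, h.2.2.2.2.2⟩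
  | cons q qs ih =>
    have := ih h.2.2.2.2.2
    refine ⟨fun q' hq' => ?_, this.2⟩
    rcases List.mem_cons.1 hq' with rfl | h'
    · exact h.2.2.2.2.1
    · exact this.1 _ h'

/-- The order of the rows of a valid tree. -/
def RowLT (Yo : Option (TimedTree ℕ κ)) (q q' : ℕ × TimedTree ℕ κ) : Prop :=
  q.1 < q'.1 ∨ q.1 = q'.1 ∧ Yo = none ∧ TieLE q.2 q'.2

/-- Split times increase down the spine. Only the last two rows of a run without rest share a split
time, and they are ordered by the tie-breaking rule of the node whose children they are. -/
theorem SRun.rows_of_valid {γ : ℕ} {p : ℕ × TimedTree ℕ κ} {ps : List (ℕ × TimedTree ℕ κ)}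
    {Yo : Option (TimedTree ℕ κ)} (h : SRun μ γ p ps Yo) (hv : Valid μ (build p ps Yo)) :
    (∀ q ∈ p :: ps, ∀ t ∈ q.2.times, q.1 < t) ∧
    (∀ q ∈ p :: ps, ∀ Y ∈ Yo, ∀ t ∈ Y.times, q.1 < t) ∧
    (p :: ps).Pairwise (RowLT Yo) ∧
    (sRows p ps Yo).Pairwise (fun q q' => q.1 < q'.1) ∧ (∀ Y ∈ Yo, γ < wt μ Y) ∧
    (∀ q ∈ p :: ps, p.1 ≤ q.1) := by
  induction h with
  | last p Y hp hY hl =>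
    refine ⟨by simpa using hv.1, by simpa using hv.2.1, by simp, by simp [sRows], ?_, by simp⟩
    have := hv.wt_le
    simp only [Option.mem_def, Option.some.injEq]
    rintro _ rfl
    omega
  | pair p q hp hq hl hs =>
    refine ⟨?_, by simp, ?_, by simp [sRows], by simp, by simp [hs]⟩
    · simpa [hs] using ⟨hv.1, hv.2.1⟩
    · simp only [List.pairwise_cons, List.mem_singleton, forall_eq, List.not_mem_nil,
        IsEmpty.forall_iff, implies_true, List.Pairwise.nil, and_self, and_true]
      refine Or.inr ⟨hs.symm, rfl, ?_⟩
      rcases hv.2.2.2.1 with h | h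
      · rw [build, hp, hq] at h
        exact absurd h (lt_irrefl _)
      · exact h.2
  | cons p q qs Yo hp hrun ih =>
    obtain ⟨h1, h2, h3, h4, h5, h6⟩ := ih hv.2.2.2.2.2
    have hpq : p.1 < q.1 := hv.2.1 _ (mem_times_of_root hrun.root_build)
    have hall : ∀ q' ∈ q :: qs, p.1 < q'.1 := fun q' hq' => lt_of_lt_of_le hpq (h6 q' hq')
    have h7 : sRows p (q :: qs) Yo = p :: sRows q qs Yo := by
      cases Yo <;> simp [sRows]
    refine ⟨?_, ?_, ?_, ?_, h5, ?_⟩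
    · intro q' hq'
      rcases List.mem_cons.1 hq' with rfl | h'
      · exact hv.1
      · exact h1 _ h'
    · intro q' hq' Y hY t ht
      rcases List.mem_cons.1 hq' with rfl | h'
      · exact hpq.trans (h2 q (by simp) Y hY t ht)
      · exact h2 _ h' Y hY t ht
    · exact List.pairwise_cons.2 ⟨fun q' hq' => Or.inl (hall q' hq'), h3⟩
    · rw [h7]
      exact List.pairwise_cons.2 ⟨fun q' hq' => hall q' (mem_of_mem_sRows hq'), h4⟩
    · intro q' hq'
      rcases List.mem_cons.1 hq' with rfl | h'
      · exact le_rfl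
      · exact (hall _ h').le

end Runs

end TimedTree

/-! ### The reading order of the times -/

namespace TimedTree

section Keys

variable {κ : Type*} [Encodable κ] (μ : Multiset κ → ℕ)

/-- The position in the reading order of the time `t` inside a row `q`. -/
noncomputable def cKey (ρ : TimedTree ℕ κ → ℕ → ℕ) (q : ℕ × TimedTree ℕ κ) (t : ℕ) : List ℕ :=
  [0, fcode q.2, ρ q.2 t, listNext q.2.times q.1 t, rt q.2]

/-- The position in the reading order of the time at which a row is split off. -/
def sKey (c : ℕ) (q : ℕ × TimedTree ℕ κ) : List ℕ := [c, fcode q.2, rt q.2, q.1]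

open Classical in
/-- The times at which rows of weight `γ` are split off are read before those of the rest unless
the next left child is smaller. -/
noncomputable def sClass (γ : ℕ) : Option (TimedTree ℕ κ) → ℕ
  | none => 1
  | some Y => if ∃ m, leftWt μ Y = some m ∧ m < γ then 3 else 1

/-- All times of a tree with their positions in the reading order, in terms of the reading orders
`ρ` of the parts of its run. -/
noncomputable def keyList (ρ : TimedTree ℕ κ → ℕ → ℕ) (p : ℕ × TimedTree ℕ κ)
    (ps : List (ℕ × TimedTree ℕ κ)) (Yo : Option (TimedTree ℕ κ)) : List (ℕ × List ℕ) :=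
  (p :: ps).flatMap (fun q => q.2.times.map fun t => (t, cKey ρ q t)) ++
    ((sRows p ps Yo).map (fun q => (q.1, sKey (sClass μ (wt μ p.2) Yo) q)) ++
      Yo.elim [] fun Y => Y.times.map fun t => (t, [2, ρ Y t]))

/-- The position of the time `t` in the reading order. -/
noncomputable def keyOf (ρ : TimedTree ℕ κ → ℕ → ℕ) (T : TimedTree ℕ κ) (t : ℕ) : List ℕ :=
  ((keyList μ ρ (run μ T).1 (run μ T).2.1 (run μ T).2.2).lookup t).getD []

/-- Auxiliary recursion for `ridx`. -/
noncomputable def ridxAux : ℕ → TimedTree ℕ κ → ℕ → ℕ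
  | 0, _, _ => 0
  | n + 1, T, t => T.times.countP fun u =>
      keyOf μ (fun R v => ridxAux n (std R) (listIdx R.times v)) T u <
        keyOf μ (fun R v => ridxAux n (std R) (listIdx R.times v)) T t

/-- The number of times of `T` that are read before `t`. -/
noncomputable def ridx (T : TimedTree ℕ κ) (t : ℕ) : ℕ :=
  ridxAux μ T.times.length (std T) (listIdx T.times t)

/-- The reading order of the times of `T`. -/
noncomputable def key (T : TimedTree ℕ κ) (t : ℕ) : List ℕ := keyOf μ (ridx μ) T t

variable {μ}

/-- The parts of a run have fewer times than the tree, so keys only call the recursion on smaller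
trees. -/
theorem keyOf_congr {ρ ρ' : TimedTree ℕ κ → ℕ → ℕ} {T : TimedTree ℕ κ}
    (h : ∀ R : TimedTree ℕ κ, R.times.length < T.times.length → ρ R = ρ' R) :
    keyOf μ ρ T = keyOf μ ρ' T := by
  cases T with
  | leaf x => rfl
  | node t l r =>
    have hr := sRun_run (μ := μ) (T := node t l r) rfl
    have hl := hr.length_lt
    rw [build_run] at hl
    funext u
    rw [keyOf, keyOf]
    congr 2
    unfold keyList
    congr 1
    · refine List.flatMap_congr fun q hq => ?_
      unfold cKey
      rw [h _ (hl.1 q hq)]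
    · congr 1
      cases hY : (run μ (node t l r)).2.2 with
      | none => rfl
      | some Y =>
        simp only [Option.elim]
        rw [h _ (hl.2 Y hY)]

/-- The first argument of `ridxAux` merely bounds the depth of the recursion; any bound that is
large enough gives the same result. -/
theorem ridxAux_eq {n m : ℕ} {T : TimedTree ℕ κ} (hn : T.times.length ≤ n)
    (hm : T.times.length ≤ m) : ridxAux μ n T = ridxAux μ m T := by
  induction n generalizing m T with
  | zero =>
    cases m with
    | zero => rfl
    | succ m =>
      funext t
      rw [ridxAux, ridxAux, List.eq_nil_of_length_eq_zero (Nat.le_zero.1 hn)]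
      rfl
  | succ n ih =>
    cases m with
    | zero =>
      funext t
      rw [ridxAux, ridxAux, List.eq_nil_of_length_eq_zero (Nat.le_zero.1 hm)]
      rfl
    | succ m =>
      funext t
      rw [ridxAux, ridxAux, keyOf_congr (T := T)]
      intro R hR
      funext v
      rw [ih (T := std R) (m := m)]
      · simp
        omega
      · simp
        omega

/-- With the recursion bound removed, `ridx` counts the times with smaller key. It is stated for
standardized trees because `ridx` is evaluated there, which makes it a function of the shape and the
column. -/
theorem ridx_of_std {G : TimedTree ℕ κ} (hG : std G = G) (hn : G.times.Nodup) {j : ℕ}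
    (hj : j ∈ G.times) :
    ridx μ G j = G.times.countP fun i => key μ G i < key μ G j := by
  have hp : G.times.Perm (List.range G.times.length) := by
    have := times_std_perm hn
    rwa [hG] at this
  have hidx : listIdx G.times j = j := by
    rw [listIdx_perm hp]
    exact listIdx_range (List.mem_range.1 (hp.mem_iff.1 hj))
  rw [ridx, hG, hidx]
  have h : G.times.length ≤ G.times.length := le_rfl
  obtain ⟨n, hn⟩ : ∃ n, G.times.length = n + 1 :=
    ⟨G.times.length - 1, by have := List.length_pos_of_mem hj; omega⟩
  rw [hn, ridxAux]
  have : keyOf μ (fun R v => ridxAux μ n (std R) (listIdx R.times v)) G = key μ G := by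
    refine keyOf_congr fun R hR => ?_
    funext v
    rw [ridx, ridxAux_eq (n := n) (m := R.times.length)]
    · simp
      omega
    · simp
  rw [this]

theorem ridx_std (R : TimedTree ℕ κ) (t : ℕ) :
    ridx μ (std R) (listIdx R.times t) = ridx μ R t := by
  rw [ridx, ridx, std_std]
  congr 1
  · simp
  · rw [times_std, listIdx_map]
    exact fun u hu => listIdx_lt_iff hu

theorem lookup_eq_some_of_mem {α β : Type*} [DecidableEq α] {l : List (α × β)}
    (h : (l.map Prod.fst).Nodup) {a : α} {b : β} (hab : (a, b) ∈ l) : l.lookup a = some b := by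
  induction l with
  | nil => simp at hab
  | cons x l ih =>
    obtain ⟨x1, x2⟩ := x
    simp only [List.map_cons, List.nodup_cons] at h
    rcases List.mem_cons.1 hab with h' | h'
    · obtain ⟨rfl, rfl⟩ := Prod.mk.inj h'
      simp [List.lookup]
    · have : a ≠ x1 := by
        rintro rfl
        exact h.1 (List.mem_map_of_mem (f := Prod.fst) h')
      rw [List.lookup_cons, beq_eq_false_iff_ne.2 this]
      exact ih h.2 h'

theorem keyList_fst_perm (ρ : TimedTree ℕ κ → ℕ → ℕ) (p : ℕ × TimedTree ℕ κ)
    (ps : List (ℕ × TimedTree ℕ κ)) (Yo : Option (TimedTree ℕ κ)) :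
    ((keyList μ ρ p ps Yo).map Prod.fst).Perm (build p ps Yo).times := by
  refine List.Perm.trans (List.Perm.of_eq ?_) (times_build_perm p ps Yo).symm
  unfold keyList
  rw [List.map_append, List.map_append, List.map_flatMap]
  congr 1
  · simp [Function.comp_def]
  · congr 1
    · simp [Function.comp_def]
    · cases Yo <;> simp [Function.comp_def]

/-- The list `keyList` mentions every time once, so the lookup returns the entry belonging to the
part of the run that contains the time. Later arguments about the reading order rest on these three
formulas. -/
theorem SRun.key_eq {γ : ℕ} {p : ℕ × TimedTree ℕ κ} {ps : List (ℕ × TimedTree ℕ κ)}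
    {Yo : Option (TimedTree ℕ κ)} (h : SRun μ γ p ps Yo) (hn : (build p ps Yo).times.Nodup) :
    (∀ q ∈ p :: ps, ∀ t ∈ q.2.times, key μ (build p ps Yo) t = cKey (ridx μ) q t) ∧
    (∀ q ∈ sRows p ps Yo, key μ (build p ps Yo) q.1 = sKey (sClass μ γ Yo) q) ∧
    ∀ Y ∈ Yo, ∀ t ∈ Y.times, key μ (build p ps Yo) t = [2, ridx μ Y t] := by
  have hn' := (keyList_fst_perm (μ := μ) (ridx μ) p ps Yo).nodup_iff.2 hn
  have hγ : wt μ p.2 = γ := h.wt_eq p (by simp)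
  have main : ∀ t k, (t, k) ∈ keyList μ (ridx μ) p ps Yo → key μ (build p ps Yo) t = k := by
    intro t k hk
    rw [key, keyOf, h.run_build, lookup_eq_some_of_mem hn' hk]
    rfl
  refine ⟨fun q hq t ht => main _ _ ?_, fun q hq => main _ _ ?_, fun Y hY t ht => main _ _ ?_⟩
  · exact List.mem_append.2 (Or.inl (List.mem_flatMap.2 ⟨q, hq, List.mem_map.2 ⟨t, ht, rfl⟩⟩))
  · refine List.mem_append.2 (Or.inr (List.mem_append.2 (Or.inl (List.mem_map.2 ⟨q, hq, ?_⟩))))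
    rw [hγ]
  · refine List.mem_append.2 (Or.inr (List.mem_append.2 (Or.inr ?_)))
    rw [Option.mem_def] at hY
    subst hY
    exact List.mem_map.2 ⟨t, ht, rfl⟩

end Keys

end TimedTree

/-! ### Runs with indexed rows, and injectivity of the reading order -/

namespace TimedTree

section BuildIdx

variable {Λ Λ' α β γ : Type*}

/-- `build` for rows that depend on their position. -/
def buildIdx (F : ℕ → β → Λ × TimedTree Λ α) (p : β) (ps : List β) (Yo : Option (TimedTree Λ α)) :
    TimedTree Λ α :=
  build (F 0 p) (ps.mapIdx fun i => F (i + 1)) Yo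

theorem mapT_buildIdx (f : Λ → Λ') (F : ℕ → β → Λ × TimedTree Λ α) (p : β) (ps : List β)
    (Yo : Option (TimedTree Λ α)) :
    mapT f (buildIdx F p ps Yo) =
      buildIdx (fun i a => (f (F i a).1, mapT f (F i a).2)) p ps (Yo.map (mapT f)) := by
  rw [buildIdx, mapT_build, buildIdx]
  congr 1
  exact List.ext_getElem (by simp) (by simp)

theorem buildIdx_map (g : γ → β) (F : ℕ → β → Λ × TimedTree Λ α) (p : γ) (ps : List γ)
    (Yo : Option (TimedTree Λ α)) :
    buildIdx F (g p) (ps.map g) Yo = buildIdx (fun i a => F i (g a)) p ps Yo := by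
  rw [buildIdx, buildIdx]
  congr 1
  exact List.ext_getElem (by simp) (by simp)

theorem mem_sRows_iff {α β : Type*} {p : α} {ps : List α} {Yo : Option β} {q : α} :
    q ∈ sRows p ps Yo ↔
      ∃ i, ∃ h : i < (p :: ps).length, (i + 1 < (p :: ps).length ∨ Yo ≠ none) ∧
        (p :: ps)[i] = q := by
  cases Yo with
  | none =>
    rw [sRows, List.mem_iff_getElem]
    constructor
    · rintro ⟨i, hi, rfl⟩
      simp only [List.length_dropLast, List.length_cons] at hi
      refine ⟨i, by simp; omega, Or.inl (by simp; omega), ?_⟩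
      rw [List.getElem_dropLast]
    · rintro ⟨i, hi, h, rfl⟩
      simp only [ne_eq, not_true_eq_false, or_false, List.length_cons] at h
      exact ⟨i, by simp; omega, by rw [List.getElem_dropLast]⟩
  | some Y =>
    rw [sRows, List.mem_iff_getElem]
    simp

theorem mem_times_buildIdx {F : ℕ → β → Λ × TimedTree Λ α} {p : β} {ps : List β}
    {Yo : Option (TimedTree Λ α)} {t : Λ} :
    t ∈ (buildIdx F p ps Yo).times ↔
      (∃ i, ∃ h : i < (p :: ps).length, t ∈ (F i (p :: ps)[i]).2.times) ∨
      (∃ i, ∃ h : i < (p :: ps).length, (i + 1 < (p :: ps).length ∨ Yo ≠ none) ∧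
        (F i (p :: ps)[i]).1 = t) ∨
      ∃ Y ∈ Yo, t ∈ Y.times := by
  have h0 : F 0 p :: (ps.mapIdx fun i => F (i + 1)) = (p :: ps).mapIdx F := by
    rw [List.mapIdx_cons]
  rw [buildIdx, mem_times_build, h0]
  have h1 : (∃ q ∈ (p :: ps).mapIdx F, t ∈ q.2.times) ↔
      ∃ i, ∃ h : i < (p :: ps).length, t ∈ (F i (p :: ps)[i]).2.times := by
    constructor
    · rintro ⟨q, hq, ht⟩
      obtain ⟨i, hi, rfl⟩ := List.mem_mapIdx.1 hq
      exact ⟨i, hi, ht⟩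
    · rintro ⟨i, hi, ht⟩
      exact ⟨_, List.mem_mapIdx.2 ⟨i, hi, rfl⟩, ht⟩
  have h2 : (∃ q ∈ sRows (F 0 p) (ps.mapIdx fun i => F (i + 1)) Yo, q.1 = t) ↔
      ∃ i, ∃ h : i < (p :: ps).length, (i + 1 < (p :: ps).length ∨ Yo ≠ none) ∧
        (F i (p :: ps)[i]).1 = t := by
    have hl : (F 0 p :: (ps.mapIdx fun i => F (i + 1))).length = (p :: ps).length := by simp
    have hg : ∀ i (h : i < (F 0 p :: (ps.mapIdx fun i => F (i + 1))).length)
        (h' : i < (p :: ps).length), (F 0 p :: (ps.mapIdx fun i => F (i + 1)))[i] =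
          F i (p :: ps)[i] := by
      intro i h h'
      cases i <;> simp
    constructor
    · rintro ⟨q, hq, rfl⟩
      obtain ⟨i, hi, h, rfl⟩ := mem_sRows_iff.1 hq
      rw [hl] at h
      exact ⟨i, hl ▸ hi, h, by rw [hg i hi (hl ▸ hi)]⟩
    · rintro ⟨i, hi, h, rfl⟩
      exact ⟨F i (p :: ps)[i], mem_sRows_iff.2 ⟨i, hl.symm ▸ hi, hl.symm ▸ h, hg i _ hi⟩, rfl⟩
  rw [h1, h2]

end BuildIdx

/-- The value `g` need not be a function of `f` globally: it is enough that matched entries agree.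
-/
theorem perm_map_of_perm_map {α α' β γ : Type*} {l : List α} {l' : List α'} {f : α → β}
    {f' : α' → β} {g : α → γ} {g' : α' → γ} (h : (l.map f).Perm (l'.map f'))
    (hfg : ∀ a ∈ l, ∀ b ∈ l', f a = f' b → g a = g' b) : (l.map g).Perm (l'.map g') := by
  induction l generalizing l' with
  | nil =>
    have : l' = [] := by simpa using h.symm
    simp [this]
  | cons a l ih =>
    have ha : f a ∈ l'.map f' := h.mem_iff.1 (by simp)
    obtain ⟨b, hb, hab⟩ := List.mem_map.1 ha
    obtain ⟨A, B, rfl⟩ := List.append_of_mem hb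
    have h1 : ((A ++ B).map f').Perm (l.map f) := by
      have h2 : ((A ++ b :: B).map f').Perm (f' b :: (A ++ B).map f') := by
        simp only [List.map_append, List.map_cons]
        exact List.perm_middle
      have h3 := h2.symm.trans h.symm
      rw [List.map_cons, ← hab] at h3
      exact h3.cons_inv
    have h4 := ih h1.symm fun x hx y hy => hfg x (List.mem_cons_of_mem _ hx) y (by
      simp only [List.mem_append, List.mem_cons] at hy ⊢
      tauto)
    rw [List.map_cons, hfg a (by simp) b (by simp) hab.symm]
    refine (h4.cons _).trans ?_
    simp only [List.map_append, List.map_cons]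
    exact List.perm_middle.symm

section KeyInj

variable {κ : Type*} [Encodable κ] {μ : Multiset κ → ℕ}

theorem ridx_eq_listIdx {G : TimedTree ℕ κ} (hG : std G = G) (hn : G.times.Nodup) {j : ℕ}
    (hj : j ∈ G.times) : ridx μ G j = listIdx (G.times.map (key μ G)) (key μ G j) := by
  rw [ridx_of_std hG hn hj, listIdx, List.countP_map]
  exact List.countP_congr fun i _ => by simp

theorem ridx_lt_iff {G : TimedTree ℕ κ} (hG : std G = G) (hn : G.times.Nodup) {i j : ℕ}
    (hi : i ∈ G.times) (hj : j ∈ G.times) : ridx μ G i < ridx μ G j ↔ key μ G i < key μ G j := by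
  rw [ridx_eq_listIdx hG hn hi, ridx_eq_listIdx hG hn hj,
    listIdx_lt_iff (List.mem_map_of_mem hi)]

theorem rt_mem {T : TimedTree ℕ κ} {t : ℕ} (h : t ∈ T.times) : rt T ∈ T.times := by
  cases T with
  | leaf x => simp [times] at h
  | node t l r => simp [rt, root, times]

theorem disjoint_of_nodup_build {Λ α : Type*} {p : Λ × TimedTree Λ α}
    {ps : List (Λ × TimedTree Λ α)} {Yo : Option (TimedTree Λ α)}
    (hn : (build p ps Yo).times.Nodup) :
    (p :: ps).Pairwise fun q q' => q.2.times.Disjoint q'.2.times := by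
  have := (times_build_perm p ps Yo).nodup_iff.1 hn
  exact (List.nodup_flatMap.1 (List.nodup_append'.1 this).1).2

theorem sClass_eq (γ : ℕ) (Yo : Option (TimedTree ℕ κ)) :
    sClass μ γ Yo = 1 ∨ sClass μ γ Yo = 3 := by
  cases Yo with
  | none => exact Or.inl rfl
  | some Y =>
    simp only [sClass]
    split_ifs
    · exact Or.inr rfl
    · exact Or.inl rfl

/-- Both statements are proved together: keys of a tree contain positions in smaller trees, and
positions in a tree count keys of its standardization. -/
theorem key_and_ridx_injOn (n : ℕ) : ∀ T : TimedTree ℕ κ, T.times.length ≤ n → Valid μ T →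
    ∀ t ∈ T.times, ∀ u ∈ T.times,
      (key μ T t = key μ T u → t = u) ∧ (ridx μ T t = ridx μ T u → t = u) := by
  induction n with
  | zero =>
    intro T hT _ t ht
    rw [List.eq_nil_of_length_eq_zero (Nat.le_zero.1 hT)] at ht
    simp at ht
  | succ n ih =>
    have main : ∀ T : TimedTree ℕ κ, T.times.length ≤ n + 1 → Valid μ T →
        ∀ t ∈ T.times, ∀ u ∈ T.times, key μ T t = key μ T u → t = u := by
      intro T hT hv t ht u hu htu
      obtain ⟨γ, hγ⟩ : ∃ γ, leftWt μ T = some γ := by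
        cases T with
        | leaf x => simp [times] at ht
        | node t l r => exact ⟨_, rfl⟩
      have hrun := sRun_run hγ
      have hb := build_run (μ := μ) T
      generalize (run μ T).1 = p at hrun hb
      generalize (run μ T).2.1 = ps at hrun hb
      generalize (run μ T).2.2 = Yo at hrun hb
      subst hb
      obtain ⟨k1, k2, k3⟩ := hrun.key_eq hv.nodup
      have hdis := disjoint_of_nodup_build hv.nodup
      have hlen := hrun.length_lt
      have hval := hv.of_build
      have hc := sClass_eq (μ := μ) γ Yo
      rcases mem_times_build.1 ht with ⟨q, hq, htq⟩ | ⟨q, hq, rfl⟩ | ⟨Y, hY, htY⟩ <;>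
        rcases mem_times_build.1 hu with ⟨q', hq', huq⟩ | ⟨q', hq', rfl⟩ | ⟨Y', hY', huY⟩
      · rw [k1 q hq t htq, k1 q' hq' u huq] at htu
        simp only [cKey, List.cons.injEq, true_and, and_true] at htu
        obtain ⟨hf, hri, -, hrt⟩ := htu
        -- Times in different rows are told apart by the last entry of the key, because the roots of
        -- disjoint rows have different times.
        by_cases hqq : q = q'
        · subst hqq
          exact (ih q.2 (by have := hlen.1 q hq; omega) (hval.1 q hq) t htq u huq).2 hri
        · have : Std.Symm fun a b : ℕ × TimedTree ℕ κ => a.2.times.Disjoint b.2.times :=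
            ⟨fun _ _ h => h.symm⟩
          have := hdis.forall hq hq' hqq
          exact absurd (rt_mem huq) (hrt ▸ this (rt_mem htq))
      · rw [k1 q hq t htq, k2 q' hq'] at htu
        simp only [cKey, sKey, List.cons.injEq] at htu
        omega
      · rw [k1 q hq t htq, k3 Y' hY' u huY] at htu
        simp [cKey] at htu
      · rw [k1 q' hq' u huq, k2 q hq] at htu
        simp only [cKey, sKey, List.cons.injEq] at htu
        omega
      · rw [k2 q hq, k2 q' hq'] at htu
        simp only [sKey, List.cons.injEq] at htu
        exact htu.2.2.2.1
      · rw [k2 q hq, k3 Y' hY' u huY] at htu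
        simp [sKey] at htu
      · rw [k3 Y hY t htY, k1 q' hq' u huq] at htu
        simp [cKey] at htu
      · rw [k2 q' hq', k3 Y hY t htY] at htu
        simp [sKey] at htu
      · rw [k3 Y hY t htY, k3 Y' hY' u huY] at htu
        obtain rfl : Y = Y' := Option.mem_unique hY hY'
        simp only [List.cons.injEq, true_and, and_true] at htu
        exact (ih Y (by have := hlen.2 Y hY; omega) (hval.2 Y hY) t htY u huY).2 htu
    intro T hT hv t ht u hu
    refine ⟨main T hT hv t ht u hu, fun h => ?_⟩
    rw [← ridx_std T t, ← ridx_std T u] at h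
    have hmem : ∀ v ∈ T.times, listIdx T.times v ∈ (std T).times := fun v hv => by
      rw [times_std]
      exact List.mem_map_of_mem hv
    rw [ridx_eq_listIdx (std_std T) hv.std.nodup (hmem t ht),
      ridx_eq_listIdx (std_std T) hv.std.nodup (hmem u hu)] at h
    have h1 := listIdx_inj (List.mem_map_of_mem (hmem t ht)) (List.mem_map_of_mem (hmem u hu)) h
    exact listIdx_inj ht hu
      (main (std T) (by simpa using hT) hv.std _ (hmem t ht) _ (hmem u hu) h1)

theorem Valid.ridx_inj {T : TimedTree ℕ κ} (h : Valid μ T) {t u : ℕ} (ht : t ∈ T.times)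
    (hu : u ∈ T.times) (htu : ridx μ T t = ridx μ T u) : t = u :=
  (key_and_ridx_injOn _ T le_rfl h t ht u hu).2 htu

theorem Valid.key_inj {T : TimedTree ℕ κ} (h : Valid μ T) {t u : ℕ} (ht : t ∈ T.times)
    (hu : u ∈ T.times) (htu : key μ T t = key μ T u) : t = u :=
  (key_and_ridx_injOn _ T le_rfl h t ht u hu).1 htu

end KeyInj

end TimedTree

/-! ### Compatible identifications and lexicographic codes of times -/

namespace TimedTree

section Compatible

variable {κ : Type*} [Encodable κ] (μ : Multiset κ → ℕ)

/-- The map `w` of times is weakly increasing and only identifies times which occur in reading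
order. -/
def Compat (T : TimedTree ℕ κ) (w : ℕ → ℕ) : Prop :=
  (∀ t ∈ T.times, ∀ u ∈ T.times, t ≤ u → w t ≤ w u) ∧
    ∀ t ∈ T.times, ∀ u ∈ T.times, t < u → w t = w u → key μ T t < key μ T u

/-- The values of `w` at the times of `R`, in increasing order. -/
noncomputable def word (w : ℕ → ℕ) (R : TimedTree ℕ κ) : List ℕ :=
  (List.range R.times.length).map fun j => w (listUnidx R.times j)

/-- The label of column `j` in the `i`-th row, which has shape `G` and word `W`. -/
noncomputable def cCode (W : List ℕ) (G : TimedTree ℕ κ) (i j : ℕ) : List ℕ :=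
  W.getD j 0 :: 0 :: enc G :: ridx μ G j :: (W.drop (j + 1) ++ [i])

/-- The label of column `j` of the rest, which has shape `G` and word `W`. -/
noncomputable def yCode (W : List ℕ) (G : TimedTree ℕ κ) (j : ℕ) : List ℕ :=
  [W.getD j 0, 2, ridx μ G j]

/-- The labelled row with given time, shape and word. -/
noncomputable def codeRow (c i : ℕ) (d : ℕ × TimedTree ℕ κ × List ℕ) :
    List ℕ × TimedTree (List ℕ) κ :=
  ([d.1, c, i], mapT (cCode μ d.2.2 d.2.1 i) d.2.1)

/-- The tree labelled by lists that is determined by the shapes and words of its parts. -/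
noncomputable def codeTree (c : ℕ) (d : ℕ × TimedTree ℕ κ × List ℕ)
    (ds : List (ℕ × TimedTree ℕ κ × List ℕ)) (Yo : Option (TimedTree ℕ κ × List ℕ)) :
    TimedTree (List ℕ) κ :=
  buildIdx (codeRow μ c) d ds (Yo.map fun e => mapT (yCode μ e.2 e.1) e.1)

/-- The time, the shape and the word of a row. -/
noncomputable def rowData (w : ℕ → ℕ) (q : ℕ × TimedTree ℕ κ) : ℕ × TimedTree ℕ κ × List ℕ :=
  (w q.1, std q.2, word w q.2)

/-- The row with both its times and their codes. -/
noncomputable def pairRow (w : ℕ → ℕ) (c i : ℕ) (q : ℕ × TimedTree ℕ κ) :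
    (ℕ × List ℕ) × TimedTree (ℕ × List ℕ) κ :=
  ((q.1, [w q.1, c, i]),
    mapT (fun j => (listUnidx q.2.times j, cCode μ (word w q.2) (std q.2) i j)) (std q.2))

/-- The tree with both its times and their codes. -/
noncomputable def pairTree (w : ℕ → ℕ) (c : ℕ) (p : ℕ × TimedTree ℕ κ)
    (ps : List (ℕ × TimedTree ℕ κ)) (Yo : Option (TimedTree ℕ κ)) :
    TimedTree (ℕ × List ℕ) κ :=
  buildIdx (pairRow μ w c) p ps
    (Yo.map fun Y => mapT (fun j => (listUnidx Y.times j, yCode μ (word w Y) (std Y) j)) (std Y))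

variable {μ}

theorem mapT_fst_pairTree (w : ℕ → ℕ) (c : ℕ) (p : ℕ × TimedTree ℕ κ)
    (ps : List (ℕ × TimedTree ℕ κ)) (Yo : Option (TimedTree ℕ κ)) :
    mapT Prod.fst (pairTree μ w c p ps Yo) = build p ps Yo := by
  have h : ∀ R : TimedTree ℕ κ, mapT (fun j => listUnidx R.times j) (std R) = R :=
    fun R => mapT_listUnidx_std R
  rw [pairTree, mapT_buildIdx, Option.map_map]
  simp only [pairRow, mapT_mapT, Function.comp_def, h]
  rw [buildIdx]
  congr 1
  · exact List.ext_getElem (by simp) (by simp)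
  · cases Yo <;> simp

theorem mapT_snd_pairTree (w : ℕ → ℕ) (c : ℕ) (p : ℕ × TimedTree ℕ κ)
    (ps : List (ℕ × TimedTree ℕ κ)) (Yo : Option (TimedTree ℕ κ)) :
    mapT Prod.snd (pairTree μ w c p ps Yo) =
      codeTree μ c (rowData w p) (ps.map (rowData w)) (Yo.map fun Y => (std Y, word w Y)) := by
  rw [pairTree, mapT_buildIdx, codeTree, buildIdx_map, Option.map_map, Option.map_map]
  simp only [pairRow, codeRow, rowData, mapT_mapT, Function.comp_def]

theorem length_word (w : ℕ → ℕ) (R : TimedTree ℕ κ) : (word w R).length = R.times.length := by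
  simp [word]

theorem word_getD (w : ℕ → ℕ) (R : TimedTree ℕ κ) {j : ℕ} (hj : j < R.times.length) :
    (word w R).getD j 0 = w (listUnidx R.times j) := by
  simp [word, List.getD, hj]

theorem word_drop (w : ℕ → ℕ) (R : TimedTree ℕ κ) {j : ℕ} (hj : j < R.times.length) :
    (word w R).drop j = w (listUnidx R.times j) :: (word w R).drop (j + 1) := by
  rw [List.drop_eq_getElem_cons (by simpa [word] using hj)]
  simp [word]

theorem mem_times_std {R : TimedTree ℕ κ} (hR : R.times.Nodup) {j : ℕ} :
    j ∈ (std R).times ↔ j < R.times.length := by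
  rw [(times_std_perm hR).mem_iff, List.mem_range]

theorem ridx_std' {R : TimedTree ℕ κ} (hR : R.times.Nodup) {j : ℕ} (hj : j < R.times.length) :
    ridx μ (std R) j = ridx μ R (listUnidx R.times j) := by
  rw [← ridx_std R (listUnidx R.times j), listIdx_listUnidx hR hj]

/-- Compatibility restricts to any part whose own reading order is respected by the reading order of
the whole tree. The part is standardized so that it can be fed into the induction. -/
theorem Compat.sub {T R : TimedTree ℕ κ} {w : ℕ → ℕ} (hc : Compat μ T w) (hR : Valid μ R)
    (hsub : ∀ t ∈ R.times, t ∈ T.times)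
    (hk : ∀ t ∈ R.times, ∀ u ∈ R.times, key μ T t < key μ T u → ridx μ R t ≤ ridx μ R u) :
    Compat μ (std R) (w ∘ listUnidx R.times) := by
  have hmem : ∀ v ∈ R.times, listIdx R.times v ∈ (std R).times := fun v hv => by
    rw [times_std]
    exact List.mem_map_of_mem hv
  constructor
  · intro i hi j hj hij
    rw [times_std] at hi hj
    obtain ⟨t, ht, rfl⟩ := List.mem_map.1 hi
    obtain ⟨u, hu, rfl⟩ := List.mem_map.1 hj
    simp only [Function.comp, listUnidx_listIdx ht, listUnidx_listIdx hu]
    refine hc.1 _ (hsub t ht) _ (hsub u hu) ?_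
    by_contra h
    exact absurd ((listIdx_lt_iff hu).2 (not_le.1 h)) (not_lt.2 hij)
  · intro i hi j hj hij hw
    rw [times_std] at hi hj
    obtain ⟨t, ht, rfl⟩ := List.mem_map.1 hi
    obtain ⟨u, hu, rfl⟩ := List.mem_map.1 hj
    simp only [Function.comp, listUnidx_listIdx ht, listUnidx_listIdx hu] at hw
    have htu := (listIdx_lt_iff ht).1 hij
    have h1 := hk t ht u hu (hc.2 _ (hsub t ht) _ (hsub u hu) htu hw)
    have h2 : ridx μ R t ≠ ridx μ R u := fun h => htu.ne (hR.ridx_inj ht hu h)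
    rw [← ridx_lt_iff (std_std R) hR.std.nodup (hmem t ht) (hmem u hu), ridx_std, ridx_std]
    omega

theorem word_comp (w : ℕ → ℕ) {R : TimedTree ℕ κ} (hR : R.times.Nodup) :
    word (w ∘ listUnidx R.times) (std R) = word w R := by
  unfold word
  have : (std R).times.length = R.times.length := by simp
  rw [this]
  refine List.map_congr_left fun j hj => ?_
  rw [List.mem_range] at hj
  have h1 : listIdx (std R).times j = j := by
    rw [listIdx_perm (times_std_perm hR), listIdx_range hj]
  have h2 : listUnidx (std R).times j = j := by
    have h3 := (mem_times_std hR).2 hj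
    conv_lhs => rw [← h1]
    exact listUnidx_listIdx h3
  simp only [Function.comp]
  rw [h2]

theorem mapT_comp_std (w : ℕ → ℕ) (R : TimedTree ℕ κ) :
    mapT (w ∘ listUnidx R.times) (std R) = mapT w R := by
  rw [← mapT_mapT, mapT_listUnidx_std]

section Run

variable {γ : ℕ} {p : ℕ × TimedTree ℕ κ} {ps : List (ℕ × TimedTree ℕ κ)}
  {Yo : Option (TimedTree ℕ κ)} {w : ℕ → ℕ}

theorem SRun.mem_row {q : ℕ × TimedTree ℕ κ} {t : ℕ} (hq : q ∈ p :: ps) (ht : t ∈ q.2.times) :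
    t ∈ (build p ps Yo).times := mem_times_build.2 (Or.inl ⟨q, hq, ht⟩)

theorem SRun.mem_s {q : ℕ × TimedTree ℕ κ} (hq : q ∈ sRows p ps Yo) :
    q.1 ∈ (build p ps Yo).times := mem_times_build.2 (Or.inr (Or.inl ⟨q, hq, rfl⟩))

theorem SRun.mem_rest {Y : TimedTree ℕ κ} {t : ℕ} (hY : Y ∈ Yo) (ht : t ∈ Y.times) :
    t ∈ (build p ps Yo).times := mem_times_build.2 (Or.inr (Or.inr ⟨Y, hY, ht⟩))

theorem SRun.compat_row (h : SRun μ γ p ps Yo) (hv : Valid μ (build p ps Yo))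
    (hc : Compat μ (build p ps Yo) w) {q : ℕ × TimedTree ℕ κ} (hq : q ∈ p :: ps) :
    Compat μ (std q.2) (w ∘ listUnidx q.2.times) := by
  refine hc.sub (hv.of_build.1 q hq) (fun t ht => SRun.mem_row hq ht) fun t ht u hu hk => ?_
  have hkey := (h.key_eq hv.nodup).1 q hq
  rw [hkey t ht, hkey u hu] at hk
  simp only [cKey, List.cons_lt_cons_iff] at hk
  omega

theorem SRun.compat_rest (h : SRun μ γ p ps Yo) (hv : Valid μ (build p ps Yo))
    (hc : Compat μ (build p ps Yo) w) {Y : TimedTree ℕ κ} (hY : Y ∈ Yo) :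
    Compat μ (std Y) (w ∘ listUnidx Y.times) := by
  refine hc.sub (hv.of_build.2 Y hY) (fun t ht => SRun.mem_rest hY ht) fun t ht u hu hk => ?_
  have hkey := (h.key_eq hv.nodup).2.2 Y hY
  rw [hkey t ht, hkey u hu] at hk
  simp only [List.cons_lt_cons_iff] at hk
  rcases hk with hk | ⟨-, hk | hk⟩
  · omega
  · omega
  · exact hk.1.le

theorem Pairwise.getElem_of_lt {α : Type*} {R : α → α → Prop} {l : List α} (h : l.Pairwise R)
    {i j : ℕ} (hi : i < l.length) (hj : j < l.length) (hij : i < j) : R l[i] l[j] :=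
  List.pairwise_iff_getElem.1 h i j hi hj hij

theorem fcode_length {R R' : TimedTree ℕ κ} (h : fcode R = fcode R') :
    R.times.length = R'.times.length := by
  have := congrArg (fun T => T.times.length) (std_eq_of_fcode_eq h)
  simpa using this

/-- If two rows of the same shape have identified times in column `j`, compatibility makes the
earlier one come first in the reading order, and there the comparison passes to the next column.
Iterating to the last column compares the suffixes of the two words; a complete tie is decided by
the order of the rows. -/
theorem SRun.drop_lt (h : SRun μ γ p ps Yo) (hv : Valid μ (build p ps Yo))
    (hc : Compat μ (build p ps Yo) w) {i i' : ℕ} (hi : i < (p :: ps).length)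
    (hi' : i' < (p :: ps).length) (hne : i ≠ i')
    (hf : fcode (p :: ps)[i].2 = fcode (p :: ps)[i'].2) (k : ℕ) :
    ∀ j, j + (k + 1) = (p :: ps)[i].2.times.length →
      listUnidx (p :: ps)[i].2.times j < listUnidx (p :: ps)[i'].2.times j →
      (word w (p :: ps)[i].2).drop j ++ [i] < (word w (p :: ps)[i'].2).drop j ++ [i'] := by
  have hq : (p :: ps)[i] ∈ p :: ps := List.getElem_mem hi
  have hq' : (p :: ps)[i'] ∈ p :: ps := List.getElem_mem hi'
  have hdis : (p :: ps)[i].2.times.Disjoint (p :: ps)[i'].2.times := by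
    have := disjoint_of_nodup_build hv.nodup
    rcases lt_or_gt_of_ne hne with h' | h'
    · exact Pairwise.getElem_of_lt this hi hi' h'
    · exact (Pairwise.getElem_of_lt this hi' hi h').symm
  have hpair := (h.rows_of_valid hv).2.2.1
  have hrow : i' < i → RowLT Yo (p :: ps)[i'] (p :: ps)[i] :=
    fun h' => Pairwise.getElem_of_lt hpair hi' hi h'
  have hR := (hv.of_build.1 _ hq).nodup
  have hR' := (hv.of_build.1 _ hq').nodup
  have hkey := (h.key_eq hv.nodup).1
  generalize (p :: ps)[i] = q at *
  generalize (p :: ps)[i'] = q' at *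
  have hlen := fcode_length hf
  induction k with
  | zero =>
    intro j hj hlt
    have hjl : j < q.2.times.length := by omega
    have hjl' : j < q'.2.times.length := by omega
    have ht := listUnidx_mem hR hjl
    have ht' := listUnidx_mem hR' hjl'
    have hw := hc.1 _ (SRun.mem_row hq ht) _ (SRun.mem_row hq' ht') hlt.le
    rw [word_drop w q.2 hjl, word_drop w q'.2 hjl', List.cons_append, List.cons_append,
      List.cons_lt_cons_iff]
    rcases hw.lt_or_eq with hw | hw
    · exact Or.inl hw
    · refine Or.inr ⟨hw, ?_⟩
      have hk := hc.2 _ (SRun.mem_row hq ht) _ (SRun.mem_row hq' ht') hlt hw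
      rw [hkey q hq _ ht, hkey q' hq' _ ht', cKey, cKey, hf, ← ridx_std' hR hjl,
        ← ridx_std' hR' hjl', std_eq_of_fcode_eq hf, listNext_last hR q.1 (by omega),
        listNext_last hR' q'.1 (by omega)] at hk
      simp only [List.cons_lt_cons_iff, lt_self_iff_false, false_or, true_and, and_false,
        or_false] at hk
      have e1 : (word w q.2).drop (j + 1) = [] := List.drop_eq_nil_of_le (by rw [length_word]; omega)
      have e2 : (word w q'.2).drop (j + 1) = [] := List.drop_eq_nil_of_le (by rw [length_word]; omega)
      rw [e1, e2]
      simp only [List.nil_append, List.cons_lt_cons_iff, List.not_lt_nil, and_false, or_false]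
      -- In the last column the key compares the split times and then the roots of the rows, as does
      -- the order of the rows in a run, so the indices must be ordered in the same way.
      by_contra hcon
      rcases hrow (by omega) with h1 | ⟨h1, -, h2 | h2⟩
      · omega
      · omega
      · omega
  | succ k ih =>
    intro j hj hlt
    have hjl : j < q.2.times.length := by omega
    have hjl' : j < q'.2.times.length := by omega
    have ht := listUnidx_mem hR hjl
    have ht' := listUnidx_mem hR' hjl'
    have hw := hc.1 _ (SRun.mem_row hq ht) _ (SRun.mem_row hq' ht') hlt.le
    rw [word_drop w q.2 hjl, word_drop w q'.2 hjl', List.cons_append, List.cons_append,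
      List.cons_lt_cons_iff]
    rcases hw.lt_or_eq with hw | hw
    · exact Or.inl hw
    · refine Or.inr ⟨hw, ih (j + 1) (by omega) ?_⟩
      have hk := hc.2 _ (SRun.mem_row hq ht) _ (SRun.mem_row hq' ht') hlt hw
      rw [hkey q hq _ ht, hkey q' hq' _ ht', cKey, cKey, hf, ← ridx_std' hR hjl,
        ← ridx_std' hR' hjl', std_eq_of_fcode_eq hf, listNext_listUnidx hR q.1 (by omega),
        listNext_listUnidx hR' q'.1 (by omega)] at hk
      simp only [List.cons_lt_cons_iff, lt_self_iff_false, false_or, true_and, and_false,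
        or_false] at hk
      rcases hk with hk | ⟨hk, -⟩
      · exact hk
      · exact absurd (listUnidx_mem hR' (j := j + 1) (by omega))
          (hk ▸ hdis (listUnidx_mem hR (j := j + 1) (by omega)))

theorem mem_pairTree {a : ℕ × List ℕ} {c : ℕ} (hv : Valid μ (build p ps Yo))
    (ha : a ∈ (pairTree μ w c p ps Yo).times) :
    (∃ i, ∃ hi : i < (p :: ps).length, ∃ j < (p :: ps)[i].2.times.length,
      a = (listUnidx (p :: ps)[i].2.times j,
        w (listUnidx (p :: ps)[i].2.times j) :: 0 :: fcode (p :: ps)[i].2 ::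
          ridx μ (p :: ps)[i].2 (listUnidx (p :: ps)[i].2.times j) ::
          ((word w (p :: ps)[i].2).drop (j + 1) ++ [i]))) ∨
    (∃ i, ∃ hi : i < (p :: ps).length, (p :: ps)[i] ∈ sRows p ps Yo ∧
      a = ((p :: ps)[i].1, [w (p :: ps)[i].1, c, i])) ∨
    ∃ Y ∈ Yo, ∃ t ∈ Y.times, a = (t, [w t, 2, ridx μ Y t]) := by
  rcases mem_times_buildIdx.1 ha with ⟨i, hi, h⟩ | ⟨i, hi, h, rfl⟩ | ⟨Y, hY, h⟩
  · have hR := (hv.of_build.1 _ (List.getElem_mem hi)).nodup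
    simp only [pairRow, times_mapT] at h
    obtain ⟨j, hj, rfl⟩ := List.mem_map.1 h
    rw [mem_times_std hR] at hj
    refine Or.inl ⟨i, hi, j, hj, ?_⟩
    rw [cCode, word_getD w _ hj, ridx_std' hR hj]
    rfl
  · exact Or.inr (Or.inl ⟨i, hi, mem_sRows_iff.2 ⟨i, hi, by simpa using h, rfl⟩, rfl⟩)
  · obtain ⟨Y, hY', rfl⟩ := Option.map_eq_some_iff.1 hY
    have hR := (hv.of_build.2 _ hY').nodup
    rw [times_mapT] at h
    obtain ⟨j, hj, rfl⟩ := List.mem_map.1 h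
    rw [mem_times_std hR] at hj
    refine Or.inr (Or.inr ⟨Y, hY', _, listUnidx_mem hR hj, ?_⟩)
    rw [yCode, word_getD w _ hj, ridx_std' hR hj]

theorem SRun.sRow_lt (h : SRun μ γ p ps Yo) (hv : Valid μ (build p ps Yo)) {i i' : ℕ}
    (hi : i < (p :: ps).length) (hi' : i' < (p :: ps).length)
    (hlt : (p :: ps)[i].1 < (p :: ps)[i'].1) : i < i' := by
  by_contra hcon
  rcases (not_lt.1 hcon).lt_or_eq with h1 | rfl
  · rcases Pairwise.getElem_of_lt (h.rows_of_valid hv).2.2.1 hi' hi h1 with h2 | h2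
    · omega
    · have := h2.1
      omega
  · omega

/-- The codes are ordered like the original times. An increase of the value is seen in the first
entry. For identified times, compatibility gives an inequality of keys, and the remaining entries of
a code repeat the key, with comparisons of times replaced by comparisons of suffixes of words and of
row indices. Thus the times can be reconstructed from values alone. -/
theorem SRun.pairTree_lt (h : SRun μ γ p ps Yo) (hv : Valid μ (build p ps Yo))
    (hc : Compat μ (build p ps Yo) w) {a b : ℕ × List ℕ}
    (ha : a ∈ (pairTree μ w (sClass μ γ Yo) p ps Yo).times)
    (hb : b ∈ (pairTree μ w (sClass μ γ Yo) p ps Yo).times) (hab : a.1 < b.1) : a.2 < b.2 := by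
  obtain ⟨k1, k2, k3⟩ := h.key_eq hv.nodup
  have hcl := sClass_eq (μ := μ) γ Yo
  have ha' : a.1 ∈ (build p ps Yo).times := by
    rw [← mapT_fst_pairTree (μ := μ) w (sClass μ γ Yo), times_mapT]
    exact List.mem_map_of_mem ha
  have hb' : b.1 ∈ (build p ps Yo).times := by
    rw [← mapT_fst_pairTree (μ := μ) w (sClass μ γ Yo), times_mapT]
    exact List.mem_map_of_mem hb
  have hw := hc.1 _ ha' _ hb' hab.le
  have hk := hc.2 _ ha' _ hb' hab
  rcases mem_pairTree hv ha with ⟨i, hi, j, hj, rfl⟩ | ⟨i, hi, hs, rfl⟩ | ⟨Y, hY, t, ht, rfl⟩ <;>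
    rcases mem_pairTree hv hb with
      ⟨i', hi', j', hj', rfl⟩ | ⟨i', hi', hs', rfl⟩ | ⟨Y', hY', t', ht', rfl⟩ <;>
    simp only [] at hab hw hk ⊢ <;> rw [List.cons_lt_cons_iff] <;>
    rcases hw.lt_or_eq with hw | hw <;> (try exact Or.inl hw) <;> refine Or.inr ⟨hw, ?_⟩ <;>
    specialize hk hw
  · have hq := List.getElem_mem hi
    have hq' := List.getElem_mem hi'
    have hR := (hv.of_build.1 _ hq).nodup
    have hR' := (hv.of_build.1 _ hq').nodup
    rw [k1 _ hq _ (listUnidx_mem hR hj), k1 _ hq' _ (listUnidx_mem hR' hj')] at hk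
    simp only [cKey, List.cons_lt_cons_iff, lt_self_iff_false, false_or, true_and] at hk ⊢
    rcases hk with hk | ⟨hf, hk⟩
    · exact Or.inl hk
    refine Or.inr ⟨hf, ?_⟩
    rcases hk with hk | ⟨hr, hk⟩
    · exact Or.inl hk
    refine Or.inr ⟨hr, ?_⟩
    have hlen := fcode_length hf
    by_cases hne : i = i'
    · subst hne
      have := (hv.of_build.1 _ hq).ridx_inj (listUnidx_mem hR hj) (listUnidx_mem hR' hj') hr
      omega
    have hjj : j = j' := by
      rw [← ridx_std' hR hj, ← ridx_std' hR' hj', ← std_eq_of_fcode_eq hf] at hr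
      exact (hv.of_build.1 _ hq).std.ridx_inj ((mem_times_std hR).2 hj)
        ((mem_times_std hR).2 (by omega)) hr
    subst hjj
    -- The suffixes starting at column `j` are compared; their first letters are equal, so the
    -- inequality passes to the suffixes that occur in the codes.
    have := h.drop_lt hv hc hi hi' hne hf ((p :: ps)[i].2.times.length - j - 1) j (by omega) hab
    rw [word_drop w _ hj, word_drop w _ hj', List.cons_append, List.cons_append,
      List.cons_lt_cons_iff] at this
    rcases this with h1 | h1
    · omega
    · exact h1.2
  · rw [List.cons_lt_cons_iff]
    exact Or.inl (by omega)
  · rw [List.cons_lt_cons_iff]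
    exact Or.inl (by omega)
  · have hq' := List.getElem_mem hi'
    have hR' := (hv.of_build.1 _ hq').nodup
    rw [k2 _ hs, k1 _ hq' _ (listUnidx_mem hR' hj')] at hk
    simp only [cKey, sKey, List.cons_lt_cons_iff] at hk
    omega
  · simp only [List.cons_lt_cons_iff, lt_self_iff_false, false_or, true_and]
    exact Or.inl (h.sRow_lt hv hi hi' hab)
  · rw [k2 _ hs, k3 _ hY' _ ht'] at hk
    simp only [sKey, List.cons_lt_cons_iff] at hk ⊢
    omega
  · have hq' := List.getElem_mem hi'
    have hR' := (hv.of_build.1 _ hq').nodup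
    rw [k3 _ hY _ ht, k1 _ hq' _ (listUnidx_mem hR' hj')] at hk
    simp only [cKey, List.cons_lt_cons_iff] at hk
    omega
  · rw [k3 _ hY _ ht, k2 _ hs'] at hk
    simp only [sKey, List.cons_lt_cons_iff] at hk ⊢
    omega
  · obtain rfl : Y = Y' := Option.mem_unique hY hY'
    rw [k3 _ hY _ ht, k3 _ hY _ ht'] at hk
    exact (List.cons_lt_cons_iff.1 hk).resolve_left (lt_irrefl _) |>.2 |> fun h =>
      List.cons_lt_cons_iff.2 (Or.inr ⟨rfl, h⟩)

end Run

end Compatible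

end TimedTree

/-! ### Uniqueness: the code of the merged tree determines the facet -/

namespace TimedTree

theorem cons_le_cons_iff_of_linear {α : Type*} [LinearOrder α] {l l' : List α} {a b : α} :
    a :: l ≤ b :: l' ↔ a < b ∨ a = b ∧ l ≤ l' := by
  rw [← not_lt, List.cons_lt_cons_iff, ← not_lt (a := l')]
  rcases lt_trichotomy a b with h | h | h
  · simp [h, h.ne', h.not_gt]
  · simp [h]
  · simp [h, h.ne', h.not_gt]

theorem le_of_append_singleton_lt {α : Type*} [LinearOrder α] {l l' : List α} {a b : α}
    (hlen : l.length = l'.length) (h : l ++ [a] < l' ++ [b]) : l ≤ l' := by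
  induction l generalizing l' with
  | nil =>
    have : l' = [] := List.eq_nil_of_length_eq_zero (by simpa using hlen.symm)
    simp [this]
  | cons x l ih =>
    cases l' with
    | nil => simp at hlen
    | cons y l' =>
      rw [List.cons_append, List.cons_append, List.cons_lt_cons_iff] at h
      rw [cons_le_cons_iff_of_linear]
      rcases h with h | ⟨h, h'⟩
      · exact Or.inl h
      · exact Or.inr ⟨h, ih (by simpa using hlen) h'⟩

section Uniqueness

variable {κ : Type*} [Encodable κ] {μ : Multiset κ → ℕ}

theorem Valid.listUnidx_zero {T : TimedTree ℕ κ} (h : Valid μ T) (hT : 0 < T.times.length) :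
    listUnidx T.times 0 = rt T := by
  obtain ⟨t, ht⟩ := List.exists_mem_of_length_pos hT
  have h1 := rt_mem ht
  have h2 : listIdx T.times (rt T) = 0 := by
    rw [listIdx, List.countP_eq_zero]
    intro u hu
    simp only [decide_eq_true_eq, not_lt]
    cases T with
    | leaf x => simp [times] at ht
    | node s l r => exact h.heap.root_le rfl u hu
  rw [← h2, listUnidx_listIdx h1]

/-- The data of a row by which the rows of a tree are sorted. -/
noncomputable def rowKey (w : ℕ → ℕ) (q : ℕ × TimedTree ℕ κ) : List ℕ :=
  w q.1 :: fcode q.2 :: word w q.2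

theorem rowData_eq {w w' : ℕ → ℕ} {q q' : ℕ × TimedTree ℕ κ} (h : rowKey w q = rowKey w' q') :
    rowData w q = rowData w' q' := by
  simp only [rowKey, List.cons.injEq] at h
  rw [rowData, rowData, h.1, h.2.2, std_eq_of_fcode_eq h.2.1]

section Run

variable {γ : ℕ} {p : ℕ × TimedTree ℕ κ} {ps : List (ℕ × TimedTree ℕ κ)}
  {Yo : Option (TimedTree ℕ κ)} {w : ℕ → ℕ}

theorem SRun.head_mem (h : SRun μ γ p ps Yo) : p ∈ sRows p ps Yo := by
  cases h with
  | last => simp [sRows]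
  | pair => simp [sRows]
  | cons => cases Yo <;> simp [sRows]

theorem sRows_cons {α β : Type*} (p q : α) (qs : List α) (Yo : Option β) :
    sRows p (q :: qs) Yo = p :: sRows q qs Yo := by
  cases Yo <;> simp [sRows]

theorem SRun.exists_sRows (h : SRun μ γ p ps Yo) :
    ∀ q ∈ p :: ps, ∃ q' ∈ sRows p ps Yo, q'.1 = q.1 := by
  induction h with
  | last p Y => simp [sRows]
  | pair p q hp hq hl hs => simp [sRows, hs]
  | cons p q qs Yo hp hrun ih =>
    rw [sRows_cons]
    intro q' hq'
    rcases List.mem_cons.1 hq' with rfl | h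
    · exact ⟨_, List.mem_cons_self, rfl⟩
    · obtain ⟨q'', h1, h2⟩ := ih _ h
      exact ⟨q'', List.mem_cons_of_mem _ h1, h2⟩

theorem SRun.leftWt_rest (h : SRun μ γ p ps Yo) : ∀ Y ∈ Yo, leftWt μ Y ≠ some γ := by
  induction h with
  | last p Y hp hY hl => simpa using hl
  | pair p q hp hq hl hs => simp
  | cons p q qs Yo hp hrun ih => exact ih

/-- The root is the first time of a row, so this is the comparison of suffixes at column zero with
the row indices removed. -/
theorem SRun.word_le (h : SRun μ γ p ps Yo) (hv : Valid μ (build p ps Yo))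
    (hc : Compat μ (build p ps Yo) w) {q q' : ℕ × TimedTree ℕ κ} (hq : q ∈ p :: ps)
    (hq' : q' ∈ p :: ps) (hf : fcode q.2 = fcode q'.2) (hrt : rt q.2 ≤ rt q'.2) :
    word w q.2 ≤ word w q'.2 := by
  have hvq := hv.of_build.1 q hq
  have hvq' := hv.of_build.1 q' hq'
  have hlen := fcode_length hf
  rcases Nat.eq_zero_or_pos q.2.times.length with h0 | h0
  · rw [List.eq_nil_of_length_eq_zero (by rw [length_word, h0] : (word w q.2).length = 0)]
    exact not_lt.1 (List.not_lt_nil _)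
  obtain ⟨i, hi, rfl⟩ := List.mem_iff_getElem.1 hq
  obtain ⟨i', hi', rfl⟩ := List.mem_iff_getElem.1 hq'
  by_cases hne : i = i'
  · subst hne
    exact le_rfl
  have hlt : rt (p :: ps)[i].2 < rt (p :: ps)[i'].2 := by
    refine lt_of_le_of_ne hrt fun he => ?_
    obtain ⟨t, ht⟩ := List.exists_mem_of_length_pos h0
    obtain ⟨t', ht'⟩ := List.exists_mem_of_length_pos (hlen ▸ h0)
    have hdis := disjoint_of_nodup_build hv.nodup
    have hdis : (p :: ps)[i].2.times.Disjoint (p :: ps)[i'].2.times := by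
      rcases lt_or_gt_of_ne hne with h' | h'
      · exact Pairwise.getElem_of_lt hdis hi hi' h'
      · exact (Pairwise.getElem_of_lt hdis hi' hi h').symm
    exact hdis (rt_mem ht) (he ▸ rt_mem ht')
  have h1 := h.drop_lt hv hc hi hi' hne hf ((p :: ps)[i].2.times.length - 1) 0 (by omega)
    (by rw [hvq.listUnidx_zero h0, hvq'.listUnidx_zero (hlen ▸ h0)]; exact hlt)
  simp only [List.drop_zero] at h1
  exact le_of_append_singleton_lt (by rw [length_word, length_word, hlen]) h1

theorem SRun.rowKey_le_of_tie (h : SRun μ γ p ps Yo) (hv : Valid μ (build p ps Yo))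
    (hc : Compat μ (build p ps Yo) w) {q q' : ℕ × TimedTree ℕ κ} (hq : q ∈ p :: ps)
    (hq' : q' ∈ p :: ps) (hs : w q.1 = w q'.1) (ht : TieLE q.2 q'.2) :
    rowKey w q ≤ rowKey w q' := by
  rw [rowKey, rowKey, cons_le_cons_iff_of_linear, cons_le_cons_iff_of_linear]
  rcases ht with ht | ⟨ht, hr⟩
  · exact Or.inr ⟨hs, Or.inl ht⟩
  · exact Or.inr ⟨hs, Or.inr ⟨ht, h.word_le hv hc hq hq' ht hr⟩⟩

/-- Identified split times occur in reading order, and their keys compare shape and root, which is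
the tie-breaking rule of siblings. -/
theorem SRun.rowKey_le_of_lt (h : SRun μ γ p ps Yo) (hv : Valid μ (build p ps Yo))
    (hc : Compat μ (build p ps Yo) w) {q q' : ℕ × TimedTree ℕ κ} (hq : q ∈ sRows p ps Yo)
    (hq' : q' ∈ sRows p ps Yo) (hs : q.1 < q'.1) : rowKey w q ≤ rowKey w q' := by
  rcases (hc.1 _ (SRun.mem_s hq) _ (SRun.mem_s hq') hs.le).lt_or_eq with hw | hw
  · rw [rowKey, rowKey, cons_le_cons_iff_of_linear]
    exact Or.inl hw
  · have hk := hc.2 _ (SRun.mem_s hq) _ (SRun.mem_s hq') hs hw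
    have hkey := (h.key_eq hv.nodup).2.1
    rw [hkey q hq, hkey q' hq', sKey, sKey] at hk
    simp only [List.cons_lt_cons_iff, lt_self_iff_false, false_or, true_and] at hk
    refine h.rowKey_le_of_tie hv hc (mem_of_mem_sRows hq) (mem_of_mem_sRows hq') hw ?_
    rcases hk with hk | ⟨hf, hk | ⟨hk, -⟩⟩
    · exact Or.inl hk
    · exact Or.inr ⟨hf, hk.le⟩
    · exact Or.inr ⟨hf, hk.le⟩

/-- The last row of a run without rest has no split time of its own in `sRows`; it is compared with
its sibling by the tie-breaking rule instead. -/
theorem SRun.pairwise_rowKey_aux (h : SRun μ γ p ps Yo) (hv : Valid μ (build p ps Yo))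
    (ht : ∀ q ∈ p :: ps, ∀ q' ∈ p :: ps, q.1 = q'.1 → TieLE q.2 q'.2 → rowKey w q ≤ rowKey w q')
    (hl : ∀ q ∈ sRows p ps Yo, ∀ q' ∈ sRows p ps Yo, q.1 < q'.1 → rowKey w q ≤ rowKey w q') :
    (p :: ps).Pairwise fun q q' => rowKey w q ≤ rowKey w q' := by
  induction h with
  | last p Y => simp
  | pair p q hp hq hlw hs =>
    have : TieLE p.2 q.2 := by
      rcases hv.2.2.2.1 with h | h
      · rw [build, hp, hq] at h
        exact absurd h (lt_irrefl _)
      · exact h.2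
    simpa using ht p (by simp) q (by simp) hs.symm this
  | cons p q qs Yo hp hrun ih =>
    rw [sRows_cons] at hl
    have h1 := ih hv.2.2.2.2.2 (fun a ha b hb => ht a (by simp [ha]) b (by simp [hb]))
      (fun a ha b hb => hl a (by simp [ha]) b (by simp [hb]))
    have hpq : rowKey w p ≤ rowKey w q :=
      hl p (by simp) q (by simp [hrun.head_mem]) (hv.2.1 _ (mem_times_of_root hrun.root_build))
    refine List.pairwise_cons.2 ⟨fun q' hq' => ?_, h1⟩
    rcases List.mem_cons.1 hq' with rfl | h
    · exact hpq
    · exact hpq.trans ((List.pairwise_cons.1 h1).1 q' h)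

theorem SRun.pairwise_rowKey (h : SRun μ γ p ps Yo) (hv : Valid μ (build p ps Yo))
    (hc : Compat μ (build p ps Yo) w) :
    (p :: ps).Pairwise fun q q' => rowKey w q ≤ rowKey w q' :=
  h.pairwise_rowKey_aux hv
    (fun _ hq _ hq' hs ht => h.rowKey_le_of_tie hv hc hq hq' (congrArg w hs) ht)
    fun _ hq _ hq' hs => h.rowKey_le_of_lt hv hc hq hq' hs

theorem SRun.wRun_aux (h : SRun μ γ p ps Yo)
    (hr : ∀ q ∈ p :: ps, (mapT w q.2).root ≠ some (w q.1))
    (hY : ∀ Y ∈ Yo, γ < wt μ Y ∧ codeMin (wk μ (mapT w Y)) ≠ some γ)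
    (hB : ∀ q ∈ p :: ps, ∀ Y ∈ Yo, (mapT w Y).root = some (w q.1) →
      ∀ x ∈ codePart (w q.1) (wt μ Y) (wk μ (mapT w Y)), γ < x.1) :
    WRun μ γ (w p.1, mapT w p.2) (ps.map fun q => (w q.1, mapT w q.2)) (Yo.map (mapT w)) := by
  induction h with
  | last p Y hp hYw hl =>
    have h1 := hY Y rfl
    exact WRun.last _ _ (by simpa) (hr p (by simp)) (by simpa using h1.1) h1.2
      (by simpa using hB p (by simp) Y rfl)
  | pair p q hp hq hlw hs =>
    exact WRun.pair _ _ (by simpa) (hr p (by simp)) (by simpa) (hs ▸ hr q (by simp)) (by simp [hs])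
  | cons p q qs Yo hp hrun ih =>
    refine WRun.cons _ _ _ _ (by simpa) (hr p (by simp)) (ih ?_ hY ?_)
    · exact fun q' hq' => hr q' (List.mem_cons_of_mem _ hq')
    · exact fun q' hq' => hB q' (List.mem_cons_of_mem _ hq')

theorem le_of_mem_codePart {c : TreeCode κ} {m t x : ℕ} {q : ℕ × ℕ} (hc : codeMin c = some m)
    (ht : ∃ A, c = .inr (t, A)) (hq : q ∈ codePart t x c) : m ≤ q.1 := by
  obtain ⟨A, rfl⟩ := ht
  simp only [codePart, if_true] at hq
  simp only [codeMin, Option.some.injEq] at hc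
  rw [← hc]
  exact Nat.sInf_le ⟨q, hq, rfl⟩

/-- The reading order was designed for this. A split time precedes the times of its row but is read
after them, so a compatible identification cannot merge the row into the spine. The root of the rest
may be merged with a split time only if the split times are read before the rest, which happens only
if the left child of the rest is heavier than `γ`. -/
theorem SRun.wRun (h : SRun μ γ p ps Yo) (hv : Valid μ (build p ps Yo))
    (hc : Compat μ (build p ps Yo) w) (hm : ∀ Y ∈ Yo, codeMin (wk μ (mapT w Y)) = leftWt μ Y) :
    WRun μ γ (w p.1, mapT w p.2) (ps.map fun q => (w q.1, mapT w q.2)) (Yo.map (mapT w)) := by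
  obtain ⟨k1, k2, k3⟩ := h.key_eq hv.nodup
  obtain ⟨v1, v2, -, -, v5, -⟩ := h.rows_of_valid hv
  have hcl := sClass_eq (μ := μ) γ Yo
  refine h.wRun_aux ?_ (fun Y hY => ⟨v5 Y hY, ?_⟩) ?_
  · intro q hq hroot
    rw [root_mapT] at hroot
    obtain ⟨t, ht, htw⟩ := Option.map_eq_some_iff.1 hroot
    have htm := mem_times_of_root ht
    obtain ⟨q', hq', hs⟩ := h.exists_sRows q hq
    have hk := hc.2 _ (SRun.mem_s hq') _ (SRun.mem_row hq htm) (hs ▸ v1 q hq t htm)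
      (by rw [hs, htw])
    rw [k2 q' hq', k1 q hq t htm] at hk
    simp only [sKey, cKey, List.cons_lt_cons_iff] at hk
    omega
  · rw [hm Y hY]
    exact h.leftWt_rest Y hY
  · intro q hq Y hY hroot x hx
    rw [root_mapT] at hroot
    obtain ⟨t, ht, htw⟩ := Option.map_eq_some_iff.1 hroot
    have htm := mem_times_of_root ht
    obtain ⟨q', hq', hs⟩ := h.exists_sRows q hq
    have hk := hc.2 _ (SRun.mem_s hq') _ (SRun.mem_rest hY htm) (hs ▸ v2 q hq Y hY t htm)
      (by rw [hs, htw])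
    rw [k2 q' hq', k3 Y hY t htm] at hk
    simp only [sKey, List.cons_lt_cons_iff] at hk
    -- The rest has class two, and a split time identified with its root must be read earlier; this
    -- excludes the class three.
    have h1 : sClass μ γ Yo = 1 := by omega
    rw [Option.mem_def] at hY
    subst hY
    obtain ⟨m, hmY⟩ : ∃ m, leftWt μ Y = some m := by
      cases Y with
      | leaf x => simp [root] at ht
      | node t l r => exact ⟨_, rfl⟩
    have h2 : γ < m := by
      have h3 := h.leftWt_rest Y rfl
      rw [hmY] at h3
      have h4 : m ≠ γ := fun h => h3 (by rw [h])
      by_contra h5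
      have h6 : ∃ m, leftWt μ Y = some m ∧ m < γ := ⟨m, hmY, by omega⟩
      simp [sClass, h6] at h1
    refine lt_of_lt_of_le h2 (le_of_mem_codePart (c := wk μ (mapT w Y)) ?_ ?_ hx)
    · rw [hm Y rfl, hmY]
    · exact ⟨_, wk_of_root μ (by rw [root_mapT, ht, Option.map_some, htw])⟩

end Run

/-- A compatible identification leaves the left child of the root among the lightest children of the
merged node. The induction is on the rest, where the same fact shows that the rest does not continue
the run. -/
theorem codeMin_wk_mapT (hμ : ∀ A B : Multiset κ, A ≠ 0 → B ≠ 0 → μ A ≤ μ B → μ A < μ (A + B))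
    (n : ℕ) : ∀ (T : TimedTree ℕ κ) (w : ℕ → ℕ), T.times.length ≤ n → Valid μ T → Compat μ T w →
      codeMin (wk μ (mapT w T)) = leftWt μ T := by
  induction n with
  | zero =>
    intro T w hT _ _
    cases T with
    | leaf x => rfl
    | node t l r => simp [times] at hT
  | succ n ih =>
    intro T w hT hv hc
    cases hγ : leftWt μ T with
    | none =>
      cases T with
      | leaf x => rfl
      | node t l r => simp [leftWt] at hγ
    | some γ =>
      have hrun := sRun_run hγ
      have hb := build_run (μ := μ) T
      generalize (run μ T).1 = p at hrun hb
      generalize (run μ T).2.1 = ps at hrun hb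
      generalize (run μ T).2.2 = Yo at hrun hb
      subst hb
      rw [mapT_build]
      refine (hrun.wRun hv hc fun Y hY => ?_).codeMin_wk hμ
      have := ih (std Y) (w ∘ listUnidx Y.times)
        (by have := hrun.length_lt.2 Y hY; simp; omega) (hv.of_build.2 Y hY).std
        (hrun.compat_rest hv hc hY)
      rw [mapT_comp_std] at this
      rw [this, std, leftWt_mapT]

theorem word_congr {w w' : ℕ → ℕ} {R R' : TimedTree ℕ κ} (hR : R.times.Nodup) (h : R = R')
    (hw : mapT w R = mapT w' R') : word w R = word w' R' := by
  subst h
  refine List.map_congr_left fun j hj => ?_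
  exact eq_of_mapT_eq hw _ (listUnidx_mem hR (List.mem_range.1 hj))

/-- The first entry of every code is the identified time, so the merged tree is read off from the
codes. -/
theorem mapT_head_pairTree {w : ℕ → ℕ} {c : ℕ} {p : ℕ × TimedTree ℕ κ}
    {ps : List (ℕ × TimedTree ℕ κ)} {Yo : Option (TimedTree ℕ κ)}
    (hv : Valid μ (build p ps Yo)) :
    mapT w (build p ps Yo) = mapT (fun l => l.headD 0) (mapT Prod.snd (pairTree μ w c p ps Yo)) := by
  rw [← mapT_fst_pairTree (μ := μ) w c, mapT_mapT, mapT_mapT]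
  refine mapT_congr fun a ha => ?_
  rcases mem_pairTree hv ha with ⟨i, hi, j, hj, rfl⟩ | ⟨i, hi, hs, rfl⟩ | ⟨Y, hY, t, ht, rfl⟩ <;> rfl

/-- Times and codes are two labellings of one tree with the same relative order. Together with
`mapT_snd_pairTree`, this shows that the shape of a tree is determined by the shapes and words of
its parts. -/
theorem std_eq_std_codeTree {γ : ℕ} {w : ℕ → ℕ} {p : ℕ × TimedTree ℕ κ}
    {ps : List (ℕ × TimedTree ℕ κ)} {Yo : Option (TimedTree ℕ κ)} (h : SRun μ γ p ps Yo)
    (hv : Valid μ (build p ps Yo)) (hc : Compat μ (build p ps Yo) w) :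
    std (build p ps Yo) = std (mapT Prod.snd (pairTree μ w (sClass μ γ Yo) p ps Yo)) := by
  conv_lhs => rw [← mapT_fst_pairTree (μ := μ) w (sClass μ γ Yo)]
  refine std_mapT_eq fun a ha b hb => ⟨h.pairTree_lt hv hc ha hb, fun hab => ?_⟩
  by_contra hcon
  rcases (not_lt.1 hcon).lt_or_eq with h1 | h1
  · exact lt_asymm hab (h.pairTree_lt hv hc hb ha h1)
  · have hn : ((pairTree μ w (sClass μ γ Yo) p ps Yo).times.map Prod.fst).Nodup := by
      rw [← times_mapT, mapT_fst_pairTree]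
      exact hv.nodup
    rw [List.inj_on_of_nodup_map hn hb ha h1] at hab
    exact lt_irrefl _ hab

theorem map_eq_map_of_imp {α α' β δ : Type*} {l : List α} {l' : List α'} {f : α → β} {f' : α' → β}
    {g : α → δ} {g' : α' → δ} (h : l.map f = l'.map f') (hfg : ∀ a b, f a = f' b → g a = g' b) :
    l.map g = l'.map g' := by
  induction l generalizing l' with
  | nil => cases l' <;> simp_all
  | cons a l ih =>
    cases l' with
    | nil => simp at h
    | cons b l' =>
      simp only [List.map_cons, List.cons.injEq] at h ⊢
      exact ⟨hfg _ _ h.1, ih h.2⟩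

/-- A compatible identification of times of a valid tree is determined by the code of the
resulting tree. -/
theorem eq_of_wk_mapT_eq
    (hμ : ∀ A B : Multiset κ, A ≠ 0 → B ≠ 0 → μ A ≤ μ B → μ A < μ (A + B)) (n : ℕ) :
    ∀ (G G' : TimedTree ℕ κ) (w w' : ℕ → ℕ), G.times.length ≤ n → Valid μ G → Valid μ G' →
      std G = G → std G' = G' → Compat μ G w → Compat μ G' w' →
      wk μ (mapT w G) = wk μ (mapT w' G') → G = G' ∧ mapT w G = mapT w' G' := by
  induction n with
  | zero =>
    intro G G' w w' hG _ _ _ _ _ _ he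
    cases G with
    | node t l r => simp [times] at hG
    | leaf x =>
      cases G' with
      | node t l r => simp [mapT, wk] at he
      | leaf y =>
        simp only [mapT, wk, Sum.inl.injEq] at he
        subst he
        exact ⟨rfl, rfl⟩
  | succ n ih =>
    intro G G' w w' hG hv hv' hs hs' hc hc' he
    -- The lightest child recorded in the common code gives the weight of the left child in both
    -- trees, so both are leaves or both have a run with the same `γ`.
    have hm := codeMin_wk_mapT hμ _ G w le_rfl hv hc
    have hm' := codeMin_wk_mapT hμ _ G' w' le_rfl hv' hc'
    rw [he] at hm
    have hlw := hm.symm.trans hm'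
    cases hγ : leftWt μ G with
    | none =>
      rw [hγ] at hlw
      cases G with
      | node t l r => simp [leftWt] at hγ
      | leaf x =>
        cases G' with
        | node t l r => simp [leftWt] at hlw
        | leaf y =>
          simp only [mapT, wk, Sum.inl.injEq] at he
          subst he
          exact ⟨rfl, rfl⟩
    | some γ =>
      have hrun := sRun_run hγ
      have hrun' := sRun_run (hlw ▸ hγ : leftWt μ G' = some γ)
      have hb := build_run (μ := μ) G
      have hb' := build_run (μ := μ) G'
      generalize (run μ G).1 = p at hrun hb
      generalize (run μ G).2.1 = ps at hrun hb
      generalize (run μ G).2.2 = Yo at hrun hb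
      generalize (run μ G').1 = p' at hrun' hb'
      generalize (run μ G').2.1 = ps' at hrun' hb'
      generalize (run μ G').2.2 = Yo' at hrun' hb'
      subst hb
      subst hb'
      -- The induction hypothesis for parts of the two runs: equal codes after identification force
      -- equal shapes and equal words.
      have hsub : ∀ (R R' : TimedTree ℕ κ), R.times.length ≤ n → Valid μ R → Valid μ R' →
          Compat μ (std R) (w ∘ listUnidx R.times) → Compat μ (std R') (w' ∘ listUnidx R'.times) →
          wk μ (mapT w R) = wk μ (mapT w' R') → std R = std R' ∧ word w R = word w' R' := by
        intro R R' hR hvR hvR' hcR hcR' heR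
        have h1 := ih (std R) (std R') _ _ (by simpa using hR) hvR.std hvR'.std (std_std R)
          (std_std R') hcR hcR' (by rw [mapT_comp_std, mapT_comp_std, heR])
        refine ⟨h1.1, ?_⟩
        rw [← word_comp w hvR.nodup, ← word_comp w' hvR'.nodup]
        exact word_congr hvR.std.nodup h1.1 h1.2
      have hW := hrun.wRun hv hc fun Y hY => by
        have := codeMin_wk_mapT hμ _ (std Y) _ le_rfl (hv.of_build.2 Y hY).std
          (hrun.compat_rest hv hc hY)
        rwa [mapT_comp_std, std, leftWt_mapT] at this
      have hW' := hrun'.wRun hv' hc' fun Y hY => by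
        have := codeMin_wk_mapT hμ _ (std Y) _ le_rfl (hv'.of_build.2 Y hY).std
          (hrun'.compat_rest hv' hc' hY)
        rwa [mapT_comp_std, std, leftWt_mapT] at this
      rw [mapT_build, mapT_build] at he
      obtain ⟨-, hperm, hYo⟩ := hW.unique hμ hW' he
      have hperm1 : ((p :: ps).map fun q => (w q.1, ecode μ (mapT w q.2))).Perm
          ((p' :: ps').map fun q => (w' q.1, ecode μ (mapT w' q.2))) := by
        simpa [Function.comp_def] using hperm
      have hperm2 : ((p :: ps).map (rowKey w)).Perm ((p' :: ps').map (rowKey w')) := by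
        refine perm_map_of_perm_map hperm1 fun q hq q' hq' hqq => ?_
        simp only [Prod.mk.injEq] at hqq
        have h1 := hsub q.2 q'.2 (by have := hrun.length_lt.1 q hq; omega) (hv.of_build.1 q hq)
          (hv'.of_build.1 q' hq') (hrun.compat_row hv hc hq) (hrun'.compat_row hv' hc' hq')
          (Encodable.encode_injective hqq.2)
        rw [rowKey, rowKey, hqq.1, h1.2, fcode, fcode, h1.1]
      -- The code yields the rows as a multiset; both lists are sorted by the same key, so they
      -- agree as lists.
      have hrows : (p :: ps).map (rowKey w) = (p' :: ps').map (rowKey w') := by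
        refine List.Perm.eq_of_pairwise (le := (· ≤ ·)) (fun a b _ _ h h' => le_antisymm h h')
          (List.pairwise_map.2 (hrun.pairwise_rowKey hv hc))
          (List.pairwise_map.2 (hrun'.pairwise_rowKey hv' hc')) hperm2
      have hdata := map_eq_map_of_imp (g := rowData w) (g' := rowData w') hrows
        fun a b h => rowData_eq h
      simp only [List.map_cons, List.cons.injEq] at hdata
      have hrest : (Yo.map fun Y => (std Y, word w Y)) = Yo'.map fun Y => (std Y, word w' Y) := by
        cases hY : Yo with
        | none =>
          cases hY' : Yo' with
          | none => rfl
          | some Y' => simp [hY, hY'] at hYo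
        | some Y =>
          cases hY' : Yo' with
          | none => simp [hY, hY'] at hYo
          | some Y' =>
            simp only [hY, hY', Option.map_some, Option.some.injEq] at hYo
            have h1 := hsub Y Y' (by have := hrun.length_lt.2 Y hY; omega) (hv.of_build.2 Y hY)
              (hv'.of_build.2 Y' hY') (hrun.compat_rest hv hc hY) (hrun'.compat_rest hv' hc' hY')
              hYo
            simp [h1]
      -- The class of the split times depends on the rest only through the weight of its left child,
      -- which is visible in its shape.
      have hcls : sClass μ γ Yo = sClass μ γ Yo' := by
        cases hY : Yo with
        | none =>
          cases hY' : Yo' with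
          | none => rfl
          | some Y' => simp [hY, hY'] at hYo
        | some Y =>
          cases hY' : Yo' with
          | none => simp [hY, hY'] at hYo
          | some Y' =>
            simp only [hY, hY', Option.map_some, Option.some.injEq, Prod.mk.injEq] at hrest
            have : leftWt μ Y = leftWt μ Y' := by
              have h1 := congrArg (leftWt μ) hrest.1
              rwa [std, std, leftWt_mapT, leftWt_mapT] at h1
            rw [sClass, sClass, this]
      have hct : mapT Prod.snd (pairTree μ w (sClass μ γ Yo) p ps Yo) =
          mapT Prod.snd (pairTree μ w' (sClass μ γ Yo') p' ps' Yo') := by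
        rw [mapT_snd_pairTree, mapT_snd_pairTree, hdata.1, hdata.2, hrest, hcls]
      constructor
      · rw [← hs, ← hs', std_eq_std_codeTree hrun hv hc, std_eq_std_codeTree hrun' hv' hc', hct]
      · rw [mapT_head_pairTree (c := sClass μ γ Yo) hv, hct, ← mapT_head_pairTree hv']

end Uniqueness

end TimedTree

/-! ### Existence: cutting a merged tree into sorted rows and a rest -/

namespace TimedTree

section Existence

variable {κ : Type*} [Encodable κ] {μ : Multiset κ → ℕ}

theorem leaves_ktrees {α : Type*} (t : ℕ) (T : TimedTree ℕ α) :
    (ktrees t T).flatMap leaves = T.leaves := by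
  induction T with
  | leaf x => simp [ktrees, leaves]
  | node s l r hl hr =>
    rw [ktrees]
    split_ifs with h
    · rw [List.flatMap_append, hl, hr, leaves]
    · simp

theorem Heap.of_mem_ktrees {α : Type*} {t : ℕ} {T : TimedTree ℕ α} (h : T.Heap)
    (ht : ∀ u ∈ T.times, t ≤ u) : ∀ R ∈ ktrees t T, R.Heap ∧ ∀ u ∈ R.times, t < u := by
  induction T with
  | leaf x => simp [ktrees, Heap, times]
  | node s l r hl hr =>
    simp only [times, List.mem_cons, List.mem_append] at ht
    rw [ktrees]
    split_ifs with hs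
    · intro R hR
      rcases List.mem_append.1 hR with hR | hR
      · exact hl h.2.2.1 (fun u hu => ht u (Or.inr (Or.inl hu))) R hR
      · exact hr h.2.2.2 (fun u hu => ht u (Or.inr (Or.inr hu))) R hR
    · simp only [List.mem_singleton, forall_eq]
      refine ⟨h, fun u hu => ?_⟩
      have h1 := ht s (Or.inl rfl)
      have h2 := h.root_le rfl u hu
      omega

theorem wk_leaf_or_root (T : TimedTree ℕ κ) :
    (∃ x, T = leaf x) ∨ ∃ t, T.root = some t := by
  cases T with
  | leaf x => exact Or.inl ⟨x, rfl⟩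
  | node t l r => exact Or.inr ⟨t, rfl⟩

theorem root_eq_of_wk_eq {T T' : TimedTree ℕ κ} (h : wk μ T = wk μ T') : T.root = T'.root := by
  cases T <;> cases T' <;> simp_all [wk, root]

theorem WRun.length_lt {γ : ℕ} {p : ℕ × TimedTree ℕ κ} {ps : List (ℕ × TimedTree ℕ κ)}
    {Yo : Option (TimedTree ℕ κ)} (h : WRun μ γ p ps Yo) :
    (∀ q ∈ p :: ps, q.2.times.length < (build p ps Yo).times.length) ∧
      ∀ Y ∈ Yo, Y.times.length < (build p ps Yo).times.length := by
  induction h with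
  | last p Y => simp [build, times]
  | pair p q => simp [build, times]
  | cons p q qs Yo hp _ hrun ih =>
    simp only [build, times, List.length_cons, List.length_append]
    refine ⟨fun q' hq' => ?_, fun Y hY => ?_⟩
    · rcases List.mem_cons.1 hq' with rfl | h
      · omega
      · have := ih.1 _ h
        omega
    · have := ih.2 Y hY
      omega

theorem WRun.root_build {γ : ℕ} {p : ℕ × TimedTree ℕ κ} {ps : List (ℕ × TimedTree ℕ κ)}
    {Yo : Option (TimedTree ℕ κ)} (h : WRun μ γ p ps Yo) :
    (build p ps Yo).root = some p.1 := by
  cases h <;> rfl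

/-- The trees in `A` are the remaining lightest children at a node of time `t`. They are put in
front of a run that begins at the same node or further below. -/
theorem WRun.prepend {γ : ℕ} {p : ℕ × TimedTree ℕ κ} {ps : List (ℕ × TimedTree ℕ κ)}
    {Yo : Option (TimedTree ℕ κ)} (h : WRun μ γ p ps Yo) (t : ℕ) (A : List (TimedTree ℕ κ))
    (hA : ∀ a ∈ A, wt μ a = γ ∧ a.root ≠ some t) :
    ∃ p' ps', p' :: ps' = A.map (fun a => (t, a)) ++ p :: ps ∧ WRun μ γ p' ps' Yo ∧
      codePart t (wt μ (build p' ps' Yo)) (wk μ (build p' ps' Yo)) =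
        ((A.map fun u => (wt μ u, ecode μ u) : List (ℕ × ℕ)) : Multiset (ℕ × ℕ)) +
          codePart t (wt μ (build p ps Yo)) (wk μ (build p ps Yo)) ∧
      (build p' ps' Yo).leaves = A.flatMap leaves ++ (build p ps Yo).leaves := by
  induction A with
  | nil => exact ⟨p, ps, rfl, h, by simp, by simp⟩
  | cons a A ih =>
    obtain ⟨p', ps', h1, h2, h3, h4⟩ := ih fun b hb => hA b (List.mem_cons_of_mem _ hb)
    have ha := hA a (by simp)
    refine ⟨(t, a), p' :: ps', by simp [h1], WRun.cons _ _ _ _ ha.1 ha.2 h2, ?_, ?_⟩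
    · rw [build, wk, codePart, if_pos rfl, h3, codePart_of_root_ne μ ha.2]
      simp [← add_assoc]
    · rw [build, leaves, h4]
      simp

/-- The right comb with all nodes at time `t`. -/
def comb {α : Type*} (t : ℕ) (a : TimedTree ℕ α) : List (TimedTree ℕ α) → TimedTree ℕ α
  | [] => a
  | b :: B => node t a (comb t b B)

theorem leaves_comb {α : Type*} (t : ℕ) (a : TimedTree ℕ α) (B : List (TimedTree ℕ α)) :
    (comb t a B).leaves = (a :: B).flatMap leaves := by
  induction B generalizing a with
  | nil => simp [comb]
  | cons b B ih => simp [comb, leaves, ih]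

theorem times_comb {α : Type*} {t u : ℕ} {a : TimedTree ℕ α} {B : List (TimedTree ℕ α)}
    (h : u ∈ (comb t a B).times) : u = t ∨ ∃ b ∈ a :: B, u ∈ b.times := by
  induction B generalizing a with
  | nil => exact Or.inr ⟨a, by simp, h⟩
  | cons b B ih =>
    simp only [comb, times, List.mem_cons, List.mem_append] at h
    rcases h with h | h | h
    · exact Or.inl h
    · exact Or.inr ⟨a, by simp, h⟩
    · rcases ih h with h | ⟨c, hc, h⟩
      · exact Or.inl h
      · exact Or.inr ⟨c, List.mem_cons_of_mem _ hc, h⟩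

theorem heap_comb {α : Type*} {t : ℕ} {a : TimedTree ℕ α} {B : List (TimedTree ℕ α)}
    (h : ∀ b ∈ a :: B, b.Heap ∧ ∀ u ∈ b.times, t < u) : (comb t a B).Heap := by
  induction B generalizing a with
  | nil => exact (h a (by simp)).1
  | cons b B ih =>
    refine ⟨fun u hu => ((h a (by simp)).2 u hu).le, fun u hu => ?_, (h a (by simp)).1,
      ih fun c hc => h c (List.mem_cons_of_mem _ hc)⟩
    rcases times_comb hu with rfl | ⟨c, hc, hu⟩
    · exact le_rfl
    · exact ((h c (List.mem_cons_of_mem _ hc)).2 u hu).le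

theorem codePart_comb {t : ℕ} {a : TimedTree ℕ κ} {B : List (TimedTree ℕ κ)}
    (h : ∀ b ∈ a :: B, b.root ≠ some t) :
    codePart t (wt μ (comb t a B)) (wk μ (comb t a B)) =
      (((a :: B).map fun u => (wt μ u, ecode μ u) : List (ℕ × ℕ)) : Multiset (ℕ × ℕ)) := by
  induction B generalizing a with
  | nil =>
    rw [comb, codePart_of_root_ne μ (h a (by simp))]
    simp
  | cons b B ih =>
    rw [comb, wk, codePart, if_pos rfl, ih fun c hc => h c (List.mem_cons_of_mem _ hc),
      codePart_of_root_ne μ (h a (by simp))]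
    simp

/-- The lengthening condition needs the lighter part on the left; the weight depends only on the
multiset of leaves, so the children may be exchanged. -/
theorem lt_wt_node_of_lt
    (hμ : ∀ A B : Multiset κ, A ≠ 0 → B ≠ 0 → μ A ≤ μ B → μ A < μ (A + B)) {Λ : Type*} {t : Λ}
    {l r : TimedTree Λ κ} {γ : ℕ} (hl : γ < wt μ l) (hr : γ < wt μ r) : γ < wt μ (node t l r) := by
  rcases le_total (wt μ l) (wt μ r) with h | h
  · exact hl.trans (lt_wt_node hμ h)
  · have h1 : wt μ (node t l r) = wt μ (node t r l) := by
      simp only [wt, leaves]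
      congr 1
      exact Multiset.coe_eq_coe.2 List.perm_append_comm
    rw [h1]
    exact hr.trans (lt_wt_node hμ h)

theorem lt_wt_comb
    (hμ : ∀ A B : Multiset κ, A ≠ 0 → B ≠ 0 → μ A ≤ μ B → μ A < μ (A + B)) {t γ : ℕ}
    {a : TimedTree ℕ κ} {B : List (TimedTree ℕ κ)} (h : ∀ b ∈ a :: B, γ < wt μ b) :
    γ < wt μ (comb t a B) := by
  induction B generalizing a with
  | nil => exact h a (by simp)
  | cons b B ih =>
    exact lt_wt_node_of_lt hμ (h a (by simp)) (ih fun c hc => h c (List.mem_cons_of_mem _ hc))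

theorem wk_eq_of_codePart {t : ℕ} {T T' : TimedTree ℕ κ} (h : T.root = some t)
    (h' : T'.root = some t)
    (he : codePart t (wt μ T) (wk μ T) = codePart t (wt μ T') (wk μ T')) : wk μ T = wk μ T' := by
  rw [wk_of_root μ h, wk_of_root μ h', he]

/-- Rows in which the times of the split off trees are larger than the time of the row and which
are sorted with respect to `δ`. -/
structure SortedRows (δ : TimedTree ℕ κ → List ℕ) (p : ℕ × TimedTree ℕ κ)
    (ps : List (ℕ × TimedTree ℕ κ)) (Yo : Option (TimedTree ℕ κ)) : Prop where
  row : ∀ q ∈ p :: ps, q.2.Heap ∧ ∀ t ∈ q.2.times, q.1 < t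
  rest : ∀ Y ∈ Yo, Y.Heap ∧ ∀ q ∈ p :: ps, ∀ t ∈ Y.times, q.1 ≤ t
  sorted : (p :: ps).Pairwise fun q q' => q.1 :: δ q.2 ≤ q'.1 :: δ q'.2

theorem exists_sorted_perm {α : Type*} (δ : α → List ℕ) (l : List α) :
    ∃ l' : List α, l'.Perm l ∧ l'.Pairwise fun a b => δ a ≤ δ b := by
  classical
  have : IsTrans α fun a b => δ a ≤ δ b := ⟨fun _ _ _ => le_trans⟩
  have : Std.Total fun a b : α => δ a ≤ δ b := ⟨fun _ _ => le_total _ _⟩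
  exact ⟨l.insertionSort fun a b => δ a ≤ δ b, List.perm_insertionSort _ _,
    List.pairwise_insertionSort _ _⟩

/-- The binary bracketing inside a merged node is immaterial and may be chosen anew. The lightest
children at the root become rows, sorted by `δ`. The others form the rest as a comb of nodes of the
same time, unless there is only one of them and its lightest child again has weight `γ`; then the
run continues inside it. Times increase on entering this child, so sorting each group separately
sorts the whole run by time and `δ`. -/
theorem exists_wRun
    (hμ : ∀ A B : Multiset κ, A ≠ 0 → B ≠ 0 → μ A ≤ μ B → μ A < μ (A + B))
    (δ : TimedTree ℕ κ → List ℕ) (n : ℕ) : ∀ (T : TimedTree ℕ κ) (t : ℕ), T.times.length ≤ n →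
      T.Heap → T.root = some t → ∃ γ p ps Yo, WRun μ γ p ps Yo ∧ wk μ (build p ps Yo) = wk μ T ∧
        (build p ps Yo).leaves.Perm T.leaves ∧ SortedRows δ p ps Yo := by
  classical
  induction n with
  | zero =>
    intro T t hT _ hr
    cases T with
    | leaf x => simp [root] at hr
    | node t l r => simp [times] at hT
  | succ n ih =>
    intro T t hT hheap hroot
    have hkid := hheap.of_mem_ktrees (hheap.root_le hroot)
    have hkroot : ∀ R ∈ ktrees t T, R.root ≠ some t := fun R hR h =>
      lt_irrefl t ((hkid R hR).2 t (mem_times_of_root h))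
    have hcode := codePart_wk μ t T
    have hcard := two_le_card_codePart μ hroot
    have hleaves := leaves_ktrees t T
    have hne := ktrees_ne_nil t T
    generalize ktrees t T = K at *
    obtain ⟨γ, hγmem, hγ⟩ : ∃ γ, (∃ R ∈ K, wt μ R = γ) ∧ ∀ R ∈ K, γ ≤ wt μ R := by
      have hex : ∃ m, ∃ R ∈ K, wt μ R = m := by
        obtain ⟨R, hR⟩ := List.exists_mem_of_ne_nil K hne
        exact ⟨_, R, hR, rfl⟩
      exact ⟨Nat.find hex, Nat.find_spec hex, fun R hR => Nat.find_min' hex ⟨R, hR, rfl⟩⟩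
    obtain ⟨A, hAperm, hAsort⟩ := exists_sorted_perm δ (K.filter fun R => wt μ R = γ)
    set B := K.filter fun R => ¬ wt μ R = γ with hB
    have hAB : (A ++ B).Perm K := by
      refine (hAperm.append_right B).trans ?_
      have := List.filter_append_perm (fun R => decide (wt μ R = γ)) K
      simpa [hB] using this
    have hAmem : ∀ a ∈ A, a ∈ K ∧ wt μ a = γ := fun a ha => by
      simpa using hAperm.mem_iff.1 ha
    have hBmem : ∀ b ∈ B, b ∈ K ∧ γ < wt μ b := fun b hb => by
      have h1 : b ∈ K ∧ ¬ wt μ b = γ := by simpa [hB] using hb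
      exact ⟨h1.1, lt_of_le_of_ne (hγ b h1.1) (Ne.symm h1.2)⟩
    have hA0 : A ≠ [] := by
      obtain ⟨R, hR, hRγ⟩ := hγmem
      exact List.ne_nil_of_mem (hAperm.mem_iff.2 (by simpa using ⟨hR, hRγ⟩))
    have hcodeAB : codePart t (wt μ T) (wk μ T) =
        ((A.map fun u => (wt μ u, ecode μ u) : List (ℕ × ℕ)) : Multiset (ℕ × ℕ)) +
          ((B.map fun u => (wt μ u, ecode μ u) : List (ℕ × ℕ)) : Multiset (ℕ × ℕ)) := by
      rw [hcode, Multiset.coe_add, ← List.map_append]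
      exact Multiset.coe_eq_coe.2 (hAB.map _).symm
    have hleavesAB : (A.flatMap leaves ++ B.flatMap leaves).Perm T.leaves := by
      rw [← hleaves, ← List.flatMap_append]
      exact hAB.flatMap_right _
    have hcardAB : 2 ≤ A.length + B.length := by
      rw [hcodeAB] at hcard
      simpa using hcard
    have hArow : ∀ a ∈ A, wt μ a = γ ∧ a.root ≠ some t := fun a ha =>
      ⟨(hAmem a ha).2, hkroot a (hAmem a ha).1⟩
    have hAkid : ∀ a ∈ A, a.Heap ∧ ∀ u ∈ a.times, t < u := fun a ha => hkid a (hAmem a ha).1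
    have hAs : (A.map fun a => (t, a)).Pairwise
        fun q q' : ℕ × TimedTree ℕ κ => q.1 :: δ q.2 ≤ q'.1 :: δ q'.2 := by
      rw [List.pairwise_map]
      refine hAsort.imp fun h => ?_
      rw [cons_le_cons_iff_of_linear]
      exact Or.inr ⟨rfl, h⟩
    clear_value B
    rcases List.eq_nil_or_concat A with rfl | ⟨A', a, rfl⟩
    · exact absurd rfl hA0
    rw [List.concat_eq_append] at *
    match B, hBmem, hcodeAB, hleavesAB, hcardAB with
    -- All children have weight `γ`. There are at least two of them, and the last two become the
    -- siblings that end a run without rest.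
    | [], _, hcodeAB, hleavesAB, hcardAB =>
      obtain ⟨A'', a', rfl⟩ : ∃ A'' a', A' = A'' ++ [a'] := by
        rcases List.eq_nil_or_concat A' with rfl | ⟨A'', a', rfl⟩
        · simp at hcardAB
        · exact ⟨A'', a', by simp⟩
      obtain ⟨p, ps, h1, h2, h3, h4⟩ := (WRun.pair (μ := μ) (t, a') (t, a)
        (hArow a' (by simp)).1 (hArow a' (by simp)).2 (hArow a (by simp)).1
        (hArow a (by simp)).2 rfl).prepend t A'' fun b hb => hArow b (by simp [hb])
      have h5 : p :: ps = (A'' ++ [a'] ++ [a]).map fun a => (t, a) := by simp [h1]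
      refine ⟨γ, p, ps, none, h2, ?_, ?_, ?_, by simp, ?_⟩
      · refine wk_eq_of_codePart (t := t) ?_ hroot ?_
        · rw [h2.root_build]
          have : p ∈ p :: ps := by simp
          rw [h5] at this
          obtain ⟨_, _, rfl⟩ := List.mem_map.1 this
          rfl
        · rw [h3, hcodeAB, build, wk, codePart, if_pos rfl, build,
            codePart_of_root_ne μ (hArow a' (by simp)).2,
            codePart_of_root_ne μ (hArow a (by simp)).2]
          simp only [List.map_append, List.map_cons, List.map_nil, ← Multiset.coe_add,
            Multiset.coe_nil, add_zero, Multiset.coe_singleton, add_assoc]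
      · rw [h4]
        simpa [build, leaves] using hleavesAB
      · rw [h5]
        intro q hq
        obtain ⟨b, hb, rfl⟩ := List.mem_map.1 hq
        exact hAkid b hb
      · rw [h5]
        exact hAs
    | b :: B', hBmem, hcodeAB, hleavesAB, hcardAB =>
      have hBrow : ∀ c ∈ b :: B', c.root ≠ some t := fun c hc => hkroot c (hBmem c hc).1
      have hBkid : ∀ c ∈ b :: B', c.Heap ∧ ∀ u ∈ c.times, t < u := fun c hc =>
        hkid c (hBmem c hc).1
      -- The run continues precisely if a single child remains and its lightest child has weight `γ`
      -- too.
      by_cases hrec : B' = [] ∧ codeMin (wk μ b) = some γ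
      · obtain ⟨rfl, hmin⟩ := hrec
        obtain ⟨s, hs⟩ : ∃ s, b.root = some s := by
          cases b with
          | leaf x => simp [wk, codeMin] at hmin
          | node s l r => exact ⟨s, rfl⟩
        have hlen : b.times.length ≤ n := by
          have e1 := hleavesAB.length_eq
          have e2 : 0 < a.leaves.length := List.length_pos_iff.2 a.leaves_ne_nil
          simp only [List.flatMap_append, List.flatMap_cons, List.flatMap_nil, List.append_nil,
            List.length_append, length_leaves] at e1 e2
          omega
        obtain ⟨γ', p0, ps0, Yo, g1, g2, g3, g4⟩ := ih b s hlen (hBkid b (by simp)).1 hs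
        -- The run obtained recursively has the weight of the lightest child, which is `γ` by
        -- assumption.
        have hγ' : γ' = γ := by
          have := g1.codeMin_wk hμ
          rw [g2, hmin] at this
          exact (Option.some.inj this).symm
        subst hγ'
        have hp0 : p0.1 = s := by
          have := root_eq_of_wk_eq g2
          rw [g1.root_build, hs] at this
          exact Option.some.inj this
        have hts : t < s := (hBkid b (by simp)).2 s (mem_times_of_root hs)
        have hwt : wt μ (build p0 ps0 Yo) = wt μ b := by
          rw [wt, wt, Multiset.coe_eq_coe.2 g3]
        obtain ⟨p, ps, h1, h2, h3, h4⟩ := g1.prepend t (A' ++ [a]) hArow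
        have hge : ∀ q ∈ p0 :: ps0, s ≤ q.1 := by
          intro q hq
          rcases List.mem_cons.1 hq with rfl | hq
          · exact hp0.ge
          · have := (List.pairwise_cons.1 g4.sorted).1 q hq
            rw [cons_le_cons_iff_of_linear] at this
            omega
        refine ⟨γ', p, ps, Yo, h2, ?_, ?_, ?_, ?_, ?_⟩
        · refine wk_eq_of_codePart (t := t) ?_ hroot ?_
          · rw [h2.root_build]
            cases A' with
            | nil =>
              simp only [List.nil_append, List.map_cons, List.map_nil, List.cons_append,
                List.cons.injEq] at h1
              rw [h1.1]
            | cons a0 A' =>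
              simp only [List.map_cons, List.cons_append, List.cons.injEq] at h1
              rw [h1.1]
          · rw [h3, hcodeAB, g2, hwt, codePart_of_root_ne μ (hBrow b (by simp))]
            simp
        · rw [h4]
          refine List.Perm.trans (List.Perm.append_left _ g3) ?_
          simpa using hleavesAB
        · rw [h1]
          intro q hq
          rcases List.mem_append.1 hq with hq | hq
          · obtain ⟨c, hc, rfl⟩ := List.mem_map.1 hq
            exact hAkid c hc
          · exact g4.row q hq
        · intro Y hY
          refine ⟨(g4.rest Y hY).1, ?_⟩
          rw [h1]
          intro q hq u hu
          rcases List.mem_append.1 hq with hq | hq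
          · obtain ⟨c, hc, rfl⟩ := List.mem_map.1 hq
            have := (g4.rest Y hY).2 p0 (by simp) u hu
            simp only
            omega
          · exact (g4.rest Y hY).2 q hq u hu
        · rw [h1, List.pairwise_append]
          refine ⟨hAs, g4.sorted, ?_⟩
          intro q hq q' hq'
          obtain ⟨c, hc, rfl⟩ := List.mem_map.1 hq
          rw [cons_le_cons_iff_of_linear]
          exact Or.inl (lt_of_lt_of_le hts (hge q' hq'))
      · have hcomb := codePart_comb (μ := μ) hBrow
        have hYmin : codeMin (wk μ (comb t b B')) ≠ some γ := by
          cases B' with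
          | nil => simpa [comb] using hrec
          | cons b' B' =>
            rw [comb, wk, codeMin, codePart_of_root_ne μ (hBrow b (by simp)),
              codePart_comb fun c hc => hBrow c (List.mem_cons_of_mem _ hc)]
            intro h
            have h1 := Nat.sInf_mem (s := {m | ∃ q ∈ ({(wt μ b, ecode μ b)} : Multiset (ℕ × ℕ)) +
              (((b' :: B').map fun u => (wt μ u, ecode μ u) : List (ℕ × ℕ)) : Multiset (ℕ × ℕ)),
              q.1 = m}) ⟨wt μ b, (wt μ b, ecode μ b),
                Multiset.mem_add.2 (Or.inl (Multiset.mem_singleton_self _)), rfl⟩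
            rw [Option.some.inj h] at h1
            obtain ⟨q, hq, hqγ⟩ := h1
            rcases Multiset.mem_add.1 hq with hq | hq
            · rw [Multiset.mem_singleton.1 hq] at hqγ
              have := (hBmem b (by simp)).2
              simp only at hqγ
              omega
            · obtain ⟨c, hc, rfl⟩ := List.mem_map.1 (Multiset.mem_coe.1 hq)
              have := (hBmem c (List.mem_cons_of_mem _ hc)).2
              simp only at hqγ
              omega
        have hlast : WRun μ γ (t, a) [] (some (comb t b B')) := by
          refine WRun.last _ _ (hArow a (by simp)).1 (hArow a (by simp)).2
            (lt_wt_comb hμ fun c hc => (hBmem c hc).2) hYmin fun _ q hq => ?_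
          rw [hcomb] at hq
          obtain ⟨c, hc, rfl⟩ := List.mem_map.1 (Multiset.mem_coe.1 hq)
          exact (hBmem c hc).2
        obtain ⟨p, ps, h1, h2, h3, h4⟩ := hlast.prepend t A' fun b hb => hArow b (by simp [hb])
        have h5 : p :: ps = (A' ++ [a]).map fun a => (t, a) := by simp [h1]
        refine ⟨γ, p, ps, some (comb t b B'), h2, ?_, ?_, ?_, ?_, ?_⟩
        · refine wk_eq_of_codePart (t := t) ?_ hroot ?_
          · rw [h2.root_build]
            have : p ∈ p :: ps := by simp
            rw [h5] at this
            obtain ⟨_, _, rfl⟩ := List.mem_map.1 this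
            rfl
          · rw [h3, hcodeAB, build, wk, codePart, if_pos rfl, hcomb,
              codePart_of_root_ne μ (hArow a (by simp)).2]
            rw [List.map_append, ← Multiset.coe_add, add_assoc]
            rfl
        · rw [h4, build, leaves, leaves_comb]
          simpa using hleavesAB
        · rw [h5]
          intro q hq
          obtain ⟨c, hc, rfl⟩ := List.mem_map.1 hq
          exact hAkid c hc
        · simp only [Option.mem_def, Option.some.injEq, forall_eq']
          refine ⟨heap_comb hBkid, ?_⟩
          rw [h5]
          intro q hq u hu
          obtain ⟨c, hc, rfl⟩ := List.mem_map.1 hq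
          rcases times_comb hu with rfl | ⟨c, hc, hu⟩
          · exact le_rfl
          · exact ((hBkid c hc).2 u hu).le
        · rw [h5]
          exact hAs

end Existence

end TimedTree

/-! ### Criteria for runs, valid trees and ordered codes -/

namespace TimedTree

section Realization

variable {κ : Type*} [Encodable κ] {μ : Multiset κ → ℕ}

/-- The equality of split times is required only at the end of a run without rest; it is expressed
by positions because the realized rows are given by their indices. -/
theorem SRun.of_getElem {γ : ℕ} {p : ℕ × TimedTree ℕ κ} {ps : List (ℕ × TimedTree ℕ κ)}
    {Yo : Option (TimedTree ℕ κ)} (h1 : ∀ q ∈ p :: ps, wt μ q.2 = γ ∧ leftWt μ q.2 ≠ some γ)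
    (h2 : ∀ Y ∈ Yo, wt μ Y ≠ γ ∧ leftWt μ Y ≠ some γ)
    (h3 : Yo = none → ∃ i, i + 2 = (p :: ps).length ∧
      ∀ (h : i < (p :: ps).length) (h' : i + 1 < (p :: ps).length),
        (p :: ps)[i + 1].1 = (p :: ps)[i].1) : SRun μ γ p ps Yo := by
  induction ps generalizing p with
  | nil =>
    cases Yo with
    | none =>
      obtain ⟨i, hi, -⟩ := h3 rfl
      simp at hi
    | some Y => exact SRun.last _ _ (h1 p (by simp)).1 (h2 Y rfl).1 (h2 Y rfl).2
  | cons q qs ih =>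
    by_cases hq : qs = [] ∧ Yo = none
    · obtain ⟨rfl, rfl⟩ := hq
      obtain ⟨i, hi, h⟩ := h3 rfl
      obtain rfl : i = 0 := by simpa using hi
      exact SRun.pair _ _ (h1 p (by simp)).1 (h1 q (by simp)).1 (h1 q (by simp)).2
        (h (by simp) (by simp))
    · refine SRun.cons _ _ _ _ (h1 p (by simp)).1
        (ih (fun q' hq' => h1 q' (List.mem_cons_of_mem _ hq')) fun hY => ?_)
      obtain ⟨i, hi, h⟩ := h3 hY
      have hqs : qs ≠ [] := fun h => hq ⟨h, hY⟩
      have := List.length_pos_iff.2 hqs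
      obtain ⟨i, rfl⟩ : ∃ k, i = k + 1 := ⟨i - 1, by simp at hi; omega⟩
      exact ⟨i, by simp at hi ⊢; omega, fun h4 h5 => h (by simp at h4 ⊢; omega) (by simpa using h5)⟩

theorem WRun.getElem_tail {γ : ℕ} {p : ℕ × TimedTree ℕ κ} {ps : List (ℕ × TimedTree ℕ κ)}
    {Yo : Option (TimedTree ℕ κ)} (h : WRun μ γ p ps Yo) (hY : Yo = none) :
    ∃ i, i + 2 = (p :: ps).length ∧
      ∀ (h : i < (p :: ps).length) (h' : i + 1 < (p :: ps).length),
        (p :: ps)[i + 1].1 = (p :: ps)[i].1 := by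
  induction h with
  | last p Y => simp at hY
  | pair p q _ _ _ _ hs => exact ⟨0, rfl, fun _ _ => by simpa using hs⟩
  | cons p q qs Yo hp _ hrun ih =>
    obtain ⟨i, hi, h⟩ := ih hY
    exact ⟨i + 1, by simp at hi ⊢; omega,
      fun h4 h5 => h (by simp at h4 ⊢; omega) (by simpa using h5)⟩

theorem WRun.wt_eq {γ : ℕ} {p : ℕ × TimedTree ℕ κ} {ps : List (ℕ × TimedTree ℕ κ)}
    {Yo : Option (TimedTree ℕ κ)} (h : WRun μ γ p ps Yo) :
    (∀ q ∈ p :: ps, wt μ q.2 = γ) ∧ ∀ Y ∈ Yo, γ < wt μ Y ∧ codeMin (wk μ Y) ≠ some γ := by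
  induction h with
  | last p Y hp _ hY hm => simp [hp, hY, hm]
  | pair p q hp _ hq => simp [hp, hq]
  | cons p q qs Yo hp _ _ ih =>
    refine ⟨fun q' hq' => ?_, ih.2⟩
    rcases List.mem_cons.1 hq' with rfl | h
    · exact hp
    · exact ih.1 _ h

theorem WRun.lt_of_codePart {γ : ℕ} {p : ℕ × TimedTree ℕ κ} {ps : List (ℕ × TimedTree ℕ κ)}
    {Yo : Option (TimedTree ℕ κ)} (h : WRun μ γ p ps Yo) {t : ℕ}
    (ht : ∀ q ∈ p :: ps, q.1 ≤ t) {q : ℕ × TimedTree ℕ κ} (hq : q ∈ p :: ps) (hqt : q.1 = t)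
    (hsort : (p :: ps).Pairwise fun q q' => q.1 ≤ q'.1) :
    ∀ Y ∈ Yo, Y.root = some t → ∀ x ∈ codePart t (wt μ Y) (wk μ Y), γ < x.1 := by
  induction h generalizing q with
  | last p Y _ _ _ _ hB =>
    obtain rfl : q = p := by simpa using hq
    subst hqt
    simpa using hB
  | pair p q _ _ _ _ => simp
  | cons p q' qs Yo hp _ hrun ih =>
    have h1 := List.pairwise_cons.1 hsort
    have h2 : ∀ a ∈ q' :: qs, a.1 ≤ t := fun a ha => ht a (List.mem_cons_of_mem _ ha)
    rcases List.mem_cons.1 hq with rfl | hq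
    · exact ih h2 (List.mem_cons_self)
        (le_antisymm (h2 q' List.mem_cons_self) (hqt ▸ h1.1 q' List.mem_cons_self)) h1.2
    · exact ih h2 hq hqt h1.2

/-- Strictly increasing split times give the heap condition on the spine. At each node but the last,
the left child has weight `γ` and the right one is heavier by lengthening, so a tie can only occur
between the final two rows. The bound on the weight is carried along for this induction. -/
theorem SRun.valid_build
    (hμ : ∀ A B : Multiset κ, A ≠ 0 → B ≠ 0 → μ A ≤ μ B → μ A < μ (A + B)) {γ : ℕ}
    {p : ℕ × TimedTree ℕ κ} {ps : List (ℕ × TimedTree ℕ κ)} {Yo : Option (TimedTree ℕ κ)}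
    (h : SRun μ γ p ps Yo) (hn : (build p ps Yo).times.Nodup)
    (hr : ∀ q ∈ p :: ps, Valid μ q.2 ∧ ∀ t ∈ q.2.times, q.1 < t)
    (hY : ∀ Y ∈ Yo, Valid μ Y ∧ γ < wt μ Y ∧ ∀ q ∈ p :: ps, ∀ t ∈ Y.times, q.1 < t)
    (hle : (p :: ps).Pairwise fun q q' => q.1 ≤ q'.1)
    (hs : (sRows p ps Yo).Pairwise fun q q' => q.1 < q'.1)
    (ht : Yo = none → (p :: ps).Pairwise fun q q' => q.1 = q'.1 → TieLE q.2 q'.2) :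
    Valid μ (build p ps Yo) ∧ γ < wt μ (build p ps Yo) := by
  induction h with
  | last p Y hp hYw hl =>
    obtain ⟨y1, y2, y3⟩ := hY Y rfl
    simp only [build, times, List.nodup_cons, List.nodup_append'] at hn
    refine ⟨⟨(hr p (by simp)).2, y3 p (by simp), hn.2.2.2, Or.inl (hp ▸ y2), (hr p (by simp)).1,
      y1⟩, ?_⟩
    rw [← hp]
    exact lt_wt_node hμ (by omega)
  | pair p q hp hq hlw hpq =>
    simp only [build, times, List.nodup_cons, List.nodup_append'] at hn
    have ht' := ht rfl
    simp only [List.pairwise_cons, List.mem_singleton, forall_eq] at ht'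
    refine ⟨⟨(hr p (by simp)).2, hpq ▸ (hr q (by simp)).2, hn.2.2.2,
      Or.inr ⟨hp.trans hq.symm, ht'.1 hpq.symm⟩, (hr p (by simp)).1, (hr q (by simp)).1⟩, ?_⟩
    rw [← hp]
    exact lt_wt_node hμ (by simp [build, hp, hq])
  | cons p q qs Yo hp hrun ih =>
    have hn0 := hn
    simp only [build, times, List.nodup_cons, List.nodup_append'] at hn
    rw [sRows_cons] at hs
    have hle' := List.pairwise_cons.1 hle
    have hs' := List.pairwise_cons.1 hs
    obtain ⟨i1, i2⟩ := ih hn.2.2.1 (fun a ha => hr a (List.mem_cons_of_mem _ ha))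
      (fun Y hYm => ⟨(hY Y hYm).1, (hY Y hYm).2.1,
        fun a ha => (hY Y hYm).2.2 a (List.mem_cons_of_mem _ ha)⟩) hle'.2 hs'.2
      (fun h => (List.pairwise_cons.1 (ht h)).2)
    refine ⟨⟨(hr p (by simp)).2, fun u hu => ?_, hn.2.2.2, Or.inl (hp ▸ i2), (hr p (by simp)).1,
      i1⟩, ?_⟩
    · rcases mem_times_build.1 hu with ⟨a, ha, hu⟩ | ⟨a, ha, rfl⟩ | ⟨Y, hYm, hu⟩
      · exact lt_of_le_of_lt (hle'.1 a ha) ((hr a (List.mem_cons_of_mem _ ha)).2 u hu)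
      · exact hs'.1 a ha
      · exact (hY Y hYm).2.2 p (by simp) u hu
    · rw [← hp]
      exact lt_wt_node hμ (by rw [hp]; exact i2.le)

/-- Without a rest, the split time stored with the last row is not used. -/
theorem build_congr {Λ α : Type*} {p p' : Λ × TimedTree Λ α} {ps ps' : List (Λ × TimedTree Λ α)}
    {Yo : Option (TimedTree Λ α)} (hlen : (p :: ps).length = (p' :: ps').length)
    (h2 : ∀ i (h : i < (p :: ps).length) (h' : i < (p' :: ps').length),
      (p :: ps)[i].2 = (p' :: ps')[i].2)
    (h1 : ∀ i (h : i < (p :: ps).length) (h' : i < (p' :: ps').length),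
      (i + 1 < (p :: ps).length ∨ Yo ≠ none) → (p :: ps)[i].1 = (p' :: ps')[i].1) :
    build p ps Yo = build p' ps' Yo := by
  induction ps generalizing p p' ps' with
  | nil =>
    obtain rfl : ps' = [] := List.eq_nil_of_length_eq_zero (by simpa using hlen.symm)
    have e2 := h2 0 (by simp) (by simp)
    simp only [List.getElem_cons_zero] at e2
    cases Yo with
    | none => simp [build, e2]
    | some Y =>
      have e1 := h1 0 (by simp) (by simp) (by simp)
      simp only [List.getElem_cons_zero] at e1
      simp [build, e2, e1]
  | cons q qs ih =>
    cases ps' with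
    | nil => simp at hlen
    | cons q' qs' =>
      have e2 := h2 0 (by simp) (by simp)
      have e1 := h1 0 (by simp) (by simp) (by simp)
      simp only [List.getElem_cons_zero] at e1 e2
      rw [build, build, e1, e2, ih (by simpa using hlen)
        (fun i h h' => h2 (i + 1) (by simpa using h) (by simpa using h'))
        (fun i h h' h3 => h1 (i + 1) (by simpa using h) (by simpa using h') (by simpa using h3))]

section Standard

variable {G : TimedTree ℕ κ} {f : ℕ → ℕ}

theorem ridx_mapT (hf : ∀ a ∈ G.times, ∀ b ∈ G.times, f a < f b ↔ a < b) {j : ℕ}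
    (hj : j ∈ G.times) : ridx μ (mapT f G) (f j) = ridx μ G j := by
  rw [← ridx_std (mapT f G), std_mapT hf, times_mapT, listIdx_map fun u hu => hf u hu j hj,
    ridx_std]

theorem times_perm_range (hs : std G = G) (hn : G.times.Nodup) :
    G.times.Perm (List.range G.times.length) := by
  have := times_std_perm hn
  rwa [hs] at this

theorem mem_times_iff (hs : std G = G) (hn : G.times.Nodup) {j : ℕ} :
    j ∈ G.times ↔ j < G.times.length := by
  rw [(times_perm_range hs hn).mem_iff, List.mem_range]

theorem listUnidx_mapT (hs : std G = G) (hn : G.times.Nodup)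
    (hf : ∀ a ∈ G.times, ∀ b ∈ G.times, f a < f b ↔ a < b) {j : ℕ} (hj : j < G.times.length) :
    listUnidx (mapT f G).times j = f j := by
  have hj' := (mem_times_iff hs hn).2 hj
  have h1 : listIdx (mapT f G).times (f j) = j := by
    rw [times_mapT, listIdx_map fun u hu => hf u hu j hj', listIdx_perm (times_perm_range hs hn),
      listIdx_range hj]
  conv_lhs => rw [← h1]
  refine listUnidx_listIdx ?_
  rw [times_mapT]
  exact List.mem_map_of_mem hj'

theorem listUnidx_std (hs : std G = G) (hn : G.times.Nodup) {j : ℕ} (hj : j < G.times.length) :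
    listUnidx G.times j = j := by
  have := listUnidx_mapT (f := fun t => t) hs hn (fun _ _ _ _ => Iff.rfl) hj
  rwa [mapT_id] at this

theorem listNext_mapT (hv : Valid μ G) (hs : std G = G)
    (hf : ∀ a ∈ G.times, ∀ b ∈ G.times, f a < f b ↔ a < b) (s : ℕ) {j : ℕ}
    (hj : j < G.times.length) :
    listNext (mapT f G).times s (f j) = if j + 1 < G.times.length then f (j + 1) else s := by
  have hn := hv.nodup
  have hn' := (hv.mapT hf).nodup
  rw [← listUnidx_mapT hs hn hf hj]
  split_ifs with h
  · rw [listNext_listUnidx hn' s (by simpa using h), listUnidx_mapT hs hn hf h]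
  · exact listNext_last hn' s (by simp; omega)

theorem rt_mapT_std (hv : Valid μ G) (hs : std G = G)
    (hf : ∀ a ∈ G.times, ∀ b ∈ G.times, f a < f b ↔ a < b) (h0 : 0 < G.times.length) :
    rt (mapT f G) = f 0 := by
  rw [← (hv.mapT hf).listUnidx_zero (by simpa using h0), listUnidx_mapT hs hv.nodup hf h0]

theorem rt_of_length_eq_zero {T : TimedTree ℕ κ} (h : T.times.length = 0) : rt T = 0 := by
  cases T with
  | leaf x => rfl
  | node t l r => simp [times] at h

end Standard

variable (μ) in
/-- A standard valid tree with a compatible list of values. -/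
structure Col (G : TimedTree ℕ κ) (W : List ℕ) : Prop where
  valid : Valid μ G
  std_eq : std G = G
  length_eq : W.length = G.times.length
  compat : Compat μ G fun j => W.getD j 0

theorem Col.ridx_lt {G : TimedTree ℕ κ} {W : List ℕ} (h : Col μ G W) {j j' : ℕ}
    (hj' : j' < G.times.length) (hjj : j < j') (hw : W.getD j 0 = W.getD j' 0) :
    ridx μ G j < ridx μ G j' := by
  have hn := h.valid.nodup
  have m1 := (mem_times_iff h.std_eq hn).2 (hjj.trans hj')
  have m2 := (mem_times_iff h.std_eq hn).2 hj'
  exact (ridx_lt_iff h.std_eq hn m1 m2).2 (h.compat.2 _ m1 _ m2 hjj hw)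

/-- Inside one row, equal letters are separated by the position of their columns in the reading
order of the shape, which increases by compatibility. -/
theorem Col.cCode_lt {G : TimedTree ℕ κ} {W : List ℕ} (h : Col μ G W) (i : ℕ) {j j' : ℕ}
    (hj : j ∈ G.times) (hj' : j' ∈ G.times) :
    cCode μ W G i j < cCode μ W G i j' ↔ j < j' := by
  have hn := h.valid.nodup
  have main : ∀ a ∈ G.times, ∀ b ∈ G.times, a < b → cCode μ W G i a < cCode μ W G i b := by
    intro a ha b hb hab
    rw [cCode, cCode, List.cons_lt_cons_iff]
    rcases (h.compat.1 a ha b hb hab.le).lt_or_eq with h1 | h1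
    · exact Or.inl h1
    · refine Or.inr ⟨h1, ?_⟩
      have := h.ridx_lt ((mem_times_iff h.std_eq hn).1 hb) hab h1
      simp [List.cons_lt_cons_iff, this]
  refine ⟨fun hlt => ?_, main _ hj _ hj'⟩
  by_contra hcon
  rcases (not_lt.1 hcon).lt_or_eq with h1 | rfl
  · exact lt_asymm hlt (main _ hj' _ hj h1)
  · exact lt_irrefl _ hlt

theorem Col.yCode_lt {G : TimedTree ℕ κ} {W : List ℕ} (h : Col μ G W) {j j' : ℕ}
    (hj : j ∈ G.times) (hj' : j' ∈ G.times) : yCode μ W G j < yCode μ W G j' ↔ j < j' := by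
  have hn := h.valid.nodup
  have main : ∀ a ∈ G.times, ∀ b ∈ G.times, a < b → yCode μ W G a < yCode μ W G b := by
    intro a ha b hb hab
    rw [yCode, yCode, List.cons_lt_cons_iff]
    rcases (h.compat.1 a ha b hb hab.le).lt_or_eq with h1 | h1
    · exact Or.inl h1
    · refine Or.inr ⟨h1, ?_⟩
      have := h.ridx_lt ((mem_times_iff h.std_eq hn).1 hb) hab h1
      simp [List.cons_lt_cons_iff, this]
  refine ⟨fun hlt => ?_, main _ hj _ hj'⟩
  by_contra hcon
  rcases (not_lt.1 hcon).lt_or_eq with h1 | rfl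
  · exact lt_asymm hlt (main _ hj' _ hj h1)
  · exact lt_irrefl _ hlt

theorem append_singleton_lt {α : Type*} [LinearOrder α] {l l' : List α} {a b : α}
    (hlen : l.length = l'.length) (hl : l ≤ l') (hab : a < b) : l ++ [a] < l' ++ [b] := by
  induction l generalizing l' with
  | nil =>
    have : l' = [] := List.eq_nil_of_length_eq_zero (by simpa using hlen.symm)
    subst this
    exact List.cons_lt_cons_iff.2 (Or.inl hab)
  | cons x l ih =>
    cases l' with
    | nil => simp at hlen
    | cons y l' =>
      rw [cons_le_cons_iff_of_linear] at hl
      rw [List.cons_append, List.cons_append, List.cons_lt_cons_iff]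
      rcases hl with h | ⟨h, h'⟩
      · exact Or.inl h
      · exact Or.inr ⟨h, ih (by simpa using hlen) h'⟩

theorem drop_eq_getD_cons {W : List ℕ} {j : ℕ} (h : j < W.length) :
    W.drop j = W.getD j 0 :: W.drop (j + 1) := by
  rw [List.drop_eq_getElem_cons h]
  simp [List.getD, h]

/-- In a fixed column of a fixed shape, the code is the suffix of the word, followed by the index of
the row, with constant entries inserted after the first letter. -/
theorem cCode_lt_of_drop {G : TimedTree ℕ κ} {W W' : List ℕ} {i i' j : ℕ} (h : j < W.length)
    (h' : j < W'.length) (hlt : W.drop j ++ [i] < W'.drop j ++ [i']) :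
    cCode μ W G i j < cCode μ W' G i' j := by
  rw [drop_eq_getD_cons h, drop_eq_getD_cons h', List.cons_append, List.cons_append,
    List.cons_lt_cons_iff] at hlt
  rw [cCode, cCode]
  simpa [List.cons_lt_cons_iff] using hlt

end Realization

end TimedTree

/-! ### The labelled tree built from shapes and words -/

namespace TimedTree

section RealData

variable {κ : Type*} [Encodable κ] {μ : Multiset κ → ℕ}

variable (μ) in
/-- Shapes and words of the rows and the rest of a run. -/
structure RealData (γ : ℕ) (d : ℕ × TimedTree ℕ κ × List ℕ)
    (ds : List (ℕ × TimedTree ℕ κ × List ℕ)) (Yo : Option (TimedTree ℕ κ × List ℕ)) : Prop where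
  col : ∀ e ∈ d :: ds, Col μ e.2.1 e.2.2
  wt_eq : ∀ e ∈ d :: ds, wt μ e.2.1 = γ
  lt : ∀ e ∈ d :: ds, ∀ x ∈ e.2.2, e.1 < x
  col_rest : ∀ E ∈ Yo, Col μ E.1 E.2
  lt_wt : ∀ E ∈ Yo, γ < wt μ E.1
  leftWt_ne : ∀ E ∈ Yo, leftWt μ E.1 ≠ some γ
  le_rest : ∀ E ∈ Yo, ∀ e ∈ d :: ds, ∀ x ∈ E.2,
    e.1 ≤ x ∧ (e.1 = x → sClass μ γ (Yo.map Prod.fst) = 1)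
  sorted : (d :: ds).Pairwise fun e e' => e.1 :: enc e.2.1 :: e.2.2 ≤ e'.1 :: enc e'.2.1 :: e'.2.2
  tail : Yo = none → ∃ i, i + 2 = (d :: ds).length ∧
    ∀ (h : i < (d :: ds).length) (h' : i + 1 < (d :: ds).length),
      (d :: ds)[i + 1].1 = (d :: ds)[i].1

variable {γ : ℕ} {d : ℕ × TimedTree ℕ κ × List ℕ} {ds : List (ℕ × TimedTree ℕ κ × List ℕ)}
  {Yo : Option (TimedTree ℕ κ × List ℕ)}

theorem mem_codeTree {c : ℕ} {a : List ℕ} :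
    a ∈ (codeTree μ c d ds Yo).times ↔
      (∃ i, ∃ h : i < (d :: ds).length, ∃ j ∈ (d :: ds)[i].2.1.times,
        a = cCode μ (d :: ds)[i].2.2 (d :: ds)[i].2.1 i j) ∨
      (∃ i, ∃ h : i < (d :: ds).length, (i + 1 < (d :: ds).length ∨ Yo ≠ none) ∧
        a = [(d :: ds)[i].1, c, i]) ∨
      ∃ E ∈ Yo, ∃ j ∈ E.1.times, a = yCode μ E.2 E.1 j := by
  rw [codeTree, mem_times_buildIdx]
  simp only [codeRow, times_mapT, List.mem_map, ne_eq, Option.map_eq_none_iff, Option.mem_def,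
    Option.map_eq_some_iff]
  refine or_congr ?_ (or_congr ?_ ?_)
  · refine exists_congr fun i => exists_congr fun hi => exists_congr fun j => ?_
    rw [eq_comm]
  · refine exists_congr fun i => exists_congr fun hi => ?_
    rw [eq_comm (a := a)]
  · constructor
    · rintro ⟨_, ⟨E, hE, rfl⟩, h⟩
      rw [times_mapT] at h
      obtain ⟨j, hj, rfl⟩ := List.mem_map.1 h
      exact ⟨E, hE, j, hj, rfl⟩
    · rintro ⟨E, hE, j, hj, rfl⟩
      refine ⟨_, ⟨E, hE, rfl⟩, ?_⟩
      rw [times_mapT]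
      exact List.mem_map_of_mem hj

theorem RealData.le_of_lt (h : RealData μ γ d ds Yo) {i i' : ℕ} (hi : i < (d :: ds).length)
    (hi' : i' < (d :: ds).length) (hii : i ≤ i') : (d :: ds)[i].1 ≤ (d :: ds)[i'].1 := by
  rcases hii.lt_or_eq with hii | rfl
  · have := Pairwise.getElem_of_lt h.sorted hi hi' hii
    rw [cons_le_cons_iff_of_linear] at this
    omega
  · exact le_rfl

theorem RealData.tie (h : RealData μ γ d ds Yo) {i i' : ℕ} (hi : i < (d :: ds).length)
    (hi' : i' < (d :: ds).length) (hii : i < i') (hs : (d :: ds)[i].1 = (d :: ds)[i'].1) :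
    enc (d :: ds)[i].2.1 < enc (d :: ds)[i'].2.1 ∨
      (d :: ds)[i].2.1 = (d :: ds)[i'].2.1 ∧ (d :: ds)[i].2.2 ≤ (d :: ds)[i'].2.2 := by
  have := Pairwise.getElem_of_lt h.sorted hi hi' hii
  rw [cons_le_cons_iff_of_linear, cons_le_cons_iff_of_linear] at this
  rcases this with h1 | ⟨-, h1 | ⟨h1, h2⟩⟩
  · omega
  · exact Or.inl h1
  · exact Or.inr ⟨enc_injective h1, h2⟩

/-- The second entry separates rows, split times and rest. The index at the end separates different
rows, and within a part the codes increase strictly with the column. -/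
theorem RealData.nodup (h : RealData μ γ d ds Yo) {c : ℕ} (hc : c = 1 ∨ c = 3) :
    (codeTree μ c d ds Yo).times.Nodup := by
  have hcons : codeRow μ c 0 d :: (ds.mapIdx fun i => codeRow μ c (i + 1)) =
      (d :: ds).mapIdx (codeRow μ c) := by rw [List.mapIdx_cons]
  have hcol : ∀ i (hi : i < (d :: ds).length), Col μ (d :: ds)[i].2.1 (d :: ds)[i].2.2 :=
    fun i hi => h.col _ (List.getElem_mem hi)
  rw [codeTree, buildIdx, (times_build_perm _ _ _).nodup_iff, hcons, List.nodup_append',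
    List.nodup_append']
  have hS : ∀ q ∈ sRows (codeRow μ c 0 d) (ds.mapIdx fun i => codeRow μ c (i + 1))
      (Yo.map fun e => mapT (yCode μ e.2 e.1) e.1), ∃ x i, q.1 = [x, c, i] := by
    intro q hq
    have := mem_of_mem_sRows hq
    rw [hcons] at this
    obtain ⟨i, hi, rfl⟩ := List.mem_mapIdx.1 this
    exact ⟨_, _, rfl⟩
  have hY : ∀ a ∈ (Yo.map fun e => mapT (yCode μ e.2 e.1) e.1).elim [] times,
      ∃ x ρ, a = [x, 2, ρ] := by
    cases Yo with
    | none => simp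
    | some E =>
      simp only [Option.map_some, Option.elim, times_mapT, List.mem_map]
      rintro _ ⟨j, -, rfl⟩
      exact ⟨_, _, rfl⟩
  have hC : ∀ a ∈ ((d :: ds).mapIdx (codeRow μ c)).flatMap (fun q => q.2.times),
      ∃ x l, a = x :: 0 :: l := by
    intro a ha
    obtain ⟨q, hq, ha⟩ := List.mem_flatMap.1 ha
    obtain ⟨i, hi, rfl⟩ := List.mem_mapIdx.1 hq
    simp only [codeRow, times_mapT, List.mem_map] at ha
    obtain ⟨j, -, rfl⟩ := ha
    exact ⟨_, _, rfl⟩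
  refine ⟨?_, ⟨?_, ?_, ?_⟩, ?_⟩
  · refine List.nodup_flatMap.2 ⟨?_, ?_⟩
    · intro q hq
      obtain ⟨i, hi, rfl⟩ := List.mem_mapIdx.1 hq
      simp only [codeRow, times_mapT]
      refine List.Nodup.map_on (fun a ha b hb hab => ?_) (hcol i hi).valid.nodup
      by_contra hne
      rcases lt_or_gt_of_ne hne with h1 | h1
      · exact ((((hcol i hi).cCode_lt i ha hb).2 h1).ne hab)
      · exact ((((hcol i hi).cCode_lt i hb ha).2 h1).ne hab.symm)
    · rw [List.pairwise_iff_getElem]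
      intro i i' hi hi' hii a ha ha'
      simp only [List.getElem_mapIdx, codeRow, times_mapT, List.mem_map] at ha ha'
      obtain ⟨j, hj, rfl⟩ := ha
      obtain ⟨j', hj', he⟩ := ha'
      simp only [cCode, List.cons.injEq] at he
      have := List.append_inj_right' he.2.2.2.2 rfl
      simp only [List.cons.injEq, and_true] at this
      omega
  · have h1 : ((d :: ds).mapIdx (codeRow μ c)).Pairwise fun q q' => q.1 ≠ q'.1 := by
      rw [List.pairwise_iff_getElem]
      intro i i' hi hi' hii
      simp only [List.getElem_mapIdx, codeRow, ne_eq, List.cons.injEq]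
      omega
    rw [List.nodup_iff_pairwise_ne, List.pairwise_map]
    rw [← hcons] at h1
    cases Yo with
    | none => exact h1.sublist (List.dropLast_sublist _)
    | some Y => exact h1
  · cases Yo with
    | none => simp
    | some E =>
      simp only [Option.map_some, Option.elim, times_mapT]
      have hE := h.col_rest E rfl
      refine List.Nodup.map_on (fun a ha b hb hab => ?_) hE.valid.nodup
      by_contra hne
      rcases lt_or_gt_of_ne hne with h1 | h1
      · exact ((hE.yCode_lt ha hb).2 h1).ne hab
      · exact ((hE.yCode_lt hb ha).2 h1).ne hab.symm
  · intro a ha ha'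
    obtain ⟨q, hq, rfl⟩ := List.mem_map.1 ha
    obtain ⟨x, i, e1⟩ := hS q hq
    obtain ⟨y, ρ, e2⟩ := hY _ ha'
    rw [e1] at e2
    simp only [List.cons.injEq] at e2
    omega
  · intro a ha ha'
    obtain ⟨x, l, e1⟩ := hC a ha
    rcases List.mem_append.1 ha' with ha' | ha'
    · obtain ⟨q, hq, rfl⟩ := List.mem_map.1 ha'
      obtain ⟨x, i, e2⟩ := hS q hq
      rw [e1] at e2
      simp only [List.cons.injEq] at e2
      omega
    · obtain ⟨y, ρ, e2⟩ := hY _ ha'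
      rw [e1] at e2
      simp only [List.cons.injEq] at e2
      omega

variable (μ) in
/-- The row of the realization. -/
noncomputable def realRow (c m : ℕ) (F : List ℕ → ℕ) (i : ℕ) (e : ℕ × TimedTree ℕ κ × List ℕ) :
    ℕ × TimedTree ℕ κ :=
  (F [e.1, c, min i m], mapT (fun j => F (cCode μ e.2.2 e.2.1 i j)) e.2.1)

open Classical in
/-- The position of the last row that contributes its time. -/
noncomputable def lastRow {α β : Type*} (ds : List α) (Yo : Option β) : ℕ :=
  if Yo = none then ds.length - 1 else ds.length

theorem min_lastRow {i : ℕ} (hi : i < (d :: ds).length)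
    (h : i + 1 < (d :: ds).length ∨ Yo ≠ none) : min i (lastRow ds Yo) = i := by
  simp only [List.length_cons] at hi h
  rw [lastRow]
  split_ifs with hY
  · have := h.resolve_right (not_not.2 hY)
    omega
  · omega

variable (μ) in
/-- The run of the realization. -/
noncomputable def realRest (F : List ℕ → ℕ) (Yo : Option (TimedTree ℕ κ × List ℕ)) :
    Option (TimedTree ℕ κ) :=
  Yo.map fun E => mapT (fun j => F (yCode μ E.2 E.1 j)) E.1

/-- The index in a split code is capped at the last row that contributes a node. This changes
nothing in the tree, and it gives the two final siblings of a run without rest the same split time.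
-/
theorem mapT_codeTree (c : ℕ) (F : List ℕ → ℕ) :
    mapT F (codeTree μ c d ds Yo) =
      build (realRow μ c (lastRow ds Yo) F 0 d)
        (ds.mapIdx fun i => realRow μ c (lastRow ds Yo) F (i + 1)) (realRest μ F Yo) := by
  have hY : (Yo.map fun e => mapT (yCode μ e.2 e.1) e.1).map (mapT F) = realRest μ F Yo := by
    rw [realRest, Option.map_map]
    simp only [Function.comp_def, mapT_mapT]
  rw [codeTree, mapT_buildIdx, buildIdx, hY]
  refine build_congr (by simp) (fun i h h' => ?_) fun i h h' h2 => ?_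
  · cases i <;> simp [realRow, codeRow, mapT_mapT, Function.comp_def]
  · have hm : min i (lastRow ds Yo) = i := by
      refine min_lastRow (d := d) (by simpa using h) ?_
      simpa [realRest] using h2
    cases i with
    | zero => simp [realRow, codeRow]
    | succ i => simp [realRow, codeRow, hm]

theorem realRow_cons (c m : ℕ) (F : List ℕ → ℕ) :
    realRow μ c m F 0 d :: (ds.mapIdx fun i => realRow μ c m F (i + 1)) =
      (d :: ds).mapIdx (realRow μ c m F) := by
  rw [List.mapIdx_cons]

section Realize

variable {F : List ℕ → ℕ} (hF : ∀ a ∈ (codeTree μ (sClass μ γ (Yo.map Prod.fst)) d ds Yo).times,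
  ∀ b ∈ (codeTree μ (sClass μ γ (Yo.map Prod.fst)) d ds Yo).times, F a < F b ↔ a < b)

include hF

theorem RealData.mono_row (h : RealData μ γ d ds Yo) {i : ℕ} (hi : i < (d :: ds).length) :
    ∀ a ∈ (d :: ds)[i].2.1.times, ∀ b ∈ (d :: ds)[i].2.1.times,
      F (cCode μ (d :: ds)[i].2.2 (d :: ds)[i].2.1 i a) <
        F (cCode μ (d :: ds)[i].2.2 (d :: ds)[i].2.1 i b) ↔ a < b := by
  intro a ha b hb
  rw [hF _ (mem_codeTree.2 (Or.inl ⟨i, hi, a, ha, rfl⟩)) _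
    (mem_codeTree.2 (Or.inl ⟨i, hi, b, hb, rfl⟩)),
    (h.col _ (List.getElem_mem hi)).cCode_lt i ha hb]

theorem RealData.mono_rest (h : RealData μ γ d ds Yo) {E : TimedTree ℕ κ × List ℕ} (hE : E ∈ Yo) :
    ∀ a ∈ E.1.times, ∀ b ∈ E.1.times,
      F (yCode μ E.2 E.1 a) < F (yCode μ E.2 E.1 b) ↔ a < b := by
  intro a ha b hb
  rw [hF _ (mem_codeTree.2 (Or.inr (Or.inr ⟨E, hE, a, ha, rfl⟩))) _
    (mem_codeTree.2 (Or.inr (Or.inr ⟨E, hE, b, hb, rfl⟩))), (h.col_rest E hE).yCode_lt ha hb]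

end Realize

end RealData

end TimedTree

/-! ### The realization is valid and its identification is compatible -/

namespace TimedTree

section RealData

variable {κ : Type*} [Encodable κ] {μ : Multiset κ → ℕ} {γ : ℕ} {d : ℕ × TimedTree ℕ κ × List ℕ}
  {ds : List (ℕ × TimedTree ℕ κ × List ℕ)} {Yo : Option (TimedTree ℕ κ × List ℕ)}

theorem leftWt_ne_wt (hμ : ∀ A B : Multiset κ, A ≠ 0 → B ≠ 0 → μ A ≤ μ B → μ A < μ (A + B))
    {T : TimedTree ℕ κ} (h : Valid μ T) : leftWt μ T ≠ some (wt μ T) := by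
  cases T with
  | leaf x => simp [leftWt]
  | node t l r =>
    intro he
    have := lt_wt_node (t := t) hμ h.wt_le
    simp only [leftWt, Option.some.injEq] at he
    omega

theorem sClass_realRest (F : List ℕ → ℕ) :
    sClass μ γ (realRest μ F Yo) = sClass μ γ (Yo.map Prod.fst) := by
  cases Yo with
  | none => rfl
  | some E => simp [realRest, sClass]

/-- For the last row of a run without rest, the capped code is that of its sibling, since the two
split values are equal. -/
theorem RealData.s_mem (h : RealData μ γ d ds Yo) (c : ℕ) {i : ℕ} (hi : i < (d :: ds).length) :
    [(d :: ds)[i].1, c, min i (lastRow ds Yo)] ∈ (codeTree μ c d ds Yo).times := by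
  by_cases hc : i + 1 < (d :: ds).length ∨ Yo ≠ none
  · rw [min_lastRow hi hc]
    exact mem_codeTree.2 (Or.inr (Or.inl ⟨i, hi, hc, rfl⟩))
  · push Not at hc
    obtain ⟨k, hk, hs⟩ := h.tail hc.2
    obtain rfl : i = k + 1 := by omega
    rw [hs (by omega) hi]
    have hm : min (k + 1) (lastRow ds Yo) = k := by
      rw [lastRow, if_pos hc.2]
      simp only [List.length_cons] at hk
      omega
    rw [hm]
    exact mem_codeTree.2 (Or.inr (Or.inl ⟨k, by omega, Or.inl (by omega), rfl⟩))

section Realize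

variable {F : List ℕ → ℕ} (hF : ∀ a ∈ (codeTree μ (sClass μ γ (Yo.map Prod.fst)) d ds Yo).times,
  ∀ b ∈ (codeTree μ (sClass μ γ (Yo.map Prod.fst)) d ds Yo).times, F a < F b ↔ a < b)

theorem RealData.sRun
    (hμ : ∀ A B : Multiset κ, A ≠ 0 → B ≠ 0 → μ A ≤ μ B → μ A < μ (A + B))
    (h : RealData μ γ d ds Yo) (c : ℕ) (F : List ℕ → ℕ) :
    SRun μ γ (realRow μ c (lastRow ds Yo) F 0 d)
      (ds.mapIdx fun i => realRow μ c (lastRow ds Yo) F (i + 1)) (realRest μ F Yo) := by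
  refine SRun.of_getElem ?_ ?_ ?_
  · rw [realRow_cons]
    intro q hq
    obtain ⟨i, hi, rfl⟩ := List.mem_mapIdx.1 hq
    have h1 := h.wt_eq _ (List.getElem_mem hi)
    have h2 := leftWt_ne_wt hμ (h.col _ (List.getElem_mem hi)).valid
    rw [h1] at h2
    exact ⟨by simpa [realRow] using h1, by simpa [realRow] using h2⟩
  · intro Y hY
    obtain ⟨E, hE, rfl⟩ := Option.map_eq_some_iff.1 hY
    exact ⟨by simpa using (h.lt_wt E hE).ne', by simpa using h.leftWt_ne E hE⟩
  · intro hY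
    have hY' : Yo = none := by simpa [realRest] using hY
    obtain ⟨k, hk, hs⟩ := h.tail hY'
    refine ⟨k, by simpa using hk, fun h1 h2 => ?_⟩
    have hm : lastRow ds Yo = k := by
      rw [lastRow, if_pos hY']
      simp only [List.length_cons] at hk
      omega
    have key : ∀ j (hj : j < (d :: ds).length)
        (hj' : j < (realRow μ c (lastRow ds Yo) F 0 d :: (ds.mapIdx fun i =>
          realRow μ c (lastRow ds Yo) F (i + 1))).length),
        (realRow μ c (lastRow ds Yo) F 0 d :: (ds.mapIdx fun i =>
          realRow μ c (lastRow ds Yo) F (i + 1)))[j].1 = F [(d :: ds)[j].1, c, min j k] := by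
      intro j hj hj'
      cases j <;> simp [realRow, hm]
    rw [key (k + 1) (by omega) h2, key k (by omega) h1, hs (by omega) (by omega)]
    simp

include hF

/-- Rows are sorted by split value first, and their indices decide further comparisons; equality is
only possible when capping makes the indices equal. -/
theorem RealData.s_le (h : RealData μ γ d ds Yo) {i i' : ℕ} (hi : i < (d :: ds).length)
    (hi' : i' < (d :: ds).length) (hii : i < i') :
    F [(d :: ds)[i].1, sClass μ γ (Yo.map Prod.fst), min i (lastRow ds Yo)] <
      F [(d :: ds)[i'].1, sClass μ γ (Yo.map Prod.fst), min i' (lastRow ds Yo)] ∨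
    (d :: ds)[i].1 = (d :: ds)[i'].1 ∧ min i (lastRow ds Yo) = min i' (lastRow ds Yo) := by
  rw [hF _ (h.s_mem _ hi) _ (h.s_mem _ hi')]
  have h1 := h.le_of_lt hi hi' hii.le
  simp only [List.cons_lt_cons_iff, lt_self_iff_false, false_or, true_and, and_false, or_false]
  omega

/-- The root of a row is its first column, where the code compares the whole words and then the
indices of the rows. -/
theorem RealData.rt_lt (h : RealData μ γ d ds Yo) {i i' : ℕ} (hi : i < (d :: ds).length)
    (hi' : i' < (d :: ds).length) (hii : i < i') (hG : (d :: ds)[i].2.1 = (d :: ds)[i'].2.1)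
    (hW : (d :: ds)[i].2.2 ≤ (d :: ds)[i'].2.2) (h0 : 0 < (d :: ds)[i].2.1.times.length)
    (c m : ℕ) :
    rt (realRow μ c m F i (d :: ds)[i]).2 < rt (realRow μ c m F i' (d :: ds)[i']).2 := by
  have c1 := h.col _ (List.getElem_mem hi)
  have c2 := h.col _ (List.getElem_mem hi')
  have m1 := h.mono_row hF hi
  have m2 := h.mono_row hF hi'
  have z1 := (mem_times_iff c1.std_eq c1.valid.nodup).2 h0
  have z2 := (mem_times_iff c2.std_eq c2.valid.nodup).2 (hG ▸ h0)
  rw [realRow, realRow, rt_mapT_std c1.valid c1.std_eq m1 h0,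
    rt_mapT_std c2.valid c2.std_eq m2 (hG ▸ h0),
    hF _ (mem_codeTree.2 (Or.inl ⟨i, hi, 0, z1, rfl⟩)) _
      (mem_codeTree.2 (Or.inl ⟨i', hi', 0, z2, rfl⟩))]
  have hl := c1.length_eq
  have hl' := c2.length_eq
  rw [← hG] at hl' ⊢
  refine cCode_lt_of_drop (by omega) (by omega) ?_
  rw [List.drop_zero, List.drop_zero]
  exact append_singleton_lt (by omega) hW hii

theorem RealData.rt_le (h : RealData μ γ d ds Yo) {i i' : ℕ} (hi : i < (d :: ds).length)
    (hi' : i' < (d :: ds).length) (hii : i < i') (hG : (d :: ds)[i].2.1 = (d :: ds)[i'].2.1)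
    (hW : (d :: ds)[i].2.2 ≤ (d :: ds)[i'].2.2) (c m : ℕ) :
    rt (realRow μ c m F i (d :: ds)[i]).2 ≤ rt (realRow μ c m F i' (d :: ds)[i']).2 := by
  rcases Nat.eq_zero_or_pos (d :: ds)[i].2.1.times.length with h0 | h0
  · rw [rt_of_length_eq_zero (by simpa [realRow] using h0)]
    exact Nat.zero_le _
  · exact (h.rt_lt hF hi hi' hii hG hW h0 c m).le

theorem RealData.fcode_realRow (h : RealData μ γ d ds Yo) {i : ℕ} (hi : i < (d :: ds).length)
    (c m : ℕ) : fcode (realRow μ c m F i (d :: ds)[i]).2 = enc (d :: ds)[i].2.1 := by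
  rw [realRow, fcode, std_mapT (h.mono_row hF hi), (h.col _ (List.getElem_mem hi)).std_eq]

/-- Row times exceed the split time because all letters of the word exceed the split value. Times of
the rest exceed it by value, or by the class if the values agree, since equal values force the class
one. The final siblings are in tie-breaking order because rows with equal split value are sorted by
shape and word. -/
theorem RealData.valid_build
    (hμ : ∀ A B : Multiset κ, A ≠ 0 → B ≠ 0 → μ A ≤ μ B → μ A < μ (A + B))
    (h : RealData μ γ d ds Yo) :
    Valid μ (mapT F (codeTree μ (sClass μ γ (Yo.map Prod.fst)) d ds Yo)) := by
  have hcl := sClass_eq (μ := μ) γ (Yo.map Prod.fst)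
  have hn : (mapT F (codeTree μ (sClass μ γ (Yo.map Prod.fst)) d ds Yo)).times.Nodup := by
    rw [times_mapT]
    refine List.Nodup.map_on (fun a ha b hb hab => ?_) (h.nodup hcl)
    by_contra hne
    rcases lt_or_gt_of_ne hne with h1 | h1
    · exact ((hF a ha b hb).2 h1).ne hab
    · exact ((hF b hb a ha).2 h1).ne hab.symm
  rw [mapT_codeTree] at hn ⊢
  have hcol : ∀ i (hi : i < (d :: ds).length), Col μ (d :: ds)[i].2.1 (d :: ds)[i].2.2 :=
    fun i hi => h.col _ (List.getElem_mem hi)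
  refine ((h.sRun hμ _ F).valid_build hμ hn ?_ ?_ ?_ ?_ ?_).1
  · rw [realRow_cons]
    intro q hq
    obtain ⟨i, hi, rfl⟩ := List.mem_mapIdx.1 hq
    refine ⟨(hcol i hi).valid.mapT (h.mono_row hF hi), fun t ht => ?_⟩
    simp only [realRow, times_mapT, List.mem_map] at ht
    obtain ⟨j, hj, rfl⟩ := ht
    rw [realRow, hF _ (h.s_mem _ hi) _ (mem_codeTree.2 (Or.inl ⟨i, hi, j, hj, rfl⟩)), cCode,
      List.cons_lt_cons_iff]
    refine Or.inl (h.lt _ (List.getElem_mem hi) _ ?_)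
    have := (mem_times_iff (hcol i hi).std_eq (hcol i hi).valid.nodup).1 hj
    rw [← (hcol i hi).length_eq] at this
    simp [List.getD, this]
  · intro Y hY
    obtain ⟨E, hE, rfl⟩ := Option.map_eq_some_iff.1 hY
    have hEc := h.col_rest E hE
    refine ⟨hEc.valid.mapT (h.mono_rest hF hE), by simpa using h.lt_wt E hE, ?_⟩
    rw [realRow_cons]
    intro q hq t ht
    obtain ⟨i, hi, rfl⟩ := List.mem_mapIdx.1 hq
    simp only [times_mapT, List.mem_map] at ht
    obtain ⟨j, hj, rfl⟩ := ht
    rw [realRow, hF _ (h.s_mem _ hi) _ (mem_codeTree.2 (Or.inr (Or.inr ⟨E, hE, j, hj, rfl⟩))), yCode,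
      List.cons_lt_cons_iff]
    have hjl := (mem_times_iff hEc.std_eq hEc.valid.nodup).1 hj
    rw [← hEc.length_eq] at hjl
    have := h.le_rest E hE _ (List.getElem_mem hi) (E.2.getD j 0) (by simp [List.getD, hjl])
    rcases this.1.lt_or_eq with h1 | h1
    · exact Or.inl h1
    · refine Or.inr ⟨h1, ?_⟩
      rw [this.2 h1, List.cons_lt_cons_iff]
      exact Or.inl (by omega)
  · rw [realRow_cons, List.pairwise_iff_getElem]
    intro i i' hi hi' hii
    simp only [List.length_mapIdx] at hi hi'
    simp only [List.getElem_mapIdx, realRow]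
    rcases h.s_le hF hi hi' hii with h1 | ⟨h1, h2⟩
    · exact h1.le
    · rw [h1, h2]
  · have hsub : ((d :: ds).mapIdx (realRow μ (sClass μ γ (Yo.map Prod.fst)) (lastRow ds Yo) F)).Pairwise
        fun q q' => q.1 < q'.1 ∨ q.1 = q'.1 := by
      rw [List.pairwise_iff_getElem]
      intro i i' hi hi' hii
      simp only [List.length_mapIdx] at hi hi'
      simp only [List.getElem_mapIdx, realRow]
      rcases h.s_le hF hi hi' hii with h1 | ⟨h1, h2⟩
      · exact Or.inl h1
      · exact Or.inr (by rw [h1, h2])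
    have hn1 := (times_build_perm _ _ _).nodup_iff.1 hn
    have hn2 := (List.nodup_append'.1 (List.nodup_append'.1 hn1).2.1).1
    rw [List.nodup_iff_pairwise_ne, List.pairwise_map] at hn2
    have hsub' : (sRows (realRow μ (sClass μ γ (Yo.map Prod.fst)) (lastRow ds Yo) F 0 d)
        (ds.mapIdx fun i => realRow μ (sClass μ γ (Yo.map Prod.fst)) (lastRow ds Yo) F (i + 1))
        (realRest μ F Yo)).Pairwise fun q q' => q.1 < q'.1 ∨ q.1 = q'.1 := by
      rw [← realRow_cons] at hsub
      cases hR : realRest μ F Yo with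
      | none => exact hsub.sublist (List.dropLast_sublist _)
      | some Y => exact hsub
    -- The codes have no repetition, so the weakly increasing split times of contributing rows
    -- increase strictly.
    exact List.Pairwise.imp₂ (fun _ _ h1 h2 => h1.resolve_right h2) hsub' hn2
  · intro hY
    rw [realRow_cons, List.pairwise_iff_getElem]
    intro i i' hi hi' hii
    simp only [List.length_mapIdx] at hi hi'
    simp only [List.getElem_mapIdx]
    intro hs
    rcases h.s_le hF hi hi' hii with h1 | ⟨h1, h2⟩
    · exact absurd hs h1.ne
    · rw [TieLE, h.fcode_realRow hF hi, h.fcode_realRow hF hi']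
      rcases h.tie hi hi' hii h1 with h3 | ⟨h3, h4⟩
      · exact Or.inl h3
      · exact Or.inr ⟨congrArg enc h3, h.rt_le hF hi hi' hii h3 h4 _ _⟩

/-- Converse of the computation in `SRun.pairTree_lt`. Times with equal value have codes that differ
after the first entry. Their comparison gives the comparison of keys entry by entry; a comparison of
suffixes of words becomes one of times in the next column or, after the last column, of split times
and then of roots. -/
theorem RealData.compat
    (hμ : ∀ A B : Multiset κ, A ≠ 0 → B ≠ 0 → μ A ≤ μ B → μ A < μ (A + B))
    (h : RealData μ γ d ds Yo) {w : ℕ → ℕ}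
    (hw : ∀ a ∈ (codeTree μ (sClass μ γ (Yo.map Prod.fst)) d ds Yo).times,
      w (F a) = a.headD 0) :
    Compat μ (mapT F (codeTree μ (sClass μ γ (Yo.map Prod.fst)) d ds Yo)) w := by
  have hcl := sClass_eq (μ := μ) γ (Yo.map Prod.fst)
  have hcol : ∀ i (hi : i < (d :: ds).length), Col μ (d :: ds)[i].2.1 (d :: ds)[i].2.2 :=
    fun i hi => h.col _ (List.getElem_mem hi)
  have hv := h.valid_build hF hμ
  have hs := h.sRun hμ (sClass μ γ (Yo.map Prod.fst)) F
  have hcons : ∀ a ∈ (codeTree μ (sClass μ γ (Yo.map Prod.fst)) d ds Yo).times,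
      ∃ x l, a = x :: l := by
    intro a ha
    rcases mem_codeTree.1 ha with ⟨i, hi, j, hj, rfl⟩ | ⟨i, hi, hs, rfl⟩ | ⟨E, hE, j, hj, rfl⟩ <;>
      exact ⟨_, _, rfl⟩
  have hle : ∀ a ∈ (codeTree μ (sClass μ γ (Yo.map Prod.fst)) d ds Yo).times,
      ∀ b ∈ (codeTree μ (sClass μ γ (Yo.map Prod.fst)) d ds Yo).times, F a ≤ F b → a ≤ b := by
    intro a ha b hb hab
    by_contra hcon
    exact absurd ((hF b hb a ha).2 (not_le.1 hcon)) (not_lt.2 hab)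
  obtain ⟨k1, k2, k3⟩ := hs.key_eq (by rw [← mapT_codeTree]; exact hv.nodup)
  rw [← mapT_codeTree, realRow_cons] at k1
  rw [← mapT_codeTree, sClass_realRest] at k2
  rw [← mapT_codeTree] at k3
  have kC : ∀ i (hi : i < (d :: ds).length), ∀ j ∈ (d :: ds)[i].2.1.times,
      key μ (mapT F (codeTree μ (sClass μ γ (Yo.map Prod.fst)) d ds Yo))
        (F (cCode μ (d :: ds)[i].2.2 (d :: ds)[i].2.1 i j)) =
      [0, enc (d :: ds)[i].2.1, ridx μ (d :: ds)[i].2.1 j,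
        if j + 1 < (d :: ds)[i].2.1.times.length then
          F (cCode μ (d :: ds)[i].2.2 (d :: ds)[i].2.1 i (j + 1))
        else F [(d :: ds)[i].1, sClass μ γ (Yo.map Prod.fst), min i (lastRow ds Yo)],
        rt (realRow μ (sClass μ γ (Yo.map Prod.fst)) (lastRow ds Yo) F i (d :: ds)[i]).2] := by
    intro i hi j hj
    have hm := h.mono_row hF hi
    rw [k1 _ (List.mem_mapIdx.2 ⟨i, hi, rfl⟩) (F (cCode μ (d :: ds)[i].2.2 (d :: ds)[i].2.1 i j))
      (by simp only [realRow, times_mapT]; exact List.mem_map_of_mem hj), cKey,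
      h.fcode_realRow hF hi]
    have e1 := ridx_mapT (μ := μ) hm hj
    have e2 := listNext_mapT (hcol i hi).valid (hcol i hi).std_eq hm
      (F [(d :: ds)[i].1, sClass μ γ (Yo.map Prod.fst), min i (lastRow ds Yo)])
      ((mem_times_iff (hcol i hi).std_eq (hcol i hi).valid.nodup).1 hj)
    simp only [realRow]
    rw [e1, e2]
  have kS : ∀ i (hi : i < (d :: ds).length), (i + 1 < (d :: ds).length ∨ Yo ≠ none) →
      key μ (mapT F (codeTree μ (sClass μ γ (Yo.map Prod.fst)) d ds Yo))
        (F [(d :: ds)[i].1, sClass μ γ (Yo.map Prod.fst), i]) =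
      [sClass μ γ (Yo.map Prod.fst), enc (d :: ds)[i].2.1,
        rt (realRow μ (sClass μ γ (Yo.map Prod.fst)) (lastRow ds Yo) F i (d :: ds)[i]).2,
        F [(d :: ds)[i].1, sClass μ γ (Yo.map Prod.fst), i]] := by
    intro i hi hc
    have hm := min_lastRow hi hc
    have hmem : realRow μ (sClass μ γ (Yo.map Prod.fst)) (lastRow ds Yo) F i (d :: ds)[i] ∈
        sRows (realRow μ (sClass μ γ (Yo.map Prod.fst)) (lastRow ds Yo) F 0 d)
          (ds.mapIdx fun i => realRow μ (sClass μ γ (Yo.map Prod.fst)) (lastRow ds Yo) F (i + 1))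
          (realRest μ F Yo) := by
      refine mem_sRows_iff.2 ⟨i, by simpa using hi, ?_, ?_⟩
      · simpa [realRest] using hc
      · cases i <;> simp
    have := k2 _ hmem
    rw [sKey, h.fcode_realRow hF hi] at this
    have e : (realRow μ (sClass μ γ (Yo.map Prod.fst)) (lastRow ds Yo) F i (d :: ds)[i]).1 =
        F [(d :: ds)[i].1, sClass μ γ (Yo.map Prod.fst), i] := by rw [realRow, hm]
    rwa [e] at this
  have kY : ∀ E ∈ Yo, ∀ j ∈ E.1.times,
      key μ (mapT F (codeTree μ (sClass μ γ (Yo.map Prod.fst)) d ds Yo)) (F (yCode μ E.2 E.1 j)) =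
      [2, ridx μ E.1 j] := by
    intro E hE j hj
    rw [k3 _ (Option.map_eq_some_iff.2 ⟨E, hE, rfl⟩) _
      (by rw [times_mapT]; exact List.mem_map_of_mem hj),
      ridx_mapT (f := fun j => F (yCode μ E.2 E.1 j)) (h.mono_rest hF hE) hj]
  constructor
  · intro t ht u hu htu
    rw [times_mapT] at ht hu
    obtain ⟨a, ha, rfl⟩ := List.mem_map.1 ht
    obtain ⟨b, hb, rfl⟩ := List.mem_map.1 hu
    rw [hw a ha, hw b hb]
    have := hle a ha b hb htu
    obtain ⟨x, l, rfl⟩ := hcons a ha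
    obtain ⟨y, l', rfl⟩ := hcons b hb
    rw [cons_le_cons_iff_of_linear] at this
    simp only [List.headD_cons]
    omega
  · intro t ht u hu htu hwtu
    rw [times_mapT] at ht hu
    obtain ⟨a, ha, rfl⟩ := List.mem_map.1 ht
    obtain ⟨b, hb, rfl⟩ := List.mem_map.1 hu
    rw [hw a ha, hw b hb] at hwtu
    rw [hF a ha b hb] at htu
    rcases mem_codeTree.1 ha with ⟨i, hi, j, hj, rfl⟩ | ⟨i, hi, hci, rfl⟩ | ⟨E, hE, j, hj, rfl⟩ <;>
      rcases mem_codeTree.1 hb with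
        ⟨i', hi', j', hj', rfl⟩ | ⟨i', hi', hci', rfl⟩ | ⟨E', hE', j', hj', rfl⟩
    · rw [kC i hi j hj, kC i' hi' j' hj']
      simp only [cCode, List.headD_cons] at hwtu
      simp only [cCode, hwtu, List.cons_lt_cons_iff, lt_self_iff_false, false_or, true_and] at htu
      rw [List.cons_lt_cons_iff, List.cons_lt_cons_iff, List.cons_lt_cons_iff]
      rcases htu with h1 | ⟨h1, htu⟩
      · exact Or.inr ⟨rfl, Or.inl h1⟩
      rcases htu with h2 | ⟨h2, htu⟩
      · exact Or.inr ⟨rfl, Or.inr ⟨h1, Or.inl h2⟩⟩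
      refine Or.inr ⟨rfl, Or.inr ⟨h1, Or.inr ⟨h2, ?_⟩⟩⟩
      have hG := enc_injective h1
      have c1 := hcol i hi
      have c2 := hcol i' hi'
      have l1 := c1.length_eq
      have l2 := c2.length_eq
      have hj1 := (mem_times_iff c1.std_eq c1.valid.nodup).1 hj
      have hj2 := (mem_times_iff c2.std_eq c2.valid.nodup).1 hj'
      have hjj : j = j' := by
        rw [← hG] at h2 hj'
        exact c1.valid.ridx_inj hj hj' h2
      subst hjj
      rw [← hG] at l2
      rw [List.cons_lt_cons_iff, List.cons_lt_cons_iff, ← hG]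
      split_ifs with hlen
      · refine Or.inl ((hF _ (mem_codeTree.2 (Or.inl ⟨i, hi, j + 1, ?_, rfl⟩)) _
          (mem_codeTree.2 (Or.inl ⟨i', hi', j + 1, ?_, by rw [hG]⟩))).2 ?_)
        · exact (mem_times_iff c1.std_eq c1.valid.nodup).2 hlen
        · rw [← hG]
          exact (mem_times_iff c1.std_eq c1.valid.nodup).2 hlen
        · exact cCode_lt_of_drop (by omega) (by omega) htu
      · rw [List.drop_eq_nil_of_le (by omega), List.drop_eq_nil_of_le (by omega)] at htu
        simp only [List.nil_append, List.cons_lt_cons_iff, lt_self_iff_false, and_false,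
          or_false] at htu
        -- In the last column the key looks at the split times. If these coincide, the rows are the
        -- final siblings, and the roots decide.
        rcases h.s_le hF hi hi' htu with h3 | ⟨h3, h4⟩
        · exact Or.inl h3
        · refine Or.inr ⟨by rw [h3, h4], Or.inl ?_⟩
          rcases h.tie hi hi' htu h3 with h5 | ⟨-, h5⟩
          · omega
          · exact h.rt_lt hF hi hi' htu hG h5 (by omega) _ _
    · rw [kC i hi j hj, kS i' hi' hci', List.cons_lt_cons_iff]
      exact Or.inl (by omega)
    · rw [kC i hi j hj, kY E' hE' j' hj', List.cons_lt_cons_iff]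
      exact Or.inl (by omega)
    · simp only [cCode, List.headD_cons] at hwtu
      simp only [cCode, hwtu, List.cons_lt_cons_iff] at htu
      omega
    · rw [kS i hi hci, kS i' hi' hci']
      simp only [List.headD_cons] at hwtu
      have hii : i < i' := by
        simp only [hwtu, List.cons_lt_cons_iff, lt_self_iff_false, false_or, true_and, and_false,
          or_false] at htu
        exact htu
      rw [List.cons_lt_cons_iff, List.cons_lt_cons_iff, List.cons_lt_cons_iff,
        List.cons_lt_cons_iff]
      refine Or.inr ⟨rfl, ?_⟩
      rcases h.tie hi hi' hii hwtu with h1 | ⟨h1, h2⟩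
      · exact Or.inl h1
      · refine Or.inr ⟨congrArg enc h1, ?_⟩
        rcases Nat.eq_zero_or_pos (d :: ds)[i].2.1.times.length with h0 | h0
        · refine Or.inr ⟨?_, Or.inl ((hF _ ha _ hb).2 htu)⟩
          have h0' : (d :: ds)[i'].2.1.times.length = 0 := by rw [← h1]; exact h0
          rw [rt_of_length_eq_zero (by simpa [realRow] using h0),
            rt_of_length_eq_zero (by simpa [realRow] using h0')]
        · exact Or.inl (h.rt_lt hF hi hi' hii h1 h2 h0 _ _)
    · simp only [yCode, List.headD_cons] at hwtu
      simp only [yCode, hwtu, List.cons_lt_cons_iff] at htu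
      rw [kS i hi hci, kY E' hE' j' hj', List.cons_lt_cons_iff]
      exact Or.inl (by omega)
    · simp only [yCode, cCode, List.headD_cons] at hwtu
      simp only [yCode, cCode, hwtu, List.cons_lt_cons_iff] at htu
      omega
    · simp only [yCode, List.headD_cons] at hwtu
      simp only [yCode, hwtu, List.cons_lt_cons_iff] at htu
      rw [kY E hE j hj, kS i' hi' hci', List.cons_lt_cons_iff]
      exact Or.inl (by omega)
    · obtain rfl : E = E' := Option.mem_unique hE hE'
      rw [kY E hE j hj, kY E hE j' hj']
      simp only [yCode, List.headD_cons] at hwtu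
      simp only [yCode, hwtu, List.cons_lt_cons_iff, lt_self_iff_false, false_or, true_and] at htu
      rw [List.cons_lt_cons_iff]
      exact Or.inr ⟨rfl, List.cons_lt_cons_iff.2 (Or.inl (by simpa using htu))⟩

end Realize

end RealData

end TimedTree

/-! ### Every merged tree is a compatible identification of a valid tree -/

namespace TimedTree

section Existence

variable {κ : Type*} [Encodable κ] {μ : Multiset κ → ℕ}

theorem wt_eq_of_perm {Λ Λ' : Type*} {T : TimedTree Λ κ} {T' : TimedTree Λ' κ}
    (h : T.leaves.Perm T'.leaves) : wt μ T = wt μ T' := by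
  rw [wt, wt, Multiset.coe_eq_coe.2 h]

/-- Parts may be replaced by others with the same code and the same leaves, because a node sees only
the codes and weights of its children. -/
theorem wk_build_map {f : TimedTree ℕ κ → TimedTree ℕ κ} {p : ℕ × TimedTree ℕ κ}
    {ps : List (ℕ × TimedTree ℕ κ)} {Yo : Option (TimedTree ℕ κ)}
    (h : ∀ q ∈ p :: ps, wk μ (f q.2) = wk μ q.2 ∧ (f q.2).leaves.Perm q.2.leaves)
    (hY : ∀ Y ∈ Yo, wk μ (f Y) = wk μ Y ∧ (f Y).leaves.Perm Y.leaves) :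
    wk μ (build (p.1, f p.2) (ps.map fun q => (q.1, f q.2)) (Yo.map f)) = wk μ (build p ps Yo) ∧
      (build (p.1, f p.2) (ps.map fun q => (q.1, f q.2)) (Yo.map f)).leaves.Perm
        (build p ps Yo).leaves := by
  induction ps generalizing p with
  | nil =>
    have hp := h p (by simp)
    cases Yo with
    | none => exact hp
    | some Y =>
      have hY := hY Y rfl
      refine ⟨?_, hp.2.append hY.2⟩
      simp only [List.map_nil, Option.map_some, build, wk]
      rw [hp.1, hY.1, wt_eq_of_perm hp.2, wt_eq_of_perm hY.2]
  | cons q qs ih =>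
    have hp := h p (by simp)
    have h1 := ih (p := q) fun q' hq' => h q' (List.mem_cons_of_mem _ hq')
    refine ⟨?_, hp.2.append h1.2⟩
    simp only [List.map_cons, build, wk]
    rw [hp.1, h1.1, wt_eq_of_perm hp.2, wt_eq_of_perm h1.2]

theorem Compat.congr {G : TimedTree ℕ κ} {w w' : ℕ → ℕ} (h : Compat μ G w)
    (hw : ∀ t ∈ G.times, w t = w' t) : Compat μ G w' := by
  constructor
  · intro t ht u hu htu
    rw [← hw t ht, ← hw u hu]
    exact h.1 t ht u hu htu
  · intro t ht u hu htu he
    rw [← hw t ht, ← hw u hu] at he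
    exact h.2 t ht u hu htu he

theorem Col.of_compat {G : TimedTree ℕ κ} {w : ℕ → ℕ} (hv : Valid μ G) (hs : std G = G)
    (hc : Compat μ G w) :
    Col μ G (word w G) ∧ mapT (fun j => (word w G).getD j 0) G = mapT w G := by
  have hw : ∀ t ∈ G.times, w t = (word w G).getD t 0 := by
    intro t ht
    have := (mem_times_iff hs hv.nodup).1 ht
    rw [word_getD w G this, listUnidx_std hs hv.nodup this]
  exact ⟨⟨hv, hs, length_word w G, hc.congr hw⟩, (mapT_congr hw).symm⟩

/-- Letters are bounded below by the letter of the root, which is part of the code; so lower bounds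
for the times of a part transfer to the words that represent it. -/
theorem Col.exists_root_le {G R : TimedTree ℕ κ} {W : List ℕ} (h : Col μ G W)
    (he : wk μ (mapT (fun j => W.getD j 0) G) = wk μ R) {x : ℕ} (hx : x ∈ W) :
    ∃ r, R.root = some r ∧ r ≤ x := by
  obtain ⟨j, hj, rfl⟩ := List.mem_iff_getElem.1 hx
  rw [h.length_eq] at hj
  have hj' := (mem_times_iff h.std_eq h.valid.nodup).2 hj
  have hr := root_eq_of_wk_eq he
  rw [root_mapT] at hr
  cases G with
  | leaf y => simp [times] at hj
  | node t l r =>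
    refine ⟨W.getD t 0, hr.symm, ?_⟩
    have h1 := h.compat.1 t (by simp [times]) j hj' (h.valid.heap.root_le rfl j hj')
    have h2 := h.length_eq
    simpa [List.getD, hj, h2] using h1

/-- Every tree with weakly increasing times is, up to isomorphism, obtained from a valid tree by a
compatible identification of times. -/
theorem exists_col
    (hμ : ∀ A B : Multiset κ, A ≠ 0 → B ≠ 0 → μ A ≤ μ B → μ A < μ (A + B)) (n : ℕ) :
    ∀ T : TimedTree ℕ κ, T.times.length ≤ n → T.Heap → ∃ (G : TimedTree ℕ κ) (W : List ℕ),
      Col μ G W ∧ wk μ (mapT (fun j => W.getD j 0) G) = wk μ T ∧ G.leaves.Perm T.leaves := by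
  classical
  have hleaf : ∀ x : κ, ∃ (G : TimedTree ℕ κ) (W : List ℕ), Col μ G W ∧
      wk μ (mapT (fun j => W.getD j 0) G) = wk μ (leaf x) ∧ G.leaves.Perm (leaf x : TimedTree ℕ κ).leaves := by
    intro x
    exact ⟨leaf x, [], ⟨trivial, rfl, rfl, by simp [Compat, times]⟩, rfl, List.Perm.refl _⟩
  induction n with
  | zero =>
    intro T hT _
    cases T with
    | leaf x => exact hleaf x
    | node t l r => simp [times] at hT
  | succ n ih =>
    intro T hT hheap
    rcases wk_leaf_or_root T with ⟨x, rfl⟩ | ⟨t, hroot⟩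
    · exact hleaf x
    -- A shape and a word are fixed for every tree beforehand, with a dummy value where the
    -- induction hypothesis does not apply, since the rows have to be sorted by these data when the
    -- run is formed.
    have hch : ∀ R : TimedTree ℕ κ, ∃ (G : TimedTree ℕ κ) (W : List ℕ),
        R.times.length ≤ n → R.Heap → Col μ G W ∧
          wk μ (mapT (fun j => W.getD j 0) G) = wk μ R ∧ G.leaves.Perm R.leaves := by
      intro R
      by_cases h : R.times.length ≤ n ∧ R.Heap
      · obtain ⟨G, W, hGW⟩ := ih R h.1 h.2
        exact ⟨G, W, fun _ _ => hGW⟩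
      · exact ⟨R, [], fun h1 h2 => absurd ⟨h1, h2⟩ h⟩
    choose g W hgW using hch
    obtain ⟨γ, p, ps, Yo, hrun, hwk, hleaves, hsort⟩ :=
      exists_wRun hμ (fun R => enc (g R) :: W R) (n + 1) T t hT hheap hroot
    have hlenT : (build p ps Yo).times.length = T.times.length := by
      have := hleaves.length_eq
      rw [length_leaves, length_leaves] at this
      omega
    have hlen := hrun.length_lt
    rw [hlenT] at hlen
    have hrow : ∀ q ∈ p :: ps, Col μ (g q.2) (W q.2) ∧
        wk μ (mapT (fun j => (W q.2).getD j 0) (g q.2)) = wk μ q.2 ∧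
          (g q.2).leaves.Perm q.2.leaves := fun q hq =>
      hgW q.2 (by have := hlen.1 q hq; omega) (hsort.row q hq).1
    have hrest : ∀ Y ∈ Yo, Col μ (g Y) (W Y) ∧
        wk μ (mapT (fun j => (W Y).getD j 0) (g Y)) = wk μ Y ∧ (g Y).leaves.Perm Y.leaves :=
      fun Y hY => hgW Y (by have := hlen.2 Y hY; omega) (hsort.rest Y hY).1
    have hlw : ∀ Y ∈ Yo, leftWt μ (g Y) = codeMin (wk μ Y) := by
      intro Y hY
      obtain ⟨h1, h2, -⟩ := hrest Y hY
      rw [← codeMin_wk_mapT hμ _ _ _ le_rfl h1.valid h1.compat, h2]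
    have hle : (p :: ps).Pairwise fun q q' => q.1 ≤ q'.1 := hsort.sorted.imp fun h => by
      rw [cons_le_cons_iff_of_linear] at h
      omega
    set D : ℕ × TimedTree ℕ κ → ℕ × TimedTree ℕ κ × List ℕ := fun q => (q.1, g q.2, W q.2)
      with hD
    set E : TimedTree ℕ κ → TimedTree ℕ κ × List ℕ := fun Y => (g Y, W Y) with hE
    have hdata : RealData μ γ (D p) (ps.map D) (Yo.map E) := by
      have hwt := hrun.wt_eq
      constructor
      · rw [← List.map_cons]
        intro e he
        obtain ⟨q, hq, rfl⟩ := List.mem_map.1 he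
        exact (hrow q hq).1
      · rw [← List.map_cons]
        intro e he
        obtain ⟨q, hq, rfl⟩ := List.mem_map.1 he
        exact (wt_eq_of_perm (hrow q hq).2.2).trans (hwt.1 q hq)
      · rw [← List.map_cons]
        intro e he x hx
        obtain ⟨q, hq, rfl⟩ := List.mem_map.1 he
        obtain ⟨r, hr, hrx⟩ := (hrow q hq).1.exists_root_le (hrow q hq).2.1 hx
        exact lt_of_lt_of_le ((hsort.row q hq).2 r (mem_times_of_root hr)) hrx
      · intro e he
        obtain ⟨Y, hY, rfl⟩ := Option.map_eq_some_iff.1 he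
        exact (hrest Y hY).1
      · intro e he
        obtain ⟨Y, hY, rfl⟩ := Option.map_eq_some_iff.1 he
        exact lt_of_lt_of_eq (hwt.2 Y hY).1 (wt_eq_of_perm (hrest Y hY).2.2).symm
      · intro e he
        obtain ⟨Y, hY, rfl⟩ := Option.map_eq_some_iff.1 he
        have := (hwt.2 Y hY).2
        rwa [← hlw Y hY] at this
      · rw [← List.map_cons]
        intro e he e' he' x hx
        obtain ⟨Y, hY, rfl⟩ := Option.map_eq_some_iff.1 he
        obtain ⟨q, hq, rfl⟩ := List.mem_map.1 he'
        obtain ⟨r, hr, hrx⟩ := (hrest Y hY).1.exists_root_le (hrest Y hY).2.1 hx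
        have hqr : ∀ q ∈ p :: ps, q.1 ≤ r := fun q hq =>
          (hsort.rest Y hY).2 q hq r (mem_times_of_root hr)
        refine ⟨(hqr q hq).trans hrx, fun hqx => ?_⟩
        have hkid := hrun.lt_of_codePart hqr hq
          (le_antisymm (hqr q hq) (by simp only [hD] at hqx; omega)) hle Y hY hr
        subst hY
        simp only [Option.map_some, sClass]
        rw [if_neg]
        -- If the rest is merged with a row, all its children are heavier than `γ`; its lightest
        -- child is its left child in the valid representative, so the class three is excluded.
        rintro ⟨m, hm, hmγ⟩
        rw [hlw Y rfl, wk_of_root μ hr, codeMin, Option.some.injEq] at hm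
        have hcard := two_le_card_codePart μ hr
        obtain ⟨y, hy⟩ := Multiset.card_pos_iff_exists_mem.1 (by omega :
          0 < Multiset.card (codePart r (wt μ Y) (wk μ Y)))
        have := Nat.sInf_mem (s := {m | ∃ q ∈ codePart r (wt μ Y) (wk μ Y), q.1 = m}) ⟨y.1, y, hy, rfl⟩
        rw [hm] at this
        obtain ⟨z, hz, hzm⟩ := this
        have := hkid z hz
        omega
      · rw [← List.map_cons, List.pairwise_map]
        exact hsort.sorted
      · intro hY
        obtain ⟨i, hi, h⟩ := hrun.getElem_tail (by simpa using hY)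
        simp only [← List.map_cons, List.length_map, List.getElem_map]
        exact ⟨i, hi, h⟩
    set c := sClass μ γ ((Yo.map E).map Prod.fst) with hc
    set CT := codeTree μ c (D p) (ps.map D) (Yo.map E) with hCT
    -- The times of the valid tree are the ranks of the codes in lexicographic order.
    set F := listIdx CT.times with hF
    have hFlt : ∀ a ∈ CT.times, ∀ b ∈ CT.times, F a < F b ↔ a < b :=
      fun a ha b _ => listIdx_lt_iff ha
    have hvalid : Valid μ (mapT F CT) := hdata.valid_build hFlt hμ
    -- The identification sends a rank back to the first entry of its code, which is the value in
    -- the merged tree.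
    set w : ℕ → ℕ := fun t => (listUnidx CT.times t).headD 0 with hw
    have hwF : ∀ a ∈ CT.times, w (F a) = a.headD 0 := fun a ha => by
      rw [hw, hF]
      simp only [listUnidx_listIdx ha]
    have hcompat : Compat μ (mapT F CT) w := hdata.compat hFlt hμ hwF
    have hstd : std (mapT F CT) = mapT F CT := std_std CT
    obtain ⟨hcol, hmap⟩ := Col.of_compat hvalid hstd hcompat
    have hmapw : mapT w (mapT F CT) =
        build (p.1, mapT (fun j => (W p.2).getD j 0) (g p.2))
          (ps.map fun q => (q.1, mapT (fun j => (W q.2).getD j 0) (g q.2)))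
          (Yo.map fun Y => mapT (fun j => (W Y).getD j 0) (g Y)) := by
      rw [mapT_mapT, mapT_congr (f := w ∘ F) (g := fun a => a.headD 0) fun a ha => hwF a ha, hCT, mapT_codeTree]
      congr 1
      · exact List.ext_getElem (by simp) (by simp [realRow, hD, cCode])
      · rw [realRest, Option.map_map]
        rfl
    have hfin := wk_build_map (μ := μ) (f := fun R => mapT (fun j => (W R).getD j 0) (g R))
      (fun q hq => ⟨(hrow q hq).2.1, by simpa using (hrow q hq).2.2⟩)
      (fun Y hY => ⟨(hrest Y hY).2.1, by simpa using (hrest Y hY).2.2⟩)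
    refine ⟨mapT F CT, word w (mapT F CT), hcol, ?_, ?_⟩
    · rw [hmap, hmapw, hfin.1, hwk]
    · rw [← leaves_mapT w, hmapw]
      exact hfin.2.trans hleaves

end Existence

end TimedTree

/-! ### The reading order under standardization -/

namespace TimedTree

section KeyStd

variable {κ : Type*} [Encodable κ] {μ : Multiset κ → ℕ}

theorem listNext_map {L : List ℕ} (hL : L.Nodup) {f : ℕ → ℕ}
    (hf : ∀ a ∈ L, ∀ b ∈ L, f a < f b ↔ a < b) (s : ℕ) {t : ℕ} (ht : t ∈ L) :
    listNext (L.map f) (f s) (f t) = f (listNext L s t) := by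
  have hL' : (L.map f).Nodup := by
    refine List.Nodup.map_on (fun a ha b hb hab => ?_) hL
    by_contra hne
    rcases lt_or_gt_of_ne hne with h1 | h1
    · exact ((hf a ha b hb).2 h1).ne hab
    · exact ((hf b hb a ha).2 h1).ne hab.symm
  have hidx : ∀ u ∈ L, listUnidx (L.map f) (listIdx L u) = f u := by
    intro u hu
    rw [← listIdx_map (f := f) fun v hv => hf v hv u hu]
    exact listUnidx_listIdx (List.mem_map_of_mem hu)
  have hlt := listIdx_lt_length ht
  rw [← hidx t ht]
  conv_rhs => rw [← listUnidx_listIdx ht]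
  by_cases h : listIdx L t + 1 < L.length
  · rw [listNext_listUnidx hL' _ (by simpa using h), listNext_listUnidx hL _ h,
      ← hidx _ (listUnidx_mem hL h), listIdx_listUnidx hL h]
  · rw [listNext_last hL' _ (by simp; omega), listNext_last hL _ (by omega)]

theorem exists_run {T : TimedTree ℕ κ} {t : ℕ} (ht : t ∈ T.times) :
    ∃ γ p ps Yo, SRun μ γ p ps Yo ∧ T = build p ps Yo := by
  cases T with
  | leaf x => simp [times] at ht
  | node s l r => exact ⟨_, _, _, _, sRun_run rfl, (build_run _).symm⟩

/-- Standardization changes those entries of a key that are times, and it does so by an increasing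
map; shapes, classes and positions stay the same. -/
theorem Valid.key_std_lt {T : TimedTree ℕ κ} (hv : Valid μ T) {t u : ℕ} (ht : t ∈ T.times)
    (hu : u ∈ T.times) (h : key μ T t < key μ T u) :
    key μ (TimedTree.std T) (listIdx T.times t) < key μ (TimedTree.std T) (listIdx T.times u) := by
  obtain ⟨γ, p, ps, Yo, hrun, rfl⟩ := exists_run (μ := μ) ht
  have hF : ∀ a ∈ (build p ps Yo).times, ∀ b ∈ (build p ps Yo).times,
      listIdx (build p ps Yo).times a < listIdx (build p ps Yo).times b ↔ a < b :=
    fun a ha b _ => listIdx_lt_iff ha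
  rw [TimedTree.std]
  have hv' := hv.mapT hF
  generalize listIdx (build p ps Yo).times = F at *
  obtain ⟨k1, k2, k3⟩ := hrun.key_eq hv.nodup
  have hrun' := hrun.map F
  rw [mapT_build] at hv' ⊢
  obtain ⟨k1', k2', k3'⟩ := hrun'.key_eq hv'.nodup
  have hs : ∀ q ∈ p :: ps, q.1 ∈ (build p ps Yo).times := by
    intro q hq
    obtain ⟨q', hq', he⟩ := hrun.exists_sRows q hq
    exact he ▸ SRun.mem_s hq'
  have hrowF : ∀ q ∈ p :: ps, ∀ a ∈ q.2.times, ∀ b ∈ q.2.times, F a < F b ↔ a < b :=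
    fun q hq a ha b hb => hF a (SRun.mem_row hq ha) b (SRun.mem_row hq hb)
  have hrestF : ∀ Y ∈ Yo, ∀ a ∈ Y.times, ∀ b ∈ Y.times, F a < F b ↔ a < b :=
    fun Y hY a ha b hb => hF a (SRun.mem_rest hY ha) b (SRun.mem_rest hY hb)
  have hrt : ∀ q ∈ p :: ps, ∀ t ∈ q.2.times, rt (TimedTree.mapT F q.2) = F (rt q.2) := by
    intro q _ t ht
    cases hq2 : q.2 with
    | leaf x => simp [hq2, times] at ht
    | node s l r => rfl
  have hcls : sClass μ γ (Yo.map (TimedTree.mapT F)) = sClass μ γ Yo := by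
    cases Yo <;> simp [sClass]
  have hc := sClass_eq (μ := μ) γ Yo
  have hcons : (F p.1, TimedTree.mapT F p.2) :: (ps.map fun q => (F q.1, TimedTree.mapT F q.2)) =
      (p :: ps).map fun q => (F q.1, TimedTree.mapT F q.2) := rfl
  rw [hcons] at k1'
  have hsrow : sRows (F p.1, TimedTree.mapT F p.2) (ps.map fun q => (F q.1, TimedTree.mapT F q.2)) (Yo.map (TimedTree.mapT F)) =
      (sRows p ps Yo).map fun q => (F q.1, TimedTree.mapT F q.2) := by
    cases Yo with
    | none => rw [sRows, Option.map_none, sRows, hcons, List.map_dropLast]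
    | some Y => rfl
  rw [hsrow, hcls] at k2'
  have kC : ∀ q ∈ p :: ps, ∀ t ∈ q.2.times,
      key μ (build (F p.1, TimedTree.mapT F p.2) (ps.map fun q => (F q.1, TimedTree.mapT F q.2)) (Yo.map (TimedTree.mapT F)))
        (F t) = [0, fcode q.2, ridx μ q.2 t, F (listNext q.2.times q.1 t), F (rt q.2)] := by
    intro q hq t ht
    rw [k1' _ (List.mem_map_of_mem hq) (F t) (by
      simp only [times_mapT]; exact List.mem_map_of_mem ht), cKey]
    simp only [times_mapT]
    rw [fcode_mapT (hrowF q hq), ridx_mapT (hrowF q hq) ht, hrt q hq t ht,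
      listNext_map (hv.of_build.1 q hq).nodup (hrowF q hq) _ ht]
  have kS : ∀ q ∈ sRows p ps Yo,
      key μ (build (F p.1, TimedTree.mapT F p.2) (ps.map fun q => (F q.1, TimedTree.mapT F q.2)) (Yo.map (TimedTree.mapT F)))
        (F q.1) = [sClass μ γ Yo, fcode q.2, rt (TimedTree.mapT F q.2), F q.1] := by
    intro q hq
    have := k2' _ (List.mem_map_of_mem hq)
    rw [sKey, fcode_mapT (hrowF q (mem_of_mem_sRows hq))] at this
    exact this
  have kY : ∀ Y ∈ Yo, ∀ t ∈ Y.times,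
      key μ (build (F p.1, TimedTree.mapT F p.2) (ps.map fun q => (F q.1, TimedTree.mapT F q.2)) (Yo.map (TimedTree.mapT F)))
        (F t) = [2, ridx μ Y t] := by
    intro Y hY t ht
    rw [k3' _ (Option.mem_map_of_mem _ hY) (F t) (by
      rw [times_mapT]; exact List.mem_map_of_mem ht), ridx_mapT (hrestF Y hY) ht]
  have hnext : ∀ q ∈ p :: ps, ∀ t, listNext q.2.times q.1 t ∈ (build p ps Yo).times := by
    intro q hq t
    rcases listNext_mem (L := q.2.times) q.1 t with h | h
    · rw [h]
      exact hs q hq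
    · exact SRun.mem_row hq h
  rcases mem_times_build.1 ht with ⟨q, hq, htq⟩ | ⟨q, hq, rfl⟩ | ⟨Y, hY, htY⟩ <;>
    rcases mem_times_build.1 hu with ⟨q', hq', huq⟩ | ⟨q', hq', rfl⟩ | ⟨Y', hY', huY⟩
  · rw [k1 q hq t htq, k1 q' hq' u huq] at h
    rw [kC q hq t htq, kC q' hq' u huq]
    simp only [cKey, List.cons_lt_cons_iff, lt_self_iff_false, false_or, true_and, and_false,
      or_false] at h ⊢
    rcases h with h | ⟨e1, h | ⟨e2, h | ⟨e3, h⟩⟩⟩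
    · exact Or.inl h
    · exact Or.inr ⟨e1, Or.inl h⟩
    · exact Or.inr ⟨e1, Or.inr ⟨e2, Or.inl ((hF _ (hnext q hq t) _ (hnext q' hq' u)).2 h)⟩⟩
    · exact Or.inr ⟨e1, Or.inr ⟨e2, Or.inr ⟨congrArg F e3,
        (hF _ (SRun.mem_row hq (rt_mem htq)) _ (SRun.mem_row hq' (rt_mem huq))).2 h⟩⟩⟩
  · rw [kC q hq t htq, kS q' hq', List.cons_lt_cons_iff]
    exact Or.inl (by omega)
  · rw [kC q hq t htq, kY Y' hY' u huY, List.cons_lt_cons_iff]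
    exact Or.inl (by omega)
  · rw [k2 q hq, k1 q' hq' u huq] at h
    simp only [cKey, sKey, List.cons_lt_cons_iff] at h
    omega
  · rw [k2 q hq, k2 q' hq'] at h
    rw [kS q hq, kS q' hq']
    simp only [sKey, List.cons_lt_cons_iff, lt_self_iff_false, false_or, true_and, and_false,
      or_false] at h ⊢
    rcases h with h | ⟨e1, h⟩
    · exact Or.inl h
    refine Or.inr ⟨e1, ?_⟩
    have hlen := fcode_length e1
    rcases Nat.eq_zero_or_pos q.2.times.length with h0 | h0
    · rw [rt_of_length_eq_zero (T := TimedTree.mapT F q.2) (by simpa using h0),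
        rt_of_length_eq_zero (T := TimedTree.mapT F q'.2) (by rw [times_mapT, List.length_map, ← hlen, h0])]
      rw [rt_of_length_eq_zero h0, rt_of_length_eq_zero (hlen ▸ h0)] at h
      simp only [lt_self_iff_false, true_and, false_or] at h ⊢
      exact (hF _ ht _ hu).2 h
    · obtain ⟨a, ha⟩ := List.exists_mem_of_length_pos h0
      obtain ⟨b, hb⟩ := List.exists_mem_of_length_pos (hlen ▸ h0)
      have m1 := mem_of_mem_sRows hq
      have m2 := mem_of_mem_sRows hq'
      rw [hrt q m1 a ha, hrt q' m2 b hb]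
      rcases h with h | ⟨e2, h⟩
      · exact Or.inl ((hF _ (SRun.mem_row m1 (rt_mem ha)) _ (SRun.mem_row m2 (rt_mem hb))).2 h)
      · exact Or.inr ⟨congrArg F e2, (hF _ ht _ hu).2 h⟩
  · rw [k2 q hq, k3 Y' hY' u huY] at h
    rw [kS q hq, kY Y' hY' u huY]
    simp only [sKey, List.cons_lt_cons_iff] at h ⊢
    omega
  · rw [k3 Y hY t htY, k1 q' hq' u huq] at h
    simp only [cKey, List.cons_lt_cons_iff] at h
    omega
  · rw [k3 Y hY t htY, k2 q' hq'] at h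
    rw [kS q' hq', kY Y hY t htY]
    simp only [sKey, List.cons_lt_cons_iff] at h ⊢
    omega
  · obtain rfl : Y = Y' := Option.mem_unique hY hY'
    rw [k3 Y hY t htY, k3 Y hY u huY] at h
    rw [kY Y hY t htY, kY Y hY u huY]
    exact h

/-- Positions are defined through the standardized tree; this transfers their meaning back to the
tree itself. -/
theorem Valid.ridx_lt_iff_key {T : TimedTree ℕ κ} (hv : Valid μ T) {t u : ℕ} (ht : t ∈ T.times)
    (hu : u ∈ T.times) : ridx μ T t < ridx μ T u ↔ key μ T t < key μ T u := by
  have hmem : ∀ v ∈ T.times, listIdx T.times v ∈ (TimedTree.std T).times := fun v hv => by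
    rw [times_std]
    exact List.mem_map_of_mem hv
  rw [← ridx_std T t, ← ridx_std T u,
    ridx_lt_iff (std_std T) hv.std.nodup (hmem t ht) (hmem u hu)]
  refine ⟨fun h => ?_, hv.key_std_lt ht hu⟩
  rcases lt_trichotomy (key μ T t) (key μ T u) with h1 | h1 | h1
  · exact h1
  · rw [hv.key_inj ht hu h1] at h
    exact absurd h (lt_irrefl _)
  · exact absurd h (lt_asymm (hv.key_std_lt hu ht h1))

end KeyStd

/-! ### Descents in trees and blocks with at most two leaves -/

section Descents

variable {κ : Type*} [Encodable κ] (μ : Multiset κ → ℕ)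

/-- All subtrees. -/
def subs {Λ α : Type*} : TimedTree Λ α → List (TimedTree Λ α)
  | leaf x => [leaf x]
  | node t l r => node t l r :: (subs l ++ subs r)

/-- No subtree of a right child has the weight of the left child, unless the left child has at
most two leaves. -/
def NoEqual : TimedTree ℕ κ → Prop
  | leaf _ => True
  | node _ l r => (∀ B ∈ subs r, wt μ B = wt μ l → l.leaves.length ≤ 2) ∧ NoEqual l ∧ NoEqual r

/-- The condition for a topological descent between a node with left child `X` and right child `Y`
and the next node, at time `t`, if the latter lies in `X` or `Y`. -/
def SplitDesc (X Y : TimedTree ℕ κ) (t : ℕ) : Prop :=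
  wt μ X ≤ wt μ Y ∧ (X.root = some t ∨ ∃ A B, (Y = node t A B ∨ Y = node t B A) ∧ wt μ A ≤ wt μ B ∧
    (wt μ A < wt μ X ∨ wt μ A = wt μ X ∧ X.leaves.length = 2 ∧ rt A < rt X))

/-- Topological descent between the consecutive times `t` and `u` of a tree. -/
def Desc : TimedTree ℕ κ → ℕ → ℕ → Prop
  | leaf _, _, _ => False
  | node s l r, t, u => t = s ∧ (SplitDesc μ l r u ∨ SplitDesc μ r l u) ∨
      wt μ l < wt μ r ∧ t ∈ r.times ∧ u ∈ l.times ∨ Desc l t u ∨ Desc r t u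

variable {μ}

theorem mem_subs_self {Λ α : Type*} (T : TimedTree Λ α) : T ∈ subs T := by
  cases T <;> simp [subs]

theorem sublist_of_mem_subs {Λ α : Type*} {T R : TimedTree Λ α} (h : R ∈ subs T) :
    R.leaves.Sublist T.leaves := by
  induction T with
  | leaf x =>
    rw [subs, List.mem_singleton] at h
    rw [h]
  | node t l r hl hr =>
    rw [subs, List.mem_cons, List.mem_append] at h
    rcases h with rfl | h | h
    · exact List.Sublist.refl _
    · exact (hl h).trans (List.sublist_append_left _ _)
    · exact (hr h).trans (List.sublist_append_right _ _)

theorem mem_subs_build {Λ α : Type*} {p : Λ × TimedTree Λ α} {ps : List (Λ × TimedTree Λ α)}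
    {Yo : Option (TimedTree Λ α)} : ∀ q ∈ p :: ps, q.2 ∈ subs (build p ps Yo) := by
  induction ps generalizing p with
  | nil =>
    cases Yo with
    | none => simp [build, mem_subs_self]
    | some Y => simp [build, subs, mem_subs_self]
  | cons p' ps ih =>
    intro q hq
    rw [build, subs]
    rcases List.mem_cons.1 hq with rfl | hq
    · simp [mem_subs_self]
    · simp [ih q hq]

theorem Desc.mem_times {T : TimedTree ℕ κ} {t u : ℕ} (h : Desc μ T t u) :
    t ∈ T.times ∧ u ∈ T.times := by
  induction T with
  | leaf x => exact h.elim
  | node s l r hl hr =>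
    simp only [times, List.mem_cons, List.mem_append]
    have hsplit : ∀ X Y : TimedTree ℕ κ, SplitDesc μ X Y u → u ∈ X.times ∨ u ∈ Y.times := by
      rintro X Y ⟨-, h | ⟨A, B, rfl | rfl, -⟩⟩
      · exact Or.inl (mem_times_of_root h)
      · exact Or.inr (by simp [times])
      · exact Or.inr (by simp [times])
    rcases h with ⟨rfl, h | h⟩ | ⟨-, h1, h2⟩ | h | h
    · exact ⟨Or.inl rfl, Or.inr (hsplit _ _ h)⟩
    · exact ⟨Or.inl rfl, Or.inr (hsplit _ _ h).symm⟩
    · exact ⟨Or.inr (Or.inr h1), Or.inr (Or.inl h2)⟩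
    · exact ⟨Or.inr (Or.inl (hl h).1), Or.inr (Or.inl (hl h).2)⟩
    · exact ⟨Or.inr (Or.inr (hr h).1), Or.inr (Or.inr (hr h).2)⟩

theorem fcode_leaf (x : κ) : fcode (leaf x : TimedTree ℕ κ) = 2 * Encodable.encode x := rfl

/-- A tree with at most two leaves is determined by its letters: the order of two letters is fixed
by validity. This fails for three leaves, which is why equal blocks of size at most two do no harm.
-/
theorem fcode_eq_of_perm {T T' : TimedTree ℕ κ} (hv : Valid μ T) (hv' : Valid μ T')
    (h : T.leaves.Perm T'.leaves) (h2 : T.leaves.length ≤ 2) : fcode T = fcode T' := by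
  have h2' := h.length_eq ▸ h2
  have hpos : ∀ R : TimedTree ℕ κ, 0 < R.leaves.length := fun R =>
    List.length_pos_iff.2 R.leaves_ne_nil
  have hlen := h.length_eq
  match T, T', hv, hv' with
  | leaf x, leaf y, _, _ =>
    simp only [leaves, List.perm_singleton, List.cons.injEq, and_true] at h
    rw [h]
  | leaf x, node t l r, _, _ =>
    have := hpos l; have := hpos r
    simp only [leaves, List.length_append, List.length_singleton] at hlen
    omega
  | node t l r, leaf x, _, _ =>
    have := hpos l; have := hpos r
    simp only [leaves, List.length_append, List.length_singleton] at hlen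
    omega
  | node t (leaf a) (leaf b), node t' (leaf a') (leaf b'), hv, hv' =>
    have hstd : ∀ (t : ℕ) (a b : κ), std (node t (leaf a) (leaf b)) = node 0 (leaf a) (leaf b) := by
      intro t a b
      simp [std, mapT, times, listIdx]
    rw [fcode, fcode, hstd, hstd]
    have hsw : a = a' ∧ b = b' ∨ a = b' ∧ b = a' := by
      simp only [leaves, List.singleton_append] at h
      have ha : a = a' ∨ a = b' := by simpa using h.mem_iff.1 (by simp : a ∈ [a, b])
      rcases ha with rfl | rfl
      · exact Or.inl ⟨rfl, by simpa using h.cons_inv⟩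
      · exact Or.inr ⟨rfl, by simpa using (h.trans (List.Perm.swap _ _ _)).cons_inv⟩
    rcases hsw with ⟨rfl, rfl⟩ | ⟨rfl, rfl⟩
    · rfl
    · have e1 := hv.2.2.2.1
      have e2 := hv'.2.2.2.1
      simp only [TieLE, fcode_leaf] at e1 e2
      have : a = b := Encodable.encode_injective (by omega)
      rw [this]
  | node t (node s l1 l2) r, _, _, _ =>
    have := hpos l1; have := hpos l2; have := hpos r
    simp only [leaves, List.length_append] at h2
    omega
  | node t l (node s r1 r2), _, _, _ =>
    have := hpos r1; have := hpos r2; have := hpos l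
    simp only [leaves, List.length_append] at h2
    omega
  | _, node t (node s l1 l2) r, _, _ =>
    have := hpos l1; have := hpos l2; have := hpos r
    simp only [leaves, List.length_append] at h2'
    omega
  | _, node t l (node s r1 r2), _, _ =>
    have := hpos r1; have := hpos r2; have := hpos l
    simp only [leaves, List.length_append] at h2'
    omega

/-- A row with one time has one column, so rows of this kind are read by shape, then by split time,
then by their only time. -/
theorem cKey_of_length_eq_one {q : ℕ × TimedTree ℕ κ} (hv : Valid μ q.2) {t : ℕ}
    (ht : t ∈ q.2.times) (h : q.2.times.length = 1) :
    cKey (ridx μ) q t = [0, fcode q.2, ridx μ (std q.2) 0, q.1, t] ∧ rt q.2 = t := by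
  have h0 : listIdx q.2.times t = 0 := by
    have := listIdx_lt_length ht
    omega
  have hrt : rt q.2 = t := by
    rw [← hv.listUnidx_zero (by omega), ← h0, listUnidx_listIdx ht]
  have h1 : listNext q.2.times q.1 t = q.1 := by
    rw [← listUnidx_listIdx ht]
    exact listNext_last hv.nodup _ (by omega)
  rw [cKey, ← ridx_std q.2 t, h0, h1, hrt]
  exact ⟨rfl, rfl⟩

theorem cKey_lt_iff {q : ℕ × TimedTree ℕ κ} (hv : Valid μ q.2) {t u : ℕ} (ht : t ∈ q.2.times)
    (hu : u ∈ q.2.times) :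
    cKey (ridx μ) q t < cKey (ridx μ) q u ↔ key μ q.2 t < key μ q.2 u := by
  rw [← hv.ridx_lt_iff_key ht hu, cKey, cKey]
  simp only [List.cons_lt_cons_iff, lt_self_iff_false, false_or, true_and]
  refine ⟨fun h => ?_, Or.inl⟩
  rcases h with h | ⟨h, h'⟩
  · exact h
  · rw [hv.ridx_inj ht hu h] at h'
    simp at h'

end Descents

end TimedTree

/-! ### Descents of the reading order are descents of the tree -/

namespace TimedTree

section DescentTheorem

variable {κ : Type*} [Encodable κ] {μ : Multiset κ → ℕ}

theorem eq_node_of_adjacent {T R : TimedTree ℕ κ} {t u : ℕ} (hv : Valid μ R)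
    (hR : ∀ v ∈ R.times, v ∈ T.times ∧ t < v) (hadj : ∀ v ∈ T.times, ¬ (t < v ∧ v < u))
    (hu : u ∈ R.times) : ∃ A B, R = node u A B := by
  cases R with
  | leaf x => simp [times] at hu
  | node s A B =>
    have h1 := hR s (by simp [times])
    have h2 := hv.heap.root_le rfl u hu
    have : s = u := by
      by_contra hne
      exact hadj s h1.1 ⟨h1.2, lt_of_le_of_ne h2 hne⟩
    exact ⟨A, B, by rw [this]⟩

/-- The keys of the times on the right of the root. -/
theorem key_node_right (hμ : ∀ A B : Multiset κ, A ≠ 0 → B ≠ 0 → μ A ≤ μ B → μ A < μ (A + B))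
    {t0 : ℕ} {l r : TimedTree ℕ κ} (hv : Valid μ (node t0 l r)) :
    (∀ u ∈ r.times,
      (∃ q : ℕ × TimedTree ℕ κ, wt μ q.2 = wt μ l ∧ q.2 ∈ subs r ∧ Valid μ q.2 ∧ u ∈ q.2.times ∧
        key μ (node t0 l r) u = cKey (ridx μ) q u ∧
        (t0 < q.1 ∧ wt μ l < wt μ r ∨ q.1 = t0 ∧ wt μ l = wt μ r)) ∨
      wt μ l < wt μ r ∧ ∃ a L, key μ (node t0 l r) u = a :: L ∧ 1 ≤ a) ∧
    (∀ t ∈ l.times, key μ (node t0 l r) t = cKey (ridx μ) (t0, l) t) ∧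
    (∀ t ∈ r.times, ∀ u ∈ r.times,
      key μ (node t0 l r) t < key μ (node t0 l r) u ↔ key μ r t < key μ r u) ∧
    ∃ c, (c = 1 ∨ c = 3) ∧ key μ (node t0 l r) t0 = sKey c (t0, l) ∧
      ((∃ u A B, r = node u A B ∧ wt μ A = wt μ l ∧
        key μ (node t0 l r) u = sKey c (u, A)) ∨
      (wt μ r = wt μ l ∧ ∀ u ∈ r.times, ∃ L, key μ (node t0 l r) u = 0 :: L) ∨
      (wt μ l < wt μ r ∧ leftWt μ r ≠ some (wt μ l) ∧
        (c = 3 ↔ ∃ m, leftWt μ r = some m ∧ m < wt μ l) ∧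
          ∀ u ∈ r.times, ∃ L, key μ (node t0 l r) u = 2 :: L)) := by
  have hwt := hv.wt_le
  have hvr := hv.2.2.2.2.2
  -- The three cases of `run`: the right child continues the run, it is the last row, or it is the
  -- rest. In the first case the keys on the right are unchanged by the additional row.
  by_cases h1 : leftWt μ r = some (wt μ l)
  · have hlt : wt μ l < wt μ r := by
      cases r with
      | leaf x => simp [leftWt] at h1
      | node s A B =>
        simp only [leftWt, Option.some.injEq] at h1
        rw [← h1]
        exact lt_wt_node hμ hvr.wt_le
    have hrun := sRun_run h1
    have hb := build_run (μ := μ) r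
    generalize (run μ r).1 = q at hrun hb
    generalize (run μ r).2.1 = qs at hrun hb
    generalize (run μ r).2.2 = Yo at hrun hb
    subst hb
    have hrunT := SRun.cons (t0, l) q qs Yo rfl hrun
    obtain ⟨k1, k2, k3⟩ := hrunT.key_eq hv.nodup
    obtain ⟨k1', k2', k3'⟩ := hrun.key_eq hvr.nodup
    rw [sRows_cons] at k2
    have hT : build (t0, l) (q :: qs) Yo = node t0 l (build q qs Yo) := rfl
    rw [hT] at k1 k2 k3
    have hc := sClass_eq (μ := μ) (wt μ l) Yo
    have hsame : ∀ t ∈ (build q qs Yo).times,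
        key μ (node t0 l (build q qs Yo)) t = key μ (build q qs Yo) t := by
      intro t ht
      rcases mem_times_build.1 ht with ⟨a, ha, ht⟩ | ⟨a, ha, rfl⟩ | ⟨Y, hY, ht⟩
      · rw [k1 a (List.mem_cons_of_mem _ ha) t ht, k1' a ha t ht]
      · rw [k2 a (List.mem_cons_of_mem _ ha), k2' a ha]
      · rw [k3 Y hY t ht, k3' Y hY t ht]
    refine ⟨fun u hu => ?_, k1 (t0, l) (by simp), fun t ht u hu => by rw [hsame t ht, hsame u hu],
      sClass μ (wt μ l) Yo, hc, k2 (t0, l) (by simp), Or.inl ?_⟩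
    · rcases mem_times_build.1 hu with ⟨a, ha, hu⟩ | ⟨a, ha, rfl⟩ | ⟨Y, hY, hu⟩
      · refine Or.inl ⟨a, hrun.wt_eq a ha, mem_subs_build a ha, hvr.of_build.1 a ha, hu,
          k1 a (List.mem_cons_of_mem _ ha) u hu, Or.inl ⟨?_, hlt⟩⟩
        exact lt_of_lt_of_le (hv.2.1 _ (mem_times_of_root hrun.root_build))
          ((hrun.rows_of_valid hvr).2.2.2.2.2 a ha)
      · exact Or.inr ⟨hlt, sClass μ (wt μ l) Yo, _, k2 a (List.mem_cons_of_mem _ ha), by omega⟩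
      · exact Or.inr ⟨hlt, 2, _, k3 Y hY u hu, one_le_two⟩
    · have hq := hrun.wt_eq q (by simp)
      have hk := k2 q (List.mem_cons_of_mem _ hrun.head_mem)
      cases hrun with
      | last _ Y => exact ⟨q.1, q.2, Y, rfl, hq, hk⟩
      | pair _ q' => exact ⟨q.1, q.2, q'.2, rfl, hq, hk⟩
      | cons _ q' qs => exact ⟨q.1, q.2, build q' qs Yo, rfl, hq, hk⟩
  by_cases h2 : wt μ r = wt μ l
  · have hrunT := SRun.pair (μ := μ) (t0, l) (t0, r) rfl h2 h1 rfl
    obtain ⟨k1, k2, -⟩ := hrunT.key_eq hv.nodup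
    have hT : build (t0, l) [(t0, r)] none = node t0 l r := rfl
    rw [hT] at k1 k2
    refine ⟨fun u hu => Or.inl ⟨(t0, r), h2, mem_subs_self r, hvr, hu,
      k1 (t0, r) (by simp) u hu, Or.inr ⟨rfl, h2.symm⟩⟩, k1 (t0, l) (by simp), fun t ht u hu => ?_,
      1, Or.inl rfl, k2 (t0, l) (by simp [sRows]), Or.inr (Or.inl ⟨h2, fun u hu => ?_⟩)⟩
    · rw [k1 (t0, r) (by simp) t ht, k1 (t0, r) (by simp) u hu]
      exact cKey_lt_iff (q := (t0, r)) hvr ht hu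
    · exact ⟨_, k1 (t0, r) (by simp) u hu⟩
  · have hrunT := SRun.last (μ := μ) (t0, l) r rfl h2 h1
    obtain ⟨k1, k2, k3⟩ := hrunT.key_eq hv.nodup
    have hT : build (t0, l) [] (some r) = node t0 l r := rfl
    rw [hT] at k1 k2 k3
    have hlt : wt μ l < wt μ r := by omega
    refine ⟨fun u hu => Or.inr ⟨hlt, 2, _, k3 r rfl u hu, one_le_two⟩, k1 (t0, l) (by simp),
      fun t ht u hu => ?_, sClass μ (wt μ l) (some r), sClass_eq _ _, k2 (t0, l) (by simp [sRows]),
      Or.inr (Or.inr ⟨hlt, h1, ?_, fun u hu => ⟨_, k3 r rfl u hu⟩⟩)⟩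
    · rw [k3 r rfl t ht, k3 r rfl u hu, ← hvr.ridx_lt_iff_key ht hu]
      simp [List.cons_lt_cons_iff]
    · rw [sClass]
      split_ifs with h
      · simpa using h
      · simpa using h

theorem length_times_le_one {T : TimedTree ℕ κ} (h : T.leaves.length ≤ 2) {t : ℕ}
    (ht : t ∈ T.times) : T.times.length = 1 := by
  have := length_leaves T
  have := List.length_pos_of_mem ht
  omega

theorem leaves_ne_zero {Λ : Type*} (T : TimedTree Λ κ) : (T.leaves : Multiset κ) ≠ 0 := by
  simpa using T.leaves_ne_nil

/-- In a valid tree without equal blocks, descents of the reading order are topological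
descents. -/
theorem key_lt_key_iff_desc
    (hμ : ∀ A B : Multiset κ, A ≠ 0 → B ≠ 0 → μ A ≤ μ B → μ A < μ (A + B)) {M : Multiset κ}
    (hinj : ∀ A B : Multiset κ, A ≠ 0 → B ≠ 0 → A ≤ M → B ≤ M → μ A = μ B → A = B)
    (T : TimedTree ℕ κ) (hM : (T.leaves : Multiset κ) ≤ M) (hv : Valid μ T) (hne : NoEqual μ T) :
    ∀ t ∈ T.times, ∀ u ∈ T.times, t < u → (∀ v ∈ T.times, ¬ (t < v ∧ v < u)) →
      (key μ T u < key μ T t ↔ Desc μ T t u) := by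
  induction T with
  | leaf x => simp [times]
  | node t0 l r ihl ihr =>
    obtain ⟨hv1, hv2, hdis, hord, hvl, hvr⟩ := id hv
    obtain ⟨hn1, hnl, hnr⟩ := hne
    have hMl : (l.leaves : Multiset κ) ≤ M := le_trans
      (Multiset.coe_le.2 (List.sublist_append_left _ _).subperm) hM
    have hMr : (r.leaves : Multiset κ) ≤ M := le_trans
      (Multiset.coe_le.2 (List.sublist_append_right _ _).subperm) hM
    have hwt := hv.wt_le
    obtain ⟨kR, kL, kRR, c, hc, k0, kcase⟩ := key_node_right hμ hv
    -- A block on the right with the weight of the left child is equivalent to it, since weights are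
    -- injective on blocks; by assumption it has at most two leaves.
    have hperm : ∀ B ∈ subs r, wt μ B = wt μ l → l.leaves.length ≤ 2 ∧ l.leaves.Perm B.leaves := by
      intro B hB hw
      refine ⟨hn1 B hB hw, Multiset.coe_eq_coe.1 (hinj _ _ (leaves_ne_zero l) (leaves_ne_zero B)
        hMl ?_ hw.symm)⟩
      exact le_trans (Multiset.coe_le.2 (sublist_of_mem_subs hB).subperm) hMr
    intro t ht u hu htu hadj
    simp only [times, List.mem_cons, List.mem_append] at ht hu hadj
    have hc0 : 0 < c := by rcases hc with h | h <;> simp [h]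
    -- Such equivalent blocks have the same shape, so in the reading order only their split times
    -- and then their own times matter.
    have hmixed : ∀ a ∈ l.times, ∀ q : ℕ × TimedTree ℕ κ, wt μ q.2 = wt μ l → q.2 ∈ subs r →
        Valid μ q.2 → ∀ b ∈ q.2.times, ∃ f ρ, cKey (ridx μ) (t0, l) a = [0, f, ρ, t0, a] ∧
          cKey (ridx μ) q b = [0, f, ρ, q.1, b] := by
      intro a ha q hq hqs hqv b hb
      obtain ⟨h2, hp⟩ := hperm q.2 hqs hq
      have hf := fcode_eq_of_perm hvl hqv hp h2
      refine ⟨_, _, (cKey_of_length_eq_one (q := (t0, l)) hvl ha (length_times_le_one h2 ha)).1, ?_⟩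
      rw [(cKey_of_length_eq_one hqv hb (length_times_le_one (hp.length_eq ▸ h2) hb)).1]
      simp only
      rw [hf, std_eq_of_fcode_eq hf]
    rcases ht with rfl | ht | ht
    · have hnl' : ∀ v, ¬ Desc μ l t v := fun v h => lt_irrefl t (hv1 t h.mem_times.1)
      have hnr' : ∀ v, ¬ Desc μ r t v := fun v h => lt_irrefl t (hv2 t h.mem_times.1)
      have htr : t ∉ r.times := fun h => lt_irrefl t (hv2 t h)
      have hDesc : Desc μ (node t l r) t u ↔ SplitDesc μ l r u ∨ SplitDesc μ r l u := by
        simp [Desc, hnl', hnr', htr]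
      rw [hDesc, k0]
      rcases hu with rfl | hu | hu
      · exact absurd htu (lt_irrefl _)
      · obtain ⟨A, B, rfl⟩ := eq_node_of_adjacent (T := node t l r) hvl
          (fun v hv => ⟨by simp [times, hv], hv1 v hv⟩) (by simpa [times] using hadj) hu
        rw [kL u hu]
        -- The next step splits the left child: row times are read before split times, which is
        -- always a descent.
        refine iff_of_true ?_ (Or.inl ⟨hwt, Or.inl rfl⟩)
        rw [cKey, sKey, List.cons_lt_cons_iff]
        exact Or.inl hc0
      · obtain ⟨A, B, rfl⟩ := eq_node_of_adjacent (T := node t l r) hvr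
          (fun v hv => ⟨by simp [times, hv], hv2 v hv⟩) (by simpa [times] using hadj) hu
        have hlroot : l.root ≠ some u := fun h => hdis (mem_times_of_root h) hu
        rcases kcase with ⟨u', A', B', he, hA, hk⟩ | ⟨he, hk⟩ | ⟨hlt, hlw, hc3, hk⟩
        · simp only [node.injEq] at he
          obtain ⟨rfl, rfl, rfl⟩ := he
          have hlt : wt μ l < wt μ (node u A B) := by
            rw [← hA]
            exact lt_wt_node hμ hvr.wt_le
          obtain ⟨h2, hp⟩ := hperm A (by simp [subs, mem_subs_self]) hA
          have hf := fcode_eq_of_perm hvl hvr.2.2.2.2.1 hp h2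
          rw [hk, sKey, sKey, hf]
          simp only [List.cons_lt_cons_iff, lt_self_iff_false, false_or, true_and]
          constructor
          · intro h
            -- Two consecutive rows of the same weight and shape: their split times are read in the
            -- order of their roots. Leaves have root value zero, so a strict inequality forces two
            -- leaves.
            have hrt : rt A < rt l := by omega
            refine Or.inl ⟨hwt, Or.inr ⟨A, B, Or.inl rfl, hvr.wt_le, Or.inr ⟨hA, ?_, hrt⟩⟩⟩
            cases l with
            | leaf x => simp [rt, root] at hrt
            | node s a b =>
              have := List.length_pos_iff.2 a.leaves_ne_nil
              have := List.length_pos_iff.2 b.leaves_ne_nil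
              simp only [leaves, List.length_append] at h2 ⊢
              omega
          · rintro (⟨-, h | ⟨A', B', h1 | h1, h3, h4⟩⟩ | ⟨h, -⟩)
            · exact absurd h hlroot
            · simp only [node.injEq] at h1
              obtain ⟨-, rfl, rfl⟩ := h1
              exact Or.inl (by omega)
            · simp only [node.injEq] at h1
              obtain ⟨-, rfl, rfl⟩ := h1
              have h5 := hvr.wt_le
              have hB : wt μ B = wt μ l := by omega
              obtain ⟨-, hp'⟩ := hperm B (by simp [subs, mem_subs_self]) hB
              have hf' := fcode_eq_of_perm hvl hvr.2.2.2.2.2 hp' h2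
              rcases hvr.2.2.2.1 with h6 | ⟨-, h6 | h6⟩ <;> exact Or.inl (by omega)
            · omega
        · obtain ⟨L, hL⟩ := hk u hu
          rw [hL]
          -- The children are equivalent, so the right one may be taken as the left child, which is
          -- then split by the next step.
          refine iff_of_true ?_ (Or.inr ⟨he.le, Or.inl rfl⟩)
          rw [sKey, List.cons_lt_cons_iff]
          exact Or.inl hc0
        · obtain ⟨L, hL⟩ := hk u hu
          have h5 := hvr.wt_le
          -- The right child is the rest, which has class two; the split time is read after it
          -- exactly in class three, that is, if the next left child is lighter.
          rw [hL, sKey, List.cons_lt_cons_iff]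
          simp only [leftWt, Option.some.injEq, exists_eq_left', ne_eq] at hc3 hlw
          constructor
          · intro h
            exact Or.inl ⟨hwt, Or.inr ⟨A, B, Or.inl rfl, h5, Or.inl (hc3.1 (by omega))⟩⟩
          · rintro (⟨-, h | ⟨A', B', h1 | h1, h3, h4⟩⟩ | ⟨h, -⟩)
            · exact absurd h hlroot
            · simp only [node.injEq] at h1
              obtain ⟨-, rfl, rfl⟩ := h1
              have := hc3.2 (by omega)
              omega
            · simp only [node.injEq] at h1
              obtain ⟨-, rfl, rfl⟩ := h1
              have := hc3.2 (by omega)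
              omega
            · omega
    · have h0 : t ≠ t0 := (hv1 t ht).ne'
      have htr : t ∉ r.times := fun h => hdis ht h
      have hnr' : ¬ Desc μ r t u := fun h => htr h.mem_times.1
      have hDesc : Desc μ (node t0 l r) t u ↔ Desc μ l t u := by
        simp [Desc, hnr', h0, htr]
      rw [hDesc]
      rcases hu with rfl | hu | hu
      · exact absurd htu (lt_asymm (hv1 t ht))
      · rw [kL u hu, kL t ht, cKey_lt_iff (q := (t0, l)) hvl hu ht]
        exact ihl hMl hvl hnl t ht u hu htu fun v hv => hadj v (Or.inr (Or.inl hv))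
      · refine iff_of_false (fun h => ?_) fun h => hdis h.mem_times.2 hu
        rw [kL t ht] at h
        rcases kR u hu with ⟨q, hq, hqs, hqv, huq, hk, hqt⟩ | ⟨-, a, L, hk, ha⟩
        · obtain ⟨f, ρ, e1, e2⟩ := hmixed t ht q hq hqs hqv u huq
          rw [hk, e1, e2] at h
          simp only [List.cons_lt_cons_iff, lt_self_iff_false, false_or, true_and, and_false,
            or_false] at h
          omega
        · rw [hk, cKey, List.cons_lt_cons_iff] at h
          omega
    · have h0 : t ≠ t0 := (hv2 t ht).ne'
      have htl : t ∉ l.times := fun h => hdis h ht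
      have hnl' : ¬ Desc μ l t u := fun h => htl h.mem_times.1
      rcases hu with rfl | hu | hu
      · exact absurd htu (lt_asymm (hv2 t ht))
      · have hnr' : ¬ Desc μ r t u := fun h => hdis hu h.mem_times.2
        have hDesc : Desc μ (node t0 l r) t u ↔ wt μ l < wt μ r := by
          simp [Desc, hnr', hnl', h0, ht, hu]
        rw [hDesc, kL u hu]
        rcases kR t ht with ⟨q, hq, hqs, hqv, huq, hk, hqt⟩ | ⟨hlt, a, L, hk, ha⟩
        · obtain ⟨f, ρ, e1, e2⟩ := hmixed u hu q hq hqs hqv t huq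
          rw [hk, e1, e2]
          simp only [List.cons_lt_cons_iff, lt_self_iff_false, false_or, true_and, and_false,
            or_false]
          omega
        · refine iff_of_true ?_ hlt
          rw [hk, cKey, List.cons_lt_cons_iff]
          exact Or.inl (by omega)
      · have hul : u ∉ l.times := fun h => hdis h hu
        have hDesc : Desc μ (node t0 l r) t u ↔ Desc μ r t u := by
          simp [Desc, hnl', h0, hul]
        rw [hDesc, kRR u hu t ht]
        exact ihr hMr hvr hnr t ht u hu htu fun v hv => hadj v (Or.inr (Or.inr hv))

end DescentTheorem

end TimedTree

/-! ### Lowest common ancestors as ultrametrics -/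

namespace TimedTree

section Lca

variable {α β : Type*}

open Classical in
/-- The time of the lowest common ancestor of two leaves. -/
noncomputable def lca : TimedTree ℕ α → α → α → ℕ
  | leaf _, _, _ => 0
  | node t l r, x, y => if x ∈ l.leaves ∧ y ∈ l.leaves then lca l x y
      else if x ∈ r.leaves ∧ y ∈ r.leaves then lca r x y else t

theorem lca_left {t : ℕ} {l r : TimedTree ℕ α} {x y : α} (hx : x ∈ l.leaves) (hy : y ∈ l.leaves) :
    lca (node t l r) x y = lca l x y := by
  rw [lca, if_pos ⟨hx, hy⟩]

theorem disjoint_leaves {t : ℕ} {l r : TimedTree ℕ α} (h : (node t l r).leaves.Nodup) :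
    l.leaves.Nodup ∧ r.leaves.Nodup ∧ l.leaves.Disjoint r.leaves :=
  List.nodup_append'.1 h

theorem lca_right {t : ℕ} {l r : TimedTree ℕ α} (h : (node t l r).leaves.Nodup) {x y : α}
    (hx : x ∈ r.leaves) (hy : y ∈ r.leaves) : lca (node t l r) x y = lca r x y := by
  rw [lca, if_neg fun h' => (disjoint_leaves h).2.2 h'.1 hx, if_pos ⟨hx, hy⟩]

theorem lca_mixed {t : ℕ} {l r : TimedTree ℕ α} (h : (node t l r).leaves.Nodup) {x y : α}
    (hx : x ∈ l.leaves) (hy : y ∈ r.leaves) : lca (node t l r) x y = t := by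
  rw [lca, if_neg fun h' => (disjoint_leaves h).2.2 h'.2 hy,
    if_neg fun h' => (disjoint_leaves h).2.2 hx h'.1]

theorem lca_comm (T : TimedTree ℕ α) (x y : α) : lca T x y = lca T y x := by
  induction T with
  | leaf z => rfl
  | node t l r hl hr =>
    rw [lca, lca, hl, hr]
    classical exact if_congr and_comm rfl (if_congr and_comm rfl rfl)

theorem lca_mapT (f : ℕ → ℕ) {T : TimedTree ℕ α} {x y : α} (hx : x ∈ T.leaves) (hy : y ∈ T.leaves)
    (hxy : x ≠ y) : lca (mapT f T) x y = f (lca T x y) := by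
  induction T with
  | leaf z =>
    simp only [leaves, List.mem_singleton] at hx hy
    exact absurd (hx.trans hy.symm) hxy
  | node t l r hl hr =>
    rw [mapT, lca, lca, leaves_mapT, leaves_mapT]
    split_ifs with h1 h2
    · exact hl h1.1 h1.2
    · exact hr h2.1 h2.2
    · rfl

theorem lca_mapL {σ : α → β} (hσ : Function.Injective σ) (T : TimedTree ℕ α) (x y : α) :
    lca (mapL σ T) (σ x) (σ y) = lca T x y := by
  induction T with
  | leaf z => rfl
  | node t l r hl hr =>
    have h : ∀ (R : TimedTree ℕ α) z, σ z ∈ (mapL σ R).leaves ↔ z ∈ R.leaves := fun R z => by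
      rw [leaves_mapL, List.mem_map_of_injective hσ]
    rw [mapL, lca, lca, hl, hr]
    classical exact if_congr (and_congr (h l x) (h l y)) rfl (if_congr (and_congr (h r x) (h r y)) rfl rfl)

theorem lca_mem_times {T : TimedTree ℕ α} {x y : α} (hx : x ∈ T.leaves) (hy : y ∈ T.leaves)
    (hxy : x ≠ y) : lca T x y ∈ T.times := by
  induction T with
  | leaf z =>
    simp only [leaves, List.mem_singleton] at hx hy
    exact absurd (hx.trans hy.symm) hxy
  | node t l r hl hr =>
    rw [lca, times]
    split_ifs with h1 h2
    · exact List.mem_cons_of_mem _ (List.mem_append_left _ (hl h1.1 h1.2))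
    · exact List.mem_cons_of_mem _ (List.mem_append_right _ (hr h2.1 h2.2))
    · exact List.mem_cons_self

theorem mem_times_iff_subs {Λ : Type*} {T : TimedTree Λ α} {t : Λ} :
    t ∈ T.times ↔ ∃ A B, node t A B ∈ subs T := by
  induction T with
  | leaf z => simp [times, subs]
  | node s l r hl hr =>
    simp only [times, subs, List.mem_cons, List.mem_append, hl, hr, node.injEq]
    constructor
    · rintro (rfl | ⟨A, B, h⟩ | ⟨A, B, h⟩)
      · exact ⟨l, r, Or.inl ⟨rfl, rfl, rfl⟩⟩
      · exact ⟨A, B, Or.inr (Or.inl h)⟩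
      · exact ⟨A, B, Or.inr (Or.inr h)⟩
    · rintro ⟨A, B, h | h | h⟩
      · exact Or.inl h.1
      · exact Or.inr (Or.inl ⟨A, B, h⟩)
      · exact Or.inr (Or.inr ⟨A, B, h⟩)

theorem lca_of_mem_subs {T R : TimedTree ℕ α} (hT : T.leaves.Nodup) (hR : R ∈ subs T) {x y : α}
    (hx : x ∈ R.leaves) (hy : y ∈ R.leaves) : lca T x y = lca R x y := by
  induction T with
  | leaf z =>
    rw [subs, List.mem_singleton] at hR
    rw [hR]
  | node t l r hl hr =>
    obtain ⟨h1, h2, -⟩ := disjoint_leaves hT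
    rw [subs, List.mem_cons, List.mem_append] at hR
    rcases hR with rfl | hR | hR
    · rfl
    · have hs := (sublist_of_mem_subs hR).subset
      rw [lca_left (hs hx) (hs hy), hl h1 hR]
    · have hs := (sublist_of_mem_subs hR).subset
      rw [lca_right hT (hs hx) (hs hy), hr h2 hR]

theorem lca_of_node {T A B : TimedTree ℕ α} {t : ℕ} (hT : T.leaves.Nodup) (h : node t A B ∈ subs T)
    {x y : α} (hx : x ∈ A.leaves) (hy : y ∈ B.leaves) : lca T x y = t := by
  rw [lca_of_mem_subs hT h (List.mem_append_left _ hx) (List.mem_append_right _ hy)]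
  exact lca_mixed (hT.sublist (sublist_of_mem_subs h)) hx hy

theorem exists_mem_leaves {Λ : Type*} (T : TimedTree Λ α) : ∃ x, x ∈ T.leaves :=
  List.exists_mem_of_ne_nil _ T.leaves_ne_nil

theorem exists_lca_eq {T : TimedTree ℕ α} (hT : T.leaves.Nodup) {t : ℕ} (ht : t ∈ T.times) :
    ∃ x ∈ T.leaves, ∃ y ∈ T.leaves, x ≠ y ∧ lca T x y = t := by
  obtain ⟨A, B, h⟩ := mem_times_iff_subs.1 ht
  obtain ⟨x, hx⟩ := exists_mem_leaves A
  obtain ⟨y, hy⟩ := exists_mem_leaves B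
  have hs := sublist_of_mem_subs h
  refine ⟨x, hs.subset (List.mem_append_left _ hx), y, hs.subset (List.mem_append_right _ hy), ?_,
    lca_of_node hT h hx hy⟩
  rintro rfl
  exact (disjoint_leaves (hT.sublist hs)).2.2 hx hy

theorem Heap.of_mem_subs {T R : TimedTree ℕ α} (h : T.Heap) (hR : R ∈ subs T) : R.Heap := by
  induction T with
  | leaf z =>
    rw [subs, List.mem_singleton] at hR
    rwa [hR]
  | node t l r hl hr =>
    rw [subs, List.mem_cons, List.mem_append] at hR
    rcases hR with rfl | hR | hR
    · exact h
    · exact hl h.2.2.1 hR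
    · exact hr h.2.2.2 hR

theorem Heap.lca_ultra {T : TimedTree ℕ α} (h : T.Heap) (hT : T.leaves.Nodup) {x y z : α}
    (hx : x ∈ T.leaves) (hy : y ∈ T.leaves) (hz : z ∈ T.leaves) (hxy : x ≠ y) (hxz : x ≠ z) : min (lca T x y) (lca T y z) ≤ lca T x z := by
  induction T with
  | leaf w =>
    simp only [leaves, List.mem_singleton] at hx hy
    exact absurd (hx.trans hy.symm) hxy
  | node t l r hl hr =>
    obtain ⟨h1, h2, -⟩ := disjoint_leaves hT
    have hle : ∀ a b, a ∈ (node t l r).leaves → b ∈ (node t l r).leaves → a ≠ b →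
        t ≤ lca (node t l r) a b := fun a b ha hb hab =>
      h.root_le rfl _ (lca_mem_times ha hb hab)
    have hle' := hle x z hx hz hxz
    simp only [leaves, List.mem_append] at hx hy hz
    rcases hx with hx | hx <;> rcases hz with hz | hz
    · rcases hy with hy | hy
      · rw [lca_left hx hy, lca_left hy hz, lca_left hx hz]
        exact hl h.2.2.1 h1 hx hy hz
      · rw [lca_mixed hT hx hy]
        exact (min_le_left _ _).trans hle'
    · rcases hy with hy | hy
      · rw [lca_mixed hT hy hz]
        exact (min_le_right _ _).trans hle'
      · rw [lca_mixed hT hx hy]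
        exact (min_le_left _ _).trans hle'
    · rcases hy with hy | hy
      · rw [lca_comm _ x y, lca_mixed hT hy hx]
        exact (min_le_left _ _).trans hle'
      · rw [lca_comm _ y z, lca_mixed hT hz hy]
        exact (min_le_right _ _).trans hle'
    · rcases hy with hy | hy
      · rw [lca_comm _ x y, lca_mixed hT hy hx]
        exact (min_le_left _ _).trans hle'
      · rw [lca_right hT hx hy, lca_right hT hy hz, lca_right hT hx hz]
        exact hr h.2.2.2 h2 hx hy hz

theorem mem_subs_of_mem_ktrees {t : ℕ} {T K : TimedTree ℕ α} (hK : K ∈ ktrees t T) : K ∈ subs T := by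
  induction T with
  | leaf z => simpa [ktrees, subs] using hK
  | node s l r hl hr =>
    rw [ktrees] at hK
    split_ifs at hK
    · rcases List.mem_append.1 hK with h | h
      · simp [subs, hl h]
      · simp [subs, hr h]
    · rw [List.mem_singleton.1 hK]
      exact mem_subs_self _

theorem ktrees_mapL (t : ℕ) (f : α → β) (T : TimedTree ℕ α) :
    ktrees t (mapL f T) = (ktrees t T).map (mapL f) := by
  induction T with
  | leaf z => rfl
  | node s l r hl hr =>
    rw [mapL, ktrees, ktrees]
    split_ifs
    · rw [hl, hr, List.map_append]
    · rfl

theorem lca_ktrees {t : ℕ} {T : TimedTree ℕ α} (hT : T.leaves.Nodup) {x y : α} (hx : x ∈ T.leaves)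
    (hy : y ∈ T.leaves) (h : ∀ K ∈ ktrees t T, ¬ (x ∈ K.leaves ∧ y ∈ K.leaves)) :
    lca T x y = t := by
  induction T with
  | leaf z => exact absurd ⟨hx, hy⟩ (h (leaf z) (by simp [ktrees]))
  | node s l r hl hr =>
    obtain ⟨h1, h2, -⟩ := disjoint_leaves hT
    rw [ktrees] at h
    split_ifs at h with hs
    · simp only [leaves, List.mem_append] at hx hy
      rcases hx with hx | hx <;> rcases hy with hy | hy
      · rw [lca_left hx hy]
        exact hl h1 hx hy fun K hK => h K (List.mem_append_left _ hK)
      · rw [lca_mixed hT hx hy, hs]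
      · rw [lca_comm, lca_mixed hT hy hx, hs]
      · rw [lca_right hT hx hy]
        exact hr h2 hx hy fun K hK => h K (List.mem_append_right _ hK)
    · exact absurd ⟨hx, hy⟩ (h _ (by simp))

theorem exists_mem_ktrees {t : ℕ} {T : TimedTree ℕ α} {x : α} (hx : x ∈ T.leaves) :
    ∃ K ∈ ktrees t T, x ∈ K.leaves := by
  rw [← leaves_ktrees t T] at hx
  exact List.mem_flatMap.1 hx

theorem length_times_lt_of_mem_ktrees {t : ℕ} {T K : TimedTree ℕ α} (hroot : T.root = some t)
    (hK : K ∈ ktrees t T) : K.times.length < T.times.length := by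
  cases T with
  | leaf z => simp [root] at hroot
  | node s l r =>
    have hs : s = t := by simpa [root] using hroot
    rw [ktrees, if_pos hs] at hK
    simp only [times, List.length_cons, List.length_append]
    have aux : ∀ R : TimedTree ℕ α, K ∈ ktrees t R → K.times.length ≤ R.times.length := by
      intro R hR
      have := (sublist_of_mem_subs (mem_subs_of_mem_ktrees hR)).length_le
      rw [length_leaves, length_leaves] at this
      omega
    rcases List.mem_append.1 hK with h | h
    · have := aux l h
      omega
    · have := aux r h
      omega

end Lca

section Isomorphism

variable {α β κ : Type*} [Encodable κ] {μ : Multiset κ → ℕ}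

/-- The time of the root is the smallest time of a lowest common ancestor. -/
theorem root_eq_of_lca_eq {T T' : TimedTree ℕ α} (h : T.Heap) (h' : T'.Heap) (hT : T.leaves.Nodup)
    (hp : T.leaves.Perm T'.leaves)
    (hl : ∀ x ∈ T.leaves, ∀ y ∈ T.leaves, x ≠ y → lca T x y = lca T' x y) {t : ℕ}
    (ht : T.root = some t) : T'.root = some t := by
  have hT' := hp.nodup_iff.1 hT
  obtain ⟨x, hx, y, hy, hxy, hxyt⟩ := exists_lca_eq hT (mem_times_of_root ht)
  have hx' := hp.mem_iff.1 hx
  have hy' := hp.mem_iff.1 hy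
  cases T' with
  | leaf z =>
    simp only [leaves, List.mem_singleton] at hx' hy'
    exact absurd (hx'.trans hy'.symm) hxy
  | node s l r =>
    rw [root]
    congr 1
    refine le_antisymm ?_ ?_
    · rw [← hxyt, hl x hx y hy hxy]
      exact h'.root_le rfl _ (lca_mem_times hx' hy' hxy)
    · obtain ⟨a, ha, b, hb, hab, habs⟩ := exists_lca_eq hT' (t := s) (by simp [times])
      rw [← habs, ← hl a (hp.mem_iff.2 ha) b (hp.mem_iff.2 hb) hab]
      exact h.root_le ht _ (lca_mem_times (hp.mem_iff.2 ha) (hp.mem_iff.2 hb) hab)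

theorem nodup_leafSets {L : List (TimedTree ℕ α)} (h : (L.flatMap leaves).Nodup) :
    (L.map fun K => {x | x ∈ K.leaves}).Nodup := by
  rw [List.nodup_iff_pairwise_ne, List.pairwise_map]
  refine (List.nodup_flatMap.1 h).2.imp fun {K K'} hd he => ?_
  obtain ⟨x, hx⟩ := exists_mem_leaves K
  have : x ∈ {x | x ∈ K'.leaves} := he ▸ hx
  exact hd hx this

/-- The parts below a merged root of time `t` are the classes of the relation that lowest common
ancestors are later than `t`; they do not depend on the bracketing. -/
theorem mem_kid_iff {t : ℕ} {T K : TimedTree ℕ α} (h : T.Heap) (hT : T.leaves.Nodup)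
    (ht : T.root = some t) (hK : K ∈ ktrees t T) {x y : α} (hx : x ∈ K.leaves) (hy : y ∈ T.leaves) :
    y ∈ K.leaves ↔ x = y ∨ t < lca T x y := by
  have hs := mem_subs_of_mem_ktrees hK
  have hxT := (sublist_of_mem_subs hs).subset hx
  constructor
  · intro hyK
    by_cases hxy : x = y
    · exact Or.inl hxy
    · rw [lca_of_mem_subs hT hs hx hyK]
      exact Or.inr ((h.of_mem_ktrees (h.root_le ht) K hK).2 _ (lca_mem_times hx hyK hxy))
  · rintro (rfl | hlt)
    · exact hx
    · by_contra hyK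
      have : lca T x y = t := by
        refine lca_ktrees hT hxT hy fun K' hK' hxy => ?_
        have hn : ((ktrees t T).flatMap leaves).Nodup := by rwa [leaves_ktrees]
        have hpw := (List.nodup_flatMap.1 hn).2
        have hne : K ≠ K' := fun he => hyK (he ▸ hxy.2)
        have : Std.Symm (Function.onFun List.Disjoint fun K : TimedTree ℕ α => K.leaves) :=
          ⟨fun _ _ h => h.symm⟩
        exact hpw.forall hK hK' hne hx hxy.1
      omega

/-- The code of a coloured tree only depends on the times of the lowest common ancestors. -/
theorem wk_eq_of_lca_eq (c : α → κ) (n : ℕ) : ∀ T T' : TimedTree ℕ α, T.times.length ≤ n →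
    T.Heap → T'.Heap → T.leaves.Nodup → T.leaves.Perm T'.leaves →
    (∀ x ∈ T.leaves, ∀ y ∈ T.leaves, x ≠ y → lca T x y = lca T' x y) →
      wk μ (mapL c T) = wk μ (mapL c T') := by
  induction n with
  | zero =>
    intro T T' hn _ _ _ hp _
    have hlen := hp.length_eq
    rw [length_leaves, length_leaves] at hlen
    cases T with
    | node t l r => simp [times] at hn
    | leaf x =>
      cases T' with
      | node t l r => simp [times] at hlen
      | leaf y =>
        simp only [leaves, List.perm_singleton, List.cons.injEq, and_true] at hp
        rw [hp]
  | succ n ih =>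
    intro T T' hn h h' hT hp hl
    have hT' := hp.nodup_iff.1 hT
    cases hroot : T.root with
    | none =>
      have hlen := hp.length_eq
      rw [length_leaves, length_leaves] at hlen
      cases T with
      | node t l r => simp [root] at hroot
      | leaf x =>
        cases T' with
        | node t l r => simp [times] at hlen
        | leaf y =>
          simp only [leaves, List.perm_singleton, List.cons.injEq, and_true] at hp
          rw [hp]
    | some t =>
      have hroot' := root_eq_of_lca_eq h h' hT hp hl hroot
      refine wk_eq_of_codePart (t := t) (by rwa [root_mapL]) (by rwa [root_mapL]) ?_
      rw [codePart_wk, codePart_wk, ktrees_mapL, ktrees_mapL, List.map_map, List.map_map]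
      refine Multiset.coe_eq_coe.2 ?_
      have hsets : ((ktrees t T).map fun K => {x | x ∈ K.leaves}).Perm
          ((ktrees t T').map fun K => {x | x ∈ K.leaves}) := by
        have hone : ∀ R R' : TimedTree ℕ α, R.Heap → R'.Heap → R.leaves.Nodup → R'.leaves.Nodup →
            R.leaves.Perm R'.leaves → R.root = some t → R'.root = some t →
            (∀ x ∈ R.leaves, ∀ y ∈ R.leaves, x ≠ y → lca R x y = lca R' x y) →
            ∀ S, S ∈ (ktrees t R).map (fun K => {x | x ∈ K.leaves}) →
              S ∈ (ktrees t R').map fun K => {x | x ∈ K.leaves} := by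
          intro R R' hR hR' hn hn' hp ht ht' hlca S hS
          obtain ⟨K, hK, rfl⟩ := List.mem_map.1 hS
          obtain ⟨x, hx⟩ := exists_mem_leaves K
          have hxR := (sublist_of_mem_subs (mem_subs_of_mem_ktrees hK)).subset hx
          obtain ⟨K', hK', hx'⟩ := exists_mem_ktrees (t := t) (hp.mem_iff.1 hxR)
          refine List.mem_map.2 ⟨K', hK', ?_⟩
          ext y
          simp only [Set.mem_ofPred_eq]
          have e1 : y ∈ K.leaves → y ∈ R.leaves := fun hy =>
            (sublist_of_mem_subs (mem_subs_of_mem_ktrees hK)).subset hy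
          have e2 : y ∈ K'.leaves → y ∈ R.leaves := fun hy => hp.mem_iff.2
            ((sublist_of_mem_subs (mem_subs_of_mem_ktrees hK')).subset hy)
          by_cases hyR : y ∈ R.leaves
          · rw [mem_kid_iff hR hn ht hK hx hyR,
              mem_kid_iff hR' hn' ht' hK' hx' (hp.mem_iff.1 hyR)]
            by_cases hxy : x = y
            · simp [hxy]
            · rw [hlca x hxR y hyR hxy]
          · exact iff_of_false (fun hy => hyR (e2 hy)) fun hy => hyR (e1 hy)
        refine (List.perm_ext_iff_of_nodup (nodup_leafSets ?_) (nodup_leafSets ?_)).2 fun S =>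
          ⟨hone T T' h h' hT hT' hp hroot hroot' hl S,
            hone T' T h' h hT' hT hp.symm hroot' hroot (fun x hx y hy hxy =>
              (hl x (hp.mem_iff.2 hx) y (hp.mem_iff.2 hy) hxy).symm) S⟩
        · rwa [leaves_ktrees]
        · rwa [leaves_ktrees]
      refine perm_map_of_perm_map hsets fun K hK K' hK' hKK => ?_
      have hs := mem_subs_of_mem_ktrees hK
      have hs' := mem_subs_of_mem_ktrees hK'
      have hmem : ∀ x, x ∈ K.leaves ↔ x ∈ K'.leaves := fun x => by
        have := congrArg (fun S => x ∈ S) hKK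
        simpa using this
      have hKn := hT.sublist (sublist_of_mem_subs hs)
      have hpK : K.leaves.Perm K'.leaves :=
        (List.perm_ext_iff_of_nodup hKn (hT'.sublist (sublist_of_mem_subs hs'))).2 hmem
      have hwk := ih K K' (by have := length_times_lt_of_mem_ktrees hroot hK; omega)
        (h.of_mem_subs hs) (h'.of_mem_subs hs') hKn hpK fun x hx y hy hxy => by
          rw [← lca_of_mem_subs hT hs hx hy,
            ← lca_of_mem_subs hT' hs' ((hmem x).1 hx) ((hmem y).1 hy)]
          exact hl x ((sublist_of_mem_subs hs).subset hx) y ((sublist_of_mem_subs hs).subset hy) hxy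
      simp only [Function.comp, ecode, hwk]
      rw [wt_eq_of_perm (T := mapL c K) (T' := mapL c K')]
      rw [leaves_mapL, leaves_mapL]
      exact hpK.map c

end Isomorphism

end TimedTree

/-! ### Isomorphisms of coloured trees from equal codes -/

namespace TimedTree

theorem exists_zip_of_perm_map {α α' β : Type*} {f : α → β} {f' : α' → β} :
    ∀ {l : List α} {l' : List α'}, (l.map f).Perm (l'.map f') → ∃ Z : List (α × α'),
      Z.map Prod.fst = l ∧ (Z.map Prod.snd).Perm l' ∧ ∀ z ∈ Z, f z.1 = f' z.2
  | [], l', h => by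
    have : l' = [] := by simpa using h.symm
    exact ⟨[], by simp [this]⟩
  | a :: l, l', h => by
    classical
    have ha : f a ∈ l'.map f' := h.mem_iff.1 (by simp)
    obtain ⟨b, hb, hab⟩ := List.mem_map.1 ha
    obtain ⟨l₁, l₂, rfl⟩ := List.append_of_mem hb
    have hp : (b :: (l₁ ++ l₂)).Perm (l₁ ++ b :: l₂) := List.perm_middle.symm
    have h' := h.trans (hp.map f').symm
    rw [List.map_cons, List.map_cons, hab, List.perm_cons] at h'
    obtain ⟨Z, h1, h2, h3⟩ := exists_zip_of_perm_map h'
    refine ⟨(a, b) :: Z, by simp [h1], ?_, ?_⟩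
    · exact (h2.cons b).trans hp
    · intro z hz
      rcases List.mem_cons.1 hz with rfl | hz
      · exact hab.symm
      · exact h3 z hz

section Isomorphism

variable {α α' κ : Type*} [Encodable κ] {μ : Multiset κ → ℕ}

theorem eq_of_mem_ktrees {t : ℕ} {T K K' : TimedTree ℕ α} (hT : T.leaves.Nodup)
    (hK : K ∈ ktrees t T) (hK' : K' ∈ ktrees t T) {x : α} (hx : x ∈ K.leaves)
    (hx' : x ∈ K'.leaves) : K = K' := by
  by_contra hne
  rw [← leaves_ktrees t T] at hT
  have hpw := (List.nodup_flatMap.1 hT).2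
  have : Std.Symm (Function.onFun List.Disjoint fun K : TimedTree ℕ α => K.leaves) :=
    ⟨fun _ _ h => h.symm⟩
  exact hpw.forall hK hK' hne hx hx'

theorem nodup_ktrees {t : ℕ} {T : TimedTree ℕ α} (hT : T.leaves.Nodup) : (ktrees t T).Nodup :=
  List.Nodup.of_map _ (nodup_leafSets (by rwa [leaves_ktrees]))

/-- Point trees whose colourings have the same code are isomorphic: there is a matching of the
leaves which preserves the colours and the times of the lowest common ancestors. -/
theorem exists_matching_of_wk_eq {c : α → κ} {c' : α' → κ} (n : ℕ) :
    ∀ (T : TimedTree ℕ α) (T' : TimedTree ℕ α'), T.times.length ≤ n → T.leaves.Nodup →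
      T'.leaves.Nodup → wk μ (mapL c T) = wk μ (mapL c' T') → ∃ L : List (α × α'),
        (L.map Prod.fst).Perm T.leaves ∧ (L.map Prod.snd).Perm T'.leaves ∧
        (∀ p ∈ L, c p.1 = c' p.2) ∧
        ∀ p ∈ L, ∀ q ∈ L, p.1 ≠ q.1 → lca T p.1 q.1 = lca T' p.2 q.2 := by
  have hleaf : ∀ (x : α) (T' : TimedTree ℕ α'), wk μ (mapL c (leaf x)) = wk μ (mapL c' T') →
      ∃ L : List (α × α'), (L.map Prod.fst).Perm (leaf x : TimedTree ℕ α).leaves ∧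
        (L.map Prod.snd).Perm T'.leaves ∧ (∀ p ∈ L, c p.1 = c' p.2) ∧
        ∀ p ∈ L, ∀ q ∈ L, p.1 ≠ q.1 → lca (leaf x) p.1 q.1 = lca T' p.2 q.2 := by
    intro x T' h
    cases T' with
    | node t l r => simp [mapL, wk] at h
    | leaf y =>
      refine ⟨[(x, y)], by simp [leaves], by simp [leaves], ?_, by simp [lca]⟩
      simpa [mapL, wk] using h
  induction n with
  | zero =>
    intro T T' hn _ _ h
    cases T with
    | leaf x => exact hleaf x T' h
    | node t l r => simp [times] at hn
  | succ n ih =>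
    intro T T' hn hT hT' h
    cases hroot : T.root with
    | none =>
      cases T with
      | leaf x => exact hleaf x T' h
      | node t l r => simp [root] at hroot
    | some t =>
      have hroot' : T'.root = some t := by
        have := root_eq_of_wk_eq h
        rw [root_mapL, root_mapL] at this
        rw [← this, hroot]
      have hcode : codePart t (wt μ (mapL c T)) (wk μ (mapL c T)) =
          codePart t (wt μ (mapL c' T')) (wk μ (mapL c' T')) := by
        have h1 := wk_of_root μ (T := mapL c T) (t := t) (by rw [root_mapL, hroot])
        have h2 := wk_of_root μ (T := mapL c' T') (t := t) (by rw [root_mapL, hroot'])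
        have h3 := h1.symm.trans (h.trans h2)
        simpa using h3
      rw [codePart_wk, codePart_wk, ktrees_mapL, ktrees_mapL, List.map_map, List.map_map] at hcode
      -- The equal multisets of codes pair the children of the two merged roots; the matchings
      -- inside the pairs, given by induction, are joined. Points in different pairs have their
      -- lowest common ancestor at the root on both sides.
      obtain ⟨Z, hZ1, hZ2, hZ3⟩ := exists_zip_of_perm_map (Multiset.coe_eq_coe.1 hcode)
      have hm1 : ∀ z ∈ Z, z.1 ∈ ktrees t T := fun z hz => hZ1 ▸ List.mem_map_of_mem hz
      have hm2 : ∀ z ∈ Z, z.2 ∈ ktrees t T' := fun z hz => hZ2.mem_iff.1 (List.mem_map_of_mem hz)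
      have hex : ∀ z : TimedTree ℕ α × TimedTree ℕ α', ∃ L : List (α × α'), z ∈ Z →
          (L.map Prod.fst).Perm z.1.leaves ∧ (L.map Prod.snd).Perm z.2.leaves ∧
          (∀ p ∈ L, c p.1 = c' p.2) ∧
          ∀ p ∈ L, ∀ q ∈ L, p.1 ≠ q.1 → lca z.1 p.1 q.1 = lca z.2 p.2 q.2 := by
        intro z
        by_cases hz : z ∈ Z
        · have hs := sublist_of_mem_subs (mem_subs_of_mem_ktrees (hm1 z hz))
          have hs' := sublist_of_mem_subs (mem_subs_of_mem_ktrees (hm2 z hz))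
          have hlt := length_times_lt_of_mem_ktrees hroot (hm1 z hz)
          have he := hZ3 z hz
          simp only [Function.comp, Prod.mk.injEq] at he
          obtain ⟨L, hL⟩ := ih z.1 z.2 (by omega) (hT.sublist hs) (hT'.sublist hs')
            (Encodable.encode_injective he.2)
          exact ⟨L, fun _ => hL⟩
        · exact ⟨[], fun h => absurd h hz⟩
      choose F hF using hex
      refine ⟨Z.flatMap F, ?_, ?_, ?_, ?_⟩
      · rw [List.map_flatMap]
        refine (List.Perm.flatMap_left Z fun z hz => (hF z hz).1).trans ?_
        rw [← leaves_ktrees t T, ← hZ1, List.flatMap_map]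
      · rw [List.map_flatMap]
        refine (List.Perm.flatMap_left Z fun z hz => (hF z hz).2.1).trans ?_
        rw [← leaves_ktrees t T', ← List.flatMap_map Prod.snd leaves]
        exact hZ2.flatMap_right _
      · intro p hp
        obtain ⟨z, hz, hpz⟩ := List.mem_flatMap.1 hp
        exact (hF z hz).2.2.1 p hpz
      · intro p hp q hq hpq
        obtain ⟨z, hz, hpz⟩ := List.mem_flatMap.1 hp
        obtain ⟨z', hz', hqz⟩ := List.mem_flatMap.1 hq
        have a1 := (hF z hz).1.mem_iff.1 (List.mem_map_of_mem hpz)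
        have a2 := (hF z hz).2.1.mem_iff.1 (List.mem_map_of_mem hpz)
        have b1 := (hF z' hz').1.mem_iff.1 (List.mem_map_of_mem hqz)
        have b2 := (hF z' hz').2.1.mem_iff.1 (List.mem_map_of_mem hqz)
        by_cases hzz : z = z'
        · subst hzz
          rw [lca_of_mem_subs hT (mem_subs_of_mem_ktrees (hm1 z hz)) a1 b1,
            lca_of_mem_subs hT' (mem_subs_of_mem_ktrees (hm2 z hz)) a2 b2]
          exact (hF z hz).2.2.2 p hpz q hqz hpq
        · have hs := fun {z} hz =>
            (sublist_of_mem_subs (mem_subs_of_mem_ktrees (hm1 z hz))).subset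
          have hs' := fun {z} hz =>
            (sublist_of_mem_subs (mem_subs_of_mem_ktrees (hm2 z hz))).subset
          rw [lca_ktrees hT (hs hz a1) (hs hz' b1), lca_ktrees hT' (hs' hz a2) (hs' hz' b2)]
          · intro K hK hKK
            refine hzz (List.inj_on_of_nodup_map (f := Prod.snd) ?_ hz hz' ?_)
            · exact hZ2.nodup_iff.2 (nodup_ktrees hT')
            · exact (eq_of_mem_ktrees hT' hK (hm2 z hz) hKK.1 a2).symm.trans
                (eq_of_mem_ktrees hT' hK (hm2 z' hz') hKK.2 b2)
          · intro K hK hKK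
            refine hzz (List.inj_on_of_nodup_map (f := Prod.fst) ?_ hz hz' ?_)
            · exact hZ1 ▸ nodup_ktrees hT
            · exact (eq_of_mem_ktrees hT hK (hm1 z hz) hKK.1 a1).symm.trans
                (eq_of_mem_ktrees hT hK (hm1 z' hz') hKK.2 b1)

/-- Every point is the label of exactly one leaf. -/
def Full (T : TimedTree ℕ α) : Prop := T.leaves.Nodup ∧ ∀ x, x ∈ T.leaves

theorem Full.length_leaves_eq [Fintype α] {T : TimedTree ℕ α} (h : T.Full) :
    T.leaves.length = Fintype.card α := by
  classical
  rw [← List.toFinset_card_of_nodup h.1, ← Finset.card_univ]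
  congr 1
  ext x
  simp [h.2 x]

theorem Full.coe_leaves [Fintype α] {T : TimedTree ℕ α} (h : T.Full) :
    (T.leaves : Multiset α) = Finset.univ.val :=
  (Multiset.Nodup.ext (Multiset.coe_nodup.2 h.1) Finset.univ.nodup).2 fun x => by simp [h.2 x]

theorem Full.mapT {T : TimedTree ℕ α} (h : T.Full) (f : ℕ → ℕ) : (mapT f T).Full := by
  rwa [Full, leaves_mapT]

theorem Full.mapL {T : TimedTree ℕ α} (h : T.Full) (σ : Equiv.Perm α) : (mapL σ T).Full := by
  refine ⟨?_, fun x => ?_⟩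
  · rw [leaves_mapL]
    exact h.1.map σ.injective
  · rw [leaves_mapL]
    exact List.mem_map.2 ⟨σ.symm x, h.2 _, σ.apply_symm_apply x⟩

theorem Full.perm {T T' : TimedTree ℕ α} (h : T.Full) (h' : T'.Full) :
    T.leaves.Perm T'.leaves :=
  (List.perm_ext_iff_of_nodup h.1 h'.1).2 fun x => iff_of_true (h.2 x) (h'.2 x)

theorem Full.exists_perm_of_wk_eq [Fintype α] {c : α → κ} {T T' : TimedTree ℕ α} (hT : T.Full)
    (hT' : T'.Full) (h : wk μ (TimedTree.mapL c T) = wk μ (TimedTree.mapL c T')) :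
    ∃ σ : Equiv.Perm α, (∀ x, c (σ x) = c x) ∧
      ∀ x y, x ≠ y → lca T' (σ x) (σ y) = lca T x y := by
  obtain ⟨L, h1, h2, h3, h4⟩ := exists_matching_of_wk_eq _ T T' le_rfl hT.1 hT'.1 h
  have hex : ∀ x, ∃ y, (x, y) ∈ L := by
    intro x
    obtain ⟨⟨x', y⟩, hp, rfl⟩ := List.mem_map.1 (h1.mem_iff.2 (hT.2 x))
    exact ⟨y, hp⟩
  choose f hf using hex
  have hinj : Function.Injective f := by
    intro x x' hxx
    have := List.inj_on_of_nodup_map (h2.nodup_iff.2 hT'.1) (hf x) (hf x') hxx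
    exact congrArg Prod.fst this
  refine ⟨Equiv.ofBijective f (Finite.injective_iff_bijective.1 hinj), fun x => ?_,
    fun x y hxy => ?_⟩
  · exact (h3 _ (hf x)).symm
  · exact (h4 _ (hf x) _ (hf y) hxy).symm

end Isomorphism

/-! ### Trees from ultrametrics and from coloured shapes -/

section Construction

variable {α κ : Type*}

/-- Every ultrametric on a nonempty finite set is given by a tree. -/
theorem exists_tree_of_ultra {d : α → α → ℕ} (hsymm : ∀ x y, d x y = d y x)
    (hultra : ∀ x y z, min (d x y) (d y z) ≤ d x z) (m : ℕ) : ∀ s : Finset α, s.card ≤ m →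
      s.Nonempty → ∃ T : TimedTree ℕ α, T.Heap ∧ T.leaves.Nodup ∧ (∀ x, x ∈ T.leaves ↔ x ∈ s) ∧
        ∀ x ∈ s, ∀ y ∈ s, x ≠ y → lca T x y = d x y := by
  classical
  induction m with
  | zero =>
    intro s hs hne
    exact absurd hne.card_pos (by omega)
  | succ m ih =>
    intro s hs hne
    by_cases hoff : s.offDiag.Nonempty
    · obtain ⟨⟨a, b⟩, hab, hmin⟩ := Finset.exists_min_image s.offDiag (fun p => d p.1 p.2) hoff
      obtain ⟨ha, hb, hne⟩ := Finset.mem_offDiag.1 hab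
      have hle : ∀ x ∈ s, ∀ y ∈ s, x ≠ y → d a b ≤ d x y := fun x hx y hy hxy =>
        hmin (x, y) (Finset.mem_offDiag.2 ⟨hx, hy, hxy⟩)
      have hal : a ∈ s.filter fun x => x = a ∨ d a b < d a x := by simp [ha]
      have hbr : b ∈ s.filter fun x => ¬ (x = a ∨ d a b < d a x) := by simp [hb, hne.symm]
      have hcard := Finset.card_filter_add_card_filter_not (s := s)
        (fun x => x = a ∨ d a b < d a x)
      have hl := Finset.card_pos.2 ⟨a, hal⟩
      have hr := Finset.card_pos.2 ⟨b, hbr⟩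
      obtain ⟨l, l1, l2, l3, l4⟩ := ih _ (by omega) ⟨a, hal⟩
      obtain ⟨r, r1, r2, r3, r4⟩ := ih _ (by omega) ⟨b, hbr⟩
      have hnd : (node (d a b) l r).leaves.Nodup := by
        refine List.nodup_append'.2 ⟨l2, r2, fun x hx hx' => ?_⟩
        exact (Finset.mem_filter.1 ((r3 x).1 hx')).2 (Finset.mem_filter.1 ((l3 x).1 hx)).2
      have hcross : ∀ x ∈ s.filter (fun x => x = a ∨ d a b < d a x),
          ∀ y ∈ s.filter (fun x => ¬ (x = a ∨ d a b < d a x)), d x y = d a b := by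
        intro x hx y hy
        obtain ⟨hxs, hx⟩ := Finset.mem_filter.1 hx
        obtain ⟨hys, hy⟩ := Finset.mem_filter.1 hy
        have hxy : x ≠ y := fun h => hy (h ▸ hx)
        -- A larger value between the two parts would put `y` into the ball, by the ultrametric
        -- inequality.
        refine le_antisymm (not_lt.1 fun hlt => hy ?_) (hle x hxs y hys hxy)
        rcases hx with rfl | hx
        · exact Or.inr hlt
        · exact Or.inr ((lt_min hx hlt).trans_le (hultra a x y))
      refine ⟨node (d a b) l r, ⟨?_, ?_, l1, r1⟩, hnd, ?_, ?_⟩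
      · intro u hu
        obtain ⟨x, hx, y, hy, hxy, rfl⟩ := exists_lca_eq l2 hu
        rw [l4 x ((l3 x).1 hx) y ((l3 y).1 hy) hxy]
        exact hle x (Finset.mem_filter.1 ((l3 x).1 hx)).1 y (Finset.mem_filter.1 ((l3 y).1 hy)).1 hxy
      · intro u hu
        obtain ⟨x, hx, y, hy, hxy, rfl⟩ := exists_lca_eq r2 hu
        rw [r4 x ((r3 x).1 hx) y ((r3 y).1 hy) hxy]
        exact hle x (Finset.mem_filter.1 ((r3 x).1 hx)).1 y (Finset.mem_filter.1 ((r3 y).1 hy)).1 hxy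
      · intro x
        rw [leaves, List.mem_append, l3, r3, Finset.mem_filter, Finset.mem_filter]
        tauto
      · have hmem : ∀ x ∈ s, x ∈ s.filter (fun x => x = a ∨ d a b < d a x) ∨
            x ∈ s.filter fun x => ¬ (x = a ∨ d a b < d a x) := fun x hx => by
          rw [Finset.mem_filter, Finset.mem_filter]
          tauto
        intro x hx y hy hxy
        rcases hmem x hx with hx | hx <;> rcases hmem y hy with hy | hy
        · rw [lca_left ((l3 x).2 hx) ((l3 y).2 hy)]
          exact l4 x hx y hy hxy
        · rw [lca_mixed hnd ((l3 x).2 hx) ((r3 y).2 hy), hcross x hx y hy]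
        · rw [lca_comm, lca_mixed hnd ((l3 y).2 hy) ((r3 x).2 hx), hsymm x y, hcross y hy x hx]
        · rw [lca_right hnd ((r3 x).2 hx) ((r3 y).2 hy)]
          exact r4 x hx y hy hxy
    · obtain ⟨a, ha⟩ := hne
      have hall : ∀ x ∈ s, x = a := fun x hx => by
        by_contra hxa
        exact hoff ⟨(x, a), Finset.mem_offDiag.2 ⟨hx, ha, hxa⟩⟩
      refine ⟨leaf a, trivial, by simp [leaves], fun x => ?_, fun x hx y hy hxy => ?_⟩
      · rw [leaves, List.mem_singleton]
        exact ⟨fun h => h ▸ ha, hall x⟩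
      · exact absurd ((hall x hx).trans (hall y hy).symm) hxy

theorem exists_mapL_eq {Λ : Type*} (c : α → κ) : ∀ (G : TimedTree Λ κ) (L : List α),
    L.map c = G.leaves → ∃ Q : TimedTree Λ α, mapL c Q = G ∧ Q.leaves = L
  | leaf x, L, h => by
    rw [leaves, List.map_eq_singleton_iff] at h
    obtain ⟨a, rfl, rfl⟩ := h
    exact ⟨leaf a, rfl, rfl⟩
  | node t l r, L, h => by
    obtain ⟨L1, L2, rfl, h1, h2⟩ := List.map_eq_append_iff.1 h
    obtain ⟨Q1, e1, f1⟩ := exists_mapL_eq c l L1 h1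
    obtain ⟨Q2, e2, f2⟩ := exists_mapL_eq c r L2 h2
    exact ⟨node t Q1 Q2, by rw [mapL, e1, e2], by rw [leaves, f1, f2]⟩

/-- A coloured tree with the right colours comes from a point tree. -/
theorem exists_full_mapL_eq {c : α → κ} {T : TimedTree ℕ α} (hT : T.Full) {G : TimedTree ℕ κ}
    (h : G.leaves.Perm (T.leaves.map c)) : ∃ Q : TimedTree ℕ α, mapL c Q = G ∧ Q.Full := by
  rw [← List.map_id G.leaves] at h
  obtain ⟨Z, h1, h2, h3⟩ := exists_zip_of_perm_map h
  obtain ⟨Q, hQ, hl⟩ := exists_mapL_eq c G (Z.map Prod.snd) (by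
    rw [← h1, List.map_map]
    exact List.map_congr_left fun z hz => (h3 z hz).symm)
  refine ⟨Q, hQ, ?_, fun x => ?_⟩
  · rw [hl]
    exact h2.nodup_iff.2 hT.1
  · rw [hl]
    exact h2.mem_iff.2 (hT.2 x)

end Construction

end TimedTree

namespace TimedTree

theorem heap_mapL_iff {Λ α β : Type*} [LE Λ] {f : α → β} {T : TimedTree Λ α} :
    (mapL f T).Heap ↔ T.Heap := by
  induction T with
  | leaf x => rfl
  | node t l r hl hr => simp only [mapL, Heap, times_mapL, hl, hr]

theorem mapL_mapL {Λ α β γ : Type*} (f : α → β) (g : β → γ) (T : TimedTree Λ α) :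
    mapL g (mapL f T) = mapL (g ∘ f) T := by
  induction T with
  | leaf x => rfl
  | node t l r hl hr => simp only [mapL, hl, hr]

end TimedTree

/-! ### Dendrograms: trees on the points as saturated chains of partitions -/

open TimedTree

/-- A tree with the points `0, …, n - 1` as leaves whose nodes carry the times `0, …, n - 2`. -/
structure Dendrogram (n : ℕ) where
  tree : TimedTree ℕ (Fin n)
  heap : tree.Heap
  full : tree.Full
  times_perm : tree.times.Perm (List.range tree.times.length)

/-- The number of elements of `S` which are at most `t`. -/
def countLE (S : Finset ℕ) (t : ℕ) : ℕ := (S.filter (· ≤ t)).card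

theorem countLE_mono (S : Finset ℕ) : Monotone (countLE S) := fun _ _ h =>
  Finset.card_le_card fun i hi => by
    rw [Finset.mem_filter] at hi ⊢
    exact ⟨hi.1, hi.2.trans h⟩

theorem countLE_eq_iff {S : Finset ℕ} {t u : ℕ} (h : t ≤ u) :
    countLE S t = countLE S u ↔ ∀ i ∈ S, ¬ (t < i ∧ i ≤ u) := by
  have hsub : S.filter (· ≤ t) ⊆ S.filter (· ≤ u) := fun i hi => by
    rw [Finset.mem_filter] at hi ⊢
    exact ⟨hi.1, hi.2.trans h⟩
  constructor
  · intro he i hi hti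
    have := Finset.eq_of_subset_of_card_le hsub he.ge
    have hm : i ∈ S.filter (· ≤ t) := by
      rw [this, Finset.mem_filter]
      exact ⟨hi, hti.2⟩
    have := (Finset.mem_filter.1 hm).2
    omega
  · intro hS
    rw [countLE, countLE]
    congr 1
    refine Finset.Subset.antisymm hsub fun i hi => ?_
    rw [Finset.mem_filter] at hi ⊢
    exact ⟨hi.1, not_lt.1 fun hlt => hS i hi.1 ⟨hlt, hi.2⟩⟩

namespace Dendrogram

variable {n : ℕ}

theorem length_times (Q : Dendrogram n) : Q.tree.times.length = n - 1 := by
  have h1 := Q.full.length_leaves_eq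
  rw [length_leaves, Fintype.card_fin] at h1
  omega

theorem mem_times (Q : Dendrogram n) {t : ℕ} : t ∈ Q.tree.times ↔ t < n - 1 := by
  rw [Q.times_perm.mem_iff, List.mem_range, length_times]

theorem nodup_times (Q : Dendrogram n) : Q.tree.times.Nodup :=
  Q.times_perm.nodup_iff.2 List.nodup_range

theorem lca_lt (Q : Dendrogram n) {x y : Fin n} (h : x ≠ y) : lca Q.tree x y < n - 1 :=
  Q.mem_times.1 (lca_mem_times (Q.full.2 x) (Q.full.2 y) h)

theorem exists_lca (Q : Dendrogram n) {t : ℕ} (h : t < n - 1) :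
    ∃ x y : Fin n, x ≠ y ∧ lca Q.tree x y = t := by
  obtain ⟨x, -, y, -, h⟩ := exists_lca_eq Q.full.1 (Q.mem_times.2 h)
  exact ⟨x, y, h⟩

/-- The partition into the leaf sets of the subtrees that remain when all nodes with times
smaller than `j` are removed. -/
def level (Q : Dendrogram n) (j : ℕ) : Setoid (Fin n) where
  r x y := x = y ∨ j ≤ lca Q.tree x y
  iseqv :=
    { refl := fun _ => Or.inl rfl
      symm := by
        rintro x y (h | h)
        · exact Or.inl h.symm
        · exact Or.inr (lca_comm Q.tree x y ▸ h)
      trans := by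
        rintro x y z (rfl | hxy) (rfl | hyz)
        · exact Or.inl rfl
        · exact Or.inr hyz
        · exact Or.inr hxy
        · by_cases h : x = z
          · exact Or.inl h
          by_cases h' : x = y
          · exact Or.inr (h' ▸ hyz)
          exact Or.inr ((le_min hxy hyz).trans
            (Q.heap.lca_ultra Q.full.1 (Q.full.2 x) (Q.full.2 y) (Q.full.2 z) h' h)) }

theorem level_rel (Q : Dendrogram n) {j : ℕ} {x y : Fin n} :
    Q.level j x y ↔ x = y ∨ j ≤ lca Q.tree x y := Iff.rfl

theorem level_anti (Q : Dendrogram n) {i j : ℕ} (h : i ≤ j) : Q.level j ≤ Q.level i := by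
  rintro x y (hxy | hxy)
  · exact Or.inl hxy
  · exact Or.inr (h.trans hxy)

/-- The node with time `j` joins two points that are still together in level `j` and separated in
every later level. -/
theorem level_le_iff (Q : Dendrogram n) {i j : ℕ} (hi : i ≤ n - 1) :
    Q.level j ≤ Q.level i ↔ i ≤ j := by
  refine ⟨fun h => ?_, Q.level_anti⟩
  by_contra hlt
  obtain ⟨x, y, hxy, hl⟩ := Q.exists_lca (t := j) (by omega)
  rcases h (show Q.level j x y from Or.inr hl.ge) with h' | h'
  · exact hxy h'
  · omega

theorem level_inj (Q : Dendrogram n) {i j : ℕ} (hi : i ≤ n - 1) (hj : j ≤ n - 1) :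
    Q.level i = Q.level j ↔ i = j := by
  refine ⟨fun h => le_antisymm ?_ ?_, fun h => h ▸ rfl⟩
  · exact (Q.level_le_iff hi).1 h.ge
  · exact (Q.level_le_iff hj).1 h.le

theorem level_zero (Q : Dendrogram n) : Q.level 0 = ⊤ :=
  top_le_iff.1 fun _ _ _ => Or.inr (Nat.zero_le _)

theorem level_last (Q : Dendrogram n) : Q.level (n - 1) = ⊥ := by
  refine le_bot_iff.1 ?_
  rintro x y (h | h)
  · exact h
  · by_contra hxy
    have := Q.lca_lt (x := x) (y := y) hxy
    omega

-- The members of the chain that keep two points together are the levels up to the time of their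
-- lowest common ancestor. So `countLE S` is exactly the identification of times that passes from
-- the facet to the face `S`.
open Classical in
theorem card_filter_level (Q : Dendrogram n) {S : Finset ℕ} (hS : S ⊆ Finset.Ioo 0 (n - 1))
    {x y : Fin n} (hxy : x ≠ y) :
    ((S.image Q.level).filter fun u => u x y).card = countLE S (lca Q.tree x y) := by
  rw [Finset.filter_image, Finset.card_image_of_injOn, countLE]
  · congr 1
    ext i
    simp [level_rel, hxy]
  · intro i hi j hj hij
    have hi' := Finset.mem_Ioo.1 (hS (Finset.mem_filter.1 hi).1)
    have hj' := Finset.mem_Ioo.1 (hS (Finset.mem_filter.1 hj).1)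
    exact (Q.level_inj (by omega) (by omega)).1 hij

/-- The image of a dendrogram under a permutation of the points. -/
def perm (Q : Dendrogram n) (σ : Equiv.Perm (Fin n)) : Dendrogram n where
  tree := mapL σ Q.tree
  heap := heap_mapL_iff.2 Q.heap
  full := Q.full.mapL σ
  times_perm := by
    rw [times_mapL]
    exact Q.times_perm

end Dendrogram

/-! ### From chains of partitions to dendrograms -/

section Chains

variable {n : ℕ} {κ : Type*} [Encodable κ] {μ : Multiset κ → ℕ}

open Classical in
/-- A chain of partitions, neither of the coarsest nor of the finest one, is given by the levels of
a dendrogram whose colouring is valid and compatible with the chain. -/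
theorem exists_dendrogram_of_chain (hn : 0 < n)
    (hμ : ∀ A B : Multiset κ, A ≠ 0 → B ≠ 0 → μ A ≤ μ B → μ A < μ (A + B)) (c : Fin n → κ)
    {C : Finset (Setoid (Fin n))} (hC : IsChain (· ≤ ·) (C : Set (Setoid (Fin n)))) (hbot : ⊥ ∉ C)
    (htop : ⊤ ∉ C) : ∃ (Q : Dendrogram n) (S : Finset ℕ), S ⊆ Finset.Ioo 0 (n - 1) ∧
      C = S.image Q.level ∧ Valid μ (mapL c Q.tree) ∧ std (mapL c Q.tree) = mapL c Q.tree ∧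
      Compat μ (mapL c Q.tree) (countLE S) := by
  have htot : ∀ u ∈ C, ∀ v ∈ C, u ≤ v ∨ v ≤ u := fun u hu v hv => hC.total hu hv
  set d : Fin n → Fin n → ℕ := fun x y => (C.filter fun u => u x y).card with hd
  have hsymm : ∀ x y, d x y = d y x := fun x y => by
    exact congrArg Finset.card
      (Finset.filter_congr fun u _ => ⟨fun h => u.symm h, fun h => u.symm h⟩)
  -- The number of members that keep two points together is an ultrametric, because the members are
  -- nested.
  have hultra : ∀ x y z, min (d x y) (d y z) ≤ d x z := by
    intro x y z
    by_cases h : ∀ u ∈ C, u x y → u y z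
    · refine (min_le_left _ _).trans (Finset.card_le_card fun u hu => ?_)
      rw [Finset.mem_filter] at hu ⊢
      exact ⟨hu.1, u.trans hu.2 (h u hu.1 hu.2)⟩
    · push Not at h
      obtain ⟨v, hv, hvxy, hvyz⟩ := h
      refine (min_le_right _ _).trans (Finset.card_le_card fun u hu => ?_)
      rw [Finset.mem_filter] at hu ⊢
      refine ⟨hu.1, u.trans ?_ hu.2⟩
      rcases htot u hu.1 v hv with h | h
      · exact absurd (h hu.2) hvyz
      · exact h hvxy
  obtain ⟨T, hT1, hT2, hT3, hT4⟩ := exists_tree_of_ultra hsymm hultra _ Finset.univ le_rfl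
    ⟨⟨0, hn⟩, Finset.mem_univ _⟩
  have hTf : T.Full := ⟨hT2, fun x => (hT3 x).2 (Finset.mem_univ x)⟩
  -- The tree of this ultrametric is not binary in an essential way: several of its nodes may have
  -- one value. It is replaced by a valid coloured tree with a compatible identification, whose
  -- leaves are then matched with the points by `σ`.
  obtain ⟨G, W, hcol, hwk, hperm⟩ := exists_col hμ _ (mapL c T) le_rfl (heap_mapL_iff.2 hT1)
  rw [leaves_mapL] at hperm
  obtain ⟨Q₀, hQ₀, hQf⟩ := exists_full_mapL_eq hTf hperm
  rw [← hQ₀, ← mapL_mapT] at hwk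
  obtain ⟨σ, hσ, hlca⟩ := (hQf.mapT _).exists_perm_of_wk_eq hTf hwk
  let Q : Dendrogram n := Dendrogram.perm
    ⟨Q₀, heap_mapL_iff.1 (hQ₀ ▸ hcol.valid.heap), hQf, by
      have := times_perm_range hcol.std_eq hcol.valid.nodup
      rwa [← hQ₀, times_mapL] at this⟩ σ
  have hQ : mapL c Q.tree = G := by
    change mapL c (mapL σ Q₀) = G
    rw [mapL_mapL, ← hQ₀]
    congr 1
    exact funext hσ
  have hdW : ∀ x y, x ≠ y → d x y = W.getD (lca Q.tree x y) 0 := by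
    intro x y hxy
    obtain ⟨x, rfl⟩ := σ.surjective x
    obtain ⟨y, rfl⟩ := σ.surjective y
    have hxy' : x ≠ y := fun h => hxy (h ▸ rfl)
    rw [← hT4 _ (Finset.mem_univ _) _ (Finset.mem_univ _) hxy, hlca x y hxy',
      lca_mapT _ (hQf.2 x) (hQf.2 y) hxy']
    change _ = W.getD (lca (mapL σ Q₀) (σ x) (σ y)) 0
    rw [lca_mapL σ.injective]
  have htimes : ∀ {t}, t < n - 1 → t ∈ G.times := fun {t} ht => by
    rw [← hQ, times_mapL]
    exact Q.mem_times.2 ht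
  have hlevel : ∀ u ∈ C, ∃ i ∈ Finset.Ioo 0 (n - 1), u = Q.level i := by
    intro u hu
    -- A member of the chain consists of the pairs whose value is at least the number of members
    -- above it.
    set j := (C.filter fun v => u ≤ v).card
    have hj : ∀ x y, u x y ↔ j ≤ d x y := by
      intro x y
      constructor
      · intro hxy
        refine Finset.card_le_card fun v hv => ?_
        rw [Finset.mem_filter] at hv ⊢
        exact ⟨hv.1, hv.2 hxy⟩
      · intro hle
        by_contra hxy
        refine absurd hle (not_le.2 (Finset.card_lt_card ⟨fun v hv => ?_, fun h => ?_⟩))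
        · rw [Finset.mem_filter] at hv ⊢
          refine ⟨hv.1, (htot u hu v hv.1).resolve_right fun h => hxy (h hv.2)⟩
        · exact hxy (Finset.mem_filter.1 (h (Finset.mem_filter.2 ⟨hu, le_refl u⟩))).2
    -- The level sought is the first time whose value reaches `j`; the alternative guarantees that
    -- the search stops at the last level.
    have hex : ∃ i, n - 1 ≤ i ∨ j ≤ W.getD i 0 := ⟨n - 1, Or.inl le_rfl⟩
    have hile : Nat.find hex ≤ n - 1 := Nat.find_min' hex (Or.inl le_rfl)
    have hiff : ∀ t, t < n - 1 → (j ≤ W.getD t 0 ↔ Nat.find hex ≤ t) := by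
      intro t ht
      refine ⟨fun h => Nat.find_min' hex (Or.inr h), fun h => ?_⟩
      rcases Nat.find_spec hex with h' | h'
      · omega
      · exact h'.trans (hcol.compat.1 _ (htimes (by omega)) _ (htimes ht) h)
    have hui : u = Q.level (Nat.find hex) := by
      ext x y
      by_cases hxy : x = y
      · subst hxy
        exact iff_of_true (u.refl x) ((Q.level _).refl x)
      · rw [hj, hdW x y hxy, hiff _ (Q.lca_lt hxy), Q.level_rel]
        simp [hxy]
    refine ⟨Nat.find hex, Finset.mem_Ioo.2 ⟨?_, ?_⟩, hui⟩
    · refine Nat.pos_of_ne_zero fun h0 => htop ?_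
      rwa [← Q.level_zero, ← h0, ← hui]
    · refine lt_of_le_of_ne hile fun h0 => hbot ?_
      rwa [← Q.level_last, ← h0, ← hui]
  set S := (Finset.Ioo 0 (n - 1)).filter fun i => Q.level i ∈ C
  have hS : S ⊆ Finset.Ioo 0 (n - 1) := Finset.filter_subset _ _
  have hCS : C = S.image Q.level := by
    ext u
    rw [Finset.mem_image]
    constructor
    · intro hu
      obtain ⟨i, hi, rfl⟩ := hlevel u hu
      exact ⟨i, Finset.mem_filter.2 ⟨hi, hu⟩, rfl⟩
    · rintro ⟨i, hi, rfl⟩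
      exact (Finset.mem_filter.1 hi).2
  refine ⟨Q, S, hS, hCS, hQ ▸ hcol.valid, hQ ▸ hcol.std_eq, ?_⟩
  rw [hQ]
  refine hcol.compat.congr fun t ht => ?_
  rw [← hQ, times_mapL, Q.mem_times] at ht
  obtain ⟨x, y, hxy, rfl⟩ := Q.exists_lca ht
  rw [← Q.card_filter_level hS hxy, ← hCS]
  exact (hdW x y hxy).symm

end Chains

/-! ### An abstract criterion for partitionability -/

/-- A criterion for partitionability: the faces are indexed by pairs of a cell and a set of levels,
and every cell has a smallest set of levels that belongs to it. -/
theorem exists_isPartitioning {X I : Type*} [PartialOrder X] {U : Finset ℕ}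
    {cell : I → Finset ℕ → X} {D : I → Finset ℕ} {rk : X → ℕ}
    (hD : ∀ i, D i ⊆ U)
    (hmono : ∀ i S S', S ⊆ S' → S' ⊆ U → cell i S ≤ cell i S')
    (hbelow : ∀ i S a, S ⊆ U → a ≤ cell i S → ∃ S' ⊆ S, a = cell i S')
    (hinj : ∀ i S S', S ⊆ U → S' ⊆ U → cell i S = cell i S' → S = S')
    (hrk : ∀ i S, S ⊆ U → rk (cell i S) = S.card)
    (hex : ∀ a, ∃ i S, D i ⊆ S ∧ S ⊆ U ∧ a = cell i S)
    (huniq : ∀ i i' S S', D i ⊆ S → S ⊆ U → D i' ⊆ S' → S' ⊆ U → cell i S = cell i' S' →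
      D i = D i' ∧ ∀ S'' ⊆ U, cell i S'' = cell i' S'') :
    (∀ a, IsMax a → rk a = U.card) ∧ ∃ bot : {a : X // IsMax a} → X, IsPartitioning bot ∧
      ∀ i (h : IsMax (cell i U)), bot ⟨cell i U, h⟩ = cell i (D i) := by
  classical
  have hmax : ∀ a, IsMax a → ∃ i, a = cell i U := by
    intro a ha
    obtain ⟨i, S, -, hS, rfl⟩ := hex a
    exact ⟨i, (hmono i S U hS subset_rfl).antisymm (ha (hmono i S U hS subset_rfl))⟩
  -- A face above a full cell is itself in some cell; comparing ranks shows that it is the full one.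
  have hmax' : ∀ i, IsMax (cell i U) := by
    intro i b hb
    obtain ⟨i', S, -, hS, rfl⟩ := hex b
    obtain ⟨S', hS', he⟩ := hbelow i' S _ hS hb
    have hc := hrk i U subset_rfl
    rw [he, hrk i' S' (hS'.trans hS)] at hc
    have h1 := Finset.eq_of_subset_of_card_le (hS'.trans hS) hc.ge
    rw [he, h1]
    exact hmono i' S U hS subset_rfl
  choose f hf using fun F : {a : X // IsMax a} => hmax F.1 F.2
  -- A facet may have several indices; by the uniqueness assumption all of them give the same faces
  -- and the same minimal set, so any choice will do.
  have hbot : ∀ i (h : IsMax (cell i U)),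
      D (f ⟨cell i U, h⟩) = D i ∧ ∀ S ⊆ U, cell (f ⟨cell i U, h⟩) S = cell i S := fun i h =>
    huniq _ i U U (hD _) subset_rfl (hD _) subset_rfl (hf ⟨cell i U, h⟩).symm
  have hIcc : ∀ F : {a : X // IsMax a}, ∀ a, a ∈ Set.Icc (cell (f F) (D (f F))) F.1 ↔
      ∃ S, D (f F) ⊆ S ∧ S ⊆ U ∧ a = cell (f F) S := by
    intro F a
    rw [Set.mem_Icc]
    constructor
    · rintro ⟨h1, h2⟩
      rw [hf F] at h2
      obtain ⟨S, hS, rfl⟩ := hbelow _ U a subset_rfl h2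
      obtain ⟨S', hS', he⟩ := hbelow _ S _ hS h1
      rw [← hinj _ _ _ (hD _) (hS'.trans hS) he] at hS'
      exact ⟨S, hS', hS, rfl⟩
    · rintro ⟨S, h1, h2, rfl⟩
      refine ⟨hmono _ _ _ h1 h2, ?_⟩
      conv_rhs => rw [hf F]
      exact hmono _ _ _ h2 subset_rfl
  refine ⟨fun a ha => ?_, fun F => cell (f F) (D (f F)), ⟨?_, ?_, ?_⟩, ?_⟩
  · obtain ⟨i, rfl⟩ := hmax a ha
    exact hrk i U subset_rfl
  · intro F
    conv_rhs => rw [hf F]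
    exact hmono _ _ _ (hD _) subset_rfl
  · intro F
    have hle : ∀ S S', S ⊆ U → S' ⊆ U → (cell (f F) S ≤ cell (f F) S' ↔ S ⊆ S') := by
      intro S S' hS hS'
      refine ⟨fun h => ?_, fun h => hmono _ _ _ h hS'⟩
      obtain ⟨S'', h1, h2⟩ := hbelow _ _ _ hS' h
      rwa [hinj _ _ _ hS (h1.trans hS') h2]
    let φ : Set.Iic (U \ D (f F)) → Set.Icc (cell (f F) (D (f F))) F.1 := fun S =>
      ⟨cell (f F) (D (f F) ∪ S.1), (hIcc F _).2 ⟨_, Finset.subset_union_left,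
        Finset.union_subset (hD _) (S.2.trans Finset.sdiff_subset), rfl⟩⟩
    have hφ : ∀ S S', φ S ≤ φ S' ↔ S ≤ S' := by
      intro S S'
      have hsub : ∀ S : Set.Iic (U \ D (f F)), D (f F) ∪ S.1 ⊆ U := fun S =>
        Finset.union_subset (hD _) (S.2.trans Finset.sdiff_subset)
      refine (hle _ _ (hsub S) (hsub S')).trans ⟨fun h x hx => ?_, fun h =>
        Finset.union_subset_union_right h⟩
      exact (Finset.mem_union.1 (h (Finset.mem_union_right _ hx))).resolve_left
        (Finset.mem_sdiff.1 (S.2 hx)).2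
    have hsurj : Function.Surjective φ := by
      rintro ⟨a, ha⟩
      obtain ⟨S, h1, h2, rfl⟩ := (hIcc F a).1 ha
      refine ⟨⟨S \ D (f F), Finset.sdiff_subset_sdiff h2 subset_rfl⟩, Subtype.ext ?_⟩
      change cell (f F) (D (f F) ∪ S \ D (f F)) = _
      rw [Finset.union_sdiff_of_subset h1]
    let ψ : Set.Iic (U \ D (f F)) ≃o Set.Icc (cell (f F) (D (f F))) F.1 :=
      RelIso.ofSurjective (OrderEmbedding.ofMapLEIff φ hφ) hsurj
    have e1 : Set.Iic (U \ D (f F)) ≃o Finset {x // x ∈ U \ D (f F)} :=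
      { toFun := fun S => Finset.subtype _ S.1
        invFun := fun T => ⟨T.map (Function.Embedding.subtype _), fun x hx => by
          obtain ⟨y, -, rfl⟩ := Finset.mem_map.1 hx
          exact y.2⟩
        left_inv := fun S => Subtype.ext (Finset.subtype_map_of_mem fun x hx => S.2 hx)
        right_inv := fun T => by ext x; simp
        map_rel_iff' := by
          intro S S'
          refine ⟨fun h x hx => ?_, fun h x hx => ?_⟩
          · have hx' : (⟨x, S.2 hx⟩ : {x // x ∈ U \ D (f F)}) ∈ Finset.subtype _ S.1 :=
              Finset.mem_subtype.2 hx
            exact Finset.mem_subtype.1 (h hx')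
          · exact Finset.mem_subtype.2 (h (Finset.mem_subtype.1 hx)) }
    let e2 : Finset {x // x ∈ U \ D (f F)} ≃o Finset (Fin (U \ D (f F)).card) :=
      { toEquiv := (Finset.equivFin _).finsetCongr
        map_rel_iff' := by simp }
    exact ⟨_, ⟨(ψ.symm.trans e1).trans e2⟩⟩
  · intro a
    obtain ⟨i, S, h1, h2, rfl⟩ := hex a
    refine ⟨⟨cell i U, hmax' i⟩, (hIcc _ _).2 ⟨S, ?_, h2, ?_⟩, ?_⟩
    · rwa [(hbot i (hmax' i)).1]
    · exact ((hbot i (hmax' i)).2 S h2).symm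
    · intro F hF
      obtain ⟨S', h3, h4, he⟩ := (hIcc _ _).1 hF
      refine Subtype.ext ?_
      rw [hf F]
      exact ((huniq _ _ _ _ h1 h2 h3 h4 he).2 U subset_rfl).symm
  · intro i h
    change cell (f ⟨cell i U, h⟩) (D (f ⟨cell i U, h⟩)) = _
    rw [(hbot i h).1, (hbot i h).2 _ (hD i)]

/-! ### Faces of the quotient complex as levels of dendrograms -/

open TimedTree

section Faces

variable {n k : ℕ} {c : Fin n → Fin k} {P : Type} [PartialOrder P] [BoundedOrder P]
  {ρ : youngSubgroup c →* (P ≃o P)} {e : P ≃ Setoid (Fin n)}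

/-- The poset has the same chains as the partition lattice, with the same action. -/
structure IsPartitionModel (ρ : youngSubgroup c →* (P ≃o P)) (e : P ≃ Setoid (Fin n)) : Prop where
  comparable_iff : ∀ x y : P, (x ≤ y ∨ y ≤ x) ↔ (e x ≤ e y ∨ e y ≤ e x)
  extreme_iff : ∀ x : P, (x = ⊥ ∨ x = ⊤) ↔ (e x = ⊥ ∨ e x = ⊤)
  map_rho : ∀ σ x, e (ρ σ x) = permAction n σ (e x)

open Classical in
/-- The face that consists of the levels `i ∈ S` of a dendrogram. -/
noncomputable def IsPartitionModel.face (h : IsPartitionModel ρ e) (Q : Dendrogram n)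
    (S : Finset ℕ) : Face P :=
  ⟨((S ∩ Finset.Ioo 0 (n - 1)).image Q.level).map e.symm.toEmbedding, by
    have hlevel : ∀ x ∈ ((S ∩ Finset.Ioo 0 (n - 1)).image Q.level).map e.symm.toEmbedding,
        ∃ i ∈ Finset.Ioo 0 (n - 1), e x = Q.level i := by
      intro x hx
      obtain ⟨u, hu, rfl⟩ := Finset.mem_map.1 hx
      obtain ⟨i, hi, rfl⟩ := Finset.mem_image.1 hu
      exact ⟨i, (Finset.mem_inter.1 hi).2, by simp⟩
    have hext : ∀ x ∈ ((S ∩ Finset.Ioo 0 (n - 1)).image Q.level).map e.symm.toEmbedding,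
        ¬ (x = ⊥ ∨ x = ⊤) := by
      intro x hx hbt
      obtain ⟨i, hi, he⟩ := hlevel x hx
      have hi := Finset.mem_Ioo.1 hi
      rw [h.extreme_iff, he, ← Q.level_zero, ← Q.level_last, Q.level_inj (by omega) (by omega),
        Q.level_inj (by omega) (by omega)] at hbt
      omega
    refine ⟨fun x hx y hy _ => ?_, fun hx => hext _ hx (Or.inl rfl),
      fun hx => hext _ hx (Or.inr rfl)⟩
    obtain ⟨i, -, hi⟩ := hlevel x hx
    obtain ⟨j, -, hj⟩ := hlevel y hy
    rw [h.comparable_iff, hi, hj]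
    rcases le_total i j with hij | hij
    · exact Or.inr (Q.level_anti hij)
    · exact Or.inl (Q.level_anti hij)⟩

namespace IsPartitionModel

variable (h : IsPartitionModel ρ e)

theorem mem_face {Q : Dendrogram n} {S : Finset ℕ} (hS : S ⊆ Finset.Ioo 0 (n - 1)) {x : P} :
    x ∈ (h.face Q S).1 ↔ ∃ i ∈ S, e x = Q.level i := by
  classical
  simp only [face, Finset.inter_eq_left.2 hS, Finset.mem_map_equiv, Finset.mem_image,
    Equiv.symm_symm]
  exact exists_congr fun i => and_congr_right fun _ => eq_comm

theorem card_face {Q : Dendrogram n} {S : Finset ℕ} (hS : S ⊆ Finset.Ioo 0 (n - 1)) :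
    (h.face Q S).1.card = S.card := by
  classical
  simp only [face, Finset.inter_eq_left.2 hS, Finset.card_map]
  refine Finset.card_image_of_injOn fun i hi j hj hij => ?_
  have hi' := Finset.mem_Ioo.1 (hS hi)
  have hj' := Finset.mem_Ioo.1 (hS hj)
  exact (Q.level_inj (by omega) (by omega)).1 hij

theorem permAction_rel (σ : Equiv.Perm (Fin n)) (u : Setoid (Fin n)) (x y : Fin n) :
    permAction n σ u (σ x) (σ y) ↔ u x y := by
  change u (σ⁻¹ (σ x)) (σ⁻¹ (σ y)) ↔ u x y
  have hs : ∀ z, (σ⁻¹ : Equiv.Perm (Fin n)) (σ z) = z := fun z => Equiv.symm_apply_apply σ z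
  rw [hs, hs]

/-- A permutation preserves the number of related pairs, which distinguishes the levels. Hence
different faces of one facet are never in the same orbit. -/
theorem eq_of_permAction_level {Q : Dendrogram n} {σ : Equiv.Perm (Fin n)} {i j : ℕ}
    (hi : i ≤ n - 1) (hj : j ≤ n - 1) (he : permAction n σ (Q.level i) = Q.level j) : i = j := by
  classical
  have hcard : (Finset.univ.filter fun p : Fin n × Fin n => Q.level i p.1 p.2).card =
      (Finset.univ.filter fun p : Fin n × Fin n => Q.level j p.1 p.2).card := by
    refine Finset.card_equiv (Equiv.prodCongr σ σ) fun p => ?_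
    simp only [Finset.mem_filter, Finset.mem_univ, true_and, Equiv.prodCongr_apply, Prod.map_fst,
      Prod.map_snd]
    rw [← he, permAction_rel]
  have aux : ∀ a b, a ≤ b → a ≤ n - 1 → b ≤ n - 1 →
      (Finset.univ.filter fun p : Fin n × Fin n => Q.level a p.1 p.2).card =
      (Finset.univ.filter fun p : Fin n × Fin n => Q.level b p.1 p.2).card → a = b := by
    intro a b hab ha hb hc
    have hsub : (Finset.univ.filter fun p : Fin n × Fin n => Q.level b p.1 p.2) ⊆
        Finset.univ.filter fun p : Fin n × Fin n => Q.level a p.1 p.2 := fun p hp =>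
      Finset.mem_filter.2 ⟨Finset.mem_univ _, Q.level_anti hab (Finset.mem_filter.1 hp).2⟩
    have heq := Finset.eq_of_subset_of_card_le hsub hc.le
    refine (Q.level_inj ha hb).1 (Setoid.ext fun x y => ?_)
    have := congrArg (fun s => (x, y) ∈ s) heq
    simpa using this.symm
  rcases le_total i j with hij | hij
  · exact aux i j hij hi hj hcard
  · exact (aux j i hij hj hi hcard.symm).symm

theorem exists_level_of_faceRel {Q Q' : Dendrogram n} {S S' : Finset ℕ}
    (hS : S ⊆ Finset.Ioo 0 (n - 1)) (hS' : S' ⊆ Finset.Ioo 0 (n - 1))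
    (hr : FaceRel ρ (h.face Q S) (h.face Q' S')) : ∃ σ ∈ youngSubgroup c,
      (∀ i ∈ S, ∃ j ∈ S', permAction n σ (Q.level i) = Q'.level j) ∧
      ∀ j ∈ S', ∃ i ∈ S, permAction n σ (Q.level i) = Q'.level j := by
  obtain ⟨g, hg⟩ := (faceRel_iff ρ _ _).1 hr
  refine ⟨g.1, g.2, fun i hi => ?_, fun j hj => ?_⟩
  · obtain ⟨j, hj, he⟩ := (h.mem_face hS').1
      ((hg (e.symm (Q.level i))).1 ((h.mem_face hS).2 ⟨i, hi, by simp⟩))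
    exact ⟨j, hj, by rw [← he, h.map_rho, e.apply_symm_apply]⟩
  · obtain ⟨x, hx⟩ := (ρ g).surjective (e.symm (Q'.level j))
    have hxm : ρ g x ∈ (h.face Q' S').1 := (h.mem_face hS').2 ⟨j, hj, by simp [hx]⟩
    obtain ⟨i, hi, he⟩ := (h.mem_face hS).1 ((hg x).2 hxm)
    refine ⟨i, hi, ?_⟩
    rw [← he, ← h.map_rho, hx, e.apply_symm_apply]

theorem eq_of_faceRel {Q : Dendrogram n} {S S' : Finset ℕ}
    (hS : S ⊆ Finset.Ioo 0 (n - 1)) (hS' : S' ⊆ Finset.Ioo 0 (n - 1))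
    (hr : FaceRel ρ (h.face Q S) (h.face Q S')) : S = S' := by
  obtain ⟨σ, -, h1, h2⟩ := h.exists_level_of_faceRel hS hS' hr
  ext i
  constructor
  · intro hi
    obtain ⟨j, hj, he⟩ := h1 i hi
    have hi' := Finset.mem_Ioo.1 (hS hi)
    have hj' := Finset.mem_Ioo.1 (hS' hj)
    rwa [eq_of_permAction_level (by omega) (by omega) he]
  · intro hj
    obtain ⟨j, hi, he⟩ := h2 i hj
    have hi' := Finset.mem_Ioo.1 (hS hi)
    have hj' := Finset.mem_Ioo.1 (hS' hj)
    rwa [← eq_of_permAction_level (by omega) (by omega) he]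

theorem face_mono {Q : Dendrogram n} {S S' : Finset ℕ} (hSS : S ⊆ S')
    (hS' : S' ⊆ Finset.Ioo 0 (n - 1)) : (h.face Q S).1 ⊆ (h.face Q S').1 := by
  intro x hx
  obtain ⟨i, hi, he⟩ := (h.mem_face (hSS.trans hS')).1 hx
  exact (h.mem_face hS').2 ⟨i, hSS hi, he⟩

theorem exists_of_le_face {Q : Dendrogram n} {S : Finset ℕ} (hS : S ⊆ Finset.Ioo 0 (n - 1))
    {a : QuotientComplex ρ} (ha : a ≤ orbitOf ρ (h.face Q S)) :
    ∃ S' ⊆ S, a = orbitOf ρ (h.face Q S') := by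
  classical
  obtain ⟨A, B, rfl, hB, hAB⟩ := ha
  obtain ⟨g, hg⟩ := (faceRel_iff ρ _ _).1 ((orbitOf_eq_iff ρ _ _).1 hB)
  have hsub : (S.filter fun i => ∃ x ∈ A.1, e (ρ g x) = Q.level i) ⊆ S := Finset.filter_subset _ _
  refine ⟨_, hsub, (orbitOf_eq_iff ρ _ _).2 ((faceRel_iff ρ _ _).2 ⟨g, fun x => ?_⟩)⟩
  rw [h.mem_face (hsub.trans hS)]
  constructor
  · intro hx
    obtain ⟨i, hi, he⟩ := (h.mem_face hS).1 ((hg x).1 (hAB hx))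
    exact ⟨i, Finset.mem_filter.2 ⟨hi, x, hx, he⟩, he⟩
  · rintro ⟨i, hi, he⟩
    obtain ⟨-, y, hy, he'⟩ := Finset.mem_filter.1 hi
    rwa [(ρ g).injective (e.injective (he.trans he'.symm))]

theorem face_subset_iff {Q : Dendrogram n} {S : Finset ℕ} (hS : S ⊆ Finset.Ioo 0 (n - 1))
    {A : Face P} (hA : A.1 ⊆ (h.face Q S).1) : ∃ S' ⊆ S, A = h.face Q S' := by
  classical
  have hsub : (S.filter fun i => e.symm (Q.level i) ∈ A.1) ⊆ S := Finset.filter_subset _ _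
  refine ⟨_, hsub, Subtype.ext (Finset.ext fun x => ?_)⟩
  rw [h.mem_face (hsub.trans hS)]
  constructor
  · intro hx
    obtain ⟨i, hi, he⟩ := (h.mem_face hS).1 (hA hx)
    exact ⟨i, Finset.mem_filter.2 ⟨hi, by rwa [← he, e.symm_apply_apply]⟩, he⟩
  · rintro ⟨i, hi, he⟩
    rw [← e.symm_apply_apply x, he]
    exact (Finset.mem_filter.1 hi).2

variable {μ : Multiset (Fin k) → ℕ}

/-- A letter-preserving permutation that carries one face to the other also matches the numbers of
members that keep two points together, and these numbers determine the code. -/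
theorem wk_eq_of_faceRel {Q Q' : Dendrogram n} {S S' : Finset ℕ}
    (hS : S ⊆ Finset.Ioo 0 (n - 1)) (hS' : S' ⊆ Finset.Ioo 0 (n - 1))
    (hr : FaceRel ρ (h.face Q S) (h.face Q' S')) :
    wk μ (mapT (countLE S) (mapL c Q.tree)) = wk μ (mapT (countLE S') (mapL c Q'.tree)) := by
  classical
  obtain ⟨σ, hσ, h1, h2⟩ := h.exists_level_of_faceRel hS hS' hr
  have hcount : ∀ x y, x ≠ y →
      countLE S (lca Q.tree x y) = countLE S' (lca Q'.tree (σ x) (σ y)) := by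
    intro x y hxy
    rw [← Q.card_filter_level hS hxy,
      ← Q'.card_filter_level hS' (fun he => hxy (σ.injective he))]
    refine Finset.card_equiv (permAction n σ).toEquiv fun u => ?_
    simp only [Finset.mem_filter, Finset.mem_image]
    refine and_congr ⟨?_, ?_⟩ (permAction_rel σ u x y).symm
    · rintro ⟨i, hi, rfl⟩
      obtain ⟨j, hj, he⟩ := h1 i hi
      exact ⟨j, hj, he.symm⟩
    · rintro ⟨j, hj, hu⟩
      obtain ⟨i, hi, he⟩ := h2 j hj
      exact ⟨i, hi, (permAction n σ).injective (he.trans hu)⟩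
  have hmono : ∀ (R : Dendrogram n) S, (mapT (countLE S) R.tree).Heap := fun R S =>
    R.heap.mapT fun a _ b _ hab => countLE_mono S hab
  have hfull := (Q.full.mapT (countLE S)).mapL σ
  have hc : mapL c (mapL σ (mapT (countLE S) Q.tree)) = mapL c (mapT (countLE S) Q.tree) := by
    rw [mapL_mapL]
    congr 1
    exact funext hσ
  rw [← mapL_mapT, ← mapL_mapT, ← hc]
  refine wk_eq_of_lca_eq c _ _ _ le_rfl (heap_mapL_iff.2 (hmono Q S)) (hmono Q' S') hfull.1
    (hfull.perm (Q'.full.mapT _)) fun x _ y _ hxy => ?_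
  obtain ⟨x, rfl⟩ := σ.surjective x
  obtain ⟨y, rfl⟩ := σ.surjective y
  have hxy' : x ≠ y := fun he => hxy (he ▸ rfl)
  rw [lca_mapL σ.injective, lca_mapT _ (Q.full.2 x) (Q.full.2 y) hxy',
    lca_mapT _ (Q'.full.2 _) (Q'.full.2 _) hxy, hcount x y hxy']

/-- Two dendrograms with the same coloured tree differ by a letter-preserving permutation that
carries every level to the level with the same index. -/
theorem faceRel_of_mapL_eq {Q Q' : Dendrogram n} (hQ : mapL c Q.tree = mapL c Q'.tree)
    {S : Finset ℕ} (hS : S ⊆ Finset.Ioo 0 (n - 1)) :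
    FaceRel ρ (h.face Q S) (h.face Q' S) := by
  -- The trees are equal, so their codes agree for any weight; the zero weight is chosen.
  obtain ⟨σ, hσ, hlca⟩ := Q.full.exists_perm_of_wk_eq (μ := fun _ => 0) Q'.full
    (congrArg (wk fun _ => 0) hQ)
  have hlev : ∀ i, permAction n σ (Q.level i) = Q'.level i := by
    intro i
    ext x y
    obtain ⟨x, rfl⟩ := σ.surjective x
    obtain ⟨y, rfl⟩ := σ.surjective y
    rw [permAction_rel, Q.level_rel, Q'.level_rel, σ.apply_eq_iff_eq]
    by_cases hxy : x = y
    · simp [hxy]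
    · rw [hlca x y hxy]
  refine (faceRel_iff ρ _ _).2 ⟨⟨σ, hσ⟩, fun x => ?_⟩
  rw [h.mem_face hS, h.mem_face hS]
  refine exists_congr fun i => and_congr_right fun _ => ?_
  rw [h.map_rho, ← hlev i]
  exact (permAction n σ).injective.eq_iff.symm

theorem exists_face_eq (hn : 0 < n)
    (hμ : ∀ A B : Multiset (Fin k), A ≠ 0 → B ≠ 0 → μ A ≤ μ B → μ A < μ (A + B)) (A : Face P) :
    ∃ (Q : Dendrogram n) (S : Finset ℕ), S ⊆ Finset.Ioo 0 (n - 1) ∧ A = h.face Q S ∧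
      Valid μ (mapL c Q.tree) ∧ std (mapL c Q.tree) = mapL c Q.tree ∧
      Compat μ (mapL c Q.tree) (countLE S) := by
  classical
  have hext : ∀ u ∈ A.1.map e.toEmbedding, ¬ (u = ⊥ ∨ u = ⊤) := by
    intro u hu hbt
    obtain ⟨x, hx, rfl⟩ := Finset.mem_map.1 hu
    rcases (h.extreme_iff x).2 hbt with rfl | rfl
    · exact A.2.2.1 hx
    · exact A.2.2.2 hx
  obtain ⟨Q, S, hS, hA, hQ⟩ := exists_dendrogram_of_chain hn hμ c (C := A.1.map e.toEmbedding)
    (by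
      intro u hu v hv _
      obtain ⟨x, hx, rfl⟩ := Finset.mem_map.1 hu
      obtain ⟨y, hy, rfl⟩ := Finset.mem_map.1 hv
      exact (h.comparable_iff x y).1 (A.2.1.total hx hy))
    (fun hb => hext _ hb (Or.inl rfl)) (fun hb => hext _ hb (Or.inr rfl))
  refine ⟨Q, S, hS, Subtype.ext (Finset.ext fun x => ?_), hQ⟩
  rw [h.mem_face hS, ← Finset.mem_map' e.toEmbedding, hA, Finset.mem_image]
  exact exists_congr fun i => and_congr_right fun _ => eq_comm

end IsPartitionModel

end Faces

/-! ### Descent sets and the partitioning of the quotient complex -/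

open TimedTree

namespace TimedTree

variable {κ : Type*} [Encodable κ] {μ : Multiset κ → ℕ}

open Classical in
variable (μ) in
/-- The times which are read before their predecessors. -/
noncomputable def descents (G : TimedTree ℕ κ) : Finset ℕ :=
  (Finset.Ioo 0 G.times.length).filter fun i => key μ G i < key μ G (i - 1)

theorem mem_descents {G : TimedTree ℕ κ} {i : ℕ} : i ∈ descents μ G ↔
    (0 < i ∧ i < G.times.length) ∧ key μ G i < key μ G (i - 1) := by
  rw [descents, Finset.mem_filter, Finset.mem_Ioo]

/-- Two times are identified by `countLE S` if no element of `S` lies between them. If `S` contains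
all descents, keys increase along every stretch of identified times; conversely, a descent outside
`S` would identify two consecutive times in the wrong order. -/
theorem compat_countLE_iff {G : TimedTree ℕ κ} (hv : Valid μ G) (hs : std G = G) {S : Finset ℕ} :
    Compat μ G (countLE S) ↔ descents μ G ⊆ S := by
  have hm : ∀ {t}, t ∈ G.times ↔ t < G.times.length := mem_times_iff hs hv.nodup
  constructor
  · intro hc i hi
    obtain ⟨⟨h1, h2⟩, h3⟩ := mem_descents.1 hi
    by_contra hiS
    refine lt_asymm h3 (hc.2 (i - 1) (hm.2 (by omega)) i (hm.2 h2) (by omega) ?_)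
    refine (countLE_eq_iff (by omega)).2 fun j hj hij => hiS ?_
    have : j = i := by omega
    rwa [← this]
  · intro hD
    refine ⟨fun t _ u _ h => countLE_mono S h, fun t _ u hu htu he => ?_⟩
    have hu := hm.1 hu
    rw [countLE_eq_iff htu.le] at he
    have step : ∀ m, t + m + 1 ≤ u → key μ G t < key μ G (t + m + 1) := by
      intro m
      have hone : ∀ j, t < j → j ≤ u → key μ G (j - 1) < key μ G j := by
        intro j h1 h2
        refine lt_of_le_of_ne (not_lt.1 fun hlt => ?_) fun heq => ?_
        · exact he j (hD (mem_descents.2 ⟨⟨by omega, by omega⟩, hlt⟩)) ⟨h1, h2⟩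
        · have := hv.key_inj (hm.2 (by omega)) (hm.2 (by omega)) heq
          omega
      induction m with
      | zero => exact fun h => hone (t + 1) (by omega) h
      | succ m ih => exact fun h => (ih (by omega)).trans (hone (t + (m + 1) + 1) (by omega) h)
    have := step (u - t - 1) (by omega)
    rwa [show t + (u - t - 1) + 1 = u by omega] at this

end TimedTree

namespace IsPartitionModel

variable {n k : ℕ} {c : Fin n → Fin k} {P : Type} [PartialOrder P] [BoundedOrder P]
  {ρ : youngSubgroup c →* (P ≃o P)} {e : P ≃ Setoid (Fin n)} {μ : Multiset (Fin k) → ℕ}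

/-- The cells are indexed by dendrograms with valid standardized colouring. Existence of compatible
identifications shows that the intervals cover the complex, and `eq_of_wk_mapT_eq` that they do not
overlap. -/
theorem exists_isPartitioning (h : IsPartitionModel ρ e) (hn : 0 < n)
    (hμ : ∀ A B : Multiset (Fin k), A ≠ 0 → B ≠ 0 → μ A ≤ μ B → μ A < μ (A + B)) :
    (∀ a : QuotientComplex ρ, IsMax a → a.card = (Finset.Ioo 0 (n - 1)).card) ∧
    ∃ bot : {a : QuotientComplex ρ // IsMax a} → QuotientComplex ρ, IsPartitioning bot ∧
      ∀ Q : Dendrogram n, Valid μ (mapL c Q.tree) → std (mapL c Q.tree) = mapL c Q.tree →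
        ∀ hQ : IsMax (orbitOf ρ (h.face Q (Finset.Ioo 0 (n - 1)))),
          bot ⟨_, hQ⟩ = orbitOf ρ (h.face Q (descents μ (mapL c Q.tree))) := by
  have hlen : ∀ Q : Dendrogram n, (mapL c Q.tree).times.length = n - 1 := fun Q => by
    rw [times_mapL, Q.length_times]
  obtain ⟨h1, bot, h2, h3⟩ := _root_.exists_isPartitioning (X := QuotientComplex ρ)
    (I := {Q : Dendrogram n // Valid μ (mapL c Q.tree) ∧ std (mapL c Q.tree) = mapL c Q.tree})
    (U := Finset.Ioo 0 (n - 1)) (cell := fun Q S => orbitOf ρ (h.face Q.1 S))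
    (D := fun Q => descents μ (mapL c Q.1.tree)) (rk := QuotientComplex.card)
    (fun Q i hi => by
      have := (mem_descents.1 hi).1
      rw [hlen] at this
      exact Finset.mem_Ioo.2 this)
    (fun Q S S' hSS hS' => show ∃ C D : Face P, _ from ⟨_, _, rfl, rfl, h.face_mono hSS hS'⟩)
    (fun Q S a hS ha => h.exists_of_le_face hS ha)
    (fun Q S S' hS hS' he => h.eq_of_faceRel hS hS' ((orbitOf_eq_iff ρ _ _).1 he))
    (fun Q S hS => h.card_face hS)
    (fun a => by
      obtain ⟨A, rfl⟩ := Quotient.exists_rep a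
      obtain ⟨Q, S, hS, rfl, hv, hs, hc⟩ := h.exists_face_eq (μ := μ) hn hμ A
      exact ⟨⟨Q, hv, hs⟩, S, (compat_countLE_iff hv hs).1 hc, hS, rfl⟩)
    (fun Q Q' S S' hD hS hD' hS' he => by
      have hwk := h.wk_eq_of_faceRel (μ := μ) hS hS' ((orbitOf_eq_iff ρ _ _).1 he)
      have hG := (eq_of_wk_mapT_eq hμ _ _ _ _ _ le_rfl Q.2.1 Q'.2.1 Q.2.2 Q'.2.2
        ((compat_countLE_iff Q.2.1 Q.2.2).2 hD) ((compat_countLE_iff Q'.2.1 Q'.2.2).2 hD') hwk).1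
      exact ⟨congrArg (descents μ) hG, fun S'' hS'' =>
        (orbitOf_eq_iff ρ _ _).2 (h.faceRel_of_mapL_eq hG hS'')⟩)
  exact ⟨h1, bot, h2, fun Q hv hs hQ => h3 ⟨Q, hv, hs⟩ hQ⟩

/-- The vertices of the smallest face of the interval of a facet are its levels at descents. -/
theorem exists_dendrogram_of_isMax (h : IsPartitionModel ρ e) (hn : 0 < n)
    (hμ : ∀ A B : Multiset (Fin k), A ≠ 0 → B ≠ 0 → μ A ≤ μ B → μ A < μ (A + B)) :
    (∀ a : QuotientComplex ρ, IsMax a → a.card = (Finset.Ioo 0 (n - 1)).card) ∧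
    ∃ bot : {a : QuotientComplex ρ // IsMax a} → QuotientComplex ρ, IsPartitioning bot ∧
      ∀ (C D : Face P) (hC : IsMax (orbitOf ρ C)), D.1 ⊆ C.1 →
        orbitOf ρ D = bot ⟨orbitOf ρ C, hC⟩ → ∃ Q : Dendrogram n, Valid μ (mapL c Q.tree) ∧
          (∀ x, x ∈ C.1 ↔ ∃ i ∈ Finset.Ioo 0 (n - 1), e x = Q.level i) ∧
          ∀ x, x ∈ D.1 ↔ ∃ i ∈ descents μ (mapL c Q.tree), e x = Q.level i := by
  obtain ⟨h1, bot, h2, h3⟩ := h.exists_isPartitioning (μ := μ) hn hμ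
  refine ⟨h1, bot, h2, fun C D hC hDC hD => ?_⟩
  obtain ⟨Q, S, hS, rfl, hv, hs, -⟩ := h.exists_face_eq (μ := μ) hn hμ C
  have hcard := h1 _ hC
  change (h.face Q S).1.card = _ at hcard
  rw [h.card_face hS] at hcard
  obtain rfl := Finset.eq_of_subset_of_card_le hS hcard.ge
  obtain ⟨S', hS', rfl⟩ := h.face_subset_iff subset_rfl hDC
  have hdesc : descents μ (mapL c Q.tree) ⊆ Finset.Ioo 0 (n - 1) := fun i hi => by
    have := (mem_descents.1 hi).1
    rw [times_mapL, Q.length_times] at this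
    exact Finset.mem_Ioo.2 this
  rw [h3 Q hv hs hC] at hD
  obtain rfl := h.eq_of_faceRel hS' hdesc ((orbitOf_eq_iff ρ _ _).1 hD)
  exact ⟨Q, hv, fun x => h.mem_face subset_rfl, fun x => h.mem_face hdesc⟩

end IsPartitionModel

/-! ### Siblings, subtrees and their times -/

namespace TimedTree

section Kids

variable {Λ α : Type*}

theorem subs_trans {T R R' : TimedTree Λ α} (hR : R ∈ subs T) (hR' : R' ∈ subs R) :
    R' ∈ subs T := by
  induction T with
  | leaf x =>
    rw [subs, List.mem_singleton] at hR
    rwa [hR] at hR'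
  | node t l r hl hr =>
    rw [subs, List.mem_cons, List.mem_append] at hR
    rcases hR with rfl | hR | hR
    · exact hR'
    · exact List.mem_cons_of_mem _ (List.mem_append_left _ (hl hR))
    · exact List.mem_cons_of_mem _ (List.mem_append_right _ (hr hR))

theorem subs_mapL {β : Type*} (f : α → β) (T : TimedTree Λ α) :
    subs (mapL f T) = (subs T).map (mapL f) := by
  induction T with
  | leaf x => rfl
  | node t l r hl hr => simp [subs, mapL, hl, hr]

theorem times_sublist_of_mem_subs {T R : TimedTree Λ α} (h : R ∈ subs T) :
    R.times.Sublist T.times := by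
  induction T with
  | leaf x =>
    rw [subs, List.mem_singleton] at h
    rw [h]
  | node t l r hl hr =>
    rw [subs, List.mem_cons, List.mem_append] at h
    rcases h with rfl | h | h
    · exact List.Sublist.refl _
    · exact ((hl h).trans (List.sublist_append_left _ _)).cons _
    · exact ((hr h).trans (List.sublist_append_right _ _)).cons _

theorem disjoint_times {t : Λ} {l r : TimedTree Λ α} (h : (node t l r).times.Nodup) :
    t ∉ l.times ∧ t ∉ r.times ∧ l.times.Nodup ∧ r.times.Nodup ∧ l.times.Disjoint r.times := by
  rw [times, List.nodup_cons, List.mem_append, List.nodup_append'] at h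
  exact ⟨fun h' => h.1 (Or.inl h'), fun h' => h.1 (Or.inr h'), h.2⟩

theorem eq_of_node_mem_subs {T A B A' B' : TimedTree Λ α} {t : Λ} (hT : T.times.Nodup)
    (h : node t A B ∈ subs T) (h' : node t A' B' ∈ subs T) : A = A' ∧ B = B' := by
  induction T with
  | leaf x => simp [subs] at h
  | node s l r hl hr =>
    obtain ⟨h1, h2, h3, h4, h5⟩ := disjoint_times hT
    have hm : ∀ {R A B : TimedTree Λ α}, node t A B ∈ subs R → t ∈ R.times := fun h =>
      mem_times_iff_subs.2 ⟨_, _, h⟩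
    rw [subs, List.mem_cons, List.mem_append, node.injEq] at h h'
    rcases h with ⟨rfl, rfl, rfl⟩ | h | h <;> rcases h' with ⟨h0, rfl, rfl⟩ | h' | h'
    · exact ⟨rfl, rfl⟩
    · exact absurd (hm h') h1
    · exact absurd (hm h') h2
    · exact absurd (h0 ▸ hm h) h1
    · exact hl h3 h h'
    · exact (h5 (hm h) (hm h')).elim
    · exact absurd (h0 ▸ hm h) h2
    · exact (h5 (hm h') (hm h)).elim
    · exact hr h4 h h'

/-- `A` and `B` are the children of a node with time `t`. -/
def Kids (T : TimedTree Λ α) (t : Λ) (A B : TimedTree Λ α) : Prop :=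
  node t A B ∈ subs T ∨ node t B A ∈ subs T

theorem Kids.symm {T A B : TimedTree Λ α} {t : Λ} (h : Kids T t A B) : Kids T t B A := Or.symm h

theorem Kids.trans {T R A B : TimedTree Λ α} {t : Λ} (h : Kids R t A B) (hR : R ∈ subs T) :
    Kids T t A B := h.imp (subs_trans hR) (subs_trans hR)

theorem Kids.mem_subs {T A B : TimedTree Λ α} {t : Λ} (h : Kids T t A B) : A ∈ subs T := by
  rcases h with h | h <;> exact subs_trans h (by simp [subs, mem_subs_self])

theorem Kids.mem_times {T A B : TimedTree Λ α} {t : Λ} (h : Kids T t A B) : t ∈ T.times := by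
  rcases h with h | h <;> exact mem_times_iff_subs.2 ⟨_, _, h⟩

theorem exists_kids {T : TimedTree Λ α} {t : Λ} (h : t ∈ T.times) : ∃ A B, Kids T t A B := by
  obtain ⟨A, B, h⟩ := mem_times_iff_subs.1 h
  exact ⟨A, B, Or.inl h⟩

theorem Kids.unique {T A B A' B' : TimedTree Λ α} {t : Λ} (hT : T.times.Nodup)
    (h : Kids T t A B) (h' : Kids T t A' B') : A = A' ∧ B = B' ∨ A = B' ∧ B = A' := by
  rcases h with h | h <;> rcases h' with h' | h'
  · exact Or.inl (eq_of_node_mem_subs hT h h')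
  · exact Or.inr (eq_of_node_mem_subs hT h h')
  · exact Or.inr (eq_of_node_mem_subs hT h h').symm
  · exact Or.inl (eq_of_node_mem_subs hT h h').symm

theorem Kids.lca {T A B : TimedTree ℕ α} {t : ℕ} (hT : T.leaves.Nodup) (h : Kids T t A B) {x y : α}
    (hx : x ∈ A.leaves) (hy : y ∈ B.leaves) : lca T x y = t := by
  rcases h with h | h
  · exact lca_of_node hT h hx hy
  · rw [lca_comm]
    exact lca_of_node hT h hy hx

theorem Kids.disjoint {T A B : TimedTree Λ α} {t : Λ} (hT : T.leaves.Nodup) (h : Kids T t A B) :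
    A.leaves.Disjoint B.leaves := by
  rcases h with h | h
  · exact (List.nodup_append'.1 (hT.sublist (sublist_of_mem_subs h))).2.2
  · exact (List.nodup_append'.1 (hT.sublist (sublist_of_mem_subs h))).2.2.symm

theorem Kids.lt_of_mem_times {T A B : TimedTree ℕ α} {t : ℕ} (hh : T.Heap) (hT : T.times.Nodup)
    (h : Kids T t A B) {u : ℕ} (hu : u ∈ A.times) : t < u := by
  rcases h with h | h
  · have hn := disjoint_times (hT.sublist (times_sublist_of_mem_subs h))
    exact lt_of_le_of_ne ((hh.of_mem_subs h).1 u hu) fun he => hn.1 (he ▸ hu)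
  · have hn := disjoint_times (hT.sublist (times_sublist_of_mem_subs h))
    exact lt_of_le_of_ne ((hh.of_mem_subs h).2.1 u hu) fun he => hn.2.1 (he ▸ hu)

/-- A leaf outside a subtree is separated from it at a proper ancestor, and times are distinct and
increase downwards. -/
theorem lca_lt_of_not_mem {T R : TimedTree ℕ α} (hh : T.Heap) (hT : T.times.Nodup)
    (hl : T.leaves.Nodup) (hR : R ∈ subs T) {x y : α} (hx : x ∈ R.leaves) (hy : y ∈ T.leaves)
    (hyR : y ∉ R.leaves) {t : ℕ} (ht : t ∈ R.times) : TimedTree.lca T x y < t := by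
  induction T with
  | leaf z =>
    rw [subs, List.mem_singleton] at hR
    exact absurd (hR ▸ hy) hyR
  | node s l r ihl ihr =>
    obtain ⟨h1, h2, h3, h4, -⟩ := disjoint_times hT
    obtain ⟨l1, l2, -⟩ := disjoint_leaves hl
    rw [subs, List.mem_cons, List.mem_append] at hR
    rw [leaves, List.mem_append] at hy
    rcases hR with rfl | hR | hR
    · exact absurd (List.mem_append.2 hy) hyR
    · have htl := (times_sublist_of_mem_subs hR).subset ht
      have hxl := (sublist_of_mem_subs hR).subset hx
      rcases hy with hy | hy
      · rw [lca_left hxl hy]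
        exact ihl hh.2.2.1 h3 l1 hR hy
      · rw [lca_mixed hl hxl hy]
        exact lt_of_le_of_ne (hh.1 t htl) fun he => h1 (he ▸ htl)
    · have htr := (times_sublist_of_mem_subs hR).subset ht
      have hxr := (sublist_of_mem_subs hR).subset hx
      rcases hy with hy | hy
      · rw [lca_comm, lca_mixed hl hy hxr]
        exact lt_of_le_of_ne (hh.2.1 t htr) fun he => h2 (he ▸ htr)
      · rw [lca_right hl hxr hy]
        exact ihr hh.2.2.2 h4 l2 hR hy

theorem Kids.lca_le_of_not_mem {T A B : TimedTree ℕ α} {t : ℕ} (hh : T.Heap) (hT : T.times.Nodup)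
    (hl : T.leaves.Nodup) (h : Kids T t A B) {x y : α} (hx : x ∈ A.leaves) (hy : y ∈ T.leaves)
    (hyA : y ∉ A.leaves) : TimedTree.lca T x y ≤ t := by
  by_cases hyB : y ∈ B.leaves
  · exact (h.lca hl hx hyB).le
  · rcases h with h | h
    · refine (lca_lt_of_not_mem hh hT hl h (List.mem_append_left _ hx) hy ?_ List.mem_cons_self).le
      exact fun hm => (List.mem_append.1 hm).elim hyA hyB
    · refine (lca_lt_of_not_mem hh hT hl h (List.mem_append_right _ hx) hy ?_ List.mem_cons_self).le
      exact fun hm => (List.mem_append.1 hm).elim hyB hyA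

theorem exists_kids_of_lca {T : TimedTree ℕ α} {x y : α} (hx : x ∈ T.leaves) (hy : y ∈ T.leaves)
    (hxy : x ≠ y) : ∃ A B, Kids T (TimedTree.lca T x y) A B ∧ x ∈ A.leaves ∧ y ∈ B.leaves := by
  induction T with
  | leaf z =>
    rw [leaves, List.mem_singleton] at hx hy
    exact absurd (hx.trans hy.symm) hxy
  | node s l r ihl ihr =>
    rw [TimedTree.lca]
    split_ifs with h1 h2
    · obtain ⟨A, B, h, hAB⟩ := ihl h1.1 h1.2
      exact ⟨A, B, h.trans (by simp [subs, mem_subs_self]), hAB⟩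
    · obtain ⟨A, B, h, hAB⟩ := ihr h2.1 h2.2
      exact ⟨A, B, h.trans (by simp [subs, mem_subs_self]), hAB⟩
    · rw [leaves, List.mem_append] at hx hy
      rcases hx with hx | hx <;> rcases hy with hy | hy
      · exact absurd ⟨hx, hy⟩ h1
      · exact ⟨l, r, Or.inl (mem_subs_self _), hx, hy⟩
      · exact ⟨r, l, Or.inr (mem_subs_self _), hx, hy⟩
      · exact absurd ⟨hx, hy⟩ h2

/-- A subtree contains the times of the lowest common ancestors of its leaves. -/
theorem mem_times_of_kids {T R A B : TimedTree ℕ α} {t : ℕ} (hl : T.leaves.Nodup)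
    (h : Kids T t A B) (hR : R ∈ subs T) (hA : ∀ x ∈ A.leaves, x ∈ R.leaves)
    (hB : ∀ x ∈ B.leaves, x ∈ R.leaves) : t ∈ R.times := by
  obtain ⟨x, hx⟩ := exists_mem_leaves A
  obtain ⟨y, hy⟩ := exists_mem_leaves B
  rw [← h.lca hl hx hy, lca_of_mem_subs hl hR (hA x hx) (hB y hy)]
  exact lca_mem_times (hA x hx) (hB y hy) fun he => h.disjoint hl hx (he ▸ hy)

theorem Kids.subset {T R A B : TimedTree Λ α} {t : Λ} (hT : T.times.Nodup) (h : Kids T t A B)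
    (hR : R ∈ subs T) (ht : t ∈ R.times) :
    (∀ x ∈ A.leaves, x ∈ R.leaves) ∧ ∀ x ∈ B.leaves, x ∈ R.leaves := by
  obtain ⟨A', B', h'⟩ := exists_kids ht
  have hA : ∀ x ∈ A'.leaves, x ∈ R.leaves := fun x hx =>
    (sublist_of_mem_subs h'.mem_subs).subset hx
  have hB : ∀ x ∈ B'.leaves, x ∈ R.leaves := fun x hx =>
    (sublist_of_mem_subs h'.symm.mem_subs).subset hx
  rcases h.unique hT (h'.trans hR) with ⟨rfl, rfl⟩ | ⟨rfl, rfl⟩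
  · exact ⟨hA, hB⟩
  · exact ⟨hB, hA⟩

/-- Two subtrees with the same set of leaves contain each other's roots as times; in a heap their
roots have the same time. This turns equations between blocks into equations between subtrees. -/
theorem root_eq_of_kids {T R A B : TimedTree ℕ α} {t : ℕ} (hh : T.Heap)
    (hl : T.leaves.Nodup) (h : Kids T t A B) (hR : R ∈ subs T)
    (hAB : ∀ x, x ∈ R.leaves ↔ x ∈ A.leaves ∨ x ∈ B.leaves) : R.root = some t := by
  have ht := mem_times_of_kids hl h hR (fun x hx => (hAB x).2 (Or.inl hx))
    fun x hx => (hAB x).2 (Or.inr hx)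
  cases R with
  | leaf x => simp [times] at ht
  | node s l r =>
    have hN : ∃ N ∈ subs T, N.root = some t ∧ ∀ x, x ∈ N.leaves ↔ x ∈ A.leaves ∨ x ∈ B.leaves := by
      rcases h with h | h
      · exact ⟨_, h, rfl, fun x => by simp [leaves]⟩
      · exact ⟨_, h, rfl, fun x => by simp [leaves, or_comm]⟩
    obtain ⟨N, hN, hroot, hNl⟩ := hN
    have hs : s ∈ N.times := mem_times_of_kids hl (Or.inl hR) hN
      (fun x hx => (hNl x).2 ((hAB x).1 (List.mem_append_left _ hx)))
      fun x hx => (hNl x).2 ((hAB x).1 (List.mem_append_right _ hx))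
    rw [root, le_antisymm ((hh.of_mem_subs hR).root_le rfl t ht)
      ((hh.of_mem_subs hN).root_le hroot s hs)]

theorem kids_of_root {T R A B : TimedTree Λ α} {t : Λ} (hT : T.times.Nodup) (h : Kids T t A B)
    (hR : R ∈ subs T) (ht : R.root = some t) : R = node t A B ∨ R = node t B A := by
  cases R with
  | leaf x => simp [root] at ht
  | node s l r =>
    obtain rfl : s = t := by simpa [root] using ht
    rcases h.unique hT (Or.inl hR) with ⟨rfl, rfl⟩ | ⟨rfl, rfl⟩
    · exact Or.inl rfl
    · exact Or.inr rfl

end Kids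

end TimedTree

open TimedTree

/-! ### Splits along the levels of a dendrogram -/

namespace Dendrogram

variable {n : ℕ} (Q : Dendrogram n)

/-- The leaves of a subtree form a block of level `j` if no time inside it comes before `j` and
everything outside is separated from it before `j`. -/
theorem leafSet_mem_classes {R : TimedTree ℕ (Fin n)} (hR : R ∈ subs Q.tree) {j : ℕ}
    (h1 : ∀ t ∈ R.times, j ≤ t)
    (h2 : ∀ x ∈ R.leaves, ∀ y, y ∉ R.leaves → lca Q.tree x y < j) :
    (R.leaves.toFinset : Set (Fin n)) ∈ (Q.level j).classes := by
  obtain ⟨x, hx⟩ := exists_mem_leaves R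
  refine ⟨x, Set.ext fun y => ?_⟩
  rw [Finset.mem_coe, List.mem_toFinset]
  change y ∈ R.leaves ↔ Q.level j y x
  rw [level_rel, lca_comm]
  constructor
  · intro hy
    by_cases hyx : y = x
    · exact Or.inl hyx
    · rw [lca_of_mem_subs Q.full.1 hR hx hy]
      exact Or.inr (h1 _ (lca_mem_times hx hy fun he => hyx he.symm))
  · rintro (rfl | hle)
    · exact hx
    · by_contra hy
      exact absurd (h2 x hx y hy) (not_lt.2 hle)

theorem le_of_leafSet_mem_classes {R : TimedTree ℕ (Fin n)} (hR : R ∈ subs Q.tree) {j t : ℕ}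
    (h : (R.leaves.toFinset : Set (Fin n)) ∈ (Q.level j).classes) (ht : t ∈ R.times) : j ≤ t := by
  obtain ⟨z, hz⟩ := h
  obtain ⟨x, hx, y, hy, hxy, rfl⟩ := exists_lca_eq (Q.full.1.sublist (sublist_of_mem_subs hR)) ht
  have hcl : ∀ w ∈ R.leaves, Q.level j w z := fun w hw => by
    have : w ∈ (R.leaves.toFinset : Set (Fin n)) := by simpa using hw
    rw [hz] at this
    exact this
  have := (Q.level j).trans (hcl x hx) ((Q.level j).symm (hcl y hy))
  rw [← lca_of_mem_subs Q.full.1 hR hx hy]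
  exact (Q.level_rel.1 this).resolve_left hxy

theorem leafSet_mem_classes_of_kids {A B : TimedTree ℕ (Fin n)} {t j : ℕ}
    (h : Kids Q.tree t A B) (htj : t < j) (hj : ∀ u ∈ A.times, j ≤ u) :
    (A.leaves.toFinset : Set (Fin n)) ∈ (Q.level j).classes :=
  Q.leafSet_mem_classes h.mem_subs hj fun _ hx y hy =>
    (h.lca_le_of_not_mem Q.heap Q.nodup_times Q.full.1 hx (Q.full.2 y) hy).trans_lt htj

theorem exists_leafSet_mem_classes {R : TimedTree ℕ (Fin n)} (hR : R ∈ subs Q.tree) :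
    ∃ j ≤ n - 1, (R.leaves.toFinset : Set (Fin n)) ∈ (Q.level j).classes := by
  cases R with
  | leaf x =>
    refine ⟨n - 1, le_rfl, Q.leafSet_mem_classes hR (by simp [times]) fun y hy z hz => ?_⟩
    exact Q.lca_lt fun he => hz (he ▸ hy)
  | node t l r =>
    have ht := Q.mem_times.1 ((times_sublist_of_mem_subs hR).subset List.mem_cons_self)
    refine ⟨t, ht.le, Q.leafSet_mem_classes hR ?_ fun y hy z hz => ?_⟩
    · exact (Q.heap.of_mem_subs hR).root_le rfl
    · exact lca_lt_of_not_mem Q.heap Q.nodup_times Q.full.1 hR hy (Q.full.2 z) hz List.mem_cons_self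

/-- A partition strictly above level `i + 1` and below level `i` relates points from the two
children of the node with time `i`. Both children are blocks of level `i + 1`, so this joins them
entirely and gives level `i`. -/
theorem level_covBy {i : ℕ} (hi : i < n - 1) : Q.level (i + 1) ⋖ Q.level i := by
  refine ⟨lt_of_le_of_ne (Q.level_anti (by omega)) fun he => ?_, fun w h1 h2 => ?_⟩
  · have := (Q.level_inj (by omega) (by omega)).1 he
    omega
  · obtain ⟨A, B, hAB⟩ := exists_kids (Q.mem_times.2 hi)
    have hl := Q.full.1
    have hin : ∀ {A B : TimedTree ℕ (Fin n)}, Kids Q.tree i A B → ∀ x ∈ A.leaves,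
        ∀ y ∈ A.leaves, w x y := by
      intro A B h x hx y hy
      refine h1.le ?_
      by_cases hxy : x = y
      · exact Or.inl hxy
      · rw [Q.level_rel, lca_of_mem_subs hl h.mem_subs hx hy]
        exact Or.inr (h.lt_of_mem_times Q.heap Q.nodup_times (lca_mem_times hx hy hxy))
    obtain ⟨x, y, hxy, hnxy⟩ : ∃ x y, w x y ∧ ¬ Q.level (i + 1) x y := by
      by_contra hcon
      push Not at hcon
      exact h1.not_ge fun x y => hcon x y
    have hlev := Q.level_rel.1 (h2.le hxy)
    rw [Q.level_rel, not_or] at hnxy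
    have hlca : lca Q.tree x y = i := by
      have := hlev.resolve_left hnxy.1
      omega
    obtain ⟨A, B, h, hxA, hyB⟩ := exists_kids_of_lca (Q.full.2 x) (Q.full.2 y) hnxy.1
    rw [hlca] at h
    refine h2.not_ge fun p q hpq => ?_
    rcases Q.level_rel.1 hpq with rfl | hpq'
    · exact w.refl p
    by_cases hpe : p = q
    · exact hpe ▸ w.refl p
    rcases hpq'.lt_or_eq with hlt | heq
    · exact h1.le (Q.level_rel.2 (Or.inr hlt))
    · obtain ⟨A', B', h', hpA, hqB⟩ := exists_kids_of_lca (Q.full.2 p) (Q.full.2 q) hpe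
      rw [← heq] at h'
      rcases h'.unique Q.nodup_times h with ⟨rfl, rfl⟩ | ⟨rfl, rfl⟩
      · exact w.trans (hin h p hpA x hxA) (w.trans hxy (hin h.symm y hyB q hqB))
      · exact w.trans (hin h.symm p hpA y hyB) (w.trans (w.symm hxy) (hin h x hxA q hqB))

/-- The covering relation forces consecutive levels, and the blocks that are split off are the leaf
sets below the node with time `i`. -/
theorem isSplit_iff {i j : ℕ} (hi : i ≤ n - 1) (hj : j ≤ n - 1) {X Y : Finset (Fin n)} :
    IsSplit (Q.level i) (Q.level j) X Y ↔ j = i + 1 ∧ ∃ A B, Kids Q.tree i A B ∧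
      X = A.leaves.toFinset ∧ Y = B.leaves.toFinset := by
  have hl := Q.full.1
  constructor
  · rintro ⟨hcov, hX, hY, hXY, hu⟩
    have hij : i < j := by
      by_contra hle
      exact hcov.lt.not_ge (Q.level_anti (not_lt.1 hle))
    have hj1 : j = i + 1 := by
      by_contra hne
      refine hcov.2 (c := Q.level (i + 1)) ?_ ?_
      · refine lt_of_le_of_ne (Q.level_anti (by omega)) fun he => ?_
        have := (Q.level_inj (by omega) (by omega)).1 he
        omega
      · exact (Q.level_covBy (by omega)).lt
    subst hj1
    refine ⟨rfl, ?_⟩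
    have hne : ∀ {Z : Finset (Fin n)}, (Z : Set (Fin n)) ∈ (Q.level (i + 1)).classes →
        ∃ x, x ∈ Z ∧ ∀ y, y ∈ Z ↔ Q.level (i + 1) y x := by
      rintro Z ⟨x, hx⟩
      have : ∀ y, y ∈ Z ↔ Q.level (i + 1) y x := fun y => by
        rw [← Finset.mem_coe, hx]
        rfl
      exact ⟨x, (this x).2 ((Q.level _).refl x), this⟩
    obtain ⟨x, hxX, hX'⟩ := hne hX
    obtain ⟨y, hyY, hY'⟩ := hne hY
    obtain ⟨z, hz⟩ := hu
    have hz' : ∀ w, w ∈ X ∨ w ∈ Y → Q.level i w z := fun w hw => by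
      have : w ∈ (X : Set (Fin n)) ∪ Y := hw
      rw [hz] at this
      exact this
    have hxy : Q.level i x y :=
      (Q.level i).trans (hz' x (Or.inl hxX)) ((Q.level i).symm (hz' y (Or.inr hyY)))
    have hnxy : ¬ Q.level (i + 1) x y := fun h => hXY (Finset.ext fun w => by
      rw [hX', hY']
      exact ⟨fun hw => (Q.level _).trans hw h, fun hw => (Q.level _).trans hw ((Q.level _).symm h)⟩)
    rw [Q.level_rel, not_or] at hnxy
    have hlca : lca Q.tree x y = i := by
      have := (Q.level_rel.1 hxy).resolve_left hnxy.1
      omega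
    obtain ⟨A, B, h, hxA, hyB⟩ := exists_kids_of_lca (Q.full.2 x) (Q.full.2 y) hnxy.1
    rw [hlca] at h
    have hcl : ∀ {A B : TimedTree ℕ (Fin n)} {Z : Finset (Fin n)} {x}, Kids Q.tree i A B →
        x ∈ A.leaves → (∀ y, y ∈ Z ↔ Q.level (i + 1) y x) → Z = A.leaves.toFinset := by
      intro A B Z x h hx hZ
      obtain ⟨z, hz⟩ := Q.leafSet_mem_classes_of_kids h (Nat.lt_succ_self i)
        fun u hu => h.lt_of_mem_times Q.heap Q.nodup_times hu
      have hz' : ∀ w, w ∈ A.leaves ↔ Q.level (i + 1) w z := fun w => by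
        rw [← List.mem_toFinset, ← Finset.mem_coe, hz]
        rfl
      ext w
      rw [hZ, List.mem_toFinset, hz']
      have hxz := (hz' x).1 hx
      exact ⟨fun hw => (Q.level _).trans hw hxz,
        fun hw => (Q.level _).trans hw ((Q.level _).symm hxz)⟩
    exact ⟨A, B, h, hcl h hxA hX', hcl h.symm hyB hY'⟩
  · rintro ⟨rfl, A, B, h, rfl, rfl⟩
    have hlt : ∀ {A B : TimedTree ℕ (Fin n)}, Kids Q.tree i A B →
        (A.leaves.toFinset : Set (Fin n)) ∈ (Q.level (i + 1)).classes := fun h =>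
      Q.leafSet_mem_classes_of_kids h (Nat.lt_succ_self i)
        fun u hu => h.lt_of_mem_times Q.heap Q.nodup_times hu
    refine ⟨Q.level_covBy (by omega), hlt h, hlt h.symm, fun he => ?_, ?_⟩
    · obtain ⟨x, hx⟩ := exists_mem_leaves A
      have hx' := List.mem_toFinset.2 hx
      rw [he] at hx'
      exact h.disjoint hl hx (List.mem_toFinset.1 hx')
    · have hnode : ∀ {A B : TimedTree ℕ (Fin n)}, node i A B ∈ subs Q.tree →
          ((node i A B).leaves.toFinset : Set (Fin n)) ∈ (Q.level i).classes := fun h =>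
        Q.leafSet_mem_classes h ((Q.heap.of_mem_subs h).root_le rfl) fun x hx y hy =>
          lca_lt_of_not_mem Q.heap Q.nodup_times hl h hx (Q.full.2 y) hy List.mem_cons_self
      rcases h with h | h
      · have := hnode h
        rwa [leaves, List.toFinset_append, Finset.coe_union] at this
      · have := hnode h
        rwa [leaves, List.toFinset_append, Finset.coe_union, Set.union_comm] at this

end Dendrogram

/-! ### Descents of a coloured tree in terms of its points -/

namespace TimedTree

variable {α κ : Type*} [Encodable κ] {μ : Multiset κ → ℕ} {c : α → κ}

theorem times_eq_of_length_leaves_eq_two {R : TimedTree ℕ α} (h : R.leaves.length = 2) :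
    R.times = [rt R] := by
  cases R with
  | leaf x => simp [leaves] at h
  | node t l r =>
    rw [length_leaves, times, List.length_cons, List.length_append] at h
    have h1 : l.times = [] := List.length_eq_zero_iff.1 (by omega)
    have h2 : r.times = [] := List.length_eq_zero_iff.1 (by omega)
    simp [times, h1, h2, rt, root]

theorem rt_mapL (f : α → κ) (T : TimedTree ℕ α) : rt (mapL f T) = rt T := by
  rw [rt, root_mapL, rt]

theorem Valid.of_mem_subs {T R : TimedTree ℕ κ} (h : Valid μ T) (hR : R ∈ subs T) :
    Valid μ R := by
  induction T with
  | leaf x =>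
    rw [subs, List.mem_singleton] at hR
    rwa [hR]
  | node t l r hl hr =>
    rw [subs, List.mem_cons, List.mem_append] at hR
    rcases hR with rfl | hR | hR
    · exact h
    · exact hl h.2.2.2.2.1 hR
    · exact hr h.2.2.2.2.2 hR

theorem exists_node_of_mapL_eq {Y : TimedTree ℕ α} {A B : TimedTree ℕ κ} {t : ℕ}
    (h : mapL c Y = node t A B) : ∃ A' B', Y = node t A' B' ∧ mapL c A' = A ∧ mapL c B' = B := by
  cases Y with
  | leaf x => simp [mapL] at h
  | node s l r =>
    rw [mapL, node.injEq] at h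
    exact ⟨l, r, by rw [h.1], h.2⟩

theorem splitDesc_mapL_iff {X Y : TimedTree ℕ α} {u : ℕ} :
    SplitDesc μ (mapL c X) (mapL c Y) u ↔ wt μ (mapL c X) ≤ wt μ (mapL c Y) ∧
      (X.root = some u ∨ ∃ A B, (Y = node u A B ∨ Y = node u B A) ∧
        wt μ (mapL c A) ≤ wt μ (mapL c B) ∧ (wt μ (mapL c A) < wt μ (mapL c X) ∨
          wt μ (mapL c A) = wt μ (mapL c X) ∧ X.leaves.length = 2 ∧ rt A < rt X)) := by
  rw [SplitDesc, root_mapL, leaves_mapL, List.length_map, rt_mapL]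
  refine and_congr_right fun _ => or_congr_right ⟨?_, ?_⟩
  · rintro ⟨A, B, hY | hY, h⟩
    · obtain ⟨A, B, rfl, rfl, rfl⟩ := exists_node_of_mapL_eq hY
      rw [rt_mapL] at h
      exact ⟨A, B, Or.inl rfl, h⟩
    · obtain ⟨B, A, rfl, rfl, rfl⟩ := exists_node_of_mapL_eq hY
      rw [rt_mapL] at h
      exact ⟨A, B, Or.inr rfl, h⟩
  · rintro ⟨A, B, hY, h⟩
    refine ⟨mapL c A, mapL c B, ?_, by rwa [rt_mapL]⟩
    rcases hY with rfl | rfl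
    · exact Or.inl rfl
    · exact Or.inr rfl

/-- The recursive condition is unfolded into one about siblings anywhere in the tree, which no
longer refers to the planar drawing except for the strict inequality between `L` and `R`. -/
theorem desc_mapL_iff {T : TimedTree ℕ α} {t u : ℕ} : Desc μ (mapL c T) t u ↔
    (∃ X Y, Kids T t X Y ∧ SplitDesc μ (mapL c X) (mapL c Y) u) ∨
      ∃ s L R, node s L R ∈ subs T ∧ wt μ (mapL c L) < wt μ (mapL c R) ∧ t ∈ R.times ∧
        u ∈ L.times := by
  induction T with
  | leaf x => simp [mapL, Desc, Kids, subs]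
  | node s l r hl hr =>
    have hsl : l ∈ subs (node s l r) := by simp [subs, mem_subs_self]
    have hsr : r ∈ subs (node s l r) := by simp [subs, mem_subs_self]
    rw [mapL, Desc, hl, hr, times_mapL, times_mapL]
    constructor
    · rintro (⟨rfl, h | h⟩ | h | (⟨X, Y, hXY, h⟩ | ⟨p, L, R, hp, h⟩) |
        (⟨X, Y, hXY, h⟩ | ⟨p, L, R, hp, h⟩))
      · exact Or.inl ⟨l, r, Or.inl (mem_subs_self _), h⟩
      · exact Or.inl ⟨r, l, Or.inr (mem_subs_self _), h⟩
      · exact Or.inr ⟨s, l, r, mem_subs_self _, h⟩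
      · exact Or.inl ⟨X, Y, hXY.trans hsl, h⟩
      · exact Or.inr ⟨p, L, R, subs_trans hsl hp, h⟩
      · exact Or.inl ⟨X, Y, hXY.trans hsr, h⟩
      · exact Or.inr ⟨p, L, R, subs_trans hsr hp, h⟩
    · rintro (⟨X, Y, hXY | hXY, h⟩ | ⟨p, L, R, hp, h⟩)
      · rw [subs, List.mem_cons, List.mem_append, node.injEq] at hXY
        rcases hXY with ⟨rfl, rfl, rfl⟩ | hXY | hXY
        · exact Or.inl ⟨rfl, Or.inl h⟩
        · exact Or.inr (Or.inr (Or.inl (Or.inl ⟨X, Y, Or.inl hXY, h⟩)))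
        · exact Or.inr (Or.inr (Or.inr (Or.inl ⟨X, Y, Or.inl hXY, h⟩)))
      · rw [subs, List.mem_cons, List.mem_append, node.injEq] at hXY
        rcases hXY with ⟨rfl, rfl, rfl⟩ | hXY | hXY
        · exact Or.inl ⟨rfl, Or.inr h⟩
        · exact Or.inr (Or.inr (Or.inl (Or.inl ⟨X, Y, Or.inr hXY, h⟩)))
        · exact Or.inr (Or.inr (Or.inr (Or.inl ⟨X, Y, Or.inr hXY, h⟩)))
      · rw [subs, List.mem_cons, List.mem_append, node.injEq] at hp
        rcases hp with ⟨rfl, rfl, rfl⟩ | hp | hp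
        · exact Or.inr (Or.inl h)
        · exact Or.inr (Or.inr (Or.inl (Or.inr ⟨p, L, R, hp, h⟩)))
        · exact Or.inr (Or.inr (Or.inr (Or.inr ⟨p, L, R, hp, h⟩)))

theorem noEqual_mapL {T : TimedTree ℕ α} (h : ∀ t l r, node t l r ∈ subs T → ∀ B ∈ subs r,
    wt μ (mapL c B) = wt μ (mapL c l) → l.leaves.length ≤ 2) : NoEqual μ (mapL c T) := by
  induction T with
  | leaf x => trivial
  | node t l r hl hr =>
    refine ⟨fun B hB hw => ?_, hl fun s A B hs => h s A B ?_, hr fun s A B hs => h s A B ?_⟩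
    · rw [subs_mapL, List.mem_map] at hB
      obtain ⟨B, hB, rfl⟩ := hB
      rw [leaves_mapL, List.length_map]
      exact h t l r (mem_subs_self _) B hB hw
    · exact List.mem_cons_of_mem _ (List.mem_append_left _ hs)
    · exact List.mem_cons_of_mem _ (List.mem_append_right _ hs)

end TimedTree

open TimedTree

/-! ### Topological descents of chains and descents of trees -/

namespace Dendrogram

variable {n k : ℕ} (Q : Dendrogram n) {c : Fin n → Fin k}
  {r : Multiset (Fin k) → Multiset (Fin k) → Prop} {μ : Multiset (Fin k) → ℕ}

theorem content_leafSet {R : TimedTree ℕ (Fin n)} (hR : R ∈ subs Q.tree) :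
    content c R.leaves.toFinset = ((mapL c R).leaves : Multiset (Fin k)) := by
  rw [content, List.toFinset_val, (Q.full.1.sublist (sublist_of_mem_subs hR)).dedup, leaves_mapL,
    Multiset.map_coe]

theorem card_leafSet {R : TimedTree ℕ (Fin n)} (hR : R ∈ subs Q.tree) :
    R.leaves.toFinset.card = R.leaves.length :=
  List.toFinset_card_of_nodup (Q.full.1.sublist (sublist_of_mem_subs hR))

theorem isBlock_content (R : TimedTree ℕ (Fin n)) :
    IsBlock (letters c) (content c R.leaves.toFinset) := by
  refine ⟨fun h => ?_, Multiset.map_le_map (Finset.val_le_iff.2 (Finset.subset_univ _))⟩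
  obtain ⟨x, hx⟩ := exists_mem_leaves R
  rw [content, Multiset.map_eq_zero, Finset.val_eq_zero] at h
  have := List.mem_toFinset.2 hx
  rw [h] at this
  simp at this

theorem wt_mapL_eq {R : TimedTree ℕ (Fin n)} (hR : R ∈ subs Q.tree) :
    wt μ (mapL c R) = μ (content c R.leaves.toFinset) := by
  rw [wt, Q.content_leafSet hR]

theorem content_eq_iff
    (hinj : ∀ A B, IsBlock (letters c) A → IsBlock (letters c) B → μ A = μ B → A = B)
    {R R' : TimedTree ℕ (Fin n)} (hR : R ∈ subs Q.tree) (hR' : R' ∈ subs Q.tree) :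
    content c R.leaves.toFinset = content c R'.leaves.toFinset ↔
      wt μ (mapL c R) = wt μ (mapL c R') := by
  rw [Q.wt_mapL_eq hR, Q.wt_mapL_eq hR']
  exact ⟨congrArg μ, hinj _ _ (isBlock_content R) (isBlock_content R')⟩

theorem le_content_iff
    (hr : ∀ A B, IsBlock (letters c) A → IsBlock (letters c) B → (r A B ↔ μ A ≤ μ B))
    {R R' : TimedTree ℕ (Fin n)} (hR : R ∈ subs Q.tree) (hR' : R' ∈ subs Q.tree) :
    r (content c R.leaves.toFinset) (content c R'.leaves.toFinset) ↔
      wt μ (mapL c R) ≤ wt μ (mapL c R') := by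
  rw [hr _ _ (isBlock_content R) (isBlock_content R'), Q.wt_mapL_eq hR, Q.wt_mapL_eq hR']

theorem contentLT_iff
    (hinj : ∀ A B, IsBlock (letters c) A → IsBlock (letters c) B → μ A = μ B → A = B)
    (hr : ∀ A B, IsBlock (letters c) A → IsBlock (letters c) B → (r A B ↔ μ A ≤ μ B))
    {R R' : TimedTree ℕ (Fin n)} (hR : R ∈ subs Q.tree) (hR' : R' ∈ subs Q.tree) :
    ContentLT c r R.leaves.toFinset R'.leaves.toFinset ↔
      wt μ (mapL c R) < wt μ (mapL c R') := by
  rw [ContentLT, Q.le_content_iff hr hR hR', ne_eq, Q.content_eq_iff hinj hR hR', lt_iff_le_and_ne]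

/-- Every subtree is a block of some member of the chain, so a subtree on the right with the weight
of the left sibling is an instance of the hypothesis. -/
theorem noEqual_of_hasNoEqualBlocks
    (hinj : ∀ A B, IsBlock (letters c) A → IsBlock (letters c) B → μ A = μ B → A = B)
    {K : Set (Setoid (Fin n))} (hK : ∀ u, u ∈ K ↔ ∃ j ≤ n - 1, u = Q.level j)
    (h : HasNoEqualBlocks c K) : NoEqual μ (mapL c Q.tree) := by
  refine noEqual_mapL fun t A Y hAY B hB hw => ?_
  have hkids : Kids Q.tree t A Y := Or.inl hAY
  have ht := Q.mem_times.1 hkids.mem_times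
  have hBT := subs_trans hkids.symm.mem_subs hB
  obtain ⟨j, hj, hcl⟩ := Q.exists_leafSet_mem_classes hBT
  rw [← Q.card_leafSet hkids.mem_subs]
  refine h _ ((hK _).2 ⟨t, ht.le, rfl⟩) _ ((hK _).2 ⟨t + 1, ht, rfl⟩) _ _
    ((Q.isSplit_iff ht.le ht).2 ⟨rfl, A, Y, hkids, rfl, rfl⟩) _ ((hK _).2 ⟨j, hj, rfl⟩) _ hcl ?_
    ((Q.content_eq_iff hinj hkids.mem_subs hBT).2 hw.symm)
  intro x hx
  rw [List.mem_toFinset] at hx ⊢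
  exact (sublist_of_mem_subs hB).subset hx

theorem exists_kids_le (μ : Multiset (Fin k) → ℕ) (c : Fin n → Fin k) {t : ℕ}
    {A B : TimedTree ℕ (Fin n)} (h : Kids Q.tree t A B) :
    ∃ X Y, Kids Q.tree t X Y ∧ wt μ (mapL c X) ≤ wt μ (mapL c Y) ∧
      X.leaves.toFinset ∪ Y.leaves.toFinset = A.leaves.toFinset ∪ B.leaves.toFinset := by
  rcases le_total (wt μ (mapL c A)) (wt μ (mapL c B)) with hle | hle
  · exact ⟨A, B, h, hle, rfl⟩
  · exact ⟨B, A, h.symm, hle, Finset.union_comm _ _⟩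

theorem isTopologicalDescent_of_desc
    (hinj : ∀ A B, IsBlock (letters c) A → IsBlock (letters c) B → μ A = μ B → A = B)
    (hr : ∀ A B, IsBlock (letters c) A → IsBlock (letters c) B → (r A B ↔ μ A ≤ μ B))
    {K : Set (Setoid (Fin n))} (hK : ∀ u, u ∈ K ↔ ∃ j ≤ n - 1, u = Q.level j)
    {t : ℕ} (ht : t + 1 < n - 1) (h : Desc μ (mapL c Q.tree) t (t + 1)) :
    IsTopologicalDescent c r K (Q.level (t + 1)) := by
  have hK' : ∀ {j}, j ≤ n - 1 → Q.level j ∈ K := fun {j} hj => (hK _).2 ⟨j, hj, rfl⟩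
  have hsplit : ∀ {s A B}, Kids Q.tree s A B →
      IsSplit (Q.level s) (Q.level (s + 1)) A.leaves.toFinset B.leaves.toFinset :=
    fun {s A B} hs => by
      have := Q.mem_times.1 hs.mem_times
      exact (Q.isSplit_iff this.le this).2 ⟨rfl, A, B, hs, rfl, rfl⟩
  have hunion : ∀ {s A B R}, (R = node s A B ∨ R = node s B A) →
      A.leaves.toFinset ∪ B.leaves.toFinset = (R : TimedTree ℕ (Fin n)).leaves.toFinset := by
    rintro s A B R (rfl | rfl)
    · rw [leaves, List.toFinset_append]
    · rw [leaves, List.toFinset_append, Finset.union_comm]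
  rcases desc_mapL_iff.1 h with ⟨X, Y, hXY, hS⟩ | ⟨s, L, R, hs, hw, htR, htL⟩
  · obtain ⟨hle, hS⟩ := splitDesc_mapL_iff.1 hS
    have hr1 := (Q.le_content_iff hr hXY.mem_subs hXY.symm.mem_subs).2 hle
    rcases hS with hroot | ⟨A, B, hY, hAB, hS⟩
    · obtain ⟨A, B, hAB⟩ := exists_kids (Q.mem_times.2 ht)
      have hX := kids_of_root Q.nodup_times hAB hXY.mem_subs hroot
      obtain ⟨A', B', hAB', hle', hu⟩ := Q.exists_kids_le μ c hAB
      refine ⟨_, hK' (by omega), _, hK' (j := t + 1 + 1) (by omega), _, _, _, _, hsplit hXY,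
        hsplit hAB', hr1, (Q.le_content_iff hr hAB'.mem_subs hAB'.symm.mem_subs).2 hle',
        Or.inl ?_⟩
      rw [hu, hunion hX]
    · have hYT := hXY.symm.mem_subs
      have hkids : Kids Q.tree (t + 1) A B := by
        rcases hY with rfl | rfl
        · exact Or.inl hYT
        · exact Or.inr hYT
      refine ⟨_, hK' (by omega), _, hK' (j := t + 1 + 1) (by omega), _, _, _, _, hsplit hXY,
        hsplit hkids, hr1, (Q.le_content_iff hr hkids.mem_subs hkids.symm.mem_subs).2 hAB,
        Or.inr (Or.inr ?_)⟩
      rcases hS with hS | ⟨hS1, hS2, hS3⟩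
      · exact Or.inl ⟨hunion hY, (Q.contentLT_iff hinj hr hkids.mem_subs hXY.mem_subs).2 hS⟩
      · have hce := (Q.content_eq_iff hinj hkids.mem_subs hXY.mem_subs).2 hS1
        refine Or.inr ⟨hunion hY, hce, (Q.card_leafSet hXY.mem_subs).trans hS2, ?_⟩
        have hcard := congrArg Multiset.card hce
        rw [content, content, Multiset.card_map, Multiset.card_map, Finset.card_val,
          Finset.card_val, Q.card_leafSet hkids.mem_subs, Q.card_leafSet hXY.mem_subs, hS2] at hcard
        have hXt := times_eq_of_length_leaves_eq_two hS2
        have hAt := times_eq_of_length_leaves_eq_two hcard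
        have hX : rt X ∈ X.times := by simp [hXt]
        have hA : rt A ∈ A.times := by simp [hAt]
        have hlt := hkids.lt_of_mem_times Q.heap Q.nodup_times hA
        have hlt' := hXY.lt_of_mem_times Q.heap Q.nodup_times hX
        have hXn := Q.mem_times.1 ((times_sublist_of_mem_subs hXY.mem_subs).subset hX)
        -- The witness is the level at the time of the root of `X`: `X` is still a block there,
        -- while its equivalent has been split earlier.
        refine ⟨_, hK' (j := rt X) (by omega), Q.level_anti (by omega),
          Q.leafSet_mem_classes_of_kids hXY hlt' ?_, fun hcl => ?_⟩
        · simp [hXt]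
        · have := Q.le_of_leafSet_mem_classes hkids.mem_subs hcl hA
          omega
  · have hLR : Kids Q.tree s L R := Or.inl hs
    obtain ⟨A, B, hAB⟩ := exists_kids ((times_sublist_of_mem_subs hLR.symm.mem_subs).subset htR)
    obtain ⟨A', B', hAB'⟩ := exists_kids ((times_sublist_of_mem_subs hLR.mem_subs).subset htL)
    obtain ⟨X, Y, hXY, hle, -⟩ := Q.exists_kids_le μ c hAB
    obtain ⟨X', Y', hXY', hle', -⟩ := Q.exists_kids_le μ c hAB'
    have hsn := Q.mem_times.1 hLR.mem_times
    refine ⟨_, hK' (by omega), _, hK' (j := t + 1 + 1) (by omega), _, _, _, _, hsplit hXY,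
      hsplit hXY', (Q.le_content_iff hr hXY.mem_subs hXY.symm.mem_subs).2 hle,
      (Q.le_content_iff hr hXY'.mem_subs hXY'.symm.mem_subs).2 hle',
      Or.inr (Or.inl ⟨_, hK' hsn.le, _, hK' hsn, _, _, hsplit hLR,
        (Q.contentLT_iff hinj hr hLR.mem_subs hLR.symm.mem_subs).2 hw, ?_, ?_⟩)⟩
    · have := hXY.subset Q.nodup_times hLR.symm.mem_subs htR
      refine Finset.union_subset (fun x hx => ?_) fun x hx => ?_
      · exact List.mem_toFinset.2 (this.1 x (List.mem_toFinset.1 hx))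
      · exact List.mem_toFinset.2 (this.2 x (List.mem_toFinset.1 hx))
    · have := hXY'.subset Q.nodup_times hLR.mem_subs htL
      refine Finset.union_subset (fun x hx => ?_) fun x hx => ?_
      · exact List.mem_toFinset.2 (this.1 x (List.mem_toFinset.1 hx))
      · exact List.mem_toFinset.2 (this.2 x (List.mem_toFinset.1 hx))

theorem desc_of_isTopologicalDescent
    (hinj : ∀ A B, IsBlock (letters c) A → IsBlock (letters c) B → μ A = μ B → A = B)
    (hr : ∀ A B, IsBlock (letters c) A → IsBlock (letters c) B → (r A B ↔ μ A ≤ μ B))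
    (hv : Valid μ (mapL c Q.tree))
    {K : Set (Setoid (Fin n))} (hK : ∀ u, u ∈ K ↔ ∃ j ≤ n - 1, u = Q.level j)
    {t : ℕ} (ht : t + 1 < n - 1) (h : IsTopologicalDescent c r K (Q.level (t + 1))) :
    Desc μ (mapL c Q.tree) t (t + 1) := by
  have hl := Q.full.1
  obtain ⟨u, hu, w, hw, X, Y, X', Y', hs1, hs2, hr1, hr2, hcase⟩ := h
  obtain ⟨a, ha, rfl⟩ := (hK u).1 hu
  obtain ⟨b, hb, rfl⟩ := (hK w).1 hw
  obtain ⟨hat, X, Y, hXY, rfl, rfl⟩ := (Q.isSplit_iff ha ht.le).1 hs1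
  obtain ⟨rfl, X', Y', hXY', rfl, rfl⟩ := (Q.isSplit_iff ht.le hb).1 hs2
  obtain rfl : a = t := by omega
  rw [Q.le_content_iff hr hXY.mem_subs hXY.symm.mem_subs] at hr1
  rw [Q.le_content_iff hr hXY'.mem_subs hXY'.symm.mem_subs] at hr2
  have hroot : ∀ {R : TimedTree ℕ (Fin n)}, R ∈ subs Q.tree →
      X'.leaves.toFinset ∪ Y'.leaves.toFinset = R.leaves.toFinset → R.root = some (a + 1) := by
    intro R hR he
    refine root_eq_of_kids Q.heap hl hXY' hR fun x => ?_
    rw [← List.mem_toFinset, ← he, Finset.mem_union, List.mem_toFinset, List.mem_toFinset]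
  have hrootY : X'.leaves.toFinset ∪ Y'.leaves.toFinset = Y.leaves.toFinset →
      Y = node (a + 1) X' Y' ∨ Y = node (a + 1) Y' X' := fun he =>
    kids_of_root Q.nodup_times hXY' hXY.symm.mem_subs (hroot hXY.symm.mem_subs he)
  rw [desc_mapL_iff]
  rcases hcase with he | ⟨p, hp, q, hq, L, R, hs3, hlt, hsub1, hsub2⟩ | ⟨he, hlt⟩ |
    ⟨he, hce, hcard, p, hp, hpw, hX, hX'⟩
  · exact Or.inl ⟨X, Y, hXY, splitDesc_mapL_iff.2 ⟨hr1, Or.inl (hroot hXY.mem_subs he)⟩⟩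
  · obtain ⟨p, hpn, rfl⟩ := (hK p).1 hp
    obtain ⟨q, hqn, rfl⟩ := (hK q).1 hq
    obtain ⟨rfl, L, R, hLR, rfl, rfl⟩ := (Q.isSplit_iff hpn hqn).1 hs3
    rw [Q.contentLT_iff hinj hr hLR.mem_subs hLR.symm.mem_subs] at hlt
    have hmem : ∀ {A B R : TimedTree ℕ (Fin n)},
        A.leaves.toFinset ∪ B.leaves.toFinset ⊆ R.leaves.toFinset →
        (∀ x ∈ A.leaves, x ∈ R.leaves) ∧ ∀ x ∈ B.leaves, x ∈ R.leaves := by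
      intro A B R hsub
      refine ⟨fun x hx => List.mem_toFinset.1 (hsub (Finset.mem_union_left _ ?_)),
        fun x hx => List.mem_toFinset.1 (hsub (Finset.mem_union_right _ ?_))⟩
      · exact List.mem_toFinset.2 hx
      · exact List.mem_toFinset.2 hx
    refine Or.inr ⟨p, L, R, ?_, hlt,
      mem_times_of_kids hl hXY hLR.symm.mem_subs (hmem hsub1).1 (hmem hsub1).2,
      mem_times_of_kids hl hXY' hLR.mem_subs (hmem hsub2).1 (hmem hsub2).2⟩
    rcases hLR with hs | hs
    · exact hs
    -- In a valid tree the right child is not lighter than the left one, so a strictly smaller block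
    -- cannot be drawn on the right.
    · have hm := List.mem_map_of_mem (f := mapL c) hs
      rw [← subs_mapL, mapL] at hm
      have := (hv.of_mem_subs hm).2.2.2.1
      omega
  · rw [Q.contentLT_iff hinj hr hXY'.mem_subs hXY.mem_subs] at hlt
    exact Or.inl ⟨X, Y, hXY, splitDesc_mapL_iff.2
      ⟨hr1, Or.inr ⟨X', Y', hrootY he, hr2, Or.inl hlt⟩⟩⟩
  · obtain ⟨j, hj, rfl⟩ := (hK p).1 hp
    have hja := (Q.level_le_iff hb).1 hpw
    have hcard' := congrArg Multiset.card hce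
    rw [content, content, Multiset.card_map, Multiset.card_map, Finset.card_val,
      Finset.card_val, hcard, Q.card_leafSet hXY'.mem_subs] at hcard'
    rw [Q.card_leafSet hXY.mem_subs] at hcard
    rw [Q.content_eq_iff hinj hXY'.mem_subs hXY.mem_subs] at hce
    have hXt := times_eq_of_length_leaves_eq_two hcard
    have hXt' := times_eq_of_length_leaves_eq_two hcard'
    have hjX := Q.le_of_leafSet_mem_classes hXY.mem_subs hX (t := rt X) (by simp [hXt])
    refine Or.inl ⟨X, Y, hXY, splitDesc_mapL_iff.2
      ⟨hr1, Or.inr ⟨X', Y', hrootY he, hr2, Or.inr ⟨hce, hcard, ?_⟩⟩⟩⟩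
    -- If `X'` were not split before `X`, it would still be a block of the level `j`, where `X` is
    -- intact.
    by_contra hle
    refine hX' (Q.leafSet_mem_classes_of_kids hXY' (by omega) fun v hv => ?_)
    rw [hXt', List.mem_singleton] at hv
    omega

end Dendrogram

namespace IsPartitionModel

variable {n k : ℕ} {c : Fin n → Fin k} {P : Type} [PartialOrder P] [BoundedOrder P]
  {ρ : youngSubgroup c →* (P ≃o P)} {e : P ≃ Setoid (Fin n)} {μ : Multiset (Fin k) → ℕ}
  {r : Multiset (Fin k) → Multiset (Fin k) → Prop}

/-- Level `t + 1` lies between the splits at times `t` and `t + 1`. It belongs to the minimal face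
if these times form a descent of the reading order, which without equal blocks is a topological
descent. -/
theorem yieldsPartitioning_of_weight (h : IsPartitionModel ρ e) (hn : 0 < n)
    (hμ : ∀ A B : Multiset (Fin k), A ≠ 0 → B ≠ 0 → μ A ≤ μ B → μ A < μ (A + B))
    (hinj : ∀ A B, IsBlock (letters c) A → IsBlock (letters c) B → μ A = μ B → A = B)
    (hr : ∀ A B, IsBlock (letters c) A → IsBlock (letters c) B → (r A B ↔ μ A ≤ μ B)) :
    YieldsPartitioning c r ρ e := by
  obtain ⟨h1, bot, h2, h3⟩ := h.exists_dendrogram_of_isMax (μ := μ) hn hμ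
  refine ⟨fun F F' hF hF' => (h1 F hF).trans (h1 F' hF').symm, bot, h2,
    fun C D hC hDC hD hne x hx => ?_⟩
  obtain ⟨Q, hv, hCQ, hDQ⟩ := h3 C D hC hDC hD
  have hK : ∀ u, u ∈ insert ⊤ (insert ⊥ (e '' (C.1 : Set P))) ↔
      ∃ j ≤ n - 1, u = Q.level j := by
    intro u
    simp only [Set.mem_insert_iff, Set.mem_image, Finset.mem_coe]
    constructor
    · rintro (rfl | rfl | ⟨y, hy, rfl⟩)
      · exact ⟨0, Nat.zero_le _, Q.level_zero.symm⟩
      · exact ⟨n - 1, le_rfl, Q.level_last.symm⟩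
      · obtain ⟨i, hi, he⟩ := (hCQ y).1 hy
        exact ⟨i, (Finset.mem_Ioo.1 hi).2.le, he⟩
    · rintro ⟨j, hj, rfl⟩
      rcases Nat.eq_zero_or_pos j with rfl | hj0
      · exact Or.inl Q.level_zero
      rcases hj.lt_or_eq with hlt | rfl
      · exact Or.inr (Or.inr ⟨e.symm (Q.level j), (hCQ _).2
          ⟨j, Finset.mem_Ioo.2 ⟨hj0, hlt⟩, by simp⟩, by simp⟩)
      · exact Or.inr (Or.inl Q.level_last)
  have hNE := Q.noEqual_of_hasNoEqualBlocks hinj hK hne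
  obtain ⟨i, hi, hxi⟩ := (hCQ x).1 hx
  rw [Finset.mem_Ioo] at hi
  obtain ⟨t, rfl⟩ : ∃ t, i = t + 1 := ⟨i - 1, by omega⟩
  have hlen : (mapL c Q.tree).times.length = n - 1 := by rw [times_mapL, Q.length_times]
  have hD' : x ∈ D.1 ↔ t + 1 ∈ descents μ (mapL c Q.tree) := by
    rw [hDQ]
    constructor
    · rintro ⟨j, hj, he⟩
      have hj' := (mem_descents.1 hj).1
      rw [hlen] at hj'
      rwa [(Q.level_inj hi.2.le hj'.2.le).1 (hxi.symm.trans he)]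
    · exact fun hm => ⟨t + 1, hm, hxi⟩
  have hM : ((mapL c Q.tree).leaves : Multiset (Fin k)) ≤ letters c := by
    rw [leaves_mapL, ← Multiset.map_coe, Q.full.coe_leaves]
    exact le_rfl
  have hdesc := key_lt_key_iff_desc hμ (fun A B hA hB hA' hB' => hinj A B ⟨hA, hA'⟩ ⟨hB, hB'⟩)
    (mapL c Q.tree) hM hv hNE t (by rw [times_mapL, Q.mem_times]; omega) (t + 1)
    (by rw [times_mapL, Q.mem_times]; omega) (Nat.lt_succ_self t) fun v _ hv => by omega
  rw [hD', mem_descents, hlen, and_iff_right hi, Nat.add_sub_cancel, hdesc, hxi]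
  exact ⟨Q.isTopologicalDescent_of_desc hinj hr hK hi.2,
    Q.desc_of_isTopologicalDescent hinj hr hv hK hi.2⟩

end IsPartitionModel

/-! ### Block orders as numerical weights -/

section BlockOrders

variable {k : ℕ} {M : Multiset (Fin k)} {r : Multiset (Fin k) → Multiset (Fin k) → Prop}

open Classical in
/-- The number of blocks which precede the given one. -/
noncomputable def blockRank (M : Multiset (Fin k)) (r : Multiset (Fin k) → Multiset (Fin k) → Prop)
    (B : Multiset (Fin k)) : ℕ :=
  (M.powerset.toFinset.filter fun A => A ≠ 0 ∧ r A B ∧ A ≠ B).card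

open Classical in
/-- An extension of the rank of blocks to all multisets of letters. -/
noncomputable def blockWeight (M : Multiset (Fin k))
    (r : Multiset (Fin k) → Multiset (Fin k) → Prop) (B : Multiset (Fin k)) : ℕ :=
  if B ≤ M then blockRank M r B else M.powerset.toFinset.card + B.card

theorem IsBlockOrder.blockRank_lt (h : IsBlockOrder M r) {A B : Multiset (Fin k)}
    (hA : IsBlock M A) (hB : IsBlock M B) (hAB : r A B) (hne : A ≠ B) :
    blockRank M r A < blockRank M r B := by
  classical
  refine Finset.card_lt_card ⟨fun C hC => ?_, fun hsub => ?_⟩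
  · simp only [Finset.mem_filter, Multiset.mem_toFinset, Multiset.mem_powerset] at hC ⊢
    obtain ⟨h1, h2, h3, h4⟩ := hC
    refine ⟨h1, h2, h.trans _ _ _ ⟨h2, h1⟩ hA hB h3 hAB, ?_⟩
    rintro rfl
    exact h4 (h.antisymm _ _ hB hA h3 hAB)
  · have hm : A ∈ M.powerset.toFinset.filter fun C => C ≠ 0 ∧ r C B ∧ C ≠ B := by
      simp only [Finset.mem_filter, Multiset.mem_toFinset, Multiset.mem_powerset]
      exact ⟨hA.2, hA.1, hAB, hne⟩
    exact (Finset.mem_filter.1 (hsub hm)).2.2.2 rfl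

theorem IsBlockOrder.blockWeight_inj (h : IsBlockOrder M r) (A B : Multiset (Fin k))
    (hA : IsBlock M A) (hB : IsBlock M B) (hAB : blockWeight M r A = blockWeight M r B) :
    A = B := by
  rw [blockWeight, blockWeight, if_pos hA.2, if_pos hB.2] at hAB
  by_contra hne
  rcases h.total A B hA hB with h' | h'
  · exact (h.blockRank_lt hA hB h' hne).ne hAB
  · exact (h.blockRank_lt hB hA h' (Ne.symm hne)).ne hAB.symm

theorem IsBlockOrder.iff_blockWeight (h : IsBlockOrder M r) (A B : Multiset (Fin k))
    (hA : IsBlock M A) (hB : IsBlock M B) : r A B ↔ blockWeight M r A ≤ blockWeight M r B := by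
  rw [blockWeight, blockWeight, if_pos hA.2, if_pos hB.2]
  constructor
  · intro hAB
    by_cases hne : A = B
    · rw [hne]
    · exact (h.blockRank_lt hA hB hAB hne).le
  · intro hle
    rcases h.total A B hA hB with h' | h'
    · exact h'
    · by_cases hne : B = A
      · rwa [hne] at h' ⊢
      · exact absurd (h.blockRank_lt hB hA h' hne) (not_lt.2 hle)

/-- For blocks this is the lengthening condition, strict because the concatenation differs from its
part. Multisets that are not contained in `M` get weights above all ranks that grow with the size,
so that the inequality holds without restriction. -/
theorem IsBlockOrder.blockWeight_lt_add (h : IsBlockOrder M r) (hl : LengtheningCondition M r)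
    (A B : Multiset (Fin k)) (hA : A ≠ 0) (hB : B ≠ 0)
    (hAB : blockWeight M r A ≤ blockWeight M r B) :
    blockWeight M r A < blockWeight M r (A + B) := by
  have hB0 := Multiset.card_pos.2 hB
  by_cases hM : A + B ≤ M
  · have hA' : IsBlock M A := ⟨hA, (Multiset.le_add_right A B).trans hM⟩
    have hB' : IsBlock M B := ⟨hB, (Multiset.le_add_left B A).trans hM⟩
    have hAB' : IsBlock M (A + B) := ⟨fun h0 => hA (add_eq_zero.1 h0).1, hM⟩
    have hr := hl A B hA' hB' hAB' ((h.iff_blockWeight A B hA' hB').2 hAB)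
    rw [blockWeight, blockWeight, if_pos hA'.2, if_pos hM]
    refine h.blockRank_lt hA' hAB' hr fun he => hB ?_
    exact left_eq_add.1 he
  · rw [blockWeight, blockWeight, if_neg hM, Multiset.card_add]
    split_ifs with hAM
    · have : blockRank M r A ≤ M.powerset.toFinset.card := by
        classical
        refine (Finset.card_filter_le _ _).trans (le_of_eq ?_)
        congr
      omega
    · omega

theorem isBlockOrder_lengthLex (M : Multiset (Fin k)) : IsBlockOrder M lengthLex where
  total B B' _ _ := by
    rcases lt_trichotomy B.card B'.card with h | h | h
    · exact Or.inl (Or.inl h)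
    · rcases le_total (B.sort (· ≤ ·)) (B'.sort (· ≤ ·)) with h' | h'
      · exact Or.inl (Or.inr ⟨h, h'⟩)
      · exact Or.inr (Or.inr ⟨h.symm, h'⟩)
    · exact Or.inr (Or.inl h)
  antisymm B B' _ _ h h' := by
    rcases h with h | ⟨h, hs⟩ <;> rcases h' with h' | ⟨h', hs'⟩
    · omega
    · omega
    · omega
    · rw [← B.sort_eq (· ≤ ·), ← B'.sort_eq (· ≤ ·), le_antisymm hs hs']
  trans A B D _ _ _ h h' := by
    rcases h with h | ⟨h, hs⟩ <;> rcases h' with h' | ⟨h', hs'⟩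
    · exact Or.inl (h.trans h')
    · exact Or.inl (h.trans_eq h')
    · exact Or.inl (h.trans_lt h')
    · exact Or.inr ⟨h.trans h', hs.trans hs'⟩

theorem lengtheningCondition_lengthLex (M : Multiset (Fin k)) :
    LengtheningCondition M lengthLex := by
  intro B B' _ hB' _ _
  have := Multiset.card_pos.2 hB'.1
  exact Or.inl (by rw [Multiset.card_add]; omega)

end BlockOrders

/-! ### The partition lattice, its dual, and the theorem -/

section Models

variable {n k : ℕ}

/-- Dualizing exchanges the two alternatives in comparability and in being extreme, and leaves the
action unchanged. -/
theorem isPartitionModel_youngActionDual (c : Fin n → Fin k) :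
    IsPartitionModel (youngActionDual c) OrderDual.ofDual where
  comparable_iff _ _ := ⟨Or.symm, Or.symm⟩
  extreme_iff _ := ⟨Or.symm, Or.symm⟩
  map_rho _ _ := rfl

theorem isPartitionModel_youngAction (c : Fin n → Fin k) :
    IsPartitionModel (youngAction c) (Equiv.refl _) where
  comparable_iff _ _ := Iff.rfl
  extreme_iff _ := Iff.rfl
  map_rho _ _ := rfl

variable {c : Fin n → Fin k} {P : Type} [PartialOrder P] [BoundedOrder P]
  {ρ : youngSubgroup c →* (P ≃o P)} {e : P ≃ Setoid (Fin n)}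

/-- On the empty set of points, the only face is the empty one. -/
theorem yieldsPartitioning_of_eq_zero (r : Multiset (Fin k) → Multiset (Fin k) → Prop)
    (hn : n = 0) : YieldsPartitioning c r ρ e := by
  subst hn
  have hP : ∀ x y : P, x = y := fun x y => e.injective (Setoid.ext fun a => a.elim0)
  have hempty : ∀ C : Face P, C.1 = ∅ := fun C => Finset.eq_empty_of_forall_notMem fun x hx =>
    C.2.2.1 (hP x ⊥ ▸ hx)
  have hQ : ∀ a b : QuotientComplex ρ, a = b := fun a b => by
    obtain ⟨A, rfl⟩ := Quotient.exists_rep a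
    obtain ⟨B, rfl⟩ := Quotient.exists_rep b
    exact congrArg _ (Subtype.ext ((hempty A).trans (hempty B).symm))
  refine ⟨fun F F' _ _ => congrArg _ (hQ F F'), fun F => F.1, ⟨fun F => le_rfl, fun F => ⟨0, ?_⟩,
    fun a => ⟨⟨a, fun b _ => (hQ b a).le⟩, ⟨le_rfl, le_rfl⟩, fun F _ => Subtype.ext (hQ _ _)⟩⟩,
    fun C D hC _ _ _ x hx => ?_⟩
  · have : Unique (Set.Icc F.1 F.1) :=
      ⟨⟨⟨F.1, le_rfl, le_rfl⟩⟩, fun b => Subtype.ext (hQ _ _)⟩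
    exact ⟨OrderIso.ofUnique _ _⟩
  · rw [hempty C] at hx
    simp at hx

/-- The general construction needs a point to start from, so the empty set of points is treated
separately. -/
theorem IsPartitionModel.yieldsPartitioning (h : IsPartitionModel ρ e)
    {r : Multiset (Fin k) → Multiset (Fin k) → Prop} (hr : IsBlockOrder (letters c) r)
    (hl : LengtheningCondition (letters c) r) : YieldsPartitioning c r ρ e := by
  rcases Nat.eq_zero_or_pos n with hn | hn
  · exact yieldsPartitioning_of_eq_zero r hn
  · exact h.yieldsPartitioning_of_weight hn (hr.blockWeight_lt_add hl) hr.blockWeight_inj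
      hr.iff_blockWeight

end Models

theorem theorem4 (n k : ℕ) (c : Fin n → Fin k) :
    (∀ r : Multiset (Fin k) → Multiset (Fin k) → Prop,
      IsBlockOrder (letters c) r → LengtheningCondition (letters c) r →
        YieldsPartitioning c r (youngActionDual c) OrderDual.ofDual) ∧
    (IsBlockOrder (letters c) lengthLex ∧ LengtheningCondition (letters c) lengthLex ∧
      YieldsPartitioning c lengthLex (youngAction c) (Equiv.refl _)) :=
  ⟨fun _ hr hl => (isPartitionModel_youngActionDual c).yieldsPartitioning hr hl,
    isBlockOrder_lengthLex _, lengtheningCondition_lengthLex _,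
    (isPartitionModel_youngAction c).yieldsPartitioning (isBlockOrder_lengthLex _)
      (lengtheningCondition_lengthLex _)⟩
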